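/- **Data.** Fix a type $V\in\{A,A^*,B,C,D\}$ and $n$ (with $n\ge 2$ in type $D$), and an even integer $d\ge 2$. Let $W$ be the Weyl group acting on $\mathbb Z^n=\bigoplus_j\mathbb Z H_j$: $\mathbb S_n$ for $A,A^*$, all signed permutations for $B,C$, the even ones for $D$. It has simple roots $a_i$, simple reflections $s_i$ and coroots $H_{a_i}$: $e_{i+1}-e_i$ for $1\le i<n$, together with $e_1$ (coroot $2H_1$) in type $B$, $2e_1$ (coroot $H_1$) in type $C$, and $e_1+e_2$ in type $D$. Let $T_d=C_d^n$ with elements $t_{\sum b_jH_j}=t_1^{b_1}\cdots t_n^{b_n}$; in type $A^*$, $T_d$ is the subgroup $\sum_j b_j\equiv 0 \pmod d$. Put $e_i=\frac1d\sum_{j=1}^d t_{H_{a_i}}^j$. Consider generators $t\in T_d$ and $\xi_i$, subject to the relations of $T_d$, $\xi_i t_H=t_{s_i(H)}\xi_i$, the braid relations with $m_{ij}=\mathrm{ord}(s_is_j)$, and one quadratic relation: * $Y_{d,n}$ over $\mathbb C[u^{\pm1}]$: $\xi_i^2=u\,t_{H_{a_i}}^{d/2}+(1-u)e_i\xi_i$;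 * $Z_{d,n}$ over $\mathbb C[u]$: $\xi_i^2=u\,t_{H_{a_i}}^{d/2}+(1-u)$; * the groups $N_{d,n}$: $\xi_i^2=t_{H_{a_i}}^{d/2}$, and $S_{d,n}$: $\xi_i^2=1$. Fix a reduced expression $w_0=s_{i_1}\cdots s_{i_k}$ of the longest element of $W$, and let $T_0=\xi_{i_1}\cdots\xi_{i_k}\in Y_{d,n}$. Let $\mathbb K$ be a finite Galois extension of $\mathbb C(u)$. Let $\phi_1$ be a $\mathbb C$-algebra homomorphism to $\mathbb C$ with $u\mapsto1$ on the integral closure of $\mathbb C[u^{\pm1}]$ in $\mathbb K$, and let $\tau_1,\tau_0$ be $\mathbb C$-algebra homomorphisms to $\mathbb C$ with $u\mapsto 1$, respectively $u\mapsto 0$, on the integral closure of $\mathbb C[u]$ in $\mathbb K$. For $\chi\in\mathrm{Irr}(\mathbb KY_{d,n})$ we consider $\chi'\in\mathrm{Irr}(\mathbb KZ_{d,n})$, $\chi_1\in\mathrm{Irr}(N_{d,n})$ and $\chi_0\in\mathrm{Irr}(S_{d,n})$ with $$\phi_1\circ\chi=\chi_1=\tau_1\circ\chi',\qquad \chi_0=\tau_0\circ\chi'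 ,$$ where these are equalities of values on all products of generators, and the values of $\chi$ and $\chi'$ there lie in the respective integral closures. **Theorem.** Assume that $\mathbb KY_{d,n}$ is split, and let $\chi\in\mathrm{Irr}(\mathbb KY_{d,n})$. If $\mathbb KZ_{d,n}$ is split as well, such $\chi',\chi_1,\chi_0$ exist. For any such $\chi',\chi_1,\chi_0$, the numbers $$f_\chi=\sum_{a_i}\Bigl(1-\frac{\chi_0(e_i\xi_i)}{\chi_0(1)}\Bigr),\qquad g_{\chi'}=\sum_{a_i}\frac{\chi_0(1)-\chi_0(t_{H_{a_i}}^{d/2})}{2\chi_0(1)}$$ (sums over the simple roots $a_{i_1},\dots,a_{i_k}$, with multiplicity) are integers, and $T_0^2$ acts in the representation with character $\chi$ as the scalar $$y_\chi=u^{f_\chi}(-1)^{g_{\chi'}} .$$ Moreover, let $F$ be a finite field with $q=d+1$ elements, and let $G$ be the Chevalley group over $F$ of type $V$ in its defining representation, generated by the root elements $x_a(t)$ and the torus elements $h_H(s)$, $s\in F^\times$, $H\in\mathbb Z^n$ (with $\sum_j b_j=0$ for $H=\sum_j b_jH_j$ in type $A^*$). Let $U$ be generated by the $x_a(t)$ with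 $a>0$. Let $\mathcal H(G,U)$ be the algebra of $U$-bi-invariant functions $G\to\mathbb C$ with product $(\varphi*\psi)(g)=|U|^{-1}\sum_{x\in G}\varphi(x)\psi(x^{-1}g)$. Choose a generator $\gamma$ of $F^\times$. In $\mathcal H(G,U)$ let $t_H$ be the indicator function of $Uh_H(\gamma)U$, let $\xi_i$ be $q^{-1}$ times the indicator function of $U\,x_{a_i}(1)x_{-a_i}(-1)x_{a_i}(1)\,U$, and let $T_{w_0}=\xi_{i_1}\cdots\xi_{i_k}$. Let $\phi_q$ be a $\mathbb C$-algebra homomorphism to $\mathbb C$ with $u\mapsto q^{-1}$ on the integral closure of $\mathbb C[u^{\pm1}]$ in $\mathbb K$. If $\chi',\chi_1,\chi_0$ are as above, then $\phi_q\circ\chi$ (on products of generators) is the character of an irreducible representation of $\mathcal H(G,U)$, and in every irreducible representation with that character $T_{w_0}^2$ acts as the scalar $q^{-f_\chi}(-1)^{g_{\chi'}}$. -/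

import Mathlib

set_option linter.unusedSectionVars false

noncomputable section

namespace YH

/-! ### Representations, irreducible characters, split algebras -/

section Representations

universe v

variable {k : Type v} [Field k] {A : Type*} [Ring A] [Algebra k A]
  {E : Type*} [AddCommGroup E] [Module k E]

/-- A representation `ρ` of the `k`-algebra `A` on `E` is irreducible: `E ≠ 0` and the only
invariant subspaces are `0` and `E`. -/
def IsIrreducible (ρ : A →ₐ[k] Module.End k E) : Prop :=
  Nontrivial E ∧
    ∀ W : Submodule k E, (∀ a : A, ∀ w ∈ W, ρ a w ∈ W) → W = ⊥ ∨ W = ⊤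

/-- The character `a ↦ tr (ρ a)`. -/
def character (ρ : A →ₐ[k] Module.End k E) : A →ₗ[k] k :=
  LinearMap.trace k E ∘ₗ ρ.toLinearMap

variable (k A) in
/-- `Irr(A)`: the set of characters of the irreducible finite-dimensional representations. -/
def Irr : Set (A →ₗ[k] k) :=
  {χ | ∃ (m : ℕ) (ρ : A →ₐ[k] Module.End k (Fin m → k)), IsIrreducible ρ ∧ χ = character ρ}

variable (k A) in
/-- `A` is split over `k`: every (finite-dimensional, matrix) representation of `A` over an
extension field `k'` of `k` is equivalent to the scalar extension of one over `k`. -/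
def IsSplit : Prop :=
  ∀ (k' : Type v) [Field k'] [Algebra k k'] (m : ℕ)
    (ρ : A →ₐ[k] Matrix (Fin m) (Fin m) k'),
    ∃ (ρ₀ : A →ₐ[k] Matrix (Fin m) (Fin m) k) (P : GL (Fin m) k'),
      ∀ a : A, ρ a = (P : Matrix (Fin m) (Fin m) k') * (ρ₀ a).map (algebraMap k k') *
        ((P⁻¹ : GL (Fin m) k') : Matrix (Fin m) (Fin m) k')

end Representations

/-! ### Root data of the classical types

Indices run from `0` to `n - 1`.  The simple reflections are `s_i`, `i ≥ 1`, exchanging the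
coordinates `i - 1` and `i`, and, at index `0`, the sign change of the first coordinate in types
`B` and `C` and its conjugate `(x₀, x₁) ↦ (-x₁, -x₀)` in type `D`. -/

/-- The five types; `A` is `GL_n` and `Astar` is `SL_n`. -/
inductive ClassicalType
  | A | Astar | B | C | D
  deriving DecidableEq

/-- Types that have a simple root at the index `0`. -/
def ClassicalType.HasZero : ClassicalType → Prop
  | .A => False
  | .Astar => False
  | _ => True

/-- The index set of the simple roots. -/
def SimpleIdx (V : ClassicalType) (n : ℕ) : Type :=
  {i : Fin n // (i : ℕ) = 0 → V.HasZero}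

/-- Names of roots: `diff i j` is `e_i - e_j`, `sum i j` and `negSum i j` are `±(e_i + e_j)`,
and `single i`, `negSingle i` are `±e_i` in type `B` and `±2 e_i` in type `C`. -/
inductive RootName (n : ℕ)
  | diff (i j : Fin n)
  | sum (i j : Fin n)
  | negSum (i j : Fin n)
  | single (i : Fin n)
  | negSingle (i : Fin n)

namespace RootName

variable {n : ℕ}

/-- The name of the opposite root. -/
def neg : RootName n → RootName n
  | diff i j => diff j i
  | sum i j => negSum i j
  | negSum i j => sum i j
  | single i => negSingle i
  | negSingle i => single i

/-- The positive roots, for the simple system `e_i - e_{i-1}` (`i ≥ 1`), together with `e_0`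
(type `B`), `2 e_0` (type `C`) or `e_0 + e_1` (type `D`). -/
def IsPos (V : ClassicalType) : RootName n → Prop
  | diff i j => j < i
  | sum i j => i < j ∧ V.HasZero
  | negSum _ _ => False
  | single _ => V = .B ∨ V = .C
  | negSingle _ => False

/-- The roots. -/
def IsRoot (V : ClassicalType) (a : RootName n) : Prop :=
  a.IsPos V ∨ a.neg.IsPos V

/-- The root as a linear form on the lattice `ℤ^n`, in coordinates. -/
def root (V : ClassicalType) : RootName n → Fin n → ℤ
  | diff i j => Pi.single i 1 - Pi.single j 1
  | sum i j => Pi.single i 1 + Pi.single j 1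
  | negSum i j => -(Pi.single i 1 + Pi.single j 1)
  | single i => Pi.single i (if V = .C then 2 else 1)
  | negSingle i => -Pi.single i (if V = .C then 2 else 1)

/-- The distinguished element `H_a` of the root `a` (its coroot), in the basis `H_1, …, H_n`. -/
def coroot (V : ClassicalType) : RootName n → Fin n → ℤ
  | diff i j => Pi.single i 1 - Pi.single j 1
  | sum i j => Pi.single i 1 + Pi.single j 1
  | negSum i j => -(Pi.single i 1 + Pi.single j 1)
  | single i => Pi.single i (if V = .C then 1 else 2)
  | negSingle i => -Pi.single i (if V = .C then 1 else 2)

end RootName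

variable {V : ClassicalType} {n : ℕ}

/-- The simple root with a given index.  (In type `D` the index `1 % n` is `1` for `n ≥ 2`.) -/
def SimpleIdx.name (i : SimpleIdx V n) : RootName n :=
  if (i.1 : ℕ) = 0 then
    (if V = .D then .sum i.1 ⟨1 % n, Nat.mod_lt _ i.1.pos⟩ else .single i.1)
  else .diff i.1 ⟨(i.1 : ℕ) - 1, lt_of_le_of_lt (Nat.sub_le _ _) i.1.2⟩

/-- The simple root `a_i`. -/
def SimpleIdx.root (i : SimpleIdx V n) : Fin n → ℤ := i.name.root V

/-- The distinguished element `H_{a_i}`. -/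
def SimpleIdx.coroot (i : SimpleIdx V n) : Fin n → ℤ := i.name.coroot V

/-- The simple reflection `H ↦ H - a_i(H) H_{a_i}` as an integer matrix. -/
def simpleReflection (i : SimpleIdx V n) : Matrix (Fin n) (Fin n) ℤ :=
  1 - Matrix.vecMulVec i.coroot i.root

/-- The element `s_{i_1} ⋯ s_{i_k}` of the Weyl group. -/
def weylElement (L : List (SimpleIdx V n)) : Matrix (Fin n) (Fin n) ℤ :=
  (L.map simpleReflection).prod

/-- `s_{i_1} ⋯ s_{i_k}` is a reduced expression. -/
def IsReducedWord (L : List (SimpleIdx V n)) : Prop :=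
  ∀ L' : List (SimpleIdx V n), weylElement L' = weylElement L → L.length ≤ L'.length

/-- `s_{i_1} ⋯ s_{i_k}` is a reduced expression of the longest element `w₀`. -/
def IsLongestWord (L : List (SimpleIdx V n)) : Prop :=
  IsReducedWord L ∧ ∀ L' : List (SimpleIdx V n), IsReducedWord L' → L'.length ≤ L.length

/-! ### Presentations

The torus `C_d^n` is written additively as `(ℤ/d)^n`: the vector `x` stands for
`t_1^{x_1} ⋯ t_n^{x_n}`.  In type `A*` it is replaced by the subgroup of determinant one. -/

/-- The torus: all of `(ℤ/d)^n`, or the vectors of coordinate sum zero in type `A*`. -/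
def torus (V : ClassicalType) (n d : ℕ) : Submodule (ZMod d) (Fin n → ZMod d) where
  carrier := {x | V = .Astar → ∑ j, x j = 0}
  add_mem' := by
    intro x y hx hy h
    simp [Finset.sum_add_distrib, hx h, hy h]
  zero_mem' := by
    intro _
    simp
  smul_mem' := by
    intro c x hx h
    simp [← Finset.mul_sum, hx h]

theorem coroot_mem_torus (d : ℕ) (i : SimpleIdx V n) :
    (fun j => ((i.coroot j : ℤ) : ZMod d)) ∈ torus V n d := by
  intro h
  subst h
  have h0 : ¬ ((i.1 : ℕ) = 0) := fun h => i.2 h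
  have hs : ∑ j, i.coroot j = 0 := by
    simp [SimpleIdx.coroot, SimpleIdx.name, h0, RootName.coroot, Finset.sum_sub_distrib]
  have := congrArg (Int.cast : ℤ → ZMod d) hs
  simpa using this

/-- The element `t_{H_{a_i}}` of the torus. -/
def corootTorus (d : ℕ) (i : SimpleIdx V n) : torus V n d :=
  ⟨fun j => ((i.coroot j : ℤ) : ZMod d), coroot_mem_torus d i⟩

/-- The action of the simple reflection `s_i` on the torus. -/
def reflectTorus {d : ℕ} (i : SimpleIdx V n) (x : torus V n d) : torus V n d :=
  x - (∑ j, ((i.root j : ℤ) : ZMod d) * x.1 j) • corootTorus d i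

/-- The generators: the torus elements and the `ξ_i`. -/
inductive Gen (V : ClassicalType) (n d : ℕ)
  | t (x : torus V n d)
  | xi (i : SimpleIdx V n)

variable {d : ℕ}

/-- The alternating product `a b a ⋯` with `m` factors. -/
def alternating {M : Type*} [Monoid M] : M → M → ℕ → M
  | _, _, 0 => 1
  | a, b, m + 1 => a * alternating b a m

/-- The defining relations for generators `g` of a monoid, where the quadratic relation is
`ξ_i² = sq i`, and `m_{ij}` in the braid relations is the order of `s_i s_j`. -/
inductive DefRel {M : Type*} [Monoid M] (g : Gen V n d → M) (sq : SimpleIdx V n → M) :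
    M → M → Prop
  | one : DefRel g sq (g (.t 0)) 1
  | mul (x y : torus V n d) : DefRel g sq (g (.t (x + y))) (g (.t x) * g (.t y))
  | conj (i : SimpleIdx V n) (x : torus V n d) :
      DefRel g sq (g (.xi i) * g (.t x)) (g (.t (reflectTorus i x)) * g (.xi i))
  | quad (i : SimpleIdx V n) : DefRel g sq (g (.xi i) ^ 2) (sq i)
  | braid (i j : SimpleIdx V n) :
      DefRel g sq
        (alternating (g (.xi i)) (g (.xi j)) (orderOf (simpleReflection i * simpleReflection j)))
        (alternating (g (.xi j)) (g (.xi i)) (orderOf (simpleReflection i * simpleReflection j)))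

/-- `h_i(-1) = t_{H_{a_i}}^{d/2}`. -/
def hNeg {M : Type*} (g : Gen V n d → M) (i : SimpleIdx V n) : M :=
  g (.t ((d / 2) • corootTorus d i))

/-- `e_i = (1/d) ∑_{j=1}^d t_{H_{a_i}}^j`. -/
def idem {B : Type*} [Ring B] [Algebra ℂ B] (g : Gen V n d → B) (i : SimpleIdx V n) : B :=
  (1 / (d : ℂ)) • ∑ j ∈ Finset.Icc 1 d, g (.t (j • corootTorus d i))

/-- The product `ξ_{i_1} ⋯ ξ_{i_k}`. -/
def xiProd {M : Type*} [Monoid M] (g : Gen V n d → M) (L : List (SimpleIdx V n)) : M :=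
  (L.map fun i => g (.xi i)).prod

section GenericAlgebras

variable (V n d) (R : Type*) [CommRing R] [Algebra ℂ R] (u : R)

/-- The right-hand side `u h_i(-1) + (1 - u) e_i ξ_i`. -/
def yokQuad (i : SimpleIdx V n) : FreeAlgebra R (Gen V n d) :=
  u • hNeg (FreeAlgebra.ι R) i +
    (1 - u) • (idem (FreeAlgebra.ι R) i * FreeAlgebra.ι R (.xi i))

/-- The generic Yokonuma--Hecke algebra with parameter `u` and coefficients `R`; the coefficient
ring `ℂ[u^{±1}]` gives `Y_{d,n}`, and an extension field of `ℂ(u)` its extension of scalars. -/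
abbrev Yok : Type _ :=
  RingQuot (DefRel (FreeAlgebra.ι R : Gen V n d → _) (yokQuad V n d R u))

/-- The generators of the generic Yokonuma--Hecke algebra. -/
def yokGen (x : Gen V n d) : Yok V n d R u :=
  RingQuot.mkAlgHom R _ (FreeAlgebra.ι R x)

/-- The right-hand side `u h_i(-1) + (1 - u)`. -/
def defQuad (i : SimpleIdx V n) : FreeAlgebra R (Gen V n d) :=
  u • hNeg (FreeAlgebra.ι R) i + (1 - u) • (1 : FreeAlgebra R (Gen V n d))

/-- The generic deformation `Z_{d,n}` with parameter `u` and coefficients `R`. -/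
abbrev Def : Type _ :=
  RingQuot (DefRel (FreeAlgebra.ι R : Gen V n d → _) (defQuad V n d R u))

/-- The generators of `Z_{d,n}`. -/
def defGen (x : Gen V n d) : Def V n d R u :=
  RingQuot.mkAlgHom R _ (FreeAlgebra.ι R x)

end GenericAlgebras

section Groups

variable (V n d)

/-- The group `N_{d,n}`, with `ξ_i² = t_{H_{a_i}}^{d/2}`. -/
abbrev NGroup : Type :=
  PresentedGroup {r : FreeGroup (Gen V n d) |
    ∃ a b, DefRel FreeGroup.of (hNeg FreeGroup.of) a b ∧ r = a * b⁻¹}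

/-- The group `S_{d,n}`, with `ξ_i² = 1`. -/
abbrev SGroup : Type :=
  PresentedGroup {r : FreeGroup (Gen V n d) |
    ∃ a b, DefRel FreeGroup.of (fun _ => 1) a b ∧ r = a * b⁻¹}

/-- The generators in the group algebra `ℂ[N_{d,n}]`. -/
def nGen (x : Gen V n d) : MonoidAlgebra ℂ (NGroup V n d) :=
  MonoidAlgebra.of ℂ _ (PresentedGroup.of x)

/-- The generators in the group algebra `ℂ[S_{d,n}]`. -/
def sGen (x : Gen V n d) : MonoidAlgebra ℂ (SGroup V n d) :=
  MonoidAlgebra.of ℂ _ (PresentedGroup.of x)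

end Groups

/-! ### Specialization of characters -/

section Specialization

variable {K : Type*} [Field K] [Algebra ℂ K]

/-- The integral closure in `K` of the subring of `K` generated over `ℂ` by `s`. -/
abbrev IntCl (s : Set K) : Type _ := integralClosure (Algebra.adjoin ℂ s) K

/-- `φ` takes the value `c` at `u`. -/
def SpecializesAt {s : Set K} (φ : IntCl s →ₐ[ℂ] ℂ) (u : K) (c : ℂ) : Prop :=
  ∀ a : IntCl s, (a : K) = u → φ a = c

/-- `χ₀ = φ ∘ χ`: on every product of generators, `χ` has a value in the integral closure, and
`φ` maps it to the value of `χ₀` on the corresponding product of generators. -/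
def IsSpecialization {s : Set K} (φ : IntCl s →ₐ[ℂ] ℂ)
    {B : Type*} [Ring B] [Algebra K B] (g : Gen V n d → B) (χ : B →ₗ[K] K)
    {B₀ : Type*} [Ring B₀] [Algebra ℂ B₀] (g₀ : Gen V n d → B₀) (χ₀ : B₀ →ₗ[ℂ] ℂ) : Prop :=
  ∀ w : List (Gen V n d), ∃ a : IntCl s,
    (a : K) = χ (w.map g).prod ∧ φ a = χ₀ (w.map g₀).prod

/-- The characters `χ' ∈ Irr(K Z_{d,n})`, `χ₁ ∈ Irr(N_{d,n})` and `χ₀ ∈ Irr(S_{d,n})` correspond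
to the character `χ` of `K Y_{d,n}`: `φ₁ ∘ χ = χ₁ = τ₁ ∘ χ'` and `χ₀ = τ₀ ∘ χ'`. -/
structure IsAssociated (u : K) (φ₁ : IntCl ({u, u⁻¹} : Set K) →ₐ[ℂ] ℂ)
    (τ₁ τ₀ : IntCl ({u} : Set K) →ₐ[ℂ] ℂ)
    (χ : Yok V n d K u →ₗ[K] K) (χ' : Def V n d K u →ₗ[K] K)
    (χ₁ : MonoidAlgebra ℂ (NGroup V n d) →ₗ[ℂ] ℂ)
    (χ₀ : MonoidAlgebra ℂ (SGroup V n d) →ₗ[ℂ] ℂ) : Prop where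
  irr' : χ' ∈ Irr K (Def V n d K u)
  irr₁ : χ₁ ∈ Irr ℂ (MonoidAlgebra ℂ (NGroup V n d))
  irr₀ : χ₀ ∈ Irr ℂ (MonoidAlgebra ℂ (SGroup V n d))
  spec_phi₁ : IsSpecialization φ₁ (yokGen V n d K u) χ (nGen V n d) χ₁
  spec_tau₁ : IsSpecialization τ₁ (defGen V n d K u) χ' (nGen V n d) χ₁
  spec_tau₀ : IsSpecialization τ₀ (defGen V n d K u) χ' (sGen V n d) χ₀

end Specialization

/-- `∑ (1 - χ₀(e_i ξ_i) / χ₀(1))`, over the letters of the word `L`. -/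
def fSum (L : List (SimpleIdx V n)) (χ₀ : MonoidAlgebra ℂ (SGroup V n d) →ₗ[ℂ] ℂ) : ℂ :=
  (L.map fun i => 1 - χ₀ (idem (sGen V n d) i * sGen V n d (.xi i)) / χ₀ 1).sum

/-- `∑ (χ₀(1) - χ₀(t_{H_{a_i}}^{d/2})) / (2 χ₀(1))`, over the letters of the word `L`. -/
def gSum (L : List (SimpleIdx V n)) (χ₀ : MonoidAlgebra ℂ (SGroup V n d) →ₗ[ℂ] ℂ) : ℂ :=
  (L.map fun i => (χ₀ 1 - χ₀ (hNeg (sGen V n d) i)) / (2 * χ₀ 1)).sum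

/-! ### Hecke algebras of finite groups -/

section Hecke

variable {G : Type*} [Group G] [Fintype G]

/-- The functions on `G` that are bi-invariant under `U`. -/
def biInvariant (U : Subgroup G) : Submodule ℂ (G → ℂ) where
  carrier := {f | ∀ h ∈ U, ∀ k ∈ U, ∀ g, f (h * g * k) = f g}
  add_mem' := by
    intro f f' hf hf' h hh k hk g
    simp [hf h hh k hk g, hf' h hh k hk g]
  zero_mem' := by
    intro h _ k _ g
    rfl
  smul_mem' := by
    intro c f hf h hh k hk g
    simp [hf h hh k hk g]

/-- The Hecke algebra `𝓗(G, U)`: bi-invariant functions, with the convolution product below. -/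
def HeckeAlgebra (U : Subgroup G) : Type _ := biInvariant U

namespace HeckeAlgebra

variable {U : Subgroup G}

instance : AddCommGroup (HeckeAlgebra U) := inferInstanceAs (AddCommGroup (biInvariant U))
instance : Module ℂ (HeckeAlgebra U) := inferInstanceAs (Module ℂ (biInvariant U))

/-- The underlying function. -/
def toFun (f : HeckeAlgebra U) : G → ℂ := f.1

theorem ext' {f f' : HeckeAlgebra U} (h : ∀ g, f.toFun g = f'.toFun g) : f = f' :=
  Subtype.ext (funext h)

theorem inv (f : HeckeAlgebra U) {h k : G} (hh : h ∈ U) (hk : k ∈ U) (g : G) :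
    f.toFun (h * g * k) = f.toFun g := f.2 h hh k hk g

theorem inv_left (f : HeckeAlgebra U) {h : G} (hh : h ∈ U) (g : G) :
    f.toFun (h * g) = f.toFun g := by
  simpa using f.inv hh U.one_mem g

theorem inv_right (f : HeckeAlgebra U) {k : G} (hk : k ∈ U) (g : G) :
    f.toFun (g * k) = f.toFun g := by
  simpa using f.inv U.one_mem hk g

open Classical in
/-- The convolution `(φ * ψ)(g) = |U|⁻¹ ∑_{x ∈ G} φ(x) ψ(x⁻¹ g)`. -/
instance : Mul (HeckeAlgebra U) where
  mul f f' := ⟨fun g => (Nat.card U : ℂ)⁻¹ * ∑ x : G, f.toFun x * f'.toFun (x⁻¹ * g), by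
    intro h hh k hk g
    refine congrArg ((Nat.card U : ℂ)⁻¹ * ·) ?_
    refine Fintype.sum_equiv (Equiv.mulLeft h⁻¹) _ _ fun x => ?_
    have h1 : f.toFun (h⁻¹ * x) = f.toFun x := f.inv_left (U.inv_mem hh) x
    have h2 : x⁻¹ * (h * g * k) = (h⁻¹ * x)⁻¹ * g * k := by group
    simp only [Equiv.coe_mulLeft, h1, h2]
    rw [f'.inv_right hk]⟩

theorem mul_toFun (f f' : HeckeAlgebra U) (g : G) :
    (f * f').toFun g = (Nat.card U : ℂ)⁻¹ * ∑ x : G, f.toFun x * f'.toFun (x⁻¹ * g) := rfl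

open Classical in
/-- The unit is the indicator function of `U`. -/
instance : One (HeckeAlgebra U) where
  one := ⟨fun g => if g ∈ U then 1 else 0, by
    intro h hh k hk g
    simp [U.mul_mem_cancel_right hk, U.mul_mem_cancel_left hh]⟩

open Classical in
theorem one_toFun (g : G) : (1 : HeckeAlgebra U).toFun g = if g ∈ U then 1 else 0 := rfl

theorem add_toFun (f f' : HeckeAlgebra U) (g : G) :
    (f + f').toFun g = f.toFun g + f'.toFun g := rfl

theorem smul_toFun (c : ℂ) (f : HeckeAlgebra U) (g : G) :
    (c • f).toFun g = c * f.toFun g := rfl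

theorem zero_toFun (g : G) : (0 : HeckeAlgebra U).toFun g = 0 := rfl

theorem card_ne : (Nat.card U : ℂ) ≠ 0 := by
  exact_mod_cast Nat.card_pos.ne'

open Classical in
theorem sum_ite_mem (c : ℂ) : (∑ x : G, if x ∈ U then c else 0) = Nat.card U * c := by
  rw [Finset.sum_ite, Finset.sum_const_zero, add_zero, Finset.sum_const, nsmul_eq_mul,
    Nat.card_eq_fintype_card, Fintype.card_subtype]

protected theorem one_mul' (f : HeckeAlgebra U) : 1 * f = f := by
  classical
  refine ext' fun g => ?_
  rw [mul_toFun]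
  have : ∀ x : G, (1 : HeckeAlgebra U).toFun x * f.toFun (x⁻¹ * g) =
      if x ∈ U then f.toFun g else 0 := by
    intro x
    rw [one_toFun]
    split_ifs with hx
    · rw [f.inv_left (U.inv_mem hx), one_mul]
    · rw [zero_mul]
  rw [Finset.sum_congr rfl fun x _ => this x, sum_ite_mem, inv_mul_cancel_left₀ card_ne]

protected theorem mul_one' (f : HeckeAlgebra U) : f * 1 = f := by
  classical
  refine ext' fun g => ?_
  rw [mul_toFun]
  have : ∑ x : G, f.toFun x * (1 : HeckeAlgebra U).toFun (x⁻¹ * g) =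
      ∑ y : G, if y ∈ U then f.toFun g else 0 := by
    refine Fintype.sum_equiv ((Equiv.inv G).trans (Equiv.mulRight g)) _ _ fun x => ?_
    simp only [Equiv.trans_apply, Equiv.inv_apply, Equiv.coe_mulRight, one_toFun]
    split_ifs with hx
    · have h1 : x = g * (x⁻¹ * g)⁻¹ := by group
      rw [mul_one]
      conv_lhs => rw [h1]
      rw [f.inv_right (U.inv_mem hx)]
    · rw [mul_zero]
  rw [this, sum_ite_mem, inv_mul_cancel_left₀ card_ne]

protected theorem mul_assoc' (f f' f'' : HeckeAlgebra U) : f * f' * f'' = f * (f' * f'') := by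
  refine ext' fun g => ?_
  simp only [mul_toFun]
  congr 1
  have h1 : ∀ x : G, f.toFun x * ((Nat.card U : ℂ)⁻¹ *
      ∑ y : G, f'.toFun y * f''.toFun (y⁻¹ * (x⁻¹ * g))) =
      ∑ y : G, (Nat.card U : ℂ)⁻¹ * (f.toFun x * f'.toFun (x⁻¹ * y)) * f''.toFun (y⁻¹ * g) := by
    intro x
    rw [Finset.mul_sum, Finset.mul_sum]
    refine Fintype.sum_equiv (Equiv.mulLeft x) _ _ fun y => ?_
    have h2 : (x * y)⁻¹ * g = y⁻¹ * (x⁻¹ * g) := by group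
    simp only [Equiv.coe_mulLeft, inv_mul_cancel_left, h2]
    ring
  rw [Finset.sum_congr rfl fun x _ => h1 x, Finset.sum_comm]
  refine Finset.sum_congr rfl fun y _ => ?_
  rw [Finset.mul_sum, Finset.sum_mul]

instance : Ring (HeckeAlgebra U) where
  __ := (inferInstance : AddCommGroup (HeckeAlgebra U))
  one_mul := HeckeAlgebra.one_mul'
  mul_one := HeckeAlgebra.mul_one'
  mul_assoc := HeckeAlgebra.mul_assoc'
  zero_mul f := ext' fun g => by simp [mul_toFun, zero_toFun]
  mul_zero f := ext' fun g => by simp [mul_toFun, zero_toFun]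
  left_distrib f f' f'' := ext' fun g => by
    simp only [mul_toFun, add_toFun, mul_add, Finset.sum_add_distrib]
  right_distrib f f' f'' := ext' fun g => by
    simp only [mul_toFun, add_toFun, add_mul, mul_add, Finset.sum_add_distrib]

instance : Algebra ℂ (HeckeAlgebra U) :=
  Algebra.ofModule
    (fun c f f' => ext' fun g => by
      simp only [mul_toFun, smul_toFun, Finset.mul_sum]
      exact Finset.sum_congr rfl fun _ _ => by ring)
    (fun c f f' => ext' fun g => by
      simp only [mul_toFun, smul_toFun, Finset.mul_sum]
      exact Finset.sum_congr rfl fun _ _ => by ring)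

end HeckeAlgebra

end Hecke

/-! ### The Chevalley groups

They act on the defining representation, with basis `v_1, …, v_n` in types `A` and `A*`, and
`v_{±1}, …, v_{±n}` in types `C` and `D`, and with one more vector `v_0` in type `B`. -/

/-- The index set of the basis of the defining representation: in types `B`, `C`, `D`, `inl i` is
`v_i` and `inr i` is `v_{-i}`, and in type `B` the index of `v_0` is `none`. -/
def RepIdx : ClassicalType → ℕ → Type
  | .A, n => Fin n
  | .Astar, n => Fin n
  | .B, n => Option (Fin n ⊕ Fin n)
  | .C, n => Fin n ⊕ Fin n
  | .D, n => Fin n ⊕ Fin n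

instance : (V : ClassicalType) → (n : ℕ) → Fintype (RepIdx V n)
  | .A, n => inferInstanceAs (Fintype (Fin n))
  | .Astar, n => inferInstanceAs (Fintype (Fin n))
  | .B, n => inferInstanceAs (Fintype (Option (Fin n ⊕ Fin n)))
  | .C, n => inferInstanceAs (Fintype (Fin n ⊕ Fin n))
  | .D, n => inferInstanceAs (Fintype (Fin n ⊕ Fin n))

instance : (V : ClassicalType) → (n : ℕ) → DecidableEq (RepIdx V n)
  | .A, n => inferInstanceAs (DecidableEq (Fin n))
  | .Astar, n => inferInstanceAs (DecidableEq (Fin n))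
  | .B, n => inferInstanceAs (DecidableEq (Option (Fin n ⊕ Fin n)))
  | .C, n => inferInstanceAs (DecidableEq (Fin n ⊕ Fin n))
  | .D, n => inferInstanceAs (DecidableEq (Fin n ⊕ Fin n))

/-- The weight of a basis vector: `H_j` acts on it by the `j`-th coordinate. -/
def weight : (V : ClassicalType) → (n : ℕ) → RepIdx V n → Fin n → ℤ
  | .A, _, r => Pi.single (M := fun _ => ℤ) r 1
  | .Astar, _, r => Pi.single (M := fun _ => ℤ) r 1
  | .B, _, none => 0
  | .B, _, some (.inl i) => Pi.single i 1
  | .B, _, some (.inr i) => -Pi.single i 1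
  | .C, _, .inl i => Pi.single i 1
  | .C, _, .inr i => -Pi.single i 1
  | .D, _, .inl i => Pi.single i 1
  | .D, _, .inr i => -Pi.single i 1

section RootVectors

variable (n : ℕ) (F : Type*) [Field F]

/-- Root vectors of `𝔤𝔩_n`. -/
def rootVectorA : RootName n → Matrix (Fin n) (Fin n) F
  | .diff i j => Matrix.single i j 1
  | _ => 0

/-- Root vectors of `𝔰𝔬_{2n+1}` for the form with `(v_i, v_{-i}) = 1`, `(v_0, v_0) = 2`. -/
def rootVectorB : RootName n →
    Matrix (Option (Fin n ⊕ Fin n)) (Option (Fin n ⊕ Fin n)) F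
  | .diff i j => Matrix.single (some (.inl i)) (some (.inl j)) 1 -
      Matrix.single (some (.inr j)) (some (.inr i)) 1
  | .sum i j => Matrix.single (some (.inl i)) (some (.inr j)) 1 -
      Matrix.single (some (.inl j)) (some (.inr i)) 1
  | .negSum i j => Matrix.single (some (.inr j)) (some (.inl i)) 1 -
      Matrix.single (some (.inr i)) (some (.inl j)) 1
  | .single i => Matrix.single (some (.inl i)) none 2 - Matrix.single none (some (.inr i)) 1
  | .negSingle i => Matrix.single none (some (.inl i)) 1 - Matrix.single (some (.inr i)) none 2

/-- Root vectors of `𝔰𝔭_{2n}` for the alternating form with `(v_i, v_{-i}) = 1`. -/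
def rootVectorC : RootName n → Matrix (Fin n ⊕ Fin n) (Fin n ⊕ Fin n) F
  | .diff i j => Matrix.single (.inl i) (.inl j) 1 - Matrix.single (.inr j) (.inr i) 1
  | .sum i j => Matrix.single (.inl i) (.inr j) 1 + Matrix.single (.inl j) (.inr i) 1
  | .negSum i j => Matrix.single (.inr j) (.inl i) 1 + Matrix.single (.inr i) (.inl j) 1
  | .single i => Matrix.single (.inl i) (.inr i) 1
  | .negSingle i => Matrix.single (.inr i) (.inl i) 1

/-- Root vectors of `𝔰𝔬_{2n}` for the symmetric form with `(v_i, v_{-i}) = 1`. -/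
def rootVectorD : RootName n → Matrix (Fin n ⊕ Fin n) (Fin n ⊕ Fin n) F
  | .diff i j => Matrix.single (.inl i) (.inl j) 1 - Matrix.single (.inr j) (.inr i) 1
  | .sum i j => Matrix.single (.inl i) (.inr j) 1 - Matrix.single (.inl j) (.inr i) 1
  | .negSum i j => Matrix.single (.inr j) (.inl i) 1 - Matrix.single (.inr i) (.inl j) 1
  | _ => 0

/-- The root vectors `x_a` of a Chevalley basis, reduced to `F`. -/
def rootVector : (V : ClassicalType) → RootName n → Matrix (RepIdx V n) (RepIdx V n) F
  | .A => rootVectorA n F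
  | .Astar => rootVectorA n F
  | .B => rootVectorB n F
  | .C => rootVectorC n F
  | .D => rootVectorD n F

end RootVectors

section Chevalley

variable (V : ClassicalType) (n : ℕ) (F : Type*) [Field F]

/-- `x_a(t) = ∑_k t^k x_a^k / k!`, for `F` of odd characteristic; in the defining representations
the terms with `k ≥ 3` vanish. -/
def xMatrix (a : RootName n) (t : F) : Matrix (RepIdx V n) (RepIdx V n) F :=
  1 + t • rootVector n F V a + (t ^ 2 / 2) • rootVector n F V a ^ 2

/-- `h_H(s)`, the diagonal matrix with entries `s^{λ(H)}`, for `λ` the weights. -/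
def hMatrix (H : Fin n → ℤ) (s : Fˣ) : Matrix (RepIdx V n) (RepIdx V n) F :=
  Matrix.diagonal fun r => ((s ^ (∑ j, weight V n r j * H j) : Fˣ) : F)

/-- The Chevalley group, generated by all `x_a(t)` and all `h_H(s)`, where `H` runs over the
lattice `ℤ H_1 + ⋯ + ℤ H_n` (its elements of trace zero in type `A*`). -/
def chevalley : Subgroup (GL (RepIdx V n) F) :=
  Subgroup.closure
    ({g | ∃ (a : RootName n) (t : F), a.IsRoot V ∧
        (g : Matrix (RepIdx V n) (RepIdx V n) F) = xMatrix V n F a t} ∪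
      {g | ∃ (H : Fin n → ℤ) (s : Fˣ), (V = .Astar → ∑ j, H j = 0) ∧
        (g : Matrix (RepIdx V n) (RepIdx V n) F) = hMatrix V n F H s})

/-- The maximal unipotent subgroup `U` of the Chevalley group, generated by the `x_a(t)` with `a`
a positive root. -/
def unipotent : Subgroup (chevalley V n F) :=
  (Subgroup.closure
    {g : GL (RepIdx V n) F | ∃ (a : RootName n) (t : F), a.IsPos V ∧
      (g : Matrix (RepIdx V n) (RepIdx V n) F) = xMatrix V n F a t}).subgroupOf (chevalley V n F)

variable {V n}

/-- The matrix `w_i(1) = x_{a_i}(1) x_{-a_i}(-1) x_{a_i}(1)`, the representative of `s_i`. -/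
def wMatrix (i : SimpleIdx V n) : Matrix (RepIdx V n) (RepIdx V n) F :=
  xMatrix V n F i.name 1 * xMatrix V n F i.name.neg (-1) * xMatrix V n F i.name 1

variable {F} [Fintype F]

instance : Fintype (chevalley V n F) := Fintype.ofFinite _

open Classical in
/-- The indicator function of the double coset `U M U`, for a matrix `M`. -/
def cosetIndicator (M : Matrix (RepIdx V n) (RepIdx V n) F) : HeckeAlgebra (unipotent V n F) :=
  ⟨fun g => if ∃ y ∈ unipotent V n F, ∃ z ∈ unipotent V n F,
      ((g : GL (RepIdx V n) F) : Matrix (RepIdx V n) (RepIdx V n) F) =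
        ((y : GL (RepIdx V n) F) : Matrix (RepIdx V n) (RepIdx V n) F) * M *
          ((z : GL (RepIdx V n) F) : Matrix (RepIdx V n) (RepIdx V n) F) then 1 else 0, by
    intro h hh k hk g
    refine if_congr ⟨?_, ?_⟩ rfl rfl
    · rintro ⟨y, hy, z, hz, e⟩
      refine ⟨h⁻¹ * y, mul_mem (inv_mem hh) hy, z * k⁻¹, mul_mem hz (inv_mem hk), ?_⟩
      have : g = h⁻¹ * (h * g * k) * k⁻¹ := by group
      rw [this]
      simp only [Subgroup.coe_mul, Units.val_mul] at e ⊢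
      rw [e]
      simp only [mul_assoc]
    · rintro ⟨y, hy, z, hz, e⟩
      refine ⟨h * y, mul_mem hh hy, z * k, mul_mem hz hk, ?_⟩
      simp only [Subgroup.coe_mul, Units.val_mul, e]
      simp only [mul_assoc]⟩

/-- The generators of the Yokonuma--Hecke algebra `𝓗(G, U)`, for a generator `γ` of `Fˣ`, which
identifies `C_{q-1}` with `Fˣ`: `t_x` is the indicator function of `U h_x(γ) U`, and `ξ_i` is
`q⁻¹` times that of `U w_i(1) U`. -/
def heckeGen (γ : Fˣ) : Gen V n d → HeckeAlgebra (unipotent V n F)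
  | .t x => cosetIndicator (hMatrix V n F (fun j => ((x.1 j).val : ℤ)) γ)
  | .xi i => (Fintype.card F : ℂ)⁻¹ • cosetIndicator (wMatrix F i)

end Chevalley

end YH

end

noncomputable section

namespace YH

open Matrix

section
variable {V : ClassicalType} {n : ℕ}

/-- The vectors that are positive roots. -/
def IsPosRoot (V : ClassicalType) (v : Fin n → ℤ) : Prop :=
  ∃ a : RootName n, a.IsPos V ∧ a.root V = v

/-- Twice the height functional, on the coordinate with index `i`. -/
def htCoord (V : ClassicalType) (i : ℕ) : ℤ :=
  match V with
  | .A => 2 * i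
  | .Astar => 2 * i
  | .B => 2 * i + 2
  | .C => 2 * i + 1
  | .D => 2 * i

/-- Twice the height functional. -/
def height (V : ClassicalType) (v : Fin n → ℤ) : ℤ := ∑ k : Fin n, htCoord V k * v k

theorem height_add (v w : Fin n → ℤ) : height V (v + w) = height V v + height V w := by
  simp [height, mul_add, Finset.sum_add_distrib]

theorem height_neg (v : Fin n → ℤ) : height V (-v) = -height V v := by
  simp [height]

theorem height_sub (v w : Fin n → ℤ) : height V (v - w) = height V v - height V w := by
  rw [sub_eq_add_neg, height_add, height_neg, sub_eq_add_neg]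

theorem height_smul (c : ℤ) (v : Fin n → ℤ) : height V (c • v) = c * height V v := by
  simp [height, Finset.mul_sum, mul_left_comm]

theorem height_single (i : Fin n) (c : ℤ) : height V (Pi.single i c) = htCoord V i * c := by
  simp [height, Pi.single_apply]

theorem height_pos {v : Fin n → ℤ} (h : IsPosRoot V v) : 0 < height V v := by
  obtain ⟨a, ha, rfl⟩ := h
  cases a with
  | diff i j =>
    have : (j : ℕ) < i := ha
    rw [RootName.root, height_sub, height_single, height_single]
    cases V <;> simp only [htCoord] <;> omega
  | sum i j =>
    obtain ⟨h1, h2⟩ := ha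
    have : (i : ℕ) < j := h1
    rw [RootName.root, height_add, height_single, height_single]
    cases V <;> simp only [htCoord] <;> first | omega | exact h2.elim
  | negSum i j => exact ha.elim
  | single i =>
    have ha' : V = .B ∨ V = .C := ha
    rw [RootName.root, height_single]
    rcases ha' with rfl | rfl <;> simp [htCoord] <;> omega
  | negSingle i => exact ha.elim

/-- The three shapes of a simple root. -/
inductive SimpleShape (V : ClassicalType) {n : ℕ} (i : SimpleIdx V n) : Prop
  | diff (p : Fin n) (hp : (p : ℕ) + 1 = i.1) (h : i.name = .diff i.1 p)
  | single (h0 : (i.1 : ℕ) = 0) (hV : V = .B ∨ V = .C) (h : i.name = .single i.1)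
  | sum (p : Fin n) (h0 : (i.1 : ℕ) = 0) (hp : (p : ℕ) = 1) (hV : V = .D)
      (h : i.name = .sum i.1 p)

/-- In type `D` the rank is at least two. -/
class GoodRank (V : ClassicalType) (n : ℕ) : Prop where
  two_le : V = .D → 2 ≤ n

theorem simpleShape [hg : GoodRank V n] (i : SimpleIdx V n) : SimpleShape V i := by
  by_cases h0 : (i.1 : ℕ) = 0
  · by_cases hD : V = .D
    · refine .sum ⟨1 % n, Nat.mod_lt _ i.1.pos⟩ h0 ?_ hD ?_
      · exact Nat.mod_eq_of_lt (hg.two_le hD)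
      · simp [SimpleIdx.name, h0, hD]
    · refine .single h0 ?_ ?_
      · have := i.2 h0
        cases V <;> simp_all [ClassicalType.HasZero]
      · simp [SimpleIdx.name, h0, hD]
  · refine .diff ⟨(i.1 : ℕ) - 1, lt_of_le_of_lt (Nat.sub_le _ _) i.1.2⟩ ?_ ?_
    · simp only; omega
    · simp [SimpleIdx.name, h0]

theorem simpleReflection_mulVec (i : SimpleIdx V n) (v : Fin n → ℤ) :
    simpleReflection i *ᵥ v = v - (i.root ⬝ᵥ v) • i.coroot := by
  rw [simpleReflection, Matrix.sub_mulVec, Matrix.one_mulVec, Matrix.vecMulVec_mulVec]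
  simp

theorem isPosRoot_sub {i j : Fin n} (h : (j : ℕ) < i) :
    IsPosRoot V (Pi.single i 1 - Pi.single j 1) := ⟨.diff i j, h, rfl⟩

theorem isPosRoot_add (hV : V.HasZero) {i j : Fin n} (h : i ≠ j) :
    IsPosRoot V (Pi.single i 1 + Pi.single j 1) := by
  rcases h.lt_or_gt with h | h
  · exact ⟨.sum i j, ⟨h, hV⟩, rfl⟩
  · exact ⟨.sum j i, ⟨h, hV⟩, add_comm _ _⟩

theorem weylElement_cons (i : SimpleIdx V n) (L : List (SimpleIdx V n)) :
    weylElement (i :: L) = simpleReflection i * weylElement L := by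
  simp [weylElement]

theorem weylElement_nil : weylElement ([] : List (SimpleIdx V n)) = 1 := by
  simp [weylElement]

theorem weylElement_append (L L' : List (SimpleIdx V n)) :
    weylElement (L ++ L') = weylElement L * weylElement L' := by
  simp [weylElement]

variable [GoodRank V n]

theorem name_isPos (i : SimpleIdx V n) : i.name.IsPos V := by
  rcases simpleShape i with ⟨p, hp, h⟩ | ⟨h0, hV, h⟩ | ⟨p, h0, hp, hV, h⟩
  · rw [h]
    show p < i.1
    rw [Fin.lt_def]; omega
  · rw [h]; exact hV
  · rw [h]
    refine ⟨?_, i.2 h0⟩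
    rw [Fin.lt_def]; omega

theorem isPosRoot_root (i : SimpleIdx V n) : IsPosRoot V i.root :=
  ⟨i.name, name_isPos i, rfl⟩

theorem reflection_isPosRoot (i : SimpleIdx V n) {v : Fin n → ℤ}
    (hv : IsPosRoot V v) (hne : v ≠ i.root) : IsPosRoot V (simpleReflection i *ᵥ v) := by
  obtain ⟨a, ha, rfl⟩ := hv
  rcases simpleShape i with ⟨p, hp, h⟩ | ⟨h0, hV, h⟩ | ⟨p, h0, hp, hV, h⟩
  · have hr : i.root = Pi.single i.1 1 - Pi.single p 1 := by simp [SimpleIdx.root, h, RootName.root]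
    have hc : i.coroot = Pi.single i.1 1 - Pi.single p 1 := by
      simp [SimpleIdx.coroot, h, RootName.coroot]
    have key : ∀ (c : Fin n) (m : ℤ),
        simpleReflection i *ᵥ Pi.single c m = Pi.single (Equiv.swap i.1 p c) m := by
      intro c m
      rw [simpleReflection_mulVec, hr, hc, sub_dotProduct, single_dotProduct, single_dotProduct]
      have hpi : p ≠ i.1 := fun e => by rw [e] at hp; omega
      funext k
      simp only [Pi.sub_apply, Pi.smul_apply, Pi.single_apply, Equiv.swap_apply_def, smul_eq_mul]
      grind
    cases a with
    | diff b c =>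
      have hb : (c : ℕ) < b := ha
      rw [RootName.root, mulVec_sub, key, key]
      refine isPosRoot_sub ?_
      have : ¬ (b = i.1 ∧ c = p) := by
        rintro ⟨rfl, rfl⟩
        exact hne (by simp [RootName.root, hr])
      simp only [Equiv.swap_apply_def]
      simp only [Fin.ext_iff] at this ⊢
      split_ifs <;> omega
    | sum b c =>
      rw [RootName.root, mulVec_add, key, key]
      exact isPosRoot_add ha.2 ((Equiv.swap i.1 p).injective.ne ha.1.ne)
    | negSum b c => exact ha.elim
    | single b => exact ⟨.single (Equiv.swap i.1 p b), ha, (key _ _).symm⟩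
    | negSingle b => exact ha.elim
  · have hz : V.HasZero := i.2 h0
    have key : ∀ (c : Fin n) (m : ℤ),
        simpleReflection i *ᵥ Pi.single c m = Pi.single c (if c = i.1 then -m else m) := by
      intro c m
      rw [simpleReflection_mulVec]
      funext k
      by_cases hc : c = i.1
      · subst hc
        rcases hV with rfl | rfl <;>
        simp [SimpleIdx.root, SimpleIdx.coroot, h, RootName.root, RootName.coroot, Pi.single_apply] <;>
        split_ifs <;> ring
      · rcases hV with rfl | rfl <;>
        simp [SimpleIdx.root, SimpleIdx.coroot, h, RootName.root, hc]
    cases a with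
    | diff b c =>
      have hb : (c : ℕ) < b := ha
      rw [RootName.root, mulVec_sub, key, key, if_neg fun e => by rw [← e] at h0; omega]
      split_ifs with hc
      · rw [Pi.single_neg, sub_neg_eq_add]
        exact isPosRoot_add hz (Fin.ne_of_gt hb)
      · exact isPosRoot_sub hb
    | sum b c =>
      have hb : (b : ℕ) < c := ha.1
      rw [RootName.root, mulVec_add, key, key, if_neg (c := c = _) fun e => by rw [← e] at h0; omega]
      split_ifs with hc
      · rw [Pi.single_neg, neg_add_eq_sub]
        exact isPosRoot_sub hb
      · exact isPosRoot_add hz ha.1.ne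
    | negSum b c => exact ha.elim
    | single b =>
      have hb : b ≠ i.1 := by
        rintro rfl
        exact hne (by simp [SimpleIdx.root, h])
      exact ⟨.single b, ha, by rw [RootName.root, key, if_neg hb]⟩
    | negSingle b => exact ha.elim
  · have hz : V.HasZero := i.2 h0
    have hpi : p ≠ i.1 := fun e => by rw [e] at hp; omega
    have key : ∀ c : Fin n, simpleReflection i *ᵥ Pi.single c 1 =
        if c = i.1 then -Pi.single p 1 else if c = p then -Pi.single i.1 1 else Pi.single c 1 := by
      intro c
      rw [simpleReflection_mulVec]
      funext k
      simp [SimpleIdx.root, SimpleIdx.coroot, h, RootName.root, RootName.coroot, Pi.single_apply]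
      split_ifs <;> simp [Pi.single_apply] <;> grind
    cases a with
    | diff b c =>
      have hb : (c : ℕ) < b := ha
      rw [RootName.root, mulVec_sub, key, key, if_neg fun e => by rw [← e] at h0; omega]
      split_ifs with hbp hc hc hc hc <;> simp only [Fin.ext_iff] at hbp hc <;> try omega
      · rw [neg_sub_neg]
        exact isPosRoot_sub (by omega)
      all_goals
        try rw [sub_neg_eq_add]
        first
        | exact isPosRoot_sub hb
        | exact isPosRoot_add hz (by rw [Ne, Fin.ext_iff]; omega)
    | sum b c =>
      have hb : (b : ℕ) < c := ha.1
      have hbc : ¬ (b = i.1 ∧ c = p) := by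
        rintro ⟨rfl, rfl⟩
        exact hne (by simp [SimpleIdx.root, h])
      rw [RootName.root, mulVec_add, key, key, if_neg (c := c = _) fun e => by rw [← e] at h0; omega]
      simp only [Fin.ext_iff] at hbc
      split_ifs with hbi hc hbp hc hc <;> simp only [Fin.ext_iff] at * <;> try omega
      all_goals
        try rw [neg_add_eq_sub]
        first
        | exact isPosRoot_add hz ha.1.ne
        | exact isPosRoot_sub (by omega)
    | negSum b c => exact ha.elim
    | single b =>
      have : V = .B ∨ V = .C := ha
      subst hV; simp at this
    | negSingle b => exact ha.elim
end

section
variable {V : ClassicalType} {n : ℕ} [GoodRank V n]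

theorem root_norm_pos (i : SimpleIdx V n) : 0 < i.root ⬝ᵥ i.root := by
  have hne : i.root ≠ 0 := by
    intro h0
    have := height_pos (isPosRoot_root i)
    rw [h0] at this
    simp [height] at this
  have h1 : 0 ≤ i.root ⬝ᵥ i.root := Finset.sum_nonneg fun k _ => mul_self_nonneg _
  rcases h1.lt_or_eq with h | h
  · exact h
  · refine absurd ?_ hne
    funext k
    have := (Finset.sum_eq_zero_iff_of_nonneg (fun k _ => mul_self_nonneg (i.root k))).1 h.symm k
      (Finset.mem_univ _)
    simpa using this

theorem norm_smul_coroot (i : SimpleIdx V n) :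
    (i.root ⬝ᵥ i.root) • i.coroot = (2 : ℤ) • i.root := by
  rcases simpleShape i with ⟨p, hp, h⟩ | ⟨h0, hV, h⟩ | ⟨p, h0, hp, hV, h⟩
  · have hpi : p ≠ i.1 := fun e => by rw [e] at hp; omega
    simp [SimpleIdx.root, SimpleIdx.coroot, h, RootName.root, RootName.coroot, Pi.single_apply, hpi,
      hpi.symm]
  · rcases hV with rfl | rfl <;>
    · funext k
      simp [SimpleIdx.root, SimpleIdx.coroot, h, RootName.root, RootName.coroot, Pi.single_apply]
  · have hpi : p ≠ i.1 := fun e => by rw [e] at hp; omega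
    simp [SimpleIdx.root, SimpleIdx.coroot, h, RootName.root, RootName.coroot, Pi.single_apply, hpi,
      hpi.symm]

theorem root_dot_coroot (i : SimpleIdx V n) : i.root ⬝ᵥ i.coroot = 2 := by
  have h := congrArg (i.root ⬝ᵥ ·) (norm_smul_coroot i)
  simp only [dotProduct_smul, smul_eq_mul] at h
  have := root_norm_pos i
  rw [mul_comm] at h
  exact mul_right_cancel₀ this.ne' h

theorem dot_smul_coroot (i : SimpleIdx V n) (v : Fin n → ℤ) :
    (i.root ⬝ᵥ v) • i.coroot = (i.coroot ⬝ᵥ v) • i.root := by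
  have h1 := norm_smul_coroot i
  have h0 := (root_norm_pos i).ne'
  have h2 : (i.root ⬝ᵥ i.root) * (i.coroot ⬝ᵥ v) = 2 * (i.root ⬝ᵥ v) := by
    have := congrArg (· ⬝ᵥ v) h1
    simpa only [smul_dotProduct, smul_eq_mul] using this
  have : (i.root ⬝ᵥ i.root) • ((i.root ⬝ᵥ v) • i.coroot) =
      (i.root ⬝ᵥ i.root) • ((i.coroot ⬝ᵥ v) • i.root) := by
    rw [smul_comm, h1, smul_smul, smul_smul, h2, mul_comm]
  exact smul_right_injective _ h0 this

theorem simpleReflection_mulVec' (i : SimpleIdx V n) (v : Fin n → ℤ) :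
    simpleReflection i *ᵥ v = v - (i.coroot ⬝ᵥ v) • i.root := by
  rw [simpleReflection_mulVec, dot_smul_coroot]

theorem ext_mulVec {A B : Matrix (Fin n) (Fin n) ℤ} (h : ∀ v, A *ᵥ v = B *ᵥ v) : A = B :=
  Matrix.mulVec_injective (funext h)

theorem simpleReflection_mul_self (i : SimpleIdx V n) :
    simpleReflection i * simpleReflection i = 1 := by
  refine ext_mulVec fun v => ?_
  rw [← mulVec_mulVec, simpleReflection_mulVec, simpleReflection_mulVec, dotProduct_sub,
    dotProduct_smul, root_dot_coroot, one_mulVec]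
  simp only [smul_eq_mul]
  module

theorem simpleReflection_mulVec_self (i : SimpleIdx V n) :
    simpleReflection i *ᵥ i.root = -i.root := by
  rw [simpleReflection_mulVec', dotProduct_comm, root_dot_coroot]
  module

theorem simpleReflection_dot (i : SimpleIdx V n) (v w : Fin n → ℤ) :
    (simpleReflection i *ᵥ v) ⬝ᵥ (simpleReflection i *ᵥ w) = v ⬝ᵥ w := by
  rw [simpleReflection_mulVec' i v, simpleReflection_mulVec i w]
  simp only [dotProduct_sub, sub_dotProduct, dotProduct_smul, smul_dotProduct, smul_eq_mul,
    root_dot_coroot]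
  rw [dotProduct_comm v i.coroot]
  ring

theorem weylElement_dot (L : List (SimpleIdx V n)) (v w : Fin n → ℤ) :
    (weylElement L *ᵥ v) ⬝ᵥ (weylElement L *ᵥ w) = v ⬝ᵥ w := by
  induction L with
  | nil => simp [weylElement_nil]
  | cons i L ih => rw [weylElement_cons, ← mulVec_mulVec, ← mulVec_mulVec, simpleReflection_dot, ih]

theorem weylElement_reverse_mul (L : List (SimpleIdx V n)) :
    weylElement L.reverse * weylElement L = 1 := by
  induction L with
  | nil => simp [weylElement_nil]
  | cons i L ih =>
    rw [List.reverse_cons, weylElement_append, weylElement_cons, weylElement_cons, weylElement_nil,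
      mul_one, mul_assoc, ← mul_assoc (simpleReflection i), simpleReflection_mul_self, one_mul, ih]

theorem weylElement_mul_reverse (L : List (SimpleIdx V n)) :
    weylElement L * weylElement L.reverse = 1 := by
  simpa using weylElement_reverse_mul L.reverse

theorem weylElement_reverse_eq {L L' : List (SimpleIdx V n)}
    (h : weylElement L = weylElement L') : weylElement L.reverse = weylElement L'.reverse := by
  calc weylElement L.reverse = weylElement L.reverse * (weylElement L' * weylElement L'.reverse) := by
        rw [weylElement_mul_reverse, mul_one]
    _ = _ := by rw [← h, ← mul_assoc, weylElement_reverse_mul, one_mul]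

/-- The vectors that are roots. -/
def IsRootVec (V : ClassicalType) (v : Fin n → ℤ) : Prop := IsPosRoot V v ∨ IsPosRoot V (-v)

theorem IsRootVec.reflection (i : SimpleIdx V n) {v : Fin n → ℤ}
    (h : IsRootVec V v) : IsRootVec V (simpleReflection i *ᵥ v) := by
  rcases h with h | h
  · by_cases hv : v = i.root
    · right; rw [hv, simpleReflection_mulVec_self, neg_neg]; exact isPosRoot_root i
    · exact .inl (reflection_isPosRoot i h hv)
  · by_cases hv : -v = i.root
    · left
      rw [← neg_neg v, hv, mulVec_neg, simpleReflection_mulVec_self, neg_neg]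
      exact isPosRoot_root i
    · right; rw [← mulVec_neg]; exact reflection_isPosRoot i h hv

theorem IsRootVec.weyl (L : List (SimpleIdx V n)) {v : Fin n → ℤ}
    (h : IsRootVec V v) : IsRootVec V (weylElement L *ᵥ v) := by
  induction L with
  | nil => simpa [weylElement_nil] using h
  | cons i L ih => rw [weylElement_cons, ← mulVec_mulVec]; exact ih.reflection i

theorem isRootVec_root (i : SimpleIdx V n) : IsRootVec V i.root :=
  .inl (isPosRoot_root i)

theorem IsRootVec.pos_of_height {v : Fin n → ℤ} (h : IsRootVec V v) (hv : ¬ height V v < 0) :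
    IsPosRoot V v := by
  rcases h with h | h
  · exact h
  · have := height_pos h
    rw [height_neg] at this
    omega

theorem IsRootVec.neg_of_height {v : Fin n → ℤ} (h : IsRootVec V v) (hv : height V v < 0) :
    IsPosRoot V (-v) := by
  rcases h with h | h
  · have := height_pos h
    omega
  · exact h

theorem exists_letter_of_neg (L : List (SimpleIdx V n)) {v : Fin n → ℤ}
    (hv : IsPosRoot V v) (h : height V (weylElement L.reverse *ᵥ v) < 0) :
    ∃ L₁ j L₂, L = L₁ ++ j :: L₂ ∧ weylElement L₁ *ᵥ j.root = v := by
  induction L generalizing v with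
  | nil =>
    have := height_pos hv
    simp [weylElement_nil] at h
    omega
  | cons i L ih =>
    by_cases hi : v = i.root
    · exact ⟨[], i, L, rfl, by simp [weylElement_nil, hi]⟩
    · rw [List.reverse_cons, weylElement_append, ← mulVec_mulVec, weylElement_cons, weylElement_nil,
        mul_one] at h
      obtain ⟨L₁, j, L₂, rfl, h2⟩ := ih (reflection_isPosRoot i hv hi) h
      refine ⟨i :: L₁, j, L₂, rfl, ?_⟩
      rw [weylElement_cons, ← mulVec_mulVec, h2, mulVec_mulVec, simpleReflection_mul_self,
        one_mulVec]

theorem weyl_coroot (L : List (SimpleIdx V n)) {i j : SimpleIdx V n}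
    (h : weylElement L *ᵥ j.root = i.root) : weylElement L *ᵥ j.coroot = i.coroot := by
  have h1 : j.root ⬝ᵥ j.root = i.root ⬝ᵥ i.root := by
    rw [← h, weylElement_dot]
  refine smul_right_injective _ (root_norm_pos i).ne' ?_
  simp only
  rw [norm_smul_coroot, ← h1, ← mulVec_smul, norm_smul_coroot, mulVec_smul, h]

theorem weyl_conj (L : List (SimpleIdx V n)) {i j : SimpleIdx V n}
    (h : weylElement L *ᵥ j.root = i.root) :
    weylElement L * simpleReflection j = simpleReflection i * weylElement L := by
  refine ext_mulVec fun v => ?_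
  rw [← mulVec_mulVec, ← mulVec_mulVec, simpleReflection_mulVec, simpleReflection_mulVec, mulVec_sub,
    mulVec_smul, weyl_coroot L h]
  congr 2
  rw [← h, weylElement_dot]

theorem exists_shorter_of_neg (L : List (SimpleIdx V n)) (i : SimpleIdx V n)
    (h : height V (weylElement L.reverse *ᵥ i.root) < 0) :
    ∃ L', L'.length + 1 = L.length ∧ weylElement L = weylElement (i :: L') := by
  obtain ⟨L₁, j, L₂, rfl, h2⟩ := exists_letter_of_neg L (isPosRoot_root i) h
  refine ⟨L₁ ++ L₂, by simp; omega, ?_⟩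
  rw [weylElement_append, weylElement_cons, weylElement_cons, weylElement_append, ← mul_assoc,
    weyl_conj L₁ h2, mul_assoc]

theorem weylElement_cons_cancel {i : SimpleIdx V n} {L L' : List (SimpleIdx V n)}
    (h : weylElement (i :: L) = weylElement (i :: L')) : weylElement L = weylElement L' := by
  rw [weylElement_cons, weylElement_cons] at h
  have := congrArg (simpleReflection i * ·) h
  simpa [← mul_assoc, simpleReflection_mul_self] using this

theorem IsReducedWord.tail {i : SimpleIdx V n} {L : List (SimpleIdx V n)}
    (h : IsReducedWord (i :: L)) : IsReducedWord L := by
  intro L' hL'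
  have := h (i :: L') (by rw [weylElement_cons, weylElement_cons, hL'])
  simpa using this

theorem IsReducedWord.of_eq {L L' : List (SimpleIdx V n)}
    (h : IsReducedWord L) (he : weylElement L' = weylElement L) (hl : L'.length = L.length) :
    IsReducedWord L' := by
  intro R hR
  rw [hl]
  exact h R (hR.trans he)

theorem IsReducedWord.length_eq {L L' : List (SimpleIdx V n)}
    (h : IsReducedWord L) (h' : IsReducedWord L') (he : weylElement L' = weylElement L) :
    L'.length = L.length :=
  le_antisymm (h' _ he.symm) (h _ he)

theorem IsReducedWord.reverse {L : List (SimpleIdx V n)} (h : IsReducedWord L) :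
    IsReducedWord L.reverse := by
  intro R hR
  have := h R.reverse (by simpa using weylElement_reverse_eq hR)
  simpa using this

theorem exists_reduced (L : List (SimpleIdx V n)) :
    ∃ L' : List (SimpleIdx V n), IsReducedWord L' ∧ weylElement L' = weylElement L := by
  classical
  have hex : ∃ k, ∃ L' : List (SimpleIdx V n), L'.length = k ∧ weylElement L' = weylElement L :=
    ⟨_, L, rfl, rfl⟩
  obtain ⟨L', h1, h2⟩ := Nat.find_spec hex
  refine ⟨L', fun R hR => ?_, h2⟩
  rw [h1]
  exact Nat.find_min' hex ⟨R, rfl, hR.trans h2⟩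

theorem height_neg_of_not {v : Fin n → ℤ} (h : IsRootVec V v)
    (h' : ¬ height V v < 0) : 0 < height V v := height_pos (h.pos_of_height h')

theorem reverse_cons_root (L : List (SimpleIdx V n)) (i : SimpleIdx V n) :
    weylElement (i :: L).reverse *ᵥ i.root = -(weylElement L.reverse *ᵥ i.root) := by
  rw [List.reverse_cons, weylElement_append, weylElement_cons, weylElement_nil, mul_one,
    ← mulVec_mulVec, simpleReflection_mulVec_self, mulVec_neg]

theorem isReducedWord_cons_iff {L : List (SimpleIdx V n)} (hL : IsReducedWord L)
    (i : SimpleIdx V n) :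
    IsReducedWord (i :: L) ↔ 0 < height V (weylElement L.reverse *ᵥ i.root) := by
  constructor
  · intro h
    refine height_neg_of_not ((isRootVec_root i).weyl _) fun hn => ?_
    obtain ⟨L', h1, h2⟩ := exists_shorter_of_neg L i hn
    have h3 := h L' (by
      rw [weylElement_cons, h2, weylElement_cons, ← mul_assoc, simpleReflection_mul_self, one_mul])
    simp at h3
    omega
  · intro h
    obtain ⟨R, hR, hRe⟩ := exists_reduced (i :: L)
    have h1 : height V (weylElement R.reverse *ᵥ i.root) < 0 := by
      rw [weylElement_reverse_eq hRe, reverse_cons_root, height_neg]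
      omega
    obtain ⟨R', h2, h3⟩ := exists_shorter_of_neg R i h1
    have h4 := weylElement_cons_cancel (hRe.symm.trans h3)
    have h5 := hL R' h4.symm
    refine hR.of_eq hRe.symm ?_
    refine le_antisymm ?_ (hR _ hRe.symm)
    simp; omega

theorem IsReducedWord.exists_cons {L : List (SimpleIdx V n)} (hL : IsReducedWord L)
    (i : SimpleIdx V n) (h : height V (weylElement L.reverse *ᵥ i.root) < 0) :
    ∃ L', IsReducedWord (i :: L') ∧ weylElement (i :: L') = weylElement L ∧
      L'.length + 1 = L.length := by
  obtain ⟨L', h1, h2⟩ := exists_shorter_of_neg L i h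
  exact ⟨L', hL.of_eq h2.symm (by simpa using h1), h2.symm, h1⟩

/-- The possible pairs of Cartan integers of two distinct simple roots. -/
inductive RankTwo (i j : SimpleIdx V n) : Prop
  | two (h₁ : i.root ⬝ᵥ j.coroot = 0) (h₂ : j.root ⬝ᵥ i.coroot = 0)
  | three (h₁ : i.root ⬝ᵥ j.coroot = -1) (h₂ : j.root ⬝ᵥ i.coroot = -1)
  | four (h₁ : i.root ⬝ᵥ j.coroot = -1) (h₂ : j.root ⬝ᵥ i.coroot = -2)
  | four' (h₁ : i.root ⬝ᵥ j.coroot = -2) (h₂ : j.root ⬝ᵥ i.coroot = -1)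

theorem rankTwo {i j : SimpleIdx V n} (hij : i ≠ j) : RankTwo i j := by
  have hij' : i.1 ≠ j.1 := fun e => hij (Subtype.ext e)
  suffices h : (i.root ⬝ᵥ j.coroot = 0 ∧ j.root ⬝ᵥ i.coroot = 0) ∨
      (i.root ⬝ᵥ j.coroot = -1 ∧ j.root ⬝ᵥ i.coroot = -1) ∨
      (i.root ⬝ᵥ j.coroot = -1 ∧ j.root ⬝ᵥ i.coroot = -2) ∨
      (i.root ⬝ᵥ j.coroot = -2 ∧ j.root ⬝ᵥ i.coroot = -1) by
    rcases h with ⟨a, b⟩ | ⟨a, b⟩ | ⟨a, b⟩ | ⟨a, b⟩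
    exacts [.two a b, .three a b, .four a b, .four' a b]
  rcases simpleShape i with ⟨p, hp, h⟩ | ⟨h0, hV, h⟩ | ⟨p, h0, hp, hV, h⟩ <;>
  rcases simpleShape j with ⟨q, hq, h'⟩ | ⟨h0', hV', h'⟩ | ⟨q, h0', hq, hV', h'⟩ <;>
  simp only [SimpleIdx.root, SimpleIdx.coroot, h, h', RootName.root, RootName.coroot,
    dotProduct_sub, dotProduct_add, dotProduct_single, Pi.sub_apply, Pi.add_apply,
    Pi.single_apply, mul_one] <;> grind
end

section
variable {V : ClassicalType} {n : ℕ} [GoodRank V n]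

theorem simpleReflection_coroot_self (i : SimpleIdx V n) :
    simpleReflection i *ᵥ i.coroot = -i.coroot := by
  rw [simpleReflection_mulVec, root_dot_coroot]; module

theorem simpleReflection_ne {i j : SimpleIdx V n} (h : RankTwo i j) :
    simpleReflection i * simpleReflection j ≠ 1 := by
  intro h1
  have h2 : simpleReflection i = simpleReflection j := by
    have := congrArg (simpleReflection i * ·) h1
    simpa [← mul_assoc, simpleReflection_mul_self] using this.symm
  have h3 : simpleReflection j *ᵥ i.coroot = -i.coroot := by
    rw [← h2, simpleReflection_coroot_self]
  rw [simpleReflection_mulVec] at h3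
  have h4 := congrArg (i.root ⬝ᵥ ·) h3
  simp only [dotProduct_sub, dotProduct_smul, dotProduct_neg, root_dot_coroot, smul_eq_mul] at h4
  rcases h with ⟨a, b⟩ | ⟨a, b⟩ | ⟨a, b⟩ | ⟨a, b⟩ <;> rw [a, b] at h4 <;> omega

theorem simpleReflection_injective {i j : SimpleIdx V n}
    (h : simpleReflection i = simpleReflection j) : i = j := by
  by_contra hij
  exact simpleReflection_ne (rankTwo hij) (by rw [h, simpleReflection_mul_self])

theorem orderOf_two {i j : SimpleIdx V n} (h : RankTwo i j)
    (h₁ : i.root ⬝ᵥ j.coroot = 0) (h₂ : j.root ⬝ᵥ i.coroot = 0) :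
    orderOf (simpleReflection i * simpleReflection j) = 2 := by
  refine orderOf_eq_prime ?_ (simpleReflection_ne h)
  refine ext_mulVec fun v => ?_
  simp only [pow_succ, pow_zero, one_mul, ← mulVec_mulVec, simpleReflection_mulVec, dotProduct_sub,
    dotProduct_smul, root_dot_coroot, h₁, h₂, smul_eq_mul, one_mulVec]
  module

theorem orderOf_three {i j : SimpleIdx V n} (h : RankTwo i j)
    (h₁ : i.root ⬝ᵥ j.coroot = -1) (h₂ : j.root ⬝ᵥ i.coroot = -1) :
    orderOf (simpleReflection i * simpleReflection j) = 3 := by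
  have : Fact (Nat.Prime 3) := ⟨Nat.prime_three⟩
  refine orderOf_eq_prime ?_ (simpleReflection_ne h)
  refine ext_mulVec fun v => ?_
  simp only [pow_succ, pow_zero, one_mul, ← mulVec_mulVec, simpleReflection_mulVec, dotProduct_sub,
    dotProduct_smul, root_dot_coroot, h₁, h₂, smul_eq_mul, one_mulVec]
  module

theorem orderOf_four {i j : SimpleIdx V n}
    (h₁ : i.root ⬝ᵥ j.coroot = -1) (h₂ : j.root ⬝ᵥ i.coroot = -2) :
    orderOf (simpleReflection i * simpleReflection j) = 4 := by
  have : Fact (Nat.Prime 2) := ⟨Nat.prime_two⟩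
  have key : orderOf (simpleReflection i * simpleReflection j) = 2 ^ (1 + 1) := by
    refine orderOf_eq_prime_pow ?_ ?_
    · intro h0
      have h3 := congrArg (· *ᵥ j.coroot) h0
      have h4 := congrArg (j.root ⬝ᵥ ·) h3
      simp only [pow_succ, pow_zero, one_mul, ← mulVec_mulVec, simpleReflection_mulVec,
        dotProduct_sub, dotProduct_smul, root_dot_coroot, h₁, h₂, smul_eq_mul, one_mulVec] at h4
      norm_num at h4
    · have e4 : 2 ^ (1 + 1) = 4 := rfl
      rw [e4]
      refine ext_mulVec fun v => ?_
      simp only [pow_succ, pow_zero, one_mul, ← mulVec_mulVec, simpleReflection_mulVec,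
        dotProduct_sub, dotProduct_smul, root_dot_coroot, h₁, h₂, smul_eq_mul, one_mulVec]
      module
  simpa using key

theorem orderOf_comm' (i j : SimpleIdx V n) :
    orderOf (simpleReflection i * simpleReflection j) =
      orderOf (simpleReflection j * simpleReflection i) := by
  let u : SimpleIdx V n → (Matrix (Fin n) (Fin n) ℤ)ˣ := fun i =>
    ⟨_, _, simpleReflection_mul_self i, simpleReflection_mul_self i⟩
  have h := orderOf_inv (u i * u j)
  rw [_root_.mul_inv_rev, ← orderOf_units, ← orderOf_units] at h
  exact h.symm

/-- The braid relations for the images of the simple reflections in a monoid. -/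
def Braided {M : Type*} [Monoid M] (f : SimpleIdx V n → M) : Prop :=
  ∀ i j, alternating (f i) (f j) (orderOf (simpleReflection i * simpleReflection j)) =
    alternating (f j) (f i) (orderOf (simpleReflection i * simpleReflection j))

section Braided

variable {M : Type*} [Monoid M] {f : SimpleIdx V n → M}

theorem Braided.two (hf : Braided f) {i j : SimpleIdx V n}
    (h₁ : i.root ⬝ᵥ j.coroot = 0) (h₂ : j.root ⬝ᵥ i.coroot = 0) : f i * f j = f j * f i := by
  have := hf i j
  rw [orderOf_two (.two h₁ h₂) h₁ h₂] at this
  simpa [alternating] using this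

theorem Braided.three (hf : Braided f) {i j : SimpleIdx V n}
    (h₁ : i.root ⬝ᵥ j.coroot = -1) (h₂ : j.root ⬝ᵥ i.coroot = -1) :
    f i * (f j * f i) = f j * (f i * f j) := by
  have := hf i j
  rw [orderOf_three (.three h₁ h₂) h₁ h₂] at this
  simpa [alternating] using this

theorem Braided.four (hf : Braided f) {i j : SimpleIdx V n}
    (h₁ : i.root ⬝ᵥ j.coroot = -1) (h₂ : j.root ⬝ᵥ i.coroot = -2) :
    f i * (f j * (f i * f j)) = f j * (f i * (f j * f i)) := by
  have := hf i j
  rw [orderOf_four h₁ h₂] at this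
  simpa [alternating] using this

theorem braided_of
    (h2 : ∀ i j, i.root ⬝ᵥ j.coroot = 0 → j.root ⬝ᵥ i.coroot = 0 → f i * f j = f j * f i)
    (h3 : ∀ i j, i.root ⬝ᵥ j.coroot = -1 → j.root ⬝ᵥ i.coroot = -1 →
      f i * (f j * f i) = f j * (f i * f j))
    (h4 : ∀ i j, i.root ⬝ᵥ j.coroot = -1 → j.root ⬝ᵥ i.coroot = -2 →
      f i * (f j * (f i * f j)) = f j * (f i * (f j * f i))) : Braided f := by
  intro i j
  by_cases hij : i = j
  · rw [hij]
  rcases rankTwo hij with ⟨a, b⟩ | ⟨a, b⟩ | ⟨a, b⟩ | ⟨a, b⟩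
  · rw [orderOf_two (.two a b) a b]
    simpa [alternating] using h2 i j a b
  · rw [orderOf_three (.three a b) a b]
    simpa [alternating] using h3 i j a b
  · rw [orderOf_four a b]
    simpa [alternating] using h4 i j a b
  · rw [orderOf_comm', orderOf_four b a]
    simpa [alternating] using (h4 j i b a).symm

theorem braided_simpleReflection :
    Braided (simpleReflection : SimpleIdx V n → Matrix (Fin n) (Fin n) ℤ) := by
  refine braided_of ?_ ?_ ?_ <;> intro i j a b <;> refine ext_mulVec fun v => ?_ <;>
  simp only [← mulVec_mulVec, simpleReflection_mulVec, dotProduct_sub,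
    dotProduct_smul, root_dot_coroot, a, b, smul_eq_mul] <;> module

theorem reflection_root (i j : SimpleIdx V n) :
    simpleReflection i *ᵥ j.root = j.root - (j.root ⬝ᵥ i.coroot) • i.root := by
  rw [simpleReflection_mulVec', dotProduct_comm]

theorem weyl_reverse_tail {i : SimpleIdx V n} {L : List (SimpleIdx V n)}
    (v : Fin n → ℤ) : weylElement L.reverse *ᵥ v =
      weylElement (i :: L).reverse *ᵥ (simpleReflection i *ᵥ v) := by
  rw [List.reverse_cons, weylElement_append, weylElement_cons, weylElement_nil, mul_one,
    ← mulVec_mulVec]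
  congr 1
  rw [mulVec_mulVec, simpleReflection_mul_self, one_mulVec]

/-- A reduced word all of whose rank two inversions for `i`, `j` are present can be rewritten to
start with the longest alternating word. -/
theorem exists_alternating_prefix {i j : SimpleIdx V n} (hij : i ≠ j)
    (hf : Braided f) {k : ℕ}
    (ih : ∀ L L' : List (SimpleIdx V n), IsReducedWord L → L.length = k →
      IsReducedWord L' → weylElement L' = weylElement L → (L.map f).prod = (L'.map f).prod)
    {L₁ : List (SimpleIdx V n)} (hL : IsReducedWord (i :: L₁)) (hk : L₁.length = k)
    (hj : height V (weylElement (i :: L₁).reverse *ᵥ j.root) < 0) :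
    ∃ L₂, IsReducedWord (j :: L₂) ∧ weylElement (j :: L₂) = weylElement (i :: L₁) ∧
      L₂.length = k ∧ ((i :: L₁).map f).prod = ((j :: L₂).map f).prod := by
  have hi : height V (weylElement (i :: L₁).reverse *ᵥ i.root) < 0 := by
    have := (isReducedWord_cons_iff hL.tail i).1 hL
    rw [reverse_cons_root, height_neg]; omega
  set w := weylElement (i :: L₁).reverse with hw
  have w1 : ∀ v, weylElement L₁.reverse *ᵥ v = w *ᵥ (simpleReflection i *ᵥ v) :=
    fun v => weyl_reverse_tail v
  rcases rankTwo hij with ⟨a, b⟩ | ⟨a, b⟩ | ⟨a, b⟩ | ⟨a, b⟩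
  · have n1 : height V (weylElement L₁.reverse *ᵥ j.root) < 0 := by
      rw [w1, reflection_root, b, zero_smul, sub_zero]; exact hj
    obtain ⟨R, r1, r2, r3⟩ := hL.tail.exists_cons j n1
    have e : weylElement (j :: i :: R) = weylElement (i :: L₁) := by
      rw [weylElement_cons, weylElement_cons, ← mul_assoc, ← braided_simpleReflection.two a b,
        mul_assoc, ← weylElement_cons j, r2, ← weylElement_cons]
    refine ⟨i :: R, hL.of_eq e (by simp; omega), e, by simp; omega, ?_⟩
    rw [List.map_cons, List.prod_cons, ih L₁ (j :: R) hL.tail hk r1 r2]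
    simp only [List.map_cons, List.prod_cons, ← mul_assoc]
    rw [hf.two a b]
  · have n1 : height V (weylElement L₁.reverse *ᵥ j.root) < 0 := by
      rw [w1, reflection_root, b, mulVec_sub, mulVec_smul, height_sub, height_smul]; omega
    obtain ⟨R, r1, r2, r3⟩ := hL.tail.exists_cons j n1
    have n2 : height V (weylElement R.reverse *ᵥ i.root) < 0 := by
      rw [weyl_reverse_tail (i := j), weylElement_reverse_eq r2, w1, reflection_root, a, mulVec_sub,
        mulVec_smul, simpleReflection_mulVec_self, reflection_root, b]
      have : -i.root - (-1 : ℤ) • (j.root - (-1 : ℤ) • i.root) = j.root := by module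
      rw [this]; exact hj
    obtain ⟨S, s1, s2, s3⟩ := r1.tail.exists_cons i n2
    have e1 : weylElement (j :: i :: S) = weylElement L₁ := by
      rw [weylElement_cons, s2, ← weylElement_cons, r2]
    have e : weylElement (j :: i :: j :: S) = weylElement (i :: L₁) := by
      rw [weylElement_cons i L₁, ← e1]
      simp only [weylElement_cons, ← mul_assoc]
      rw [mul_assoc (simpleReflection i), braided_simpleReflection.three a b]
      simp only [mul_assoc]
    refine ⟨i :: j :: S, hL.of_eq e (by simp; omega), e, by simp; omega, ?_⟩
    rw [List.map_cons, List.prod_cons, ih L₁ (j :: i :: S) hL.tail hk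
      (hL.tail.of_eq e1 (by simp; omega)) e1]
    simp only [List.map_cons, List.prod_cons, ← mul_assoc]
    rw [mul_assoc (f i), hf.three a b]
    simp only [mul_assoc]
  all_goals
    have h4 : f i * (f j * (f i * f j)) = f j * (f i * (f j * f i)) := by
      first
      | exact hf.four a b
      | exact (hf.four b a).symm
    have h4' : simpleReflection i * (simpleReflection j * (simpleReflection i *
        simpleReflection j)) = simpleReflection j * (simpleReflection i * (simpleReflection j *
        simpleReflection i)) := by
      first
      | exact braided_simpleReflection.four a b
      | exact (braided_simpleReflection.four b a).symm
    have n1 : height V (weylElement L₁.reverse *ᵥ j.root) < 0 := by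
      rw [w1, reflection_root, b, mulVec_sub, mulVec_smul, height_sub, height_smul]; omega
    obtain ⟨R, r1, r2, r3⟩ := hL.tail.exists_cons j n1
    have n2 : height V (weylElement R.reverse *ᵥ i.root) < 0 := by
      rw [weyl_reverse_tail (i := j), weylElement_reverse_eq r2, w1]
      simp only [reflection_root, a, b, mulVec_sub, mulVec_smul, root_dot_coroot, height_sub,
        height_smul]
      omega
    obtain ⟨S, s1, s2, s3⟩ := r1.tail.exists_cons i n2
    have n3 : height V (weylElement S.reverse *ᵥ j.root) < 0 := by
      rw [weyl_reverse_tail (i := i), weylElement_reverse_eq s2, weyl_reverse_tail (i := j),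
        weylElement_reverse_eq r2, w1]
      simp only [reflection_root, a, b, mulVec_sub, mulVec_smul, root_dot_coroot, height_sub,
        height_smul]
      omega
    obtain ⟨Q, q1, q2, q3⟩ := s1.tail.exists_cons j n3
    have e1 : weylElement (j :: i :: j :: Q) = weylElement L₁ := by
      rw [weylElement_cons, weylElement_cons, q2, ← weylElement_cons, s2, ← weylElement_cons, r2]
    have e : weylElement (j :: i :: j :: i :: Q) = weylElement (i :: L₁) := by
      rw [weylElement_cons i L₁, ← e1]
      simp only [weylElement_cons]
      have := congrArg (· * weylElement Q) h4'
      simpa only [mul_assoc] using this.symm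
    refine ⟨i :: j :: i :: Q, hL.of_eq e (by simp; omega), e, by simp; omega, ?_⟩
    rw [List.map_cons, List.prod_cons, ih L₁ (j :: i :: j :: Q) hL.tail hk
      (hL.tail.of_eq e1 (by simp; omega)) e1]
    simp only [List.map_cons, List.prod_cons]
    have := congrArg (· * (Q.map f).prod) h4
    simpa only [mul_assoc] using this

/-- **Matsumoto's theorem**: a map that satisfies the braid relations takes the same value on all
reduced words of an element. -/
theorem Braided.matsumoto (hf : Braided f) {L L' : List (SimpleIdx V n)}
    (hL : IsReducedWord L) (hL' : IsReducedWord L') (h : weylElement L' = weylElement L) :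
    (L.map f).prod = (L'.map f).prod := by
  suffices ∀ k, ∀ L L' : List (SimpleIdx V n), IsReducedWord L → L.length = k →
      IsReducedWord L' → weylElement L' = weylElement L → (L.map f).prod = (L'.map f).prod from
    this _ L L' hL rfl hL' h
  clear hL hL' h L L'
  intro k
  induction k with
  | zero =>
    intro L L' hL hk hL' h
    have h2 := hL.length_eq hL' h
    rw [hk] at h2
    rw [List.length_eq_zero_iff.1 hk, List.length_eq_zero_iff.1 h2]
  | succ k ih =>
    intro L L' hL hk hL' h
    have h2 := hL.length_eq hL' h
    rcases L with _ | ⟨i, L₁⟩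
    · simp at hk
    rcases L' with _ | ⟨j, L₁'⟩
    · simp at h2
    simp only [List.length_cons, add_left_inj] at hk h2
    by_cases hij : i = j
    · subst hij
      rw [List.map_cons, List.prod_cons, List.map_cons, List.prod_cons,
        ih L₁ L₁' hL.tail hk hL'.tail (weylElement_cons_cancel h)]
    · have hj : height V (weylElement (i :: L₁).reverse *ᵥ j.root) < 0 := by
        have := (isReducedWord_cons_iff hL'.tail j).1 hL'
        rw [← weylElement_reverse_eq h, reverse_cons_root, height_neg]; omega
      obtain ⟨L₂, a, b, c, d⟩ := exists_alternating_prefix hij hf ih hL hk hj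
      rw [d, List.map_cons, List.prod_cons, List.map_cons, List.prod_cons,
        ih L₂ L₁' a.tail c hL'.tail (weylElement_cons_cancel (h.trans b.symm))]

end Braided

theorem isPosRoot_of_simple_neg {w : Matrix (Fin n) (Fin n) ℤ}
    (h : ∀ i : SimpleIdx V n, height V (w *ᵥ i.root) < 0) {v : Fin n → ℤ} (hv : IsPosRoot V v) :
    height V (w *ᵥ v) < 0 := by
  set g : Fin n → ℤ := fun k => height V (w *ᵥ Pi.single k 1) with hg
  have hdiff : ∀ i p : Fin n, (p : ℕ) + 1 = i → g i < g p := by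
    intro i p hp
    have hi : ¬ (i : ℕ) = 0 := by omega
    obtain ⟨s, rfl⟩ : ∃ s : SimpleIdx V n, s.1 = i := ⟨⟨i, fun h => absurd h hi⟩, rfl⟩
    have := h s
    have e : s.root = Pi.single s.1 1 - Pi.single p 1 := by
      rcases simpleShape s with ⟨p', hp', h'⟩ | ⟨h0', hV', h'⟩ | ⟨p', h0', hp', hV', h'⟩
      · have : p' = p := Fin.ext (by omega)
        simp [SimpleIdx.root, h', RootName.root, this]
      · omega
      · omega
    rw [e, mulVec_sub, height_sub] at this
    simp only [hg]; omega
  have hanti : ∀ i p : Fin n, p < i → g i < g p := by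
    intro i p hp
    obtain ⟨k, hk⟩ : ∃ k : ℕ, (p : ℕ) + k + 1 = i := ⟨i - p - 1, by rw [Fin.lt_def] at hp; omega⟩
    clear hp
    induction k generalizing i with
    | zero => exact hdiff i p hk
    | succ k ih =>
      have hb : (p : ℕ) + k + 1 < n := by omega
      exact (hdiff i ⟨(p : ℕ) + k + 1, hb⟩ (by simp only; omega)).trans (ih ⟨_, hb⟩ rfl)
  have hz : V.HasZero → ∀ h0 : 0 < n, (∀ (_ : V = .B ∨ V = .C), g ⟨0, h0⟩ < 0) ∧
      (∀ (_ : V = .D) (h1 : 1 < n), g ⟨0, h0⟩ + g ⟨1, h1⟩ < 0) := by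
    intro hV h0
    obtain ⟨s, hs⟩ : ∃ s : SimpleIdx V n, s.1 = ⟨0, h0⟩ := ⟨⟨⟨0, h0⟩, fun _ => hV⟩, rfl⟩
    have hs' : (s.1 : ℕ) = 0 := by rw [hs]
    have hi := h s
    rw [← hs]
    rcases simpleShape s with ⟨p', hp', h'⟩ | ⟨h0', hV', h'⟩ | ⟨p', h0', hp', hV', h'⟩
    · omega
    · refine ⟨fun _ => ?_, fun hD => by rcases hV' with h | h <;> rw [h] at hD <;> simp at hD⟩
      have e : s.root = (if V = .C then 2 else 1 : ℤ) • Pi.single s.1 1 := by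
        rw [SimpleIdx.root, h', RootName.root]
        split_ifs <;> simp [← Pi.single_smul]
      rw [e, mulVec_smul, height_smul] at hi
      simp only [hg]
      split_ifs at hi <;> omega
    · refine ⟨fun h => by rcases h with h | h <;> rw [h] at hV' <;> simp at hV', fun _ h1 => ?_⟩
      have : p' = ⟨1, h1⟩ := Fin.ext hp'
      have e : s.root = Pi.single s.1 1 + Pi.single ⟨1, h1⟩ 1 := by
        rw [SimpleIdx.root, h', RootName.root, this]
      rw [e, mulVec_add, height_add] at hi
      simp only [hg]; omega
  have hle : ∀ (h0 : 0 < n) (k : Fin n), g k ≤ g ⟨0, h0⟩ := by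
    intro h0 k
    by_cases hk : (k : ℕ) = 0
    · have : k = ⟨0, h0⟩ := Fin.ext hk
      rw [this]
    · exact (hanti k ⟨0, h0⟩ (by rw [Fin.lt_def]; simp only; omega)).le
  obtain ⟨a, ha, rfl⟩ := hv
  cases a with
  | diff i j =>
    have := hanti i j ha
    simp only [hg] at this
    rw [RootName.root, mulVec_sub, height_sub]; omega
  | sum i j =>
    obtain ⟨hij, hV⟩ := ha
    have h0 : 0 < n := i.pos
    have hsum : g i + g j < 0 := by
      by_cases hD : V = .D
      · have h1 : 1 < n := by rw [Fin.lt_def] at hij; omega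
        have a1 := (hz hV h0).2 hD h1
        have a2 := hle h0 i
        have a3 : g j ≤ g ⟨1, h1⟩ := by
          by_cases hj : (j : ℕ) = 1
          · have : j = ⟨1, h1⟩ := Fin.ext hj
            rw [this]
          · refine (hanti j ⟨1, h1⟩ ?_).le
            rw [Fin.lt_def] at hij ⊢; simp only; omega
        omega
      · have hBC : V = .B ∨ V = .C := by
          cases V <;> simp_all [ClassicalType.HasZero]
        have a1 := (hz hV h0).1 hBC
        have a2 := hle h0 i
        have a3 := hle h0 j
        omega
    simp only [hg] at hsum
    rw [RootName.root, mulVec_add, height_add]; omega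
  | negSum i j => exact ha.elim
  | single i =>
    have hBC : V = .B ∨ V = .C := ha
    have hV : V.HasZero := by rcases hBC with rfl | rfl <;> exact trivial
    have a1 := (hz hV i.pos).1 hBC
    have a2 := hle i.pos i
    have e : RootName.root V (.single i) = (if V = .C then 2 else 1 : ℤ) • Pi.single i 1 := by
      rw [RootName.root]
      split_ifs <;> simp [← Pi.single_smul]
    rw [e, mulVec_smul, height_smul]
    have : g i < 0 := by omega
    simp only [hg] at this
    split_ifs <;> omega
  | negSingle i => exact ha.elim

theorem IsReducedWord.eq_nil_of_pos {L : List (SimpleIdx V n)} (hL : IsReducedWord L)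
    (h : ∀ v, IsPosRoot V v → 0 < height V (weylElement L.reverse *ᵥ v)) : L = [] := by
  rcases L with _ | ⟨i, L⟩
  · rfl
  · have h1 := (isReducedWord_cons_iff hL.tail i).1 hL
    have h2 := h _ (isPosRoot_root i)
    rw [reverse_cons_root, height_neg] at h2
    omega

theorem IsLongestWord.neg_simple {L : List (SimpleIdx V n)} (hL : IsLongestWord L)
    (i : SimpleIdx V n) : height V (weylElement L.reverse *ᵥ i.root) < 0 := by
  by_contra h
  have := hL.2 _ ((isReducedWord_cons_iff hL.1 i).2 (height_neg_of_not ((isRootVec_root i).weyl _) h))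
  simp at this

theorem IsLongestWord.reverse {L : List (SimpleIdx V n)} (hL : IsLongestWord L) :
    IsLongestWord L.reverse :=
  ⟨hL.1.reverse, fun R hR => by simpa using hL.2 R hR⟩

theorem IsLongestWord.neg {L : List (SimpleIdx V n)} (hL : IsLongestWord L)
    {v : Fin n → ℤ} (hv : IsPosRoot V v) : height V (weylElement L *ᵥ v) < 0 :=
  isPosRoot_of_simple_neg (fun i => by simpa using hL.reverse.neg_simple i) hv

/-- Two words whose elements make all simple roots negative have the same element. -/
theorem weylElement_eq_of_neg {L L' : List (SimpleIdx V n)}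
    (h : ∀ i : SimpleIdx V n, height V (weylElement L.reverse *ᵥ i.root) < 0)
    (h' : ∀ i : SimpleIdx V n, height V (weylElement L' *ᵥ i.root) < 0) :
    weylElement L = weylElement L' := by
  obtain ⟨R, hR, hRe⟩ := exists_reduced (L.reverse ++ L')
  have hnil : R.reverse = [] := by
    refine hR.reverse.eq_nil_of_pos fun v hv => ?_
    rw [List.reverse_reverse, hRe, weylElement_append, ← mulVec_mulVec]
    have h1 : IsRootVec V (weylElement L' *ᵥ v) := IsRootVec.weyl L' (.inl hv)
    have h2 := isPosRoot_of_simple_neg h (h1.neg_of_height (isPosRoot_of_simple_neg h' hv))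
    rw [mulVec_neg, height_neg] at h2
    omega
  have hnil' : R = [] := by simpa using hnil
  rw [hnil', weylElement_nil, weylElement_append] at hRe
  have := congrArg (weylElement L * ·) hRe
  simpa [← mul_assoc, weylElement_mul_reverse] using this

theorem IsLongestWord.weylElement_eq {L L' : List (SimpleIdx V n)}
    (hL : IsLongestWord L) (hL' : IsLongestWord L') : weylElement L = weylElement L' :=
  weylElement_eq_of_neg hL.neg_simple fun i => hL'.neg (isPosRoot_root i)

theorem IsLongestWord.mul_self {L : List (SimpleIdx V n)} (hL : IsLongestWord L) :
    weylElement L * weylElement L = 1 := by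
  conv_lhs => rw [hL.weylElement_eq hL.reverse]
  rw [← hL.weylElement_eq hL.reverse, hL.reverse.weylElement_eq hL |>.symm]
  nth_rewrite 1 [← hL.weylElement_eq hL.reverse]
  exact weylElement_mul_reverse L

theorem IsLongestWord.of_length {L L' : List (SimpleIdx V n)}
    (hL : IsLongestWord L) (hL' : IsReducedWord L') (h : L'.length = L.length) :
    IsLongestWord L' :=
  ⟨hL', fun R hR => h ▸ hL.2 R hR⟩

/-- Each simple reflection `s_i` is the first letter of a reduced word of the longest element, and
moving it to the end turns it into `s_j`, where `w₀ a_j = -a_i`. -/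
theorem IsLongestWord.exists_opposite {L : List (SimpleIdx V n)}
    (hL : IsLongestWord L) (i : SimpleIdx V n) :
    ∃ j L', IsLongestWord (i :: L') ∧ IsLongestWord (L' ++ [j]) ∧
      weylElement L' *ᵥ j.root = i.root := by
  obtain ⟨L', h1, h2, h3⟩ := hL.1.exists_cons i (hL.neg_simple i)
  have hL1 : IsLongestWord (i :: L') := hL.of_length h1 (by simpa using h3)
  obtain ⟨j, hj⟩ : ∃ j : SimpleIdx V n, ¬ height V (weylElement L' *ᵥ j.root) < 0 := by
    by_contra! hcon
    have h4 := weylElement_eq_of_neg hL.neg_simple hcon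
    have h5 := hL.1 L' h4.symm
    omega
  have hj' := height_neg_of_not ((isRootVec_root j).weyl _) hj
  have h4 : IsReducedWord (j :: L'.reverse) :=
    (isReducedWord_cons_iff h1.tail.reverse j).2 (by simpa using hj')
  have h5 : IsLongestWord (L' ++ [j]) := by
    refine hL.of_length ?_ (by simpa using h3)
    simpa using h4.reverse
  refine ⟨j, L', hL1, h5, ?_⟩
  by_contra hne
  have hp := ((isRootVec_root j).weyl L').pos_of_height hj
  have h6 := height_pos (reflection_isPosRoot i hp hne)
  have h7 := hL1.neg (isPosRoot_root j)
  rw [weylElement_cons, ← mulVec_mulVec] at h7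
  omega
end

section
variable {V : ClassicalType} {n d : ℕ} [GoodRank V n]

theorem IsLongestWord.braided_mul {M : Type*} [Monoid M] {f : SimpleIdx V n → M}
    (hf : Braided f) {L : List (SimpleIdx V n)} (hL : IsLongestWord L) {i j : SimpleIdx V n}
    {L' : List (SimpleIdx V n)} (h1 : IsLongestWord (i :: L')) (h2 : IsLongestWord (L' ++ [j])) :
    f i * (L.map f).prod = (L.map f).prod * f j := by
  have e1 := hf.matsumoto hL.1 h1.1 (h1.weylElement_eq hL)
  have e2 := hf.matsumoto hL.1 h2.1 (h2.weylElement_eq hL)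
  simp only [List.map_cons, List.prod_cons, List.map_append, List.prod_append, List.map_nil,
    List.prod_nil, mul_one] at e1 e2
  conv_lhs => rw [e2]
  rw [e1, mul_assoc]

theorem IsLongestWord.braided_commute {M : Type*} [Monoid M] {f : SimpleIdx V n → M}
    (hf : Braided f) {L : List (SimpleIdx V n)} (hL : IsLongestWord L) (i : SimpleIdx V n) :
    f i * (L.map f).prod ^ 2 = (L.map f).prod ^ 2 * f i := by
  obtain ⟨j, L', h1, h2, -⟩ := hL.exists_opposite i
  obtain ⟨k, L'', h1', h2', -⟩ := hL.exists_opposite j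
  have hki : k = i := by
    have a := hL.braided_mul braided_simpleReflection h1 h2
    have b := hL.braided_mul braided_simpleReflection h1' h2'
    have hw : (L.map simpleReflection).prod * (L.map simpleReflection).prod = 1 := hL.mul_self
    apply simpleReflection_injective
    calc simpleReflection k = (L.map simpleReflection).prod *
          ((L.map simpleReflection).prod * simpleReflection k) := by rw [← mul_assoc, hw, one_mul]
      _ = simpleReflection i := by rw [← b, ← mul_assoc, ← a, mul_assoc, hw, mul_one]
  rw [sq, ← mul_assoc, hL.braided_mul hf h1 h2, mul_assoc, hL.braided_mul hf h1' h2', hki,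
    mul_assoc]

/-- The action of `s_{i_1} ⋯ s_{i_k}` on the torus. -/
def wordTorus (L : List (SimpleIdx V n)) (x : torus V n d) : torus V n d :=
  L.foldr reflectTorus x

theorem reflectTorus_val (i : SimpleIdx V n) (x : torus V n d) :
    (reflectTorus i x).1 = (simpleReflection i).map (Int.cast : ℤ → ZMod d) *ᵥ x.1 := by
  funext k
  simp [reflectTorus, corootTorus, simpleReflection, mulVec, dotProduct, Matrix.one_apply,
    vecMulVec_apply, sub_mul, Finset.sum_sub_distrib, Finset.sum_mul]
  exact Finset.sum_congr rfl fun j _ => by ring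

theorem wordTorus_val (L : List (SimpleIdx V n)) (x : torus V n d) :
    (wordTorus L x).1 = (weylElement L).map (Int.cast : ℤ → ZMod d) *ᵥ x.1 := by
  induction L with
  | nil => simp [wordTorus, weylElement_nil]
  | cons i L ih =>
    have : wordTorus (i :: L) x = reflectTorus i (wordTorus L x) := rfl
    rw [this, reflectTorus_val, ih, weylElement_cons, mulVec_mulVec]
    congr 1
    exact (Matrix.map_mul (L := simpleReflection i) (M := weylElement L)
      (f := Int.castRingHom (ZMod d))).symm

theorem wordTorus_congr {L L' : List (SimpleIdx V n)} (h : weylElement L = weylElement L')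
    (x : torus V n d) : wordTorus L x = wordTorus L' x :=
  Subtype.ext (by rw [wordTorus_val, wordTorus_val, h])

theorem wordTorus_cons (i : SimpleIdx V n) (L : List (SimpleIdx V n)) (x : torus V n d) :
    wordTorus (i :: L) x = reflectTorus i (wordTorus L x) := rfl

theorem wordTorus_append (L L' : List (SimpleIdx V n)) (x : torus V n d) :
    wordTorus (L ++ L') x = wordTorus L (wordTorus L' x) := by
  simp [wordTorus]

theorem wordTorus_of_eq_one {L : List (SimpleIdx V n)} (h : weylElement L = 1) (x : torus V n d) :
    wordTorus L x = x := wordTorus_congr (L' := []) (by rw [h, weylElement_nil]) x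

theorem wordTorus_add (L : List (SimpleIdx V n)) (x y : torus V n d) :
    wordTorus L (x + y) = wordTorus L x + wordTorus L y := by
  refine Subtype.ext ?_
  rw [wordTorus_val]
  simp [wordTorus_val, mulVec_add]

theorem wordTorus_zero (L : List (SimpleIdx V n)) : wordTorus L (0 : torus V n d) = 0 := by
  refine Subtype.ext ?_
  rw [wordTorus_val]
  simp

theorem wordTorus_nsmul (L : List (SimpleIdx V n)) (k : ℕ) (x : torus V n d) :
    wordTorus L (k • x) = k • wordTorus L x := by
  induction k with
  | zero => rw [zero_smul, zero_smul, wordTorus_zero]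
  | succ k ih => rw [succ_nsmul, succ_nsmul, wordTorus_add, ih]

theorem reflectTorus_nsmul (i : SimpleIdx V n) (k : ℕ) (x : torus V n d) :
    reflectTorus i (k • x) = k • reflectTorus i x := wordTorus_nsmul [i] k x

theorem wordTorus_coroot {L : List (SimpleIdx V n)} {i j : SimpleIdx V n}
    (h : weylElement L *ᵥ j.root = i.root) : wordTorus L (corootTorus d j) = corootTorus d i := by
  have h' := weyl_coroot L h
  refine Subtype.ext ?_
  rw [wordTorus_val]
  funext k
  have := congrArg (Int.cast : ℤ → ZMod d) (congrFun h' k)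
  simpa [corootTorus, mulVec, dotProduct] using this

theorem reflectTorus_coroot_self (i : SimpleIdx V n) :
    reflectTorus i (corootTorus d i) = -corootTorus d i := by
  have h' := simpleReflection_coroot_self i
  refine Subtype.ext ?_
  rw [reflectTorus_val]
  funext k
  have := congrArg (Int.cast : ℤ → ZMod d) (congrFun h' k)
  simpa [corootTorus, mulVec, dotProduct] using this

theorem reflectTorus_reflectTorus (i : SimpleIdx V n) (x : torus V n d) :
    reflectTorus i (reflectTorus i x) = x :=
  wordTorus_of_eq_one (L := [i, i]) (by
    rw [weylElement_cons, weylElement_cons, weylElement_nil, mul_one, simpleReflection_mul_self]) x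

omit [GoodRank V n] in
theorem torus_nsmul_d (x : torus V n d) : d • x = 0 := by
  refine Subtype.ext ?_
  funext k
  simp

/-- The relations that all the algebras and groups have in common. -/
structure BaseRel {M : Type*} [Monoid M] (g : Gen V n d → M) : Prop where
  one : g (.t 0) = 1
  mul : ∀ x y, g (.t (x + y)) = g (.t x) * g (.t y)
  conj : ∀ i x, g (.xi i) * g (.t x) = g (.t (reflectTorus i x)) * g (.xi i)
  braid : Braided fun i => g (.xi i)

theorem BaseRel.of_defRel {M : Type*} [Monoid M] {g : Gen V n d → M} {sq : SimpleIdx V n → M}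
    (h : ∀ a b, DefRel g sq a b → a = b) : BaseRel g :=
  ⟨h _ _ .one, fun x y => h _ _ (.mul x y), fun i x => h _ _ (.conj i x),
    fun i j => h _ _ (.braid i j)⟩

theorem BaseRel.defRel {M : Type*} [Monoid M] {g : Gen V n d → M} {sq : SimpleIdx V n → M}
    (h : BaseRel g) (hsq : ∀ i, g (.xi i) ^ 2 = sq i) {a b : M} (hab : DefRel g sq a b) : a = b := by
  cases hab with
  | one => exact h.one
  | mul x y => exact h.mul x y
  | conj i x => exact h.conj i x
  | quad i => exact hsq i
  | braid i j => exact h.braid i j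

section Monoid

variable {M : Type*} [Monoid M] {g : Gen V n d → M}

omit [GoodRank V n] in
theorem xiProd_cons (i : SimpleIdx V n) (L : List (SimpleIdx V n)) :
    xiProd g (i :: L) = g (.xi i) * xiProd g L := by simp [xiProd]

omit [GoodRank V n] in
theorem xiProd_nil : xiProd g ([] : List (SimpleIdx V n)) = 1 := by simp [xiProd]

omit [GoodRank V n] in
theorem xiProd_append (L L' : List (SimpleIdx V n)) :
    xiProd g (L ++ L') = xiProd g L * xiProd g L' := by simp [xiProd]

theorem map_alternating {M' F : Type*} [Monoid M'] [FunLike F M M'] [MonoidHomClass F M M'] (φ : F)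
    (a b : M) (m : ℕ) :
    φ (alternating a b m) = alternating (φ a) (φ b) m := by
  induction m generalizing a b with
  | zero => simp [alternating]
  | succ m ih => simp [alternating, ih]

theorem map_xiProd {M' F : Type*} [Monoid M'] [FunLike F M M'] [MonoidHomClass F M M'] (φ : F)
    (L : List (SimpleIdx V n)) : φ (xiProd g L) = xiProd (fun x => φ (g x)) L := by
  simp [xiProd, map_list_prod, Function.comp_def]

theorem BaseRel.map {M' F : Type*} [Monoid M'] [FunLike F M M'] [MonoidHomClass F M M'] (φ : F)
    (h : BaseRel g) : BaseRel fun x => φ (g x) where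
  one := by rw [h.one, map_one]
  mul x y := by rw [h.mul, map_mul]
  conj i x := by rw [← map_mul, h.conj, map_mul]
  braid i j := by rw [← map_alternating, h.braid i j, map_alternating]

namespace BaseRel

variable (h : BaseRel g)
include h

theorem t_comm (x y : torus V n d) : g (.t x) * g (.t y) = g (.t y) * g (.t x) := by
  rw [← h.mul, ← h.mul, add_comm]

theorem t_neg (x : torus V n d) : g (.t (-x)) * g (.t x) = 1 := by
  rw [← h.mul, neg_add_cancel, h.one]

theorem t_nsmul (k : ℕ) (x : torus V n d) : g (.t (k • x)) = g (.t x) ^ k := by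
  induction k with
  | zero => simp [h.one]
  | succ k ih => rw [succ_nsmul, h.mul, ih, pow_succ]

theorem t_pow_d (x : torus V n d) : g (.t x) ^ d = 1 := by
  rw [← h.t_nsmul, torus_nsmul_d, h.one]

theorem xiProd_t (L : List (SimpleIdx V n)) (x : torus V n d) :
    xiProd g L * g (.t x) = g (.t (wordTorus L x)) * xiProd g L := by
  induction L with
  | nil => simp [xiProd_nil, wordTorus]
  | cons i L ih =>
    rw [xiProd_cons, mul_assoc, ih, ← mul_assoc, h.conj, mul_assoc, wordTorus_cons]

theorem xiProd_congr {L L' : List (SimpleIdx V n)} (hL : IsReducedWord L)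
    (hL' : IsReducedWord L') (e : weylElement L' = weylElement L) : xiProd g L = xiProd g L' :=
  h.braid.matsumoto hL hL' e

theorem longest_sq_t {L : List (SimpleIdx V n)} (hL : IsLongestWord L)
    (x : torus V n d) : g (.t x) * xiProd g L ^ 2 = xiProd g L ^ 2 * g (.t x) := by
  rw [sq, ← xiProd_append, h.xiProd_t, wordTorus_of_eq_one]
  rw [weylElement_append, hL.mul_self]

theorem longest_sq_xi {L : List (SimpleIdx V n)} (hL : IsLongestWord L)
    (i : SimpleIdx V n) : g (.xi i) * xiProd g L ^ 2 = xiProd g L ^ 2 * g (.xi i) :=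
  hL.braided_commute h.braid i

theorem longest_sq {L : List (SimpleIdx V n)} (hL : IsLongestWord L)
    (x : Gen V n d) : g x * xiProd g L ^ 2 = xiProd g L ^ 2 * g x := by
  cases x with
  | t x => exact h.longest_sq_t hL x
  | xi i => exact h.longest_sq_xi hL i

theorem longest_sq_eq {L : List (SimpleIdx V n)} (hL : IsLongestWord L) :
    xiProd g L ^ 2 = xiProd g L * xiProd g L.reverse := by
  rw [sq, ← h.xiProd_congr hL.1 hL.1.reverse (hL.reverse.weylElement_eq hL)]

end BaseRel

end Monoid

/-! ### Finiteness of the Weyl group and spanning sets -/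

theorem finite_weylElement :
    (Set.range (weylElement : List (SimpleIdx V n) → _)).Finite := by
  refine Set.Finite.subset (s := {A | ∀ i j, A i j ∈ Set.Icc (-1 : ℤ) 1}) ?_ ?_
  · have := Set.Finite.pi' (ι := Fin n) (κ := fun _ => Fin n → ℤ)
      (t := fun _ => {f | ∀ j, f j ∈ Set.Icc (-1 : ℤ) 1})
      fun _ => Set.Finite.pi' fun _ => Set.finite_Icc _ _
    exact this
  · rintro _ ⟨L, rfl⟩ i j
    have h := weylElement_dot L (Pi.single j 1) (Pi.single j 1)
    rw [mulVec_single_one, single_dotProduct, Pi.single_eq_same, mul_one] at h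
    have h2 : weylElement L i j * weylElement L i j ≤ 1 := by
      rw [← h]
      exact Finset.single_le_sum (f := fun k => (weylElement L).col j k * (weylElement L).col j k)
        (fun k _ => mul_self_nonneg _) (Finset.mem_univ i)
    constructor <;> nlinarith

/-- The elements `t_x ξ_{i_1} ⋯ ξ_{i_k}`, for the reduced words. -/
def standardElements {M : Type*} [Monoid M] (g : Gen V n d → M) : Set M :=
  {a | ∃ x L, IsReducedWord L ∧ a = g (.t x) * xiProd g L}

theorem BaseRel.finite_standardElements [NeZero d] {M : Type*} [Monoid M]
    {g : Gen V n d → M} (h : BaseRel g) : (standardElements g).Finite := by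
  classical
  have : Finite (Set.range (weylElement : List (SimpleIdx V n) → _)) := finite_weylElement
  choose R hR hRe using fun w : Set.range (weylElement : List (SimpleIdx V n) → _) =>
    (show ∃ R : List (SimpleIdx V n), IsReducedWord R ∧ weylElement R = w.1 by
      obtain ⟨L, hL⟩ := w.2
      rw [← hL]; exact exists_reduced L)
  refine (Set.finite_range fun p : torus V n d × Set.range weylElement =>
    g (.t p.1) * xiProd g (R p.2)).subset ?_
  rintro _ ⟨x, L, hL, rfl⟩
  refine ⟨(x, ⟨weylElement L, L, rfl⟩), ?_⟩
  exact congrArg _ (h.xiProd_congr hL (hR ⟨weylElement L, L, rfl⟩) (hRe ⟨weylElement L, L, rfl⟩)).symm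

theorem isReducedWord_nil : IsReducedWord ([] : List (SimpleIdx V n)) := fun _ _ => Nat.zero_le _

theorem BaseRel.one_mem_standardElements {M : Type*} [Monoid M]
    {g : Gen V n d → M} (h : BaseRel g) : 1 ∈ standardElements g :=
  ⟨0, [], isReducedWord_nil, by rw [h.one, xiProd_nil, mul_one]⟩

theorem BaseRel.t_mul_mem_standardElements {M : Type*} [Monoid M]
    {g : Gen V n d → M} (h : BaseRel g) (x : torus V n d) {a : M} (ha : a ∈ standardElements g) :
    g (.t x) * a ∈ standardElements g := by
  obtain ⟨y, L, hL, rfl⟩ := ha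
  exact ⟨x + y, L, hL, by rw [h.mul, mul_assoc]⟩

/-- Left multiplication by `ξ_i` on a standard element. -/
theorem BaseRel.xi_mul_standard {M : Type*} [Monoid M]
    {g : Gen V n d → M} (h : BaseRel g) (i : SimpleIdx V n) {a : M} (ha : a ∈ standardElements g) :
    g (.xi i) * a ∈ standardElements g ∨
      ∃ x L, IsReducedWord L ∧ IsReducedWord (i :: L) ∧
        g (.xi i) * a = g (.t x) * (g (.xi i) ^ 2 * xiProd g L) := by
  obtain ⟨y, L, hL, rfl⟩ := ha
  by_cases hi : IsReducedWord (i :: L)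
  · exact .inl ⟨_, _, hi, by rw [← mul_assoc, h.conj, xiProd_cons, mul_assoc]⟩
  · right
    have hn : height V (weylElement L.reverse *ᵥ i.root) < 0 := by
      by_contra hcon
      exact hi ((isReducedWord_cons_iff hL i).2
        (height_neg_of_not ((isRootVec_root i).weyl _) hcon))
    obtain ⟨L', h1, h2, -⟩ := hL.exists_cons i hn
    refine ⟨reflectTorus i y, L', h1.tail, h1, ?_⟩
    rw [h.xiProd_congr hL h1 h2, ← mul_assoc, h.conj, xiProd_cons, mul_assoc, sq, mul_assoc]

/-- If `ξ_i² = t_{H}`, the standard elements are closed under multiplication by generators. -/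
theorem BaseRel.gen_mul_mem_standardElements {M : Type*} [Monoid M]
    {g : Gen V n d → M} (h : BaseRel g) (hsq : ∀ i, g (.xi i) ^ 2 = hNeg g i) (x : Gen V n d)
    {a : M} (ha : a ∈ standardElements g) : g x * a ∈ standardElements g := by
  cases x with
  | t x => exact h.t_mul_mem_standardElements x ha
  | xi i =>
    rcases h.xi_mul_standard i ha with h1 | ⟨x, L, hL, hL', e⟩
    · exact h1
    · rw [e, hsq]
      exact ⟨x + (d / 2) • corootTorus d i, L, hL, by rw [h.mul, mul_assoc]; rfl⟩

section Span

variable {R : Type*} [CommRing R] {B : Type*} [Ring B] [Algebra R B] {g : Gen V n d → B}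

/-- The span of the torus. -/
def torusSpan (R : Type*) [CommRing R] {B : Type*} [Ring B] [Algebra R B] (g : Gen V n d → B) :
    Submodule R B := Submodule.span R (Set.range fun x => g (.t x))

theorem BaseRel.torusSpan_mul (h : BaseRel g) {p : B} (hp : p ∈ torusSpan R g) {a : B}
    (ha : a ∈ Submodule.span R (standardElements g)) :
    p * a ∈ Submodule.span R (standardElements g) := by
  induction hp using Submodule.span_induction with
  | mem p hp =>
    obtain ⟨x, rfl⟩ := hp
    induction ha using Submodule.span_induction with
    | mem a ha => exact Submodule.subset_span (h.t_mul_mem_standardElements x ha)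
    | zero => simp
    | add a b _ _ ha hb => simp only at ha hb ⊢; rw [mul_add]; exact add_mem ha hb
    | smul c a _ ha => simp only at ha ⊢; rw [mul_smul_comm]; exact Submodule.smul_mem _ _ ha
  | zero => simp
  | add p q _ _ hp hq => rw [add_mul]; exact add_mem hp hq
  | smul c p _ hp => rw [smul_mul_assoc]; exact Submodule.smul_mem _ _ hp

theorem BaseRel.gen_mul_mem_span (h : BaseRel g)
    (hsq : ∀ i, ∃ p ∈ torusSpan R g, ∃ q ∈ torusSpan R g, g (.xi i) ^ 2 = p + q * g (.xi i))
    (x : Gen V n d) {a : B} (ha : a ∈ Submodule.span R (standardElements g)) :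
    g x * a ∈ Submodule.span R (standardElements g) := by
  induction ha using Submodule.span_induction with
  | mem a ha =>
    cases x with
    | t x => exact Submodule.subset_span (h.t_mul_mem_standardElements x ha)
    | xi i =>
      rcases h.xi_mul_standard i ha with h1 | ⟨x, L, hL, hL', e⟩
      · exact Submodule.subset_span h1
      · obtain ⟨p, hp, q, hq, e'⟩ := hsq i
        rw [e, e', add_mul, mul_assoc, ← xiProd_cons]
        have hst : ∀ {L}, IsReducedWord L → xiProd g L ∈ Submodule.span R (standardElements g) :=
          fun {L} hL => Submodule.subset_span ⟨0, L, hL, by rw [h.one, one_mul]⟩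
        refine h.torusSpan_mul (Submodule.subset_span ⟨x, rfl⟩) (add_mem ?_ ?_)
        · exact h.torusSpan_mul hp (hst hL)
        · exact h.torusSpan_mul hq (hst hL')
  | zero => simp
  | add a b _ _ ha hb => rw [mul_add]; exact add_mem ha hb
  | smul c a _ ha => rw [mul_smul_comm]; exact Submodule.smul_mem _ _ ha

/-- The subalgebra generated by the generators is spanned by the standard elements. -/
theorem BaseRel.adjoin_le_span (h : BaseRel g)
    (hsq : ∀ i, ∃ p ∈ torusSpan R g, ∃ q ∈ torusSpan R g, g (.xi i) ^ 2 = p + q * g (.xi i))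
    {a : B} (ha : a ∈ Algebra.adjoin R (Set.range g)) :
    a ∈ Submodule.span R (standardElements g) := by
  have key : ∀ b ∈ Submodule.span R (standardElements g),
      a * b ∈ Submodule.span R (standardElements g) := by
    induction ha using Algebra.adjoin_induction with
    | mem a ha =>
      obtain ⟨x, rfl⟩ := ha
      exact fun b hb => h.gen_mul_mem_span hsq x hb
    | algebraMap r =>
      intro b hb
      rw [← Algebra.smul_def]
      exact Submodule.smul_mem _ _ hb
    | add a b _ _ ha hb => intro c hc; rw [add_mul]; exact add_mem (ha c hc) (hb c hc)
    | mul a b _ _ ha hb => intro c hc; rw [mul_assoc]; exact ha _ (hb c hc)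
  simpa using key 1 (Submodule.subset_span h.one_mem_standardElements)

end Span
end

section
variable {V : ClassicalType} {n d : ℕ} [GoodRank V n]

theorem DefRel.map {M M' F : Type*} [Monoid M] [Monoid M'] [FunLike F M M'] [MonoidHomClass F M M']
    (φ : F) {g : Gen V n d → M} {sq : SimpleIdx V n → M} {a b : M} (h : DefRel g sq a b) :
    DefRel (fun x => φ (g x)) (fun i => φ (sq i)) (φ a) (φ b) := by
  cases h with
  | one => rw [map_one]; exact .one
  | mul x y => rw [map_mul]; exact .mul x y
  | conj i x => rw [map_mul, map_mul]; exact .conj i x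
  | quad i => rw [map_pow]; exact .quad i
  | braid i j => rw [map_alternating, map_alternating]; exact .braid i j

/-- The idempotent `e_i`, with the scalar `1/d` taken in `R`. -/
def idemR (R : Type*) [CommRing R] [Algebra ℂ R] {B : Type*} [Ring B] [Algebra R B]
    (g : Gen V n d → B) (i : SimpleIdx V n) : B :=
  algebraMap ℂ R (1 / (d : ℂ)) • ∑ j ∈ Finset.Icc 1 d, g (.t (j • corootTorus d i))

theorem idem_eq_idemR {R : Type*} [CommRing R] [Algebra ℂ R] {B : Type*} [Ring B] [Algebra R B]
    [Algebra ℂ B] [IsScalarTower ℂ R B] (g : Gen V n d → B) (i : SimpleIdx V n) :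
    idem g i = idemR R g i := by
  rw [idem, idemR, algebraMap_smul]

theorem map_idemR {R : Type*} [CommRing R] [Algebra ℂ R] {B B' : Type*} [Ring B] [Algebra R B]
    [Ring B'] [Algebra R B'] (φ : B →ₐ[R] B') (g : Gen V n d → B) (i : SimpleIdx V n) :
    φ (idemR R g i) = idemR R (fun x => φ (g x)) i := by
  simp [idemR]

section Presented

variable {R : Type*} [CommRing R] {Q : SimpleIdx V n → FreeAlgebra R (Gen V n d)}

/-- The generators of a presented algebra. -/
def presGen (Q : SimpleIdx V n → FreeAlgebra R (Gen V n d)) (x : Gen V n d) :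
    RingQuot (DefRel (FreeAlgebra.ι R) Q) :=
  RingQuot.mkAlgHom R _ (FreeAlgebra.ι R x)

theorem presGen_rel {a b : RingQuot (DefRel (FreeAlgebra.ι R) Q)}
    (h : DefRel (presGen Q) (fun i => RingQuot.mkAlgHom R _ (Q i)) a b) : a = b := by
  cases h with
  | one =>
    rw [← map_one (RingQuot.mkAlgHom R (DefRel (FreeAlgebra.ι R) Q))]
    exact RingQuot.mkAlgHom_rel R .one
  | mul x y =>
    have := RingQuot.mkAlgHom_rel R (s := DefRel (FreeAlgebra.ι R) Q) (.mul x y)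
    rwa [map_mul] at this
  | conj i x =>
    have := RingQuot.mkAlgHom_rel R (s := DefRel (FreeAlgebra.ι R) Q) (.conj i x)
    rwa [map_mul, map_mul] at this
  | quad i =>
    have := RingQuot.mkAlgHom_rel R (s := DefRel (FreeAlgebra.ι R) Q) (.quad i)
    rwa [map_pow] at this
  | braid i j =>
    have := RingQuot.mkAlgHom_rel R (s := DefRel (FreeAlgebra.ι R) Q) (.braid i j)
    rwa [map_alternating, map_alternating] at this

theorem baseRel_presGen : BaseRel (presGen Q) := BaseRel.of_defRel fun _ _ => presGen_rel

theorem presGen_sq (i : SimpleIdx V n) :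
    presGen Q (.xi i) ^ 2 = RingQuot.mkAlgHom R _ (Q i) := presGen_rel (.quad i)

theorem exists_pres_lift {B : Type*} [Ring B] [Algebra R B] {g : Gen V n d → B} (h : BaseRel g)
    (hsq : ∀ i, g (.xi i) ^ 2 = FreeAlgebra.lift R g (Q i)) :
    ∃ f : RingQuot (DefRel (FreeAlgebra.ι R) Q) →ₐ[R] B, ∀ x, f (presGen Q x) = g x := by
  refine ⟨RingQuot.liftAlgHom R ⟨FreeAlgebra.lift R g, ?_⟩, ?_⟩
  · intro a b hab
    have h1 := hab.map (FreeAlgebra.lift R g)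
    simp only [FreeAlgebra.lift_ι_apply] at h1
    exact h.defRel hsq h1
  · intro x
    rw [presGen, RingQuot.liftAlgHom_mkAlgHom_apply, FreeAlgebra.lift_ι_apply]

theorem adjoin_presGen : Algebra.adjoin R (Set.range (presGen Q)) = ⊤ := by
  have h1 : Set.range (presGen Q) =
      RingQuot.mkAlgHom R (DefRel (FreeAlgebra.ι R) Q) '' Set.range (FreeAlgebra.ι R) := by
    rw [← Set.range_comp]; rfl
  rw [h1, Algebra.adjoin_image, FreeAlgebra.adjoin_range_ι, Algebra.map_top,
    AlgHom.range_eq_top]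
  exact RingQuot.mkAlgHom_surjective R _

end Presented

section Generic

variable {R : Type*} [CommRing R] [Algebra ℂ R] {u : R}

/-- The quadratic relation of the Yokonuma--Hecke algebra. -/
def YokQuad {B : Type*} [Ring B] [Algebra R B] (u : R) (g : Gen V n d → B) : Prop :=
  ∀ i, g (.xi i) ^ 2 = u • hNeg g i + (1 - u) • (idemR R g i * g (.xi i))

/-- The quadratic relation of the deformation `Z`. -/
def DefQuad {B : Type*} [Ring B] [Algebra R B] (u : R) (g : Gen V n d → B) : Prop :=
  ∀ i, g (.xi i) ^ 2 = u • hNeg g i + (1 - u) • (1 : B)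

theorem baseRel_yokGen : BaseRel (yokGen V n d R u) :=
  baseRel_presGen (Q := yokQuad V n d R u)

theorem baseRel_defGen : BaseRel (defGen V n d R u) :=
  baseRel_presGen (Q := defQuad V n d R u)

theorem map_yokQuad {B : Type*} [Ring B] [Algebra R B] (φ : FreeAlgebra R (Gen V n d) →ₐ[R] B)
    (i : SimpleIdx V n) : φ (yokQuad V n d R u i) =
      u • hNeg (fun x => φ (FreeAlgebra.ι R x)) i +
        (1 - u) • (idemR R (fun x => φ (FreeAlgebra.ι R x)) i * φ (FreeAlgebra.ι R (.xi i))) := by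
  rw [yokQuad, idem_eq_idemR (R := R), map_add, map_smul, map_smul, map_mul, map_idemR]
  rfl

theorem map_defQuad {B : Type*} [Ring B] [Algebra R B] (φ : FreeAlgebra R (Gen V n d) →ₐ[R] B)
    (i : SimpleIdx V n) : φ (defQuad V n d R u i) =
      u • hNeg (fun x => φ (FreeAlgebra.ι R x)) i + (1 - u) • (1 : B) := by
  rw [defQuad, map_add, map_smul, map_smul, map_one]
  rfl

theorem yokQuad_yokGen : YokQuad u (yokGen V n d R u) := fun i =>
  (presGen_sq (Q := yokQuad V n d R u) i).trans (map_yokQuad _ i)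

theorem defQuad_defGen : DefQuad u (defGen V n d R u) := fun i =>
  (presGen_sq (Q := defQuad V n d R u) i).trans (map_defQuad _ i)

theorem exists_yok_lift {B : Type*} [Ring B] [Algebra R B] {g : Gen V n d → B} (h : BaseRel g)
    (hq : YokQuad u g) : ∃ f : Yok V n d R u →ₐ[R] B, ∀ x, f (yokGen V n d R u x) = g x := by
  refine exists_pres_lift h fun i => ?_
  rw [hq i, map_yokQuad]
  simp only [FreeAlgebra.lift_ι_apply]

theorem exists_def_lift {B : Type*} [Ring B] [Algebra R B] {g : Gen V n d → B} (h : BaseRel g)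
    (hq : DefQuad u g) : ∃ f : Def V n d R u →ₐ[R] B, ∀ x, f (defGen V n d R u x) = g x := by
  refine exists_pres_lift h fun i => ?_
  rw [hq i, map_defQuad]
  simp only [FreeAlgebra.lift_ι_apply]

theorem adjoin_yokGen : Algebra.adjoin R (Set.range (yokGen V n d R u)) = ⊤ :=
  adjoin_presGen (Q := yokQuad V n d R u)

theorem YokQuad.map {B B' : Type*} [Ring B] [Algebra R B] [Ring B'] [Algebra R B']
    {g : Gen V n d → B} (h : YokQuad u g) (φ : B →ₐ[R] B') : YokQuad u fun x => φ (g x) := by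
  intro i
  rw [← map_pow, h i, map_add, map_smul, map_smul, map_mul, map_idemR]
  rfl

theorem DefQuad.map {B B' : Type*} [Ring B] [Algebra R B] [Ring B'] [Algebra R B']
    {g : Gen V n d → B} (h : DefQuad u g) (φ : B →ₐ[R] B') : DefQuad u fun x => φ (g x) := by
  intro i
  rw [← map_pow, h i, map_add, map_smul, map_smul, map_one]
  rfl

theorem idemR_mem_torusSpan {B : Type*} [Ring B] [Algebra R B] (g : Gen V n d → B)
    (i : SimpleIdx V n) : idemR R g i ∈ torusSpan R g :=
  Submodule.smul_mem _ _ (Submodule.sum_mem _ fun _ _ => Submodule.subset_span ⟨_, rfl⟩)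

theorem YokQuad.exists_span {B : Type*} [Ring B] [Algebra R B] {g : Gen V n d → B}
    (hq : YokQuad u g) (i : SimpleIdx V n) :
    ∃ p ∈ torusSpan R g, ∃ q ∈ torusSpan R g, g (.xi i) ^ 2 = p + q * g (.xi i) :=
  ⟨u • hNeg g i, Submodule.smul_mem _ _ (Submodule.subset_span ⟨_, rfl⟩),
    (1 - u) • idemR R g i, Submodule.smul_mem _ _ (idemR_mem_torusSpan g i), by
      rw [hq i, smul_mul_assoc]⟩

end Generic

/-! ### Units -/

section Units

variable {B : Type*} [Monoid B] {g : Gen V n d → B}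

theorem isUnit_of_sq_isUnit {a : B} (h : IsUnit (a ^ 2)) : IsUnit a :=
  (isUnit_pow_iff two_ne_zero).1 h

theorem BaseRel.isUnit_t (h : BaseRel g) (x : torus V n d) : IsUnit (g (.t x)) :=
  ⟨⟨g (.t x), g (.t (-x)), by rw [h.t_comm, h.t_neg], h.t_neg x⟩, rfl⟩

theorem BaseRel.isUnit (h : BaseRel g) (hsq : ∀ i, IsUnit (g (.xi i) ^ 2)) (x : Gen V n d) :
    IsUnit (g x) := by
  cases x with
  | t x => exact h.isUnit_t x
  | xi i => exact isUnit_of_sq_isUnit (hsq i)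

theorem BaseRel.isUnit_hNeg (h : BaseRel g) (i : SimpleIdx V n) : IsUnit (hNeg g i) :=
  h.isUnit_t _

theorem BaseRel.units {gU : Gen V n d → Bˣ} (h : BaseRel g) (hg : ∀ x, (gU x : B) = g x) :
    BaseRel gU where
  one := Units.ext (by rw [hg, h.one]; rfl)
  mul x y := Units.ext (by rw [Units.val_mul, hg, hg, hg, h.mul])
  conj i x := Units.ext (by rw [Units.val_mul, Units.val_mul, hg, hg, hg, h.conj])
  braid i j := Units.ext (by
    have := h.braid i j
    simp only [← hg] at this
    have h2 := map_alternating (Units.coeHom B) (gU (.xi i)) (gU (.xi j))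
    have h3 := map_alternating (Units.coeHom B) (gU (.xi j)) (gU (.xi i))
    simp only [Units.coeHom_apply] at h2 h3
    rw [h2, h3, this])

end Units

/-! ### The groups -/

section PresentedGroups

variable {Q : SimpleIdx V n → FreeGroup (Gen V n d)}

/-- The set of relators. -/
def groupRels (Q : SimpleIdx V n → FreeGroup (Gen V n d)) : Set (FreeGroup (Gen V n d)) :=
  {r | ∃ a b, DefRel FreeGroup.of Q a b ∧ r = a * b⁻¹}

theorem presentedGroup_rel {a b : FreeGroup (Gen V n d)} (h : DefRel FreeGroup.of Q a b) :
    PresentedGroup.mk (groupRels Q) a = PresentedGroup.mk (groupRels Q) b := by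
  have : PresentedGroup.mk (groupRels Q) (a * b⁻¹) = 1 :=
    PresentedGroup.one_of_mem ⟨a, b, h, rfl⟩
  rwa [map_mul, map_inv, mul_inv_eq_one] at this

theorem baseRel_presentedGroup :
    BaseRel (fun x => (PresentedGroup.of x : PresentedGroup (groupRels Q))) where
  one := (presentedGroup_rel .one).trans (map_one _)
  mul x y := (presentedGroup_rel (.mul x y)).trans (map_mul _ _ _)
  conj i x := by
    have := presentedGroup_rel (Q := Q) (.conj i x)
    rwa [map_mul, map_mul] at this
  braid i j := by
    have := presentedGroup_rel (Q := Q) (.braid i j)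
    rwa [map_alternating, map_alternating] at this

theorem presentedGroup_sq (i : SimpleIdx V n) :
    (PresentedGroup.of (.xi i) : PresentedGroup (groupRels Q)) ^ 2 =
      PresentedGroup.mk (groupRels Q) (Q i) := by
  have := presentedGroup_rel (Q := Q) (.quad i)
  rwa [map_pow] at this

theorem exists_presentedGroup_lift {H : Type*} [Group H] {g : Gen V n d → H} (h : BaseRel g)
    (hsq : ∀ i, g (.xi i) ^ 2 = FreeGroup.lift g (Q i)) :
    ∃ f : PresentedGroup (groupRels Q) →* H, ∀ x, f (PresentedGroup.of x) = g x := by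
  refine ⟨PresentedGroup.toGroup (f := g) ?_, fun x => PresentedGroup.toGroup.of _⟩
  rintro _ ⟨a, b, hab, rfl⟩
  have h1 := hab.map (FreeGroup.lift g)
  simp only [FreeGroup.lift_apply_of] at h1
  rw [map_mul, map_inv, mul_inv_eq_one]
  exact h.defRel hsq h1

theorem exists_groupAlgebra_lift {B : Type*} [Ring B] [Algebra ℂ B] {g : Gen V n d → B}
    (h : BaseRel g) (hu : ∀ x, IsUnit (g x))
    (hsq : ∀ gU : Gen V n d → Bˣ, (∀ x, (gU x : B) = g x) →
      ∀ i, gU (.xi i) ^ 2 = FreeGroup.lift gU (Q i)) :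
    ∃ f : MonoidAlgebra ℂ (PresentedGroup (groupRels Q)) →ₐ[ℂ] B,
      ∀ x, f (MonoidAlgebra.of ℂ _ (PresentedGroup.of x)) = g x := by
  choose gU hgU using hu
  obtain ⟨f, hf⟩ := exists_presentedGroup_lift (h.units hgU) (hsq gU hgU)
  refine ⟨MonoidAlgebra.lift ℂ B _ ((Units.coeHom B).comp f), fun x => ?_⟩
  rw [MonoidAlgebra.lift_of]
  simp [hf, hgU]

end PresentedGroups

theorem baseRel_nGen : BaseRel (nGen V n d) :=
  (baseRel_presentedGroup (Q := hNeg FreeGroup.of)).map (MonoidAlgebra.of ℂ _)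

theorem nGen_sq (i : SimpleIdx V n) : nGen V n d (.xi i) ^ 2 = hNeg (nGen V n d) i := by
  have := congrArg (MonoidAlgebra.of ℂ _) (presentedGroup_sq (d := d) (Q := hNeg FreeGroup.of) i)
  rw [map_pow] at this
  exact this

theorem exists_nGroup_lift {B : Type*} [Ring B] [Algebra ℂ B] {g : Gen V n d → B}
    (h : BaseRel g) (hsq : ∀ i, g (.xi i) ^ 2 = hNeg g i) :
    ∃ f : MonoidAlgebra ℂ (NGroup V n d) →ₐ[ℂ] B, ∀ x, f (nGen V n d x) = g x := by
  refine exists_groupAlgebra_lift h (h.isUnit fun i => by rw [hsq]; exact h.isUnit_hNeg i) ?_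
  intro gU hgU i
  refine Units.ext ?_
  rw [Units.val_pow_eq_pow_val, hgU, hsq]
  simp [hNeg, hgU]

theorem exists_sGroup_lift {B : Type*} [Ring B] [Algebra ℂ B] {g : Gen V n d → B}
    (h : BaseRel g) (hsq : ∀ i, g (.xi i) ^ 2 = 1) :
    ∃ f : MonoidAlgebra ℂ (SGroup V n d) →ₐ[ℂ] B, ∀ x, f (sGen V n d x) = g x := by
  refine exists_groupAlgebra_lift h (h.isUnit fun i => by rw [hsq]; exact isUnit_one) ?_
  intro gU hgU i
  refine Units.ext ?_
  rw [Units.val_pow_eq_pow_val, hgU, hsq]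
  simp

theorem mem_standardElements_nGroup (a : NGroup V n d) :
    a ∈ standardElements (fun x => (PresentedGroup.of x : NGroup V n d)) := by
  have hb : BaseRel (fun x => (PresentedGroup.of x : NGroup V n d)) := baseRel_presentedGroup
  have hsq : ∀ i, (PresentedGroup.of (.xi i) : NGroup V n d) ^ 2 =
      hNeg (fun x => (PresentedGroup.of x : NGroup V n d)) i := presentedGroup_sq
  have ha : a ∈ Subgroup.closure (Set.range fun x => (PresentedGroup.of x : NGroup V n d)) := by
    rw [PresentedGroup.closure_range_of]; trivial
  induction ha using Subgroup.closure_induction_left with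
  | one => exact hb.one_mem_standardElements
  | mul_left x hx y _ hy =>
    obtain ⟨x, rfl⟩ := hx
    exact hb.gen_mul_mem_standardElements hsq x hy
  | inv_mul_cancel x hx y _ hy =>
    obtain ⟨x, rfl⟩ := hx
    cases x with
    | t x =>
      have : (PresentedGroup.of (.t x) : NGroup V n d)⁻¹ = PresentedGroup.of (.t (-x)) :=
        inv_eq_of_mul_eq_one_left (hb.t_neg x)
      simp only
      rw [this]
      exact hb.t_mul_mem_standardElements _ hy
    | xi i =>
      have e : (PresentedGroup.of (.xi i) : NGroup V n d)⁻¹ =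
          PresentedGroup.of (.t (-((d / 2) • corootTorus d i))) * PresentedGroup.of (.xi i) := by
        refine inv_eq_of_mul_eq_one_left ?_
        rw [mul_assoc, ← sq, hsq i]
        exact hb.t_neg _
      simp only
      rw [e, mul_assoc]
      exact hb.t_mul_mem_standardElements _ (hb.gen_mul_mem_standardElements hsq (.xi i) hy)

instance [NeZero d] : Finite (NGroup V n d) := by
  have hb : BaseRel (fun x => (PresentedGroup.of x : NGroup V n d)) := baseRel_presentedGroup
  have := hb.finite_standardElements
  rw [Set.eq_univ_of_forall mem_standardElements_nGroup] at this
  exact Set.finite_univ_iff.1 this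

theorem xiProd_mem_adjoin {R : Type*} [CommRing R] {B : Type*} [Ring B] [Algebra R B]
    (g : Gen V n d → B) (L : List (SimpleIdx V n)) :
    xiProd g L ∈ Algebra.adjoin R (Set.range g) := by
  induction L with
  | nil => rw [xiProd_nil]; exact one_mem _
  | cons i L ih => rw [xiProd_cons]; exact mul_mem (Algebra.subset_adjoin ⟨_, rfl⟩) ih

theorem adjoin_nGen : Algebra.adjoin ℂ (Set.range (nGen V n d)) = ⊤ := by
  refine eq_top_iff.2 fun a _ => ?_
  induction a using MonoidAlgebra.induction_on with
  | of a =>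
    obtain ⟨x, L, -, rfl⟩ := mem_standardElements_nGroup a
    rw [map_mul, map_xiProd]
    exact mul_mem (Algebra.subset_adjoin ⟨_, rfl⟩) (xiProd_mem_adjoin (nGen V n d) L)
  | add a b ha hb => exact add_mem (ha trivial) (hb trivial)
  | smul c a ha => exact Subalgebra.smul_mem _ (ha trivial) c
end

section
variable {V : ClassicalType} {n d : ℕ} [GoodRank V n]

section Conjugates

variable {A : Type*} [Ring A]

/-- The sum of the conjugates of `x_{i_j}` by `u_{i_1} ⋯ u_{i_{j-1}}`. -/
def conjSum (u : SimpleIdx V n → Aˣ) (x : SimpleIdx V n → A) : List (SimpleIdx V n) → A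
  | [] => 0
  | i :: L => x i + u i * conjSum u x L * (↑(u i)⁻¹ : A)

variable {u : SimpleIdx V n → Aˣ} {x : SimpleIdx V n → A}

/-- The dual number `u_i + ε x_i u_i`. -/
def dualGen (u : SimpleIdx V n → Aˣ) (x : SimpleIdx V n → A) (i : SimpleIdx V n) :
    TrivSqZeroExt A A := TrivSqZeroExt.inl (u i : A) + TrivSqZeroExt.inr (x i * u i)

theorem dualGen_prod (L : List (SimpleIdx V n)) :
    (L.map (dualGen u x)).prod = TrivSqZeroExt.inl ((L.map u).prod : A) +
      TrivSqZeroExt.inr (conjSum u x L * ((L.map u).prod : Aˣ)) := by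
  induction L with
  | nil => simp [conjSum]
  | cons i L ih =>
    rw [List.map_cons, List.prod_cons, ih]
    ext
    · simp [dualGen]
    · simp [dualGen, conjSum, add_mul, mul_assoc]
      abel

theorem dualGen_alternating_eq {L L' : List (SimpleIdx V n)}
    (h1 : (L.map u).prod = (L'.map u).prod) (h2 : conjSum u x L = conjSum u x L') :
    (L.map (dualGen u x)).prod = (L'.map (dualGen u x)).prod := by
  rw [dualGen_prod, dualGen_prod, h1, h2]

/-- Compatibility of elements `x_i` with units `u_i` that satisfy the braid relations. -/
structure ConjCompat (u : SimpleIdx V n → Aˣ) (x : SimpleIdx V n → A) : Prop where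
  self : ∀ i, (u i : A) * x i = x i * u i
  sq : ∀ i j k, (u i : A) * u i * (u k * x j * (↑(u k)⁻¹ : A)) =
    (u k * x j * (↑(u k)⁻¹ : A)) * (u i * u i)
  conj : ∀ (L : List (SimpleIdx V n)) (i j : SimpleIdx V n), weylElement L *ᵥ j.root = i.root →
    (L.map u).prod * u j = u i * (L.map u).prod →
    ((L.map u).prod : A) * x j = x i * ((L.map u).prod : Aˣ)

theorem ConjCompat.conj_inv (h : ConjCompat u x) (i j k : SimpleIdx V n) :
    (↑(u i)⁻¹ : A) * ((↑(u i)⁻¹ : A) * (u k * x j * (↑(u k)⁻¹ : A)) * u i) * u i =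
      u k * x j * (↑(u k)⁻¹ : A) := by
  have := h.sq i j k
  calc _ = (↑(u i)⁻¹ : A) * ((↑(u i)⁻¹ : A) * ((u k * x j * (↑(u k)⁻¹ : A)) * (u i * u i))) := by
        simp only [mul_assoc]
    _ = _ := by rw [← this]; simp only [mul_assoc, Units.inv_mul_cancel_left]

theorem eq_conj_of_mul_eq {w : Aˣ} {a b : A} (h : (w : A) * a = b * w) :
    w * a * (↑w⁻¹ : A) = b := by
  rw [h, mul_assoc, Units.mul_inv, mul_one]

theorem ConjCompat.braided (hu : Braided u) (h : ConjCompat u x) : Braided (dualGen u x) := by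
  refine braided_of ?_ ?_ ?_
  · intro i j a b
    have huu := hu.two a b
    have c1 := h.conj [i] j j (by
      rw [weylElement_cons, weylElement_nil, mul_one, reflection_root, b, zero_smul, sub_zero])
      (by simpa using huu)
    have c2 := h.conj [j] i i (by
      rw [weylElement_cons, weylElement_nil, mul_one, reflection_root, a, zero_smul, sub_zero])
      (by simpa using huu.symm)
    have := dualGen_alternating_eq (u := u) (x := x) (L := [i, j]) (L' := [j, i])
      (by simpa using huu) (by
        simp only [conjSum, mul_zero, zero_mul, add_zero]
        simp only [List.map_cons, List.map_nil, List.prod_cons, List.prod_nil, mul_one] at c1 c2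
        rw [eq_conj_of_mul_eq c1, eq_conj_of_mul_eq c2, add_comm])
    simpa using this
  · intro i j a b
    have huu := hu.three a b
    have r1 : weylElement [i, j] *ᵥ i.root = j.root := by
      simp only [weylElement_cons, weylElement_nil, mul_one, ← mulVec_mulVec]
      simp only [reflection_root, a, b, mulVec_sub, mulVec_smul, root_dot_coroot]; module
    have r2 : weylElement [j, i] *ᵥ j.root = i.root := by
      simp only [weylElement_cons, weylElement_nil, mul_one, ← mulVec_mulVec]
      simp only [reflection_root, a, b, mulVec_sub, mulVec_smul, root_dot_coroot]; module
    have c1 := h.conj [i, j] j i r1 (by simpa [mul_assoc] using huu)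
    have c2 := h.conj [j, i] i j r2 (by simpa [mul_assoc] using huu.symm)
    simp only [List.map_cons, List.map_nil, List.prod_cons, List.prod_nil, mul_one] at c1 c2
    have d1 := eq_conj_of_mul_eq c1
    have d2 := eq_conj_of_mul_eq c2
    simp only [Units.val_mul, _root_.mul_inv_rev, mul_assoc] at d1 d2
    have mid : (u i : A) * (x j * (↑(u i)⁻¹ : A)) = u j * (x i * (↑(u j)⁻¹ : A)) := by
      have h2 := h.sq j j i
      simp only [mul_assoc] at h2
      have h3 := congrArg (· * ((↑(u j)⁻¹ : A) * (↑(u j)⁻¹ : A))) h2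
      simp only [mul_assoc, Units.mul_inv_cancel_left, Units.mul_inv, mul_one] at h3
      conv_rhs => rw [← d2]
      simp only [mul_assoc]
      exact h3.symm
    have := dualGen_alternating_eq (u := u) (x := x) (L := [i, j, i]) (L' := [j, i, j])
      (by simpa [mul_assoc] using huu) (by
        simp only [conjSum, mul_zero, zero_mul, add_zero, mul_add, add_mul, mul_assoc]
        rw [d1, d2, mid]; abel)
    simpa [mul_assoc] using this
  · intro i j a b
    have huu := hu.four a b
    have r1 : weylElement [i, j, i] *ᵥ j.root = j.root := by
      simp only [weylElement_cons, weylElement_nil, mul_one, ← mulVec_mulVec]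
      simp only [reflection_root, a, b, mulVec_sub, mulVec_smul, root_dot_coroot]; module
    have r2 : weylElement [j, i, j] *ᵥ i.root = i.root := by
      simp only [weylElement_cons, weylElement_nil, mul_one, ← mulVec_mulVec]
      simp only [reflection_root, a, b, mulVec_sub, mulVec_smul, root_dot_coroot]; module
    have c1 := h.conj [i, j, i] j j r1 (by simpa [mul_assoc] using huu)
    have c2 := h.conj [j, i, j] i i r2 (by simpa [mul_assoc] using huu.symm)
    simp only [List.map_cons, List.map_nil, List.prod_cons, List.prod_nil, mul_one] at c1 c2
    have d1 := eq_conj_of_mul_eq c1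
    have d2 := eq_conj_of_mul_eq c2
    simp only [Units.val_mul, _root_.mul_inv_rev, mul_assoc] at d1 d2
    have mid : ∀ i j, (u i : A) * ((u j : A) * ((u i : A) * (x j * ((↑(u i)⁻¹ : A) *
        ((↑(u j)⁻¹ : A) * (↑(u i)⁻¹ : A)))))) = x j →
        (u j : A) * ((u i : A) * (x j * ((↑(u i)⁻¹ : A) * (↑(u j)⁻¹ : A)))) =
        (u i : A) * (x j * (↑(u i)⁻¹ : A)) := by
      intro i j d1
      have h1 : (u j : A) * ((u i : A) * (x j * ((↑(u i)⁻¹ : A) * (↑(u j)⁻¹ : A)))) =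
          (↑(u i)⁻¹ : A) * (x j * u i) := by
        conv_rhs => rw [← d1]
        simp only [mul_assoc, Units.inv_mul_cancel_left, Units.inv_mul, mul_one]
      have h2 := h.conj_inv i j i
      simp only [mul_assoc] at h2
      rw [h1, ← h2]
      simp only [mul_assoc, Units.inv_mul_cancel_left]
    have := dualGen_alternating_eq (u := u) (x := x) (L := [i, j, i, j]) (L' := [j, i, j, i])
      (by simpa [mul_assoc] using huu) (by
        simp only [conjSum, mul_zero, zero_mul, add_zero, mul_add, add_mul, mul_assoc]
        rw [d1, d2, mid i j d1, mid j i d2]; abel)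
    simpa [mul_assoc] using this

theorem dual_snd_eq {a b c e : A} (h : (TrivSqZeroExt.inl a + TrivSqZeroExt.inr b :
    TrivSqZeroExt A A) = TrivSqZeroExt.inl c + TrivSqZeroExt.inr e) : b = e := by
  simpa using congrArg TrivSqZeroExt.snd h

/-- The sum of conjugates along the longest word commutes with the `u_i`. -/
theorem ConjCompat.conjSum_comm (hu : Braided u) (h : ConjCompat u x) {L : List (SimpleIdx V n)}
    (hL : IsLongestWord L) (i : SimpleIdx V n) :
    (u i : A) * conjSum u x L = conjSum u x L * u i := by
  obtain ⟨j, L', h1, h2, h3⟩ := hL.exists_opposite i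
  have e1 : conjSum u x L = conjSum u x (i :: L') := by
    have := (h.braided hu).matsumoto hL.1 h1.1 (h1.weylElement_eq hL)
    rw [dualGen_prod, dualGen_prod, hu.matsumoto hL.1 h1.1 (h1.weylElement_eq hL)] at this
    exact (Units.isUnit _).mul_right_cancel (dual_snd_eq this)
  have e2 : conjSum u x L = conjSum u x (L' ++ [j]) := by
    have := (h.braided hu).matsumoto hL.1 h2.1 (h2.weylElement_eq hL)
    rw [dualGen_prod, dualGen_prod, hu.matsumoto hL.1 h2.1 (h2.weylElement_eq hL)] at this
    exact (Units.isUnit _).mul_right_cancel (dual_snd_eq this)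
  have app : ∀ R : List (SimpleIdx V n), conjSum u x (R ++ [j]) =
      conjSum u x R + (R.map u).prod * x j * (↑(R.map u).prod⁻¹ : A) := by
    intro R
    induction R with
    | nil => simp [conjSum]
    | cons k R ih =>
      rw [List.cons_append, conjSum, ih, conjSum, List.map_cons, List.prod_cons]
      simp only [Units.val_mul, _root_.mul_inv_rev, mul_add, add_mul, mul_assoc, add_assoc]
  have e3 : (L'.map u).prod * u j = u i * (L'.map u).prod := by
    have := hu.matsumoto h1.1 h2.1 (h2.weylElement_eq h1)
    simpa using this.symm
  rw [app, eq_conj_of_mul_eq (h.conj L' i j h3 e3)] at e2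
  have e4 : conjSum u x L' = u i * conjSum u x L' * (↑(u i)⁻¹ : A) := by
    rw [e1, conjSum, add_comm] at e2
    exact (add_right_cancel e2).symm
  have e5 : conjSum u x L = u i * conjSum u x L * (↑(u i)⁻¹ : A) := by
    rw [e2, mul_add, add_mul, ← e4, h.self, mul_assoc, Units.mul_inv, mul_one]
  conv_rhs => rw [e5]
  simp only [mul_assoc, Units.inv_mul, mul_one]

end Conjugates
end

section
variable {V : ClassicalType} {n d : ℕ} [GoodRank V n]

section Idempotents

variable {R : Type*} [CommRing R] [Algebra ℂ R] {B : Type*} [Ring B] [Algebra R B]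
  {g : Gen V n d → B}

theorem smul_coroot_eq_nsmul [NeZero d] (i : SimpleIdx V n) (c : ZMod d) :
    c • corootTorus d i = c.val • corootTorus d i := by
  refine Subtype.ext ?_
  funext k
  simp

namespace BaseRel

variable (h : BaseRel g)
include h

theorem sum_shift (τ : B) (hτ : τ ^ d = 1) : ∑ j ∈ Finset.Icc 1 d, τ ^ j = ∑ j ∈ Finset.range d, τ ^ j := by
  have h1 : ∑ j ∈ Finset.Icc 1 d, τ ^ j = ∑ j ∈ Finset.range d, τ ^ (j + 1) := by
    rw [Finset.range_eq_Ico, Finset.sum_Ico_add' (fun j => τ ^ j) 0 d 1]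
    rfl
  have h2 := Finset.sum_range_succ (fun j => τ ^ j) d
  rw [Finset.sum_range_succ', hτ, pow_zero] at h2
  rw [h1]
  exact add_right_cancel h2

theorem idemR_eq (i : SimpleIdx V n) : idemR R g i =
    algebraMap ℂ R (1 / (d : ℂ)) • ∑ j ∈ Finset.range d, g (.t (corootTorus d i)) ^ j := by
  rw [idemR, ← h.sum_shift _ (h.t_pow_d _)]
  simp only [h.t_nsmul]

theorem t_mul_idemR (i : SimpleIdx V n) :
    g (.t (corootTorus d i)) * idemR R g i = idemR R g i := by
  conv_rhs => rw [idemR]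
  rw [h.idemR_eq, mul_smul_comm, Finset.mul_sum]
  congr 1
  simp only [h.t_nsmul, ← pow_succ']
  rw [Finset.range_eq_Ico, Finset.sum_Ico_add' (fun j => g (.t (corootTorus d i)) ^ j) 0 d 1]
  rfl

theorem idemR_comm_t (i : SimpleIdx V n) (x : torus V n d) :
    idemR R g i * g (.t x) = g (.t x) * idemR R g i := by
  simp only [idemR, smul_mul_assoc, mul_smul_comm, Finset.mul_sum, Finset.sum_mul, h.t_comm _ x]

theorem t_nsmul_mul_idemR (k : ℕ) (i : SimpleIdx V n) :
    g (.t (k • corootTorus d i)) * idemR R g i = idemR R g i := by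
  induction k with
  | zero => rw [zero_smul, h.one, one_mul]
  | succ k ih => rw [succ_nsmul, h.mul, mul_assoc, h.t_mul_idemR, ih]

theorem hNeg_mul_idemR (i : SimpleIdx V n) : hNeg g i * idemR R g i = idemR R g i :=
  h.t_nsmul_mul_idemR _ i

theorem idemR_mul_self [NeZero d] (i : SimpleIdx V n) :
    idemR R g i * idemR R g i = idemR R g i := by
  conv_lhs => enter [1]; rw [idemR]
  rw [smul_mul_assoc, Finset.sum_mul, Finset.sum_congr rfl fun j _ => h.t_nsmul_mul_idemR j i]
  rw [Finset.sum_const, Nat.card_Icc, add_tsub_cancel_right, ← Nat.cast_smul_eq_nsmul R, smul_smul]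
  have : algebraMap ℂ R (1 / (d : ℂ)) * (d : R) = 1 := by
    rw [← map_natCast (algebraMap ℂ R), ← map_mul, one_div_mul_cancel (NeZero.ne _), map_one]
  rw [this, one_smul]

theorem xiProd_mul_idemR {L : List (SimpleIdx V n)} {i j : SimpleIdx V n}
    (hL : weylElement L *ᵥ j.root = i.root) :
    xiProd g L * idemR R g j = idemR R g i * xiProd g L := by
  simp only [idemR, smul_mul_assoc, mul_smul_comm, Finset.mul_sum, Finset.sum_mul, h.xiProd_t,
    wordTorus_nsmul, wordTorus_coroot hL]

theorem xiProd_mul_hNeg {L : List (SimpleIdx V n)} {i j : SimpleIdx V n}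
    (hL : weylElement L *ᵥ j.root = i.root) :
    xiProd g L * hNeg g j = hNeg g i * xiProd g L := by
  simp only [hNeg, h.xiProd_t, wordTorus_nsmul, wordTorus_coroot hL]

theorem xi_mul_idemR (i : SimpleIdx V n) :
    g (.xi i) * idemR R g i = idemR R g i * g (.xi i) := by
  have key : ∑ j ∈ Finset.range d, g (.t (-corootTorus d i)) ^ j =
      ∑ j ∈ Finset.range d, g (.t (corootTorus d i)) ^ j := by
    rw [← h.sum_shift (g (.t (corootTorus d i))) (h.t_pow_d _)]
    have h1 : ∑ j ∈ Finset.Icc 1 d, g (.t (corootTorus d i)) ^ j =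
        ∑ j ∈ Finset.range d, g (.t (corootTorus d i)) ^ (j + 1) := by
      rw [Finset.range_eq_Ico,
        Finset.sum_Ico_add' (fun j => g (.t (corootTorus d i)) ^ j) 0 d 1]
      rfl
    rw [h1, ← Finset.sum_range_reflect]
    refine Finset.sum_congr rfl fun j hj => ?_
    rw [Finset.mem_range] at hj
    have h2 : g (.t (-corootTorus d i)) ^ (d - 1 - j) * g (.t (corootTorus d i)) ^ (d - 1 - j) = 1 := by
      rw [← h.t_nsmul, ← h.t_nsmul, ← h.mul, ← smul_add, neg_add_cancel, smul_zero, h.one]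
    have h3 : g (.t (corootTorus d i)) ^ (d - 1 - j) * g (.t (corootTorus d i)) ^ (j + 1) = 1 := by
      rw [← pow_add, show d - 1 - j + (j + 1) = d by omega, h.t_pow_d]
    calc _ = g (.t (-corootTorus d i)) ^ (d - 1 - j) * (g (.t (corootTorus d i)) ^ (d - 1 - j) *
          g (.t (corootTorus d i)) ^ (j + 1)) := by rw [h3, mul_one]
      _ = _ := by rw [← mul_assoc, h2, one_mul]
  rw [h.idemR_eq, mul_smul_comm, smul_mul_assoc]
  congr 1
  conv_rhs => rw [← key]
  rw [Finset.mul_sum, Finset.sum_mul]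
  refine Finset.sum_congr rfl fun j _ => ?_
  rw [← h.t_nsmul, ← h.t_nsmul, h.conj, reflectTorus_nsmul, reflectTorus_coroot_self]

theorem xi_mul_hNeg (i : SimpleIdx V n) (hd : Even d) :
    g (.xi i) * hNeg g i = hNeg g i * g (.xi i) := by
  rw [hNeg, h.conj, reflectTorus_nsmul, reflectTorus_coroot_self]
  congr 3
  rw [smul_neg, neg_eq_iff_add_eq_zero, ← add_smul]
  obtain ⟨c, rfl⟩ := hd
  rw [show (c + c) / 2 + (c + c) / 2 = c + c by omega, torus_nsmul_d]

theorem hNeg_mul_self (i : SimpleIdx V n) (hd : Even d) : hNeg g i * hNeg g i = 1 := by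
  rw [hNeg, ← h.mul, ← add_smul]
  obtain ⟨c, rfl⟩ := hd
  rw [show (c + c) / 2 + (c + c) / 2 = c + c by omega, torus_nsmul_d, h.one]

theorem idemR_xi_comm_t [NeZero d] (i : SimpleIdx V n) (x : torus V n d) :
    idemR R g i * g (.xi i) * g (.t x) = g (.t x) * (idemR R g i * g (.xi i)) := by
  obtain ⟨k, hk⟩ : ∃ k : ℕ, reflectTorus i x = x + k • corootTorus d i := by
    refine ⟨(-(∑ j, ((i.root j : ℤ) : ZMod d) * x.1 j)).val, ?_⟩
    rw [← smul_coroot_eq_nsmul, reflectTorus]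
    refine Subtype.ext ?_
    funext k
    simp [sub_eq_add_neg]
  rw [mul_assoc, h.conj, hk, h.mul, ← mul_assoc, ← mul_assoc, ← mul_assoc, h.idemR_comm_t,
    mul_assoc (g (.t x)), h.idemR_comm_t, h.t_nsmul_mul_idemR]

end BaseRel

end Idempotents

/-! ### Central sums of conjugates in an image of the group `N` -/

section Sums

variable {A : Type*} [Ring A] [Algebra ℂ A] {g : Gen V n d → A} {u : SimpleIdx V n → Aˣ}

theorem val_prod_units (hu : ∀ i, (u i : A) = g (.xi i)) (L : List (SimpleIdx V n)) :
    ((L.map u).prod : A) = xiProd g L := by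
  have := map_list_prod (Units.coeHom A) (L.map u)
  simp only [Units.coeHom_apply, List.map_map] at this
  rw [this, xiProd]
  congr 2
  funext i
  simp [hu]

theorem BaseRel.braided_units (h : BaseRel g) (hu : ∀ i, (u i : A) = g (.xi i)) : Braided u := by
  intro i j
  refine Units.ext ?_
  have h2 := map_alternating (Units.coeHom A) (u i) (u j)
  have h3 := map_alternating (Units.coeHom A) (u j) (u i)
  simp only [Units.coeHom_apply] at h2 h3
  rw [h2, h3, hu, hu, h.braid i j]

theorem BaseRel.conj_comm_t (h : BaseRel g) (hu : ∀ i, (u i : A) = g (.xi i))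
    {x : A} (hx : ∀ y, x * g (.t y) = g (.t y) * x) (k : SimpleIdx V n) (y : torus V n d) :
    g (.t y) * (u k * x * (↑(u k)⁻¹ : A)) = (u k * x * (↑(u k)⁻¹ : A)) * g (.t y) := by
  have e1 : g (.t y) * u k = u k * g (.t (reflectTorus k y)) := by
    rw [hu, h.conj, reflectTorus_reflectTorus]
  have e2 : (↑(u k)⁻¹ : A) * g (.t y) = g (.t (reflectTorus k y)) * (↑(u k)⁻¹ : A) := by
    rw [← (u k).isUnit.mul_right_inj, Units.mul_inv_cancel_left, ← mul_assoc, ← e1, mul_assoc,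
      Units.mul_inv, mul_one]
  calc g (.t y) * (u k * x * (↑(u k)⁻¹ : A)) = g (.t y) * u k * x * (↑(u k)⁻¹ : A) := by
        simp only [mul_assoc]
    _ = u k * (g (.t (reflectTorus k y)) * x) * (↑(u k)⁻¹ : A) := by rw [e1]; simp only [mul_assoc]
    _ = u k * x * (g (.t (reflectTorus k y)) * (↑(u k)⁻¹ : A)) := by
        rw [← hx]; simp only [mul_assoc]
    _ = _ := by rw [← e2]; simp only [mul_assoc]

theorem BaseRel.conjCompat_idem [NeZero d] (h : BaseRel g)
    (hsq : ∀ i, g (.xi i) ^ 2 = hNeg g i) (hu : ∀ i, (u i : A) = g (.xi i)) :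
    ConjCompat u fun i => idemR ℂ g i * g (.xi i) where
  self i := by rw [hu, ← mul_assoc, h.xi_mul_idemR]
  sq i j k := by
    have : (u i : A) * u i = hNeg g i := by rw [hu, ← sq, hsq]
    rw [this]
    exact h.conj_comm_t hu (fun y => h.idemR_xi_comm_t j y) k _
  conj L i j hL hLu := by
    have := congrArg (Units.val) hLu
    rw [Units.val_mul, Units.val_mul, val_prod_units hu, hu, hu] at this
    rw [val_prod_units hu, ← mul_assoc, h.xiProd_mul_idemR hL, mul_assoc, this, mul_assoc]

/-- The projection `(1 - h_i(-1)) / 2`. -/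
def negPart {A : Type*} [Ring A] [Algebra ℂ A] (g : Gen V n d → A) (i : SimpleIdx V n) : A :=
  (1 / 2 : ℂ) • (1 - hNeg g i)

theorem BaseRel.conjCompat_negPart [NeZero d] (hd : Even d) (h : BaseRel g)
    (hsq : ∀ i, g (.xi i) ^ 2 = hNeg g i) (hu : ∀ i, (u i : A) = g (.xi i)) :
    ConjCompat u (negPart g) where
  self i := by
    rw [hu, negPart, mul_smul_comm, smul_mul_assoc, mul_sub, sub_mul, h.xi_mul_hNeg i hd, mul_one,
      one_mul]
  sq i j k := by
    have : (u i : A) * u i = hNeg g i := by rw [hu, ← sq, hsq]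
    rw [this]
    refine h.conj_comm_t hu (fun y => ?_) k _
    rw [negPart, mul_smul_comm, smul_mul_assoc, mul_sub, sub_mul, mul_one, one_mul, hNeg, h.t_comm]
  conj L i j hL _ := by
    rw [val_prod_units hu, negPart, negPart, mul_smul_comm, smul_mul_assoc, mul_sub, sub_mul,
      h.xiProd_mul_hNeg hL, mul_one, one_mul]

theorem BaseRel.conjSum_comm_t (h : BaseRel g) (hu : ∀ i, (u i : A) = g (.xi i))
    {x : SimpleIdx V n → A} (hx : ∀ i y, x i * g (.t y) = g (.t y) * x i)
    (L : List (SimpleIdx V n)) (y : torus V n d) :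
    conjSum u x L * g (.t y) = g (.t y) * conjSum u x L := by
  induction L generalizing y with
  | nil => simp [conjSum]
  | cons i L ih => rw [conjSum, add_mul, mul_add, hx, ← h.conj_comm_t hu ih i y]

end Sums

/-! ### Action on weight vectors -/

section Weights

variable {E : Type*} [AddCommGroup E] [Module ℂ E] {g : Gen V n d → Module.End ℂ E}
  {u : SimpleIdx V n → (Module.End ℂ E)ˣ}

/-- `v` is an eigenvector of the torus. -/
def IsWeightVec (g : Gen V n d → Module.End ℂ E) (v : E) : Prop :=
  ∀ x, ∃ c : ℂ, g (.t x) v = c • v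

theorem IsWeightVec.xi (h : BaseRel g) {v : E} (hv : IsWeightVec g v) (i : SimpleIdx V n) :
    IsWeightVec g (g (.xi i) v) := by
  intro x
  obtain ⟨c, hc⟩ := hv (reflectTorus i x)
  refine ⟨c, ?_⟩
  have := congrArg (· v) (h.conj i (reflectTorus i x))
  simp only [reflectTorus_reflectTorus, Module.End.mul_apply] at this
  rw [← this, hc, map_smul]

theorem IsWeightVec.t (h : BaseRel g) {v : E} (hv : IsWeightVec g v) (y : torus V n d) :
    IsWeightVec g (g (.t y) v) := by
  intro x
  obtain ⟨c, hc⟩ := hv x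
  refine ⟨c, ?_⟩
  have := congrArg (· v) (h.t_comm x y)
  simp only [Module.End.mul_apply] at this
  rw [this, hc, map_smul]

theorem IsWeightVec.idem (h : BaseRel g) {v : E} (hv : IsWeightVec g v) (i : SimpleIdx V n) :
    idemR ℂ g i v = 0 ∨ idemR ℂ g i v = v := by
  obtain ⟨c, hc⟩ := hv (corootTorus d i)
  have hp : ∀ j : ℕ, g (.t (j • corootTorus d i)) v = c ^ j • v := by
    intro j
    induction j with
    | zero => rw [zero_smul, h.one, pow_zero, one_smul, Module.End.one_apply]
    | succ j ih =>
      rw [succ_nsmul, h.mul, Module.End.mul_apply, hc, map_smul, ih, smul_smul, pow_succ']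
  have he : idemR ℂ g i v = (1 / (d : ℂ) * ∑ j ∈ Finset.Icc 1 d, c ^ j) • v := by
    simp only [idemR, LinearMap.smul_apply, LinearMap.sum_apply, hp, ← Finset.sum_smul, smul_smul,
      Algebra.algebraMap_self, RingHom.id_apply]
  have h1 := congrArg (· v) (h.t_mul_idemR (R := ℂ) i)
  simp only [Module.End.mul_apply] at h1
  rw [he, map_smul, hc] at h1
  by_cases hv0 : v = 0
  · left; rw [hv0, map_zero]
  by_cases h2 : (1 / (d : ℂ) * ∑ j ∈ Finset.Icc 1 d, c ^ j) = 0
  · left; rw [he, h2, zero_smul]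
  · right
    have h3 : c = 1 := by
      have h4 := smul_right_injective E h2 h1
      have : (c - 1) • v = 0 := by
        rw [sub_smul, one_smul, sub_eq_zero]; exact h4
      rcases smul_eq_zero.1 this with h | h
      · exact sub_eq_zero.1 h
      · exact absurd h hv0
    have hd : (d : ℂ) ≠ 0 := by
      intro hd
      rw [hd] at h2
      simp at h2
    rw [he, h3]
    simp [hd]

theorem IsWeightVec.hNeg (hd : Even d) (h : BaseRel g) {v : E} (hv : IsWeightVec g v)
    (i : SimpleIdx V n) : hNeg g i v = v ∨ hNeg g i v = -v := by
  obtain ⟨c, hc⟩ := hv ((d / 2) • corootTorus d i)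
  have h1 := congrArg (· v) (h.hNeg_mul_self i hd)
  simp only [Module.End.mul_apply, Module.End.one_apply] at h1
  have hc' : YH.hNeg g i v = c • v := hc
  rw [hc', map_smul, hc', smul_smul] at h1
  by_cases hv0 : v = 0
  · left; rw [hv0, map_zero]
  have : c * c = 1 := by
    have : (c * c - 1) • v = 0 := by rw [sub_smul, h1, one_smul, sub_self]
    rcases smul_eq_zero.1 this with h | h
    · exact sub_eq_zero.1 h
    · exact absurd h hv0
  rcases mul_self_eq_one_iff.1 this with h | h
  · left; rw [hc', h, one_smul]
  · right; rw [hc', h, neg_one_smul]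

/-- On a weight vector, the sum of conjugates of the `(1 - h_i(-1))/2` counts signs, and
`ξ_{i_1} ⋯ ξ_{i_k} ξ_{i_k} ⋯ ξ_{i_1}` is the corresponding product of signs. -/
theorem IsWeightVec.conjSum_negPart (hd : Even d) (h : BaseRel g)
    (hsq : ∀ i, g (.xi i) ^ 2 = YH.hNeg g i) (hu : ∀ i, (u i : Module.End ℂ E) = g (.xi i))
    (L : List (SimpleIdx V n)) {v : E} (hv : IsWeightVec g v) :
    ∃ c : ℕ, conjSum u (negPart g) L v = (c : ℂ) • v ∧
      (xiProd g L * xiProd g L.reverse) v = ((-1 : ℂ) ^ c) • v := by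
  induction L generalizing v with
  | nil => exact ⟨0, by simp [conjSum, xiProd_nil]⟩
  | cons i L ih =>
    have hinv : (↑(u i)⁻¹ : Module.End ℂ E) = YH.hNeg g i * g (.xi i) := by
      rw [← (u i).isUnit.mul_left_inj, Units.inv_mul, mul_assoc, hu, ← sq, hsq, h.hNeg_mul_self i hd]
    have hinv' : ∀ v, (↑(u i)⁻¹ : Module.End ℂ E) v = YH.hNeg g i (g (.xi i) v) := by
      intro v; rw [hinv]; rfl
    have hui : ∀ v, (u i : Module.End ℂ E) ((↑(u i)⁻¹ : Module.End ℂ E) v) = v := by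
      intro v
      rw [← Module.End.mul_apply, Units.mul_inv, Module.End.one_apply]
    obtain ⟨c, hc1, hc2⟩ := ih (v := (↑(u i)⁻¹ : Module.End ℂ E) v)
      (by rw [hinv']; exact (hv.xi h i).t h _)
    have hxx : ∀ v, g (.xi i) (g (.xi i) v) = YH.hNeg g i v := by
      intro v; rw [← hsq, sq]; rfl
    have hpr : (xiProd g (i :: L) * xiProd g (i :: L).reverse) v =
        ((-1 : ℂ) ^ c) • YH.hNeg g i v := by
      rw [xiProd_cons, List.reverse_cons, xiProd_append, xiProd_cons, xiProd_nil, mul_one]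
      have : g (.xi i) v = YH.hNeg g i ((↑(u i)⁻¹ : Module.End ℂ E) v) := by
        rw [hinv', ← Module.End.mul_apply (YH.hNeg g i), h.hNeg_mul_self i hd]
        rfl
      simp only [Module.End.mul_apply] at hc2 ⊢
      rcases hv.xi h i |>.hNeg hd h i with h3 | h3
      · rw [← hinv'] at h3
        rw [← h3, hc2, map_smul, h3, hxx]
      · rw [← hinv'] at h3
        have h4 : g (.xi i) v = -((↑(u i)⁻¹ : Module.End ℂ E) v) := by rw [h3, neg_neg]
        rw [h4, map_neg, map_neg, hc2, ← smul_neg, ← h4, map_smul, hxx]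
    rcases hv.hNeg hd h i with h2 | h2
    · refine ⟨c, ?_, ?_⟩
      · simp only [conjSum, LinearMap.add_apply, Module.End.mul_apply, hc1, map_smul, hui, negPart,
          LinearMap.smul_apply, LinearMap.sub_apply, Module.End.one_apply, h2, sub_self, smul_zero,
          zero_add]
      · rw [hpr, h2]
    · refine ⟨c + 1, ?_, ?_⟩
      · simp only [conjSum, LinearMap.add_apply, Module.End.mul_apply, hc1, map_smul, hui, negPart,
          LinearMap.smul_apply, LinearMap.sub_apply, Module.End.one_apply, h2, sub_neg_eq_add]
        rw [← two_smul ℂ v, smul_smul, ← add_smul]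
        congr 1
        push_cast
        ring
      · rw [hpr, h2, smul_neg, pow_succ, mul_neg_one, neg_smul]

end Weights
end

section
/-! ### Irreducible representations over algebraically closed and over splitting fields -/

section Burnside

variable {k : Type*} [Field k] {A : Type*} [Ring A] [Algebra k A]
  {E : Type*} [AddCommGroup E] [Module k E]

theorem IsIrreducible.surjective_of_isAlgClosed [IsAlgClosed k] [FiniteDimensional k E]
    {ρ : A →ₐ[k] Module.End k E} (hρ : IsIrreducible ρ) : Function.Surjective ρ := by
  let R := ρ.range
  have : Nontrivial E := hρ.1
  have : IsSimpleModule R E := by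
    rw [isSimpleModule_iff]
    refine { exists_pair_ne := ⟨⊥, ⊤, bot_ne_top⟩, eq_bot_or_eq_top := fun W => ?_ }
    have := hρ.2 (W.restrictScalars k) fun a w hw =>
      W.smul_mem (⟨ρ a, ⟨a, rfl⟩⟩ : R) hw
    simpa only [Submodule.restrictScalars_eq_bot_iff, Submodule.restrictScalars_eq_top_iff] using this
  intro f
  let f' : Module.End (Module.End R E) E :=
    { toFun := f
      map_add' := map_add f
      map_smul' := fun D x => by
        obtain ⟨c, hc⟩ := (IsSimpleModule.algebraMap_end_bijective_of_isAlgClosed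
          (A := R) (V := E) k).2 D
        subst hc
        simp }
  obtain ⟨s, hs⟩ := Module.Finite.fg_top (R := k) (M := E)
  obtain ⟨r, hr⟩ := jacobson_density f' s
  obtain ⟨r, a, ha⟩ := r
  refine ⟨a, (LinearMap.ext_on hs fun m hm => ?_)⟩
  rw [← show r = ρ a from ha.symm]
  exact (hr m hm).symm

theorem isIrreducible_of_surjective [Nontrivial E] {ρ : A →ₐ[k] Module.End k E}
    (h : Function.Surjective ρ) : IsIrreducible ρ := by
  refine ⟨inferInstance, fun W hW => ?_⟩
  by_contra! hne
  obtain ⟨w, hw, hw0⟩ := Submodule.exists_mem_ne_zero_of_ne_bot hne.1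
  refine hne.2 (eq_top_iff.2 fun x _ => ?_)
  obtain ⟨f, hf⟩ := Module.Projective.exists_dual_eq_one k hw0
  obtain ⟨a, ha⟩ := h (LinearMap.smulRight f x)
  have := hW a w hw
  rwa [ha, LinearMap.smulRight_apply, hf, one_smul] at this

/-- A nonzero invariant subspace of a finite-dimensional space contains an irreducible one. -/
theorem exists_irreducible_sub [FiniteDimensional k E] [Nontrivial E] (ρ : A →ₐ[k] Module.End k E) :
    ∃ W : Submodule k E, W ≠ ⊥ ∧ (∀ a, ∀ w ∈ W, ρ a w ∈ W) ∧
      ∀ W' : Submodule k E, W' ≤ W → (∀ a, ∀ w ∈ W', ρ a w ∈ W') → W' = ⊥ ∨ W' = W := by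
  have hwf : WellFounded ((· < ·) : Submodule k E → Submodule k E → Prop) := wellFounded_lt
  obtain ⟨W, ⟨hW0, hW⟩, hmin⟩ := hwf.has_min
    {W : Submodule k E | W ≠ ⊥ ∧ (∀ a, ∀ w ∈ W, ρ a w ∈ W)} ⟨⊤, top_ne_bot, fun _ _ _ => trivial⟩
  refine ⟨W, hW0, hW, fun W' hle hW' => ?_⟩
  by_cases h : W' = ⊥
  · exact Or.inl h
  · exact Or.inr (hle.eq_of_not_lt (hmin W' ⟨h, hW'⟩))

/-- A finite family of commuting operators has a common eigenvector. -/
theorem exists_common_eigenvector [IsAlgClosed k] [FiniteDimensional k E] [Nontrivial E]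
    {ι : Type*} (f : ι → Module.End k E) (hf : ∀ i j, f i * f j = f j * f i) :
    ∃ v : E, v ≠ 0 ∧ ∀ i, ∃ c : k, f i v = c • v := by
  let ρ : FreeAlgebra k ι →ₐ[k] Module.End k E := FreeAlgebra.lift k f
  obtain ⟨W, hW0, hW, hmin⟩ := exists_irreducible_sub ρ
  have hWi : ∀ i, ∀ w ∈ W, f i w ∈ W := by
    intro i w hw
    have := hW (FreeAlgebra.ι k i) w hw
    rwa [FreeAlgebra.lift_ι_apply] at this
  obtain ⟨v, hv, hv0⟩ := Submodule.exists_mem_ne_zero_of_ne_bot hW0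
  refine ⟨v, hv0, fun i => ?_⟩
  have : Nontrivial W := ⟨⟨⟨v, hv⟩, 0, fun h => hv0 (congrArg Subtype.val h)⟩⟩
  obtain ⟨c, hc⟩ := Module.End.exists_eigenvalue ((f i).restrict (hWi i))
  obtain ⟨w, hw⟩ := hc.exists_hasEigenvector
  have hw1 : f i w = c • (w : E) := congrArg Subtype.val hw.apply_eq_smul
  have hstab : ∀ a, ∀ x ∈ (LinearMap.ker (f i - c • 1) ⊓ W), ρ a x ∈ (LinearMap.ker (f i - c • 1) ⊓ W) := by
    intro a x hx
    refine ⟨?_, hW a x hx.2⟩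
    have hcomm : ρ a * f i = f i * ρ a := by
      induction a using FreeAlgebra.induction with
      | grade0 r => rw [AlgHom.commutes, Algebra.commutes]
      | grade1 j => rw [FreeAlgebra.lift_ι_apply, hf]
      | mul a b ha hb => rw [map_mul, mul_assoc, hb, ← mul_assoc, ha, mul_assoc]
      | add a b ha hb => rw [map_add, add_mul, mul_add, ha, hb]
    have hx1 : f i x = c • x := by
      simpa [sub_eq_zero] using hx.1
    have : f i (ρ a x) = ρ a (f i x) := by
      rw [← Module.End.mul_apply, ← hcomm]; rfl
    simp [this, hx1]
  rcases hmin _ inf_le_right hstab with h | h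
  · exfalso
    have : (w : E) ∈ (LinearMap.ker (f i - c • 1) ⊓ W) := ⟨by simp [hw1], w.2⟩
    rw [h] at this
    exact hw.2 (Subtype.ext this)
  · have : v ∈ (LinearMap.ker (f i - c • 1) ⊓ W) := by rw [h]; exact hv
    exact ⟨c, by simpa [sub_eq_zero] using this.1⟩

end Burnside

section Split

universe v

variable {K : Type v} [Field K] {A : Type*} [Ring A] [Algebra K A]

/-- The entries of matrices over an extension field, under a linear functional. -/
theorem exists_functional {k' : Type*} [Field k'] [Algebra K k'] {m r : ℕ}
    (X : Matrix (Fin m) (Fin r) k') (hX : X ≠ 0) :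
    ∃ l : k' →ₗ[K] K, X.map l ≠ 0 := by
  obtain ⟨i, j, hij⟩ : ∃ i j, X i j ≠ 0 := by
    by_contra! h
    exact hX (Matrix.ext h)
  obtain ⟨l, hl⟩ := Module.Projective.exists_dual_ne_zero K hij
  refine ⟨l, fun h => hl ?_⟩
  exact congrFun (congrFun h i) j

theorem map_mul_map_algebraMap {k' : Type*} [Field k'] [Algebra K k'] {m r s : ℕ} (l : k' →ₗ[K] K)
    (X : Matrix (Fin m) (Fin r) k') (Y : Matrix (Fin r) (Fin s) K) :
    (X * Y.map (algebraMap K k')).map l = X.map l * Y := by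
  ext i j
  simp only [Matrix.map_apply, Matrix.mul_apply, map_sum]
  refine Finset.sum_congr rfl fun x _ => ?_
  rw [mul_comm, ← Algebra.smul_def, map_smul, smul_eq_mul, mul_comm]

theorem map_algebraMap_mul_map {k' : Type*} [Field k'] [Algebra K k'] {m r s : ℕ} (l : k' →ₗ[K] K)
    (Y : Matrix (Fin m) (Fin r) K) (X : Matrix (Fin r) (Fin s) k') :
    (Y.map (algebraMap K k') * X).map l = Y * X.map l := by
  ext i j
  simp only [Matrix.map_apply, Matrix.mul_apply, map_sum]
  refine Finset.sum_congr rfl fun x _ => ?_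
  rw [← Algebra.smul_def, map_smul, smul_eq_mul]

/-- Equivalent representations. -/
theorem IsIrreducible.of_equiv {E E' : Type*} [AddCommGroup E] [Module K E] [AddCommGroup E']
    [Module K E'] {ρ : A →ₐ[K] Module.End K E} {ρ' : A →ₐ[K] Module.End K E'} (h : IsIrreducible ρ)
    (e : E ≃ₗ[K] E') (he : ∀ a x, e (ρ a x) = ρ' a (e x)) : IsIrreducible ρ' := by
  have := h.1
  refine ⟨e.symm.toEquiv.nontrivial, fun W hW => ?_⟩
  rcases h.2 (W.comap e.toLinearMap) fun a w hw => by
    simpa [he] using hW a _ hw with h | h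
  · left
    rw [eq_bot_iff]
    intro x hx
    have : e.symm x ∈ W.comap e.toLinearMap := by simpa using hx
    rw [h] at this
    simpa using this
  · right
    rw [eq_top_iff]
    intro x _
    have : e.symm x ∈ W.comap e.toLinearMap := by rw [h]; trivial
    simpa using this

/-- The matrix form of a representation. -/
def matrixRep {E : Type*} [AddCommGroup E] [Module K E] {m : ℕ} (b : Module.Basis (Fin m) K E)
    (ρ : A →ₐ[K] Module.End K E) : A →ₐ[K] Matrix (Fin m) (Fin m) K :=
  (LinearMap.toMatrixAlgEquiv b).toAlgHom.comp ρ

/-- The representation by matrices on column vectors. -/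
def vecRep {m : ℕ} (R : A →ₐ[K] Matrix (Fin m) (Fin m) K) : A →ₐ[K] Module.End K (Fin m → K) :=
  Matrix.toLinAlgEquiv'.toAlgHom.comp R

theorem vecRep_apply {m : ℕ} (R : A →ₐ[K] Matrix (Fin m) (Fin m) K) (a : A) (x : Fin m → K) :
    vecRep R a x = R a *ᵥ x := by
  simp [vecRep, Matrix.toLinAlgEquiv'_apply]

theorem isIrreducible_vecRep_matrixRep {E : Type*} [AddCommGroup E] [Module K E] {m : ℕ}
    (b : Module.Basis (Fin m) K E) {ρ : A →ₐ[K] Module.End K E} (h : IsIrreducible ρ) :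
    IsIrreducible (vecRep (matrixRep b ρ)) := by
  refine h.of_equiv b.equivFun fun a x => ?_
  rw [vecRep_apply]
  simp only [matrixRep, AlgHom.comp_apply]
  have := LinearMap.toMatrix_mulVec_repr b b (ρ a) x
  exact this.symm

theorem trace_matrixRep {E : Type*} [AddCommGroup E] [Module K E] {m : ℕ}
    (b : Module.Basis (Fin m) K E) (ρ : A →ₐ[K] Module.End K E) (a : A) :
    (matrixRep b ρ a).trace = character ρ a := by
  simp only [character, LinearMap.comp_apply, AlgHom.toLinearMap_apply]
  rw [LinearMap.trace_eq_matrix_trace K b]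
  rfl

theorem character_vecRep {m : ℕ} (R : A →ₐ[K] Matrix (Fin m) (Fin m) K) (a : A) :
    character (vecRep R) a = (R a).trace := by
  simp only [character, LinearMap.comp_apply, AlgHom.toLinearMap_apply, vecRep, AlgHom.comp_apply]
  exact Matrix.trace_toLin'_eq _

/-- A family of matrices spanning the full matrix algebra over an extension field spans it. -/
theorem range_eq_top_of_span_map {k' : Type*} [Field k'] [Algebra K k'] {m : ℕ}
    (T : Submodule K (Matrix (Fin m) (Fin m) K))
    (hT : Submodule.span k' ((fun M : Matrix (Fin m) (Fin m) K => M.map (algebraMap K k')) '' T) = ⊤) :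
    T = ⊤ := by
  by_contra hne
  obtain ⟨f, hf, hfT⟩ := Submodule.exists_dual_map_eq_bot_of_lt_top (lt_top_iff_ne_top.2 hne)
    inferInstance
  let F : Matrix (Fin m) (Fin m) k' →ₗ[k'] k' :=
    ∑ i, ∑ j, algebraMap K k' (f (Matrix.single i j 1)) • Matrix.entryLinearMap k' k' i j
  have hF : ∀ M : Matrix (Fin m) (Fin m) K, F (M.map (algebraMap K k')) = algebraMap K k' (f M) := by
    intro M
    conv_rhs => rw [Matrix.matrix_eq_sum_single M]
    simp only [F, LinearMap.sum_apply, LinearMap.smul_apply, Matrix.entryLinearMap_apply,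
      Matrix.map_apply, map_sum, smul_eq_mul]
    refine Finset.sum_congr rfl fun i _ => Finset.sum_congr rfl fun j _ => ?_
    rw [← map_mul]
    congr 1
    rw [mul_comm, ← smul_eq_mul, ← map_smul, Matrix.smul_single, smul_eq_mul, mul_one]
  have hF0 : F = 0 := by
    refine LinearMap.ext_on hT ?_
    rintro _ ⟨M, hM, rfl⟩
    rw [hF, show f M = 0 from by
      have : f M ∈ T.map f := ⟨M, hM, rfl⟩
      rw [hfT] at this; simpa using this]
    simp
  refine hf (LinearMap.ext fun M => ?_)
  have := hF M
  rw [hF0] at this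
  simpa using this.symm

/-- An irreducible representation of a split algebra is surjective. -/
theorem surjective_of_isSplit (hA : IsSplit K A) {m : ℕ} (R : A →ₐ[K] Matrix (Fin m) (Fin m) K)
    (hR : IsIrreducible (vecRep R)) : Function.Surjective R := by
  let k' := AlgebraicClosure K
  let R' : A → Matrix (Fin m) (Fin m) k' := fun a => (R a).map (algebraMap K k')
  let l' : FreeAlgebra k' A →ₐ[k'] Matrix (Fin m) (Fin m) k' := FreeAlgebra.lift k' R'
  let ρ' : FreeAlgebra k' A →ₐ[k'] Module.End k' (Fin m → k') := vecRep l'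
  have hρ' : ∀ a x, ρ' (FreeAlgebra.ι k' a) x = R' a *ᵥ x := by
    intro a x
    rw [vecRep_apply, FreeAlgebra.lift_ι_apply]
  have hm : 0 < m := by
    by_contra h
    obtain rfl : m = 0 := by omega
    have := hR.1
    exact not_subsingleton (Fin 0 → K) inferInstance
  have : Nonempty (Fin m) := ⟨⟨0, hm⟩⟩
  obtain ⟨W, hW0, hW, hmin⟩ := exists_irreducible_sub ρ'
  let r := Module.finrank k' W
  let bW : Module.Basis (Fin r) k' W := Module.finBasis k' W
  let J : Matrix (Fin m) (Fin r) k' := Matrix.of fun i j => (bW j : Fin m → k') i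
  have hJv : ∀ x : Fin r → k', J *ᵥ x = ((∑ j, x j • bW j : W) : Fin m → k') := by
    intro x
    funext i
    simp [J, Matrix.mulVec, dotProduct, mul_comm]
  have hJinj : ∀ x, J *ᵥ x = 0 → x = 0 := by
    intro x hx
    rw [hJv] at hx
    have h1 : (∑ j, x j • bW j : W) = 0 := Subtype.ext hx
    funext j
    exact Fintype.linearIndependent_iff.1 bW.linearIndependent x h1 j
  have hJcancel : ∀ M M' : Matrix (Fin r) (Fin r) k', J * M = J * M' → M = M' := by
    intro M M' h
    rw [← sub_eq_zero, ← Matrix.mul_sub] at h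
    rw [← sub_eq_zero]
    refine Matrix.ext fun i j => ?_
    have := hJinj ((M - M') *ᵥ Pi.single j 1) (by rw [Matrix.mulVec_mulVec, h, Matrix.zero_mulVec])
    simpa using congrFun this i
  have hex : ∀ a, ∃ M : Matrix (Fin r) (Fin r) k', R' a * J = J * M := by
    intro a
    have : ∀ j, ∃ x : Fin r → k', J *ᵥ x = R' a *ᵥ (bW j : Fin m → k') := by
      intro j
      have hw := hW (FreeAlgebra.ι k' a) (bW j) (bW j).2
      rw [hρ'] at hw
      refine ⟨bW.repr ⟨_, hw⟩, ?_⟩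
      rw [hJv, bW.sum_repr]
    choose x hx using this
    refine ⟨Matrix.of fun i j => x j i, Matrix.ext fun i j => ?_⟩
    exact (congrFun (hx j) i).symm
  choose M hM using hex
  let ρW : A →ₐ[K] Matrix (Fin r) (Fin r) k' :=
    { toFun := M
      map_one' := hJcancel _ _ (by rw [← hM]; simp [R'])
      map_mul' := fun a b => hJcancel _ _ (by
        rw [← hM, ← Matrix.mul_assoc, ← hM, Matrix.mul_assoc, ← hM]
        simp [R', Matrix.mul_assoc, Matrix.map_mul])
      map_zero' := hJcancel _ _ (by rw [← hM]; simp [R'])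
      map_add' := fun a b => hJcancel _ _ (by
        rw [← hM, Matrix.mul_add, ← hM, ← hM, ← Matrix.add_mul]
        simp [R', Matrix.map_add])
      commutes' := fun c => hJcancel _ _ (by
        have e1 : R' (algebraMap K A c) = (algebraMap K k' c) • (1 : Matrix (Fin m) (Fin m) k') := by
          ext i j
          simp only [R', AlgHom.commutes, Matrix.map_apply, Matrix.algebraMap_matrix_apply,
            Matrix.smul_apply, Matrix.one_apply]
          split_ifs <;> simp
        have e2 : algebraMap K (Matrix (Fin r) (Fin r) k') c =
            (algebraMap K k' c) • (1 : Matrix (Fin r) (Fin r) k') := by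
          ext i j
          simp only [Matrix.algebraMap_matrix_apply, Matrix.smul_apply, Matrix.one_apply]
          split_ifs <;> simp
        rw [← hM, e1, e2, Matrix.smul_mul, Matrix.mul_smul, Matrix.one_mul, Matrix.mul_one]) }
  obtain ⟨ρ₀, P, hP⟩ := hA k' r ρW
  let X : Matrix (Fin m) (Fin r) k' := J * (P : Matrix (Fin r) (Fin r) k')
  have hXi : ∀ a, R' a * X = X * (ρ₀ a).map (algebraMap K k') := by
    intro a
    have h1 : M a * (P : Matrix (Fin r) (Fin r) k') =
        (P : Matrix (Fin r) (Fin r) k') * (ρ₀ a).map (algebraMap K k') := by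
      have := hP a
      rw [show M a = ρW a from rfl, this, Matrix.mul_assoc, ← Units.val_mul, inv_mul_cancel,
        Units.val_one, Matrix.mul_one]
    rw [← Matrix.mul_assoc, hM, Matrix.mul_assoc, h1, ← Matrix.mul_assoc]
  have hr : 0 < r := by
    have : Nontrivial W := Submodule.nontrivial_iff_ne_bot.2 hW0
    exact Module.finrank_pos
  have hX0 : X ≠ 0 := by
    intro h
    have h1 : J = 0 := by
      have : J * (P : Matrix (Fin r) (Fin r) k') * ((P⁻¹ : GL (Fin r) k') : Matrix (Fin r) (Fin r) k') = J := by
        rw [Matrix.mul_assoc, ← Units.val_mul, mul_inv_cancel, Units.val_one, Matrix.mul_one]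
      rw [← this, show J * (P : Matrix (Fin r) (Fin r) k') = 0 from h, Matrix.zero_mul]
    have h2 := hJinj (Pi.single ⟨0, hr⟩ 1) (by rw [h1, Matrix.zero_mulVec])
    have := congrFun h2 ⟨0, hr⟩
    simp at this
  obtain ⟨l, hl⟩ := exists_functional (K := K) X hX0
  have hXl : ∀ a, R a * X.map l = X.map l * ρ₀ a := by
    intro a
    rw [← map_algebraMap_mul_map, ← map_mul_map_algebraMap]
    exact congrArg (fun Y => Matrix.map Y l) (hXi a)
  have hrange : LinearMap.range (X.map l).mulVecLin = ⊤ := by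
    rcases hR.2 (LinearMap.range (X.map l).mulVecLin) (by
      rintro a _ ⟨y, rfl⟩
      refine ⟨ρ₀ a *ᵥ y, ?_⟩
      rw [vecRep_apply, Matrix.mulVecLin_apply, Matrix.mulVecLin_apply, Matrix.mulVec_mulVec,
        Matrix.mulVec_mulVec, hXl]) with h | h
    · exfalso
      refine hl (Matrix.ext fun i j => ?_)
      have : (X.map l).mulVecLin (Pi.single j 1) ∈ LinearMap.range (X.map l).mulVecLin := ⟨_, rfl⟩
      rw [h] at this
      have h2 : (X.map l) *ᵥ (Pi.single j 1) = 0 := by simpa using this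
      simpa using congrFun h2 i
    · exact h
  have hrm : m ≤ r := by
    have h1 := LinearMap.finrank_range_le (X.map l).mulVecLin
    rw [hrange, finrank_top] at h1
    simpa using h1
  have hWtop : W = ⊤ := by
    refine Submodule.eq_top_of_finrank_eq ?_
    have := Submodule.finrank_le W
    have h2 : Module.finrank k' (Fin m → k') = m := by simp
    change r ≤ _ at this
    change r = _
    omega
  have hirr : IsIrreducible ρ' := by
    refine ⟨inferInstance, fun W' hW' => ?_⟩
    have := hmin W' (by rw [hWtop]; exact le_top) hW'
    rwa [hWtop] at this
  have hl : Algebra.adjoin k' (Set.range R') = ⊤ := by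
    rw [Algebra.adjoin_range_eq_range_freeAlgebra_lift, AlgHom.range_eq_top]
    intro Y
    obtain ⟨a, ha⟩ := hirr.surjective_of_isAlgClosed (Matrix.toLinAlgEquiv' Y)
    exact ⟨a, Matrix.toLinAlgEquiv'.injective ha⟩
  have hspan : Submodule.span k' (Set.range R') = ⊤ := by
    let S : Submonoid (Matrix (Fin m) (Fin m) k') :=
      MonoidHom.mrange ((algebraMap K k').mapMatrix.toMonoidHom.comp (R : A →* _))
    have hS : (S : Set _) = Set.range R' := rfl
    have := congrArg Subalgebra.toSubmodule hl
    rwa [Algebra.adjoin_eq_span, ← hS, Submonoid.closure_eq, Algebra.top_toSubmodule] at this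
  have htop := range_eq_top_of_span_map (k' := k') (LinearMap.range R.toLinearMap) (by
    rw [← hspan]
    congr 1
    ext Y
    constructor
    · rintro ⟨_, ⟨a, rfl⟩, rfl⟩
      exact ⟨a, rfl⟩
    · rintro ⟨a, rfl⟩
      exact ⟨_, ⟨a, rfl⟩, rfl⟩)
  intro Y
  have : Y ∈ LinearMap.range R.toLinearMap := by rw [htop]; trivial
  exact this

end Split
end

section
/-! ### Reduction of representations modulo a prime of a principal ideal domain -/

section Reduction

variable {O K : Type*} [CommRing O] [IsDomain O] [IsPrincipalIdealRing O] [Field K] [Algebra O K]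
  [IsFractionRing O K] {Λ : Type*} [Ring Λ] [Algebra O Λ]

/-- The action on a stable lattice, in coordinates. -/
theorem exists_lattice_form {W : Type*} [AddCommGroup W] [Module K W] [Module O W]
    [IsScalarTower O K W] [FiniteDimensional K W] {N : ℕ} (hNW : Module.finrank K W = N)
    (R : Λ →+* Module.End K W) (hR : ∀ (o : O) x w, R (algebraMap O Λ o * x) w = o • R x w)
    (M : Submodule O W) [Submodule.IsLattice K M] (hM : ∀ x, ∀ w ∈ M, R x w ∈ M) :
    ∃ (c : Module.Basis (Fin N) O M) (S : Λ →ₐ[O] Matrix (Fin N) (Fin N) O),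
      (∀ x (v : M), S x *ᵥ c.repr v = c.repr ⟨R x v, hM x v v.2⟩) ∧
      ∀ x, algebraMap O K (S x).trace = LinearMap.trace K W (R x) := by
  have : FaithfulSMul O K := inferInstance
  have : Module.Free O M := Submodule.IsLattice.free K M
  have : Module.Finite O M := Submodule.IsLattice.finite K M
  have hN : Module.finrank O M = N := by
    rw [← hNW, Module.finrank, Submodule.IsLattice.rank' K M, Module.finrank]
  let c : Module.Basis (Fin N) O M := (Module.finBasisOfFinrankEq O M hN)
  let L : Λ →ₐ[O] Module.End O M := AlgHom.ofLinearMap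
    { toFun := fun x =>
        { toFun := fun v => ⟨R x v, hM x v v.2⟩
          map_add' := fun v w => Subtype.ext (by simp)
          map_smul' := fun o v => Subtype.ext (by
            change R x (o • (v : W)) = o • R x v
            rw [← algebraMap_smul K o (v : W), map_smul, algebraMap_smul]) }
      map_add' := fun x y => LinearMap.ext fun v => Subtype.ext (by simp)
      map_smul' := fun o x => LinearMap.ext fun v => Subtype.ext (by
        change R (o • x) v = o • R x v
        rw [Algebra.smul_def, hR]) }
    (LinearMap.ext fun v => Subtype.ext (by simp))
    (fun x y => LinearMap.ext fun v => Subtype.ext (by simp))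
  refine ⟨c, (LinearMap.toMatrixAlgEquiv c).toAlgHom.comp L, fun x v => ?_, fun x => ?_⟩
  · exact LinearMap.toMatrix_mulVec_repr c c (L x) v
  · let c' := c.extendOfIsLattice K
    rw [LinearMap.trace_eq_matrix_trace K c', Matrix.trace, Matrix.trace, map_sum]
    refine Finset.sum_congr rfl fun i _ => ?_
    have hrepr : ∀ (v : M) i, c'.repr (v : W) i = algebraMap O K (c.repr v i) := by
      intro v i
      have h1 : (v : W) = ∑ j, algebraMap O K (c.repr v j) • c' j := by
        have h := congrArg Subtype.val (c.sum_repr v)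
        rw [Submodule.coe_sum] at h
        refine h.symm.trans (Finset.sum_congr rfl fun j _ => ?_)
        rw [algebraMap_smul, Module.Basis.extendOfIsLattice_apply]
        rfl
      rw [h1, c'.repr_sum_self]
    simp only [Matrix.diag_apply, LinearMap.toMatrix_apply]
    have : c' i = (c i : W) := Module.Basis.extendOfIsLattice_apply K c i
    rw [this]
    have h2 := hrepr (L x (c i)) i
    change c'.repr (R x (c i)) i = _ at h2
    rw [h2]
    simp [LinearMap.toMatrixAlgEquiv_apply]

theorem trace_mulLeft_matrix {m : ℕ} (X : Matrix (Fin m) (Fin m) K) :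
    LinearMap.trace K _ (LinearMap.mulLeft K X) = (m : K) * X.trace := by
  rw [LinearMap.trace_eq_matrix_trace K (Matrix.stdBasis K (Fin m) (Fin m)), Matrix.trace,
    Fintype.sum_prod_type]
  simp only [Matrix.diag_apply, LinearMap.toMatrix_apply, LinearMap.mulLeft_apply]
  have : ∀ i j, ((Matrix.stdBasis K (Fin m) (Fin m)).repr
      (X * (Matrix.stdBasis K (Fin m) (Fin m)) (i, j))) (i, j) = X i i := by
    intro i j
    rw [Matrix.stdBasis_eq_single]
    have h : ∀ Y : Matrix (Fin m) (Fin m) K, (Matrix.stdBasis K (Fin m) (Fin m)).repr Y (i, j) = Y i j := by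
      intro Y
      have h1 : Y = ∑ p : Fin m × Fin m, Y p.1 p.2 • Matrix.stdBasis K (Fin m) (Fin m) p := by
        conv_lhs => rw [Matrix.matrix_eq_sum_single Y]
        rw [Fintype.sum_prod_type]
        simp [Matrix.stdBasis_eq_single]
      conv_lhs => rw [h1]
      rw [Module.Basis.repr_sum_self]
    rw [h]
    simp
  simp only [this]
  simp [Matrix.trace, Finset.mul_sum]

/-- An irreducible representation of a finite algebra over a principal ideal domain with values in
matrices over the field of fractions reduces to an irreducible representation of a semisimple
specialization. -/
theorem exists_reduction [Module.Finite O Λ] (θ : O →+* ℂ) {m : ℕ}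
    (R : Λ →+* Matrix (Fin m) (Fin m) K)
    (hR : ∀ o, R (algebraMap O Λ o) = algebraMap O K o • (1 : Matrix (Fin m) (Fin m) K))
    (hspan : Submodule.span K (Set.range R) = ⊤)
    {A₀ : Type*} [Ring A₀] [Algebra ℂ A₀] [IsSemisimpleRing A₀] (p : Λ →+* A₀)
    (hpspan : Submodule.span ℂ (Set.range p) = ⊤)
    (huniv : ∀ (N : ℕ) (f : Λ →+* Matrix (Fin N) (Fin N) ℂ),
      (∀ o, f (algebraMap O Λ o) = θ o • (1 : Matrix (Fin N) (Fin N) ℂ)) →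
      ∃ f₀ : A₀ →ₐ[ℂ] Matrix (Fin N) (Fin N) ℂ, ∀ x, f₀ (p x) = f x) :
    ∃ σ : A₀ →ₐ[ℂ] Matrix (Fin m) (Fin m) ℂ, Function.Surjective σ ∧
      ∀ x, ∃ o, algebraMap O K o = (R x).trace ∧ (σ (p x)).trace = θ o := by
  have hRmul : ∀ o x, R (algebraMap O Λ o * x) = algebraMap O K o • R x := by
    intro o x
    rw [map_mul, hR, Matrix.smul_mul, Matrix.one_mul]
  have hθtr : ∀ {N : ℕ} (X : Matrix (Fin N) (Fin N) O), (X.map θ).trace = θ X.trace := by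
    intro N X
    simp [Matrix.trace]
  -- reduction of an integral form
  have hred : ∀ (N : ℕ) (S : Λ →ₐ[O] Matrix (Fin N) (Fin N) O),
      ∃ f₀ : A₀ →ₐ[ℂ] Matrix (Fin N) (Fin N) ℂ, ∀ x, f₀ (p x) = (S x).map θ := by
    intro N S
    refine huniv N (θ.mapMatrix.comp S.toRingHom) fun o => ?_
    ext i j
    simp only [RingHom.comp_apply, AlgHom.toRingHom_eq_coe, RingHom.coe_coe, AlgHom.commutes,
      RingHom.mapMatrix_apply, Matrix.map_apply, Matrix.algebraMap_matrix_apply, Matrix.smul_apply,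
      Matrix.one_apply]
    split_ifs <;> simp
  -- the lattice in the space of column vectors
  let T : Fin m → Λ →ₗ[O] (Fin m → K) := fun j =>
    { toFun := fun x => R x *ᵥ Pi.single j 1
      map_add' := fun x y => by rw [map_add, Matrix.add_mulVec]
      map_smul' := fun o x => by
        rw [Algebra.smul_def, hRmul, Matrix.smul_mulVec, RingHom.id_apply, algebraMap_smul] }
  let M₁ : Submodule O (Fin m → K) := ⨆ j, LinearMap.range (T j)
  have : Submodule.IsLattice K M₁ :=
    { fg := Submodule.fg_iSup _ fun j => by
        rw [LinearMap.range_eq_map]; exact Module.Finite.fg_top.map _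
      span_eq_top := by
        rw [eq_top_iff, ← (Pi.basisFun K (Fin m)).span_eq, Submodule.span_le]
        rintro _ ⟨j, rfl⟩
        refine Submodule.subset_span (Submodule.mem_iSup_of_mem j ⟨1, ?_⟩)
        change R 1 *ᵥ Pi.single j 1 = _
        rw [map_one, Matrix.one_mulVec, Pi.basisFun_apply] }
  have hvec : ∀ (X : Matrix (Fin m) (Fin m) K) v,
      (Matrix.toLinAlgEquiv' (R := K) X) v = X *ᵥ v := fun X v => by
    rw [Matrix.toLinAlgEquiv'_apply]
  obtain ⟨c₁, S₁, -, htr₁⟩ := exists_lattice_form (O := O) (N := m) (by simp)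
    ((Matrix.toLinAlgEquiv' (R := K) (n := Fin m)).toAlgHom.toRingHom.comp R)
    (fun o x w => by
      change Matrix.toLinAlgEquiv' (R _) w = o • Matrix.toLinAlgEquiv' (R x) w
      rw [hvec, hvec, hRmul, Matrix.smul_mulVec, algebraMap_smul]) M₁
    (fun x w hw => by
      change Matrix.toLinAlgEquiv' (R x) w ∈ M₁
      rw [hvec]
      induction hw using Submodule.iSup_induction' with
      | mem j w hw =>
        obtain ⟨y, rfl⟩ := hw
        refine Submodule.mem_iSup_of_mem j ⟨x * y, ?_⟩
        change R (x * y) *ᵥ _ = R x *ᵥ (R y *ᵥ _)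
        rw [map_mul, Matrix.mulVec_mulVec]
      | zero => rw [Matrix.mulVec_zero]; exact zero_mem _
      | add v w _ _ hv hw => rw [Matrix.mulVec_add]; exact add_mem hv hw)
  have htr₁' : ∀ x, algebraMap O K (S₁ x).trace = (R x).trace := by
    intro x
    rw [htr₁]
    exact Matrix.trace_toLin'_eq _
  obtain ⟨σ, hσ⟩ := hred m S₁
  -- the lattice in the space of matrices
  let M₂ : Submodule O (Matrix (Fin m) (Fin m) K) := LinearMap.range (
    { toFun := fun x => R x
      map_add' := fun x y => by rw [map_add]
      map_smul' := fun o x => by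
        rw [Algebra.smul_def, hRmul, RingHom.id_apply, algebraMap_smul] } :
      Λ →ₗ[O] Matrix (Fin m) (Fin m) K)
  have : Submodule.IsLattice K M₂ :=
    { fg := by
        simp only [M₂, LinearMap.range_eq_map]; exact Module.Finite.fg_top.map _
      span_eq_top := hspan }
  have hM₂ : ∀ x y, R x * R y ∈ M₂ := fun x y => ⟨x * y, by simp⟩
  obtain ⟨c₂, S₂, hS₂, htr₂⟩ := exists_lattice_form (O := O) (N := m * m) (by simp [Module.finrank_matrix])
    ((Algebra.lmul K (Matrix (Fin m) (Fin m) K)).toRingHom.comp R)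
    (fun o x w => by
      change R _ * w = o • (R x * w)
      rw [hRmul, Matrix.smul_mul, algebraMap_smul]) M₂
    (fun x w hw => by
      obtain ⟨y, rfl⟩ := hw
      exact hM₂ x y)
  have htr₂' : ∀ x, (S₂ x).trace = (m : O) * (S₁ x).trace := by
    intro x
    refine IsFractionRing.injective O K ?_
    rw [htr₂, map_mul, htr₁', map_natCast]
    exact trace_mulLeft_matrix (R x)
  obtain ⟨τ, hτ⟩ := hred (m * m) S₂
  have htr : ∀ a, (τ a).trace = (m : ℂ) * (σ a).trace := by
    intro a
    have : a ∈ Submodule.span ℂ (Set.range p) := by rw [hpspan]; trivial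
    induction this using Submodule.span_induction with
    | mem a ha =>
      obtain ⟨x, rfl⟩ := ha
      rw [hτ, hσ, ← map_natCast θ, hθtr, hθtr, htr₂', map_mul]
    | zero => simp
    | add a b _ _ ha hb => simp only [map_add, Matrix.trace_add, ha, hb, mul_add]
    | smul c a _ ha => simp only [map_smul, Matrix.trace_smul, ha, smul_eq_mul]; ring
  have hker : ∀ a, σ a = 0 → τ a = 0 := by
    intro a ha
    obtain ⟨e, he, hI⟩ := IsSemisimpleRing.ideal_eq_span_idempotent (RingHom.ker σ.toRingHom)
    have he0 : σ e = 0 := by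
      have : e ∈ RingHom.ker σ.toRingHom := by rw [hI]; exact Ideal.mem_span_singleton_self e
      exact this
    have hτe : τ e = 0 := by
      have h1 : IsIdempotentElem (Matrix.toLin' (τ e)) := by
        have : τ e * τ e = τ e := by rw [← map_mul, he]
        change Matrix.toLin' (τ e) ∘ₗ Matrix.toLin' (τ e) = _
        rw [← Matrix.toLin'_mul, this]
      have h2 := (LinearMap.IsIdempotentElem.trace_eq_zero_iff h1).1 (by
        rw [Matrix.trace_toLin'_eq, htr, he0]; simp)
      simpa using h2
    have : a ∈ RingHom.ker σ.toRingHom := ha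
    rw [hI, Ideal.mem_span_singleton'] at this
    obtain ⟨b, rfl⟩ := this
    rw [map_mul, hτe, mul_zero]
  -- the orbit of the identity
  let v₁ : Fin (m * m) → ℂ := fun i => θ (c₂.repr ⟨R 1, ⟨1, rfl⟩⟩ i)
  have horb : ∀ j, ∃ a, τ a *ᵥ v₁ = Pi.single j 1 := by
    intro j
    obtain ⟨x, hx⟩ := (c₂ j).2
    refine ⟨p x, ?_⟩
    have h1 := hS₂ x ⟨R 1, ⟨1, rfl⟩⟩
    have h2 : (⟨((Algebra.lmul K (Matrix (Fin m) (Fin m) K)).toRingHom.comp R) x (R 1), by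
        simpa using hM₂ x 1⟩ : M₂) = c₂ j := by
      refine Subtype.ext ?_
      rw [← hx]
      change R x * R 1 = R x
      rw [map_one, mul_one]
    rw [h2] at h1
    rw [hτ]
    funext i
    have h3 := congrArg θ (congrFun h1 i)
    simp only [Matrix.mulVec, dotProduct, map_sum, map_mul, Module.Basis.repr_self] at h3 ⊢
    simp only [Matrix.map_apply, v₁]
    rw [h3, Finsupp.single_apply, Pi.single_apply]
    simp [eq_comm]
  choose a ha using horb
  have hind : LinearIndependent ℂ fun j => σ (a j) := by
    rw [Fintype.linearIndependent_iff]
    intro w hw j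
    have h1 := hker (∑ j, w j • a j) (by rw [map_sum]; simpa using hw)
    have h2 := congrArg (fun X : Matrix (Fin (m * m)) (Fin (m * m)) ℂ => (X *ᵥ v₁) j) h1
    simpa [Matrix.sum_mulVec, Matrix.smul_mulVec, ha, Pi.single_apply] using h2
  refine ⟨σ, fun Y => ?_, fun x => ⟨(S₁ x).trace, htr₁' x, by rw [hσ]; exact hθtr _⟩⟩
  have h1 := hind.span_eq_top_of_card_eq_finrank' (by simp [Module.finrank_matrix])
  have h2 : Y ∈ LinearMap.range σ.toLinearMap :=
    (h1.ge.trans (Submodule.span_le.2 (by rintro _ ⟨j, rfl⟩; exact ⟨_, rfl⟩))) trivial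
  exact h2

end Reduction
end

section
/-! ### The local ring at a point of the integral closure -/

section LocalRing

theorem isPrincipalIdealRing_of_surjective {R S : Type*} [CommRing R] [IsDomain R]
    [IsDiscreteValuationRing R] [CommRing S] (f : R →+* S) (hf : Function.Surjective f) :
    IsPrincipalIdealRing S :=
  IsPrincipalIdealRing.of_surjective f hf

open Polynomial in
/-- The local ring of a point of the integral closure of `ℂ[u^{±1}]` is a principal ideal domain. -/
theorem exists_local_ring {K : Type*} [Field K] [Algebra ℂ K] [Algebra (RatFunc ℂ) K]
    [IsScalarTower ℂ (RatFunc ℂ) K] [FiniteDimensional (RatFunc ℂ) K] [IsGalois (RatFunc ℂ) K]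
    {u : K} (hu : u = algebraMap (RatFunc ℂ) K RatFunc.X)
    (φ : IntCl ({u, u⁻¹} : Set K) →ₐ[ℂ] ℂ) :
    ∃ (O : Subalgebra ℂ K) (θ : O →ₐ[ℂ] ℂ), IsPrincipalIdealRing O ∧ IsFractionRing O K ∧
      ∀ a : IntCl ({u, u⁻¹} : Set K), ∃ h : (a : K) ∈ O, θ ⟨a, h⟩ = φ a := by
  letI : Algebra ℂ[X] K := ((algebraMap (RatFunc ℂ) K).comp (algebraMap ℂ[X] (RatFunc ℂ))).toAlgebra
  have : IsScalarTower ℂ[X] (RatFunc ℂ) K := .of_algebraMap_eq' rfl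
  have : IsScalarTower ℂ ℂ[X] K := by
    refine .of_algebraMap_eq fun c => ?_
    rw [IsScalarTower.algebraMap_apply ℂ[X] (RatFunc ℂ) K, ← IsScalarTower.algebraMap_apply ℂ ℂ[X] (RatFunc ℂ),
      ← IsScalarTower.algebraMap_apply ℂ (RatFunc ℂ) K]
  have hX : algebraMap ℂ[X] K X = u := by
    rw [IsScalarTower.algebraMap_apply ℂ[X] (RatFunc ℂ) K, RatFunc.algebraMap_X, hu]
  have hinj : Function.Injective (algebraMap ℂ[X] K) :=
    (algebraMap (RatFunc ℂ) K).injective.comp (IsFractionRing.injective ℂ[X] (RatFunc ℂ))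
  have hu0 : u ≠ 0 := by
    rw [← hX]
    exact fun h => X_ne_zero (hinj (by rw [h, map_zero]))
  let A := Algebra.adjoin ℂ ({u, u⁻¹} : Set K)
  have huA : u ∈ A := Algebra.subset_adjoin (by simp)
  have huA' : u⁻¹ ∈ A := Algebra.subset_adjoin (by simp)
  let B := integralClosure ℂ[X] K
  have hBI : ∀ b : B, (b : K) ∈ integralClosure A K := by
    intro b
    have := IsIntegral.map_of_comp_eq (aeval (R := ℂ) (⟨u, huA⟩ : A)).toRingHom (RingHom.id K)
      (by
        refine RingHom.ext fun p => ?_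
        simp only [RingHom.comp_apply, RingHom.id_apply]
        have h1 : ((aeval (⟨u, huA⟩ : A) p : A) : K) = aeval u p := by
          have := aeval_algHom_apply A.val (⟨u, huA⟩ : A) p
          exact this.symm
        refine h1.trans ?_
        rw [← hX, aeval_algebraMap_apply, aeval_X_left_apply]) b.2
    exact this
  let ι : B →+* IntCl ({u, u⁻¹} : Set K) :=
    { toFun := fun b => ⟨b, hBI b⟩
      map_one' := rfl
      map_mul' := fun _ _ => rfl
      map_zero' := rfl
      map_add' := fun _ _ => rfl }
  let ψ : B →+* ℂ := φ.toRingHom.comp ι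
  let P := RingHom.ker ψ
  have : P.IsPrime := RingHom.ker_isPrime ψ
  have : IsFractionRing B K := integralClosure.isFractionRing_of_finite_extension (RatFunc ℂ) K
  have : IsDedekindDomain B := integralClosure.isDedekindDomain ℂ[X] (RatFunc ℂ) K
  let uI : IntCl ({u, u⁻¹} : Set K) := algebraMap A _ ⟨u, huA⟩
  let uI' : IntCl ({u, u⁻¹} : Set K) := algebraMap A _ ⟨u⁻¹, huA'⟩
  have huu : φ uI * φ uI' = 1 := by
    rw [← map_mul, ← map_one φ]
    exact congrArg φ (Subtype.ext (mul_inv_cancel₀ hu0))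
  let uB : B := algebraMap ℂ[X] B X
  have huB : ψ uB = φ uI := congrArg φ (Subtype.ext hX)
  have hψC : ∀ c : ℂ, ψ (algebraMap ℂ B c) = c := by
    intro c
    have : ι (algebraMap ℂ B c) = algebraMap ℂ _ c := Subtype.ext rfl
    change φ (ι _) = c
    rw [this, AlgHom.commutes]
    rfl
  have hP : P ≠ ⊥ := by
    intro hP
    have h1 : uB - algebraMap ℂ B (φ uI) ∈ P := by
      rw [RingHom.mem_ker, map_sub, huB, hψC, sub_self]
    rw [hP, Ideal.mem_bot] at h1
    have h2 : algebraMap ℂ[X] K (X - C (φ uI)) = 0 := by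
      have := congrArg (algebraMap B K) h1
      rw [map_zero] at this
      have hc : algebraMap B K (algebraMap ℂ B (φ uI)) = algebraMap ℂ[X] K (C (φ uI)) :=
        IsScalarTower.algebraMap_apply ℂ ℂ[X] K (φ uI)
      rw [← this, map_sub, map_sub, hc]
      rfl
    exact X_sub_C_ne_zero (φ uI) (hinj (by rw [h2, map_zero]))
  let O' := Localization.subalgebra.ofField K P.primeCompl P.primeCompl_le_nonZeroDivisors
  have : IsLocalization.AtPrime O' P := Localization.subalgebra.isLocalization_ofField K _ _
  have : IsDiscreteValuationRing O' :=
    IsLocalization.AtPrime.isDiscreteValuationRing_of_dedekind_domain B hP O'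
  have : IsFractionRing O' K := Localization.subalgebra.isFractionRing_ofField K _ _
  have hunit : ∀ y : P.primeCompl, IsUnit (ψ y) := fun y => IsUnit.mk0 _ y.2
  let θ' : O' →+* ℂ := IsLocalization.lift (M := P.primeCompl) hunit
  have hθ' : ∀ b : B, θ' (algebraMap B O' b) = ψ b := IsLocalization.lift_eq hunit
  have hBO : ∀ b : B, (b : K) ∈ O' := fun b => (algebraMap B O' b).2
  let O : Subalgebra ℂ K :=
    { O'.toSubring with
      algebraMap_mem' := fun c => by
        have := hBO (algebraMap ℂ B c)
        exact this }
  have hAO : A ≤ O := by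
    refine Algebra.adjoin_le ?_
    rintro x (rfl | rfl)
    · rw [← hX]; exact hBO uB
    · have h1 : uB ∈ P.primeCompl := by
        intro h
        have h2 : ψ uB = 0 := h
        rw [huB] at h2
        rw [h2, zero_mul] at huu
        exact zero_ne_one huu
      obtain ⟨v, hv⟩ := (IsLocalization.map_units O' (⟨uB, h1⟩ : P.primeCompl)).exists_left_inv
      have h3 : (v : K) * u = 1 := by
        have := congrArg (algebraMap O' K) hv
        rw [map_mul, map_one] at this
        rw [← hX]
        exact this
      rw [show u⁻¹ = (v : K) from (eq_inv_of_mul_eq_one_left h3).symm]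
      exact v.2
  have hcl : ∀ a : IntCl ({u, u⁻¹} : Set K), (a : K) ∈ O := by
    intro a
    have h1 : IsIntegral O' (a : K) := by
      have := IsIntegral.map_of_comp_eq (Subalgebra.inclusion hAO).toRingHom (RingHom.id K)
        (RingHom.ext fun _ => rfl) a.2
      exact this
    obtain ⟨y, hy⟩ := IsIntegrallyClosed.isIntegral_iff.1 h1
    rw [← hy]
    exact y.2
  let θ : O →ₐ[ℂ] ℂ :=
    { θ' with
      commutes' := fun c => (hθ' (algebraMap ℂ B c)).trans (hψC c) }
  let f : O' →+* O :=
    { toFun := fun x => ⟨x.1, x.2⟩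
      map_one' := rfl
      map_mul' := fun _ _ => rfl
      map_zero' := rfl
      map_add' := fun _ _ => rfl }
  have hpid : IsPrincipalIdealRing O := by
    refine isPrincipalIdealRing_of_surjective (R := O') (S := O) f ?_
    intro x
    exact ⟨⟨x.1, x.2⟩, rfl⟩
  refine ⟨O, θ, hpid, inferInstanceAs (IsFractionRing O' K),
    fun a => ⟨hcl a, ?_⟩⟩
  change θ' ⟨a, hcl a⟩ = φ a
  obtain ⟨⟨b, c⟩, hbc⟩ := IsLocalization.surj P.primeCompl (⟨a, hcl a⟩ : O')
  have h1 := congrArg θ' hbc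
  rw [map_mul, hθ', hθ'] at h1
  have h2 : a * ι c = ι b := Subtype.ext (by
    have := congrArg (algebraMap O' K) hbc
    rw [map_mul] at this
    exact this)
  have h3 := congrArg φ h2
  rw [map_mul] at h3
  refine mul_right_cancel₀ (hunit c).ne_zero (h1.trans h3.symm)

end LocalRing

/-! ### Integrality of character values -/

section Integrality

theorem isIntegral_trace_matrix {A K : Type*} [CommRing A] [Field K] [Algebra A K] {m : ℕ}
    {X : Matrix (Fin m) (Fin m) K} (hX : IsIntegral A X) : IsIntegral A X.trace := by
  let k' := AlgebraicClosure K
  obtain ⟨p, hp, hpX⟩ := hX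
  have hpX' : Polynomial.aeval X p = 0 := hpX
  let Y : Matrix (Fin m) (Fin m) k' := X.map (algebraMap K k')
  have h1 : IsIntegral A Y.trace := by
    rw [Matrix.trace_eq_sum_roots_charpoly]
    refine IsIntegral.multiset_sum fun z hz => ?_
    have hz' : z ∈ spectrum k' Y := by
      rw [Matrix.mem_spectrum_iff_isRoot_charpoly]
      exact (Polynomial.mem_roots (Matrix.charpoly_monic Y).ne_zero).1 hz
    have hpY : Polynomial.aeval Y (p.map (algebraMap A k')) = 0 := by
      rw [Polynomial.aeval_map_algebraMap]
      let f : Matrix (Fin m) (Fin m) K →ₐ[A] Matrix (Fin m) (Fin m) k' :=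
        (IsScalarTower.toAlgHom A K k').mapMatrix
      have : Y = f X := rfl
      rw [this, Polynomial.aeval_algHom_apply, hpX', map_zero]
    have h := spectrum.subset_polynomial_aeval Y (p.map (algebraMap A k')) ⟨z, hz', rfl⟩
    rw [hpY, spectrum.mem_iff, sub_zero] at h
    refine ⟨p, hp, ?_⟩
    rw [← Polynomial.eval_map]
    by_contra hne
    exact h ((IsUnit.mk0 _ hne).map (algebraMap k' (Matrix (Fin m) (Fin m) k')))
  have h2 : Y.trace = algebraMap K k' X.trace := by
    simp [Y, Matrix.trace]
  rw [h2] at h1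
  exact (isIntegral_algebraMap_iff (algebraMap K k').injective).1 h1

variable {V : ClassicalType} {n d : ℕ} [GoodRank V n] [NeZero d]

theorem isIntegral_of_mem_adjoin {R B : Type*} [CommRing R] [Algebra ℂ R] [Ring B] [Algebra R B]
    {g : Gen V n d → B} (h : BaseRel g)
    (hsq : ∀ i, ∃ p ∈ torusSpan R g, ∃ q ∈ torusSpan R g, g (.xi i) ^ 2 = p + q * g (.xi i))
    {a : B} (ha : a ∈ Algebra.adjoin R (Set.range g)) : IsIntegral R a := by
  refine IsIntegral.of_mem_of_fg (Algebra.adjoin R (Set.range g)) ?_ a ha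
  have : Subalgebra.toSubmodule (Algebra.adjoin R (Set.range g)) =
      Submodule.span R (standardElements g) := by
    refine le_antisymm (fun x hx => h.adjoin_le_span hsq hx) (Submodule.span_le.2 ?_)
    rintro _ ⟨x, L, -, rfl⟩
    refine Subalgebra.mul_mem _ (Algebra.subset_adjoin ⟨_, rfl⟩) ?_
    rw [xiProd]
    refine Subalgebra.list_prod_mem _ fun y hy => ?_
    obtain ⟨i, -, rfl⟩ := List.mem_map.1 hy
    exact Algebra.subset_adjoin ⟨_, rfl⟩
  rw [this]
  exact Submodule.fg_span h.finite_standardElements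

end Integrality
end

section
variable {V : ClassicalType} {n d : ℕ} [GoodRank V n]

/-! ### Change of coefficients -/

section Coefficients

variable {R R' : Type*} [CommRing R] [Algebra ℂ R] [CommRing R'] [Algebra ℂ R']

theorem YokQuad.map_ringHom {B B' : Type*} [Ring B] [Algebra R B] [Ring B'] [Algebra R' B'] {u : R}
    {g : Gen V n d → B} (h : YokQuad u g) (f : R →+* R')
    (hf : ∀ c, f (algebraMap ℂ R c) = algebraMap ℂ R' c) (F : B →+* B')
    (hF : ∀ r, F (algebraMap R B r) = algebraMap R' B' (f r)) : YokQuad (f u) fun x => F (g x) := by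
  intro i
  rw [← map_pow, h i]
  simp only [Algebra.smul_def, map_add, map_mul, hF, idemR, map_sum, map_sub, map_one, hf]
  rfl

theorem exists_yok_lift_ringHom {B : Type*} [Ring B] [Algebra R' B] {u : R}
    {g : Gen V n d → B} (f : R →+* R') (hf : ∀ c, f (algebraMap ℂ R c) = algebraMap ℂ R' c)
    (h : BaseRel g) (hq : YokQuad (f u) g) :
    ∃ F : Yok V n d R u →+* B, (∀ x, F (yokGen V n d R u x) = g x) ∧
      ∀ r, F (algebraMap R _ r) = algebraMap R' B (f r) := by
  letI : Algebra R B := Algebra.compHom B f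
  obtain ⟨F, hF⟩ := exists_yok_lift (R := R) (u := u) h (by
    intro i
    refine (hq i).trans ?_
    simp only [idemR, ← hf]
    rw [← map_one f, ← map_sub]
    rfl)
  exact ⟨F.toRingHom, hF, fun r => F.commutes r⟩

theorem YokQuad.restrictScalars [Algebra R R'] [IsScalarTower ℂ R R'] {B : Type*} [Ring B]
    [Algebra R B] [Algebra R' B] [IsScalarTower R R' B] {u : R} {g : Gen V n d → B}
    (h : YokQuad (algebraMap R R' u) g) : YokQuad u g := by
  intro i
  rw [h i]
  simp only [idemR]
  rw [← map_one (algebraMap R R'), ← map_sub, algebraMap_smul, algebraMap_smul,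
    IsScalarTower.algebraMap_apply ℂ R R', algebraMap_smul]

theorem DefQuad.restrictScalars [Algebra R R'] {B : Type*} [Ring B]
    [Algebra R B] [Algebra R' B] [IsScalarTower R R' B] {u : R} {g : Gen V n d → B}
    (h : DefQuad (algebraMap R R' u) g) : DefQuad u g := by
  intro i
  rw [h i, ← map_one (algebraMap R R'), ← map_sub, algebraMap_smul, algebraMap_smul]

end Coefficients

/-! ### Words in the generators -/

section Words

variable {R B : Type*} [CommRing R] [Ring B] [Algebra R B] {g : Gen V n d → B}

theorem span_words (h : Algebra.adjoin R (Set.range g) = ⊤) :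
    Submodule.span R (Set.range fun w : List (Gen V n d) => (w.map g).prod) = ⊤ := by
  have h1 : (Set.range fun w : List (Gen V n d) => (w.map g).prod) =
      (Submonoid.closure (Set.range g) : Set B) := by
    ext x
    rw [SetLike.mem_coe, ← FreeMonoid.mrange_lift, MonoidHom.mem_mrange]
    constructor
    · rintro ⟨w, rfl⟩
      exact ⟨FreeMonoid.ofList w, by rw [FreeMonoid.lift_apply]; rfl⟩
    · rintro ⟨w, rfl⟩
      exact ⟨FreeMonoid.toList w, by rw [FreeMonoid.lift_apply]⟩
  rw [h1, ← Algebra.adjoin_eq_span, h]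
  rfl

theorem word_mem_adjoin (w : List (Gen V n d)) :
    (w.map g).prod ∈ Algebra.adjoin R (Set.range g) := by
  refine Subalgebra.list_prod_mem _ fun y hy => ?_
  obtain ⟨i, -, rfl⟩ := List.mem_map.1 hy
  exact Algebra.subset_adjoin ⟨_, rfl⟩

theorem map_word {M M' F : Type*} [Monoid M] [Monoid M'] [FunLike F M M'] [MonoidHomClass F M M']
    (φ : F) {X : Type*} (g : X → M) (g' : X → M') (h : ∀ x, φ (g x) = g' x) (w : List X) :
    φ (w.map g).prod = (w.map g').prod := by
  rw [map_list_prod, List.map_map]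
  congr 2
  funext x
  exact h x

variable [NeZero d]

theorem BaseRel.moduleFinite [Algebra ℂ R] (h : BaseRel g)
    (hsq : ∀ i, ∃ p ∈ torusSpan R g, ∃ q ∈ torusSpan R g, g (.xi i) ^ 2 = p + q * g (.xi i))
    (hadj : Algebra.adjoin R (Set.range g) = ⊤) : Module.Finite R B := by
  refine ⟨?_⟩
  have : (⊤ : Submodule R B) = Submodule.span R (standardElements g) := by
    refine le_antisymm (fun x _ => h.adjoin_le_span hsq ?_) le_top
    rw [hadj]; trivial
  rw [this]
  exact Submodule.fg_span h.finite_standardElements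

end Words

/-! ### Specialization of irreducible characters -/

section Specialize

variable [NeZero d] {K : Type*} [Field K] [Algebra ℂ K]

theorem mem_integralClosure_word {s : Set K} {u : K} (hu : u ∈ s) {m : ℕ}
    {g : Gen V n d → Matrix (Fin m) (Fin m) K} (h : BaseRel g) (hq : YokQuad u g)
    (w : List (Gen V n d)) : (w.map g).prod.trace ∈ integralClosure (Algebra.adjoin ℂ s) K := by
  have hq' : YokQuad (R := Algebra.adjoin ℂ s) ⟨u, Algebra.subset_adjoin hu⟩ g :=
    YokQuad.restrictScalars (R' := K) hq
  exact isIntegral_trace_matrix (isIntegral_of_mem_adjoin h hq'.exists_span (word_mem_adjoin w))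

theorem mem_integralClosure_word_def {s : Set K} {u : K} (hu : u ∈ s) {m : ℕ}
    {g : Gen V n d → Matrix (Fin m) (Fin m) K} (h : BaseRel g) (hq : DefQuad u g)
    (w : List (Gen V n d)) : (w.map g).prod.trace ∈ integralClosure (Algebra.adjoin ℂ s) K := by
  have hq' : DefQuad (R := Algebra.adjoin ℂ s) ⟨u, Algebra.subset_adjoin hu⟩ g :=
    DefQuad.restrictScalars (R' := K) hq
  refine isIntegral_trace_matrix (isIntegral_of_mem_adjoin h (fun i => ?_) (word_mem_adjoin w))
  refine ⟨_, ?_, 0, zero_mem _, by rw [hq' i, zero_mul, add_zero]⟩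
  refine add_mem (Submodule.smul_mem _ _ (Submodule.subset_span ⟨_, rfl⟩))
    (Submodule.smul_mem _ _ (Submodule.subset_span ⟨0, h.one⟩))

/-- The characters of the generic algebra specialize to irreducible characters of the semisimple
specializations. -/
theorem exists_specialization [Algebra (RatFunc ℂ) K]
    [IsScalarTower ℂ (RatFunc ℂ) K] [FiniteDimensional (RatFunc ℂ) K] [IsGalois (RatFunc ℂ) K]
    {u : K} (hu : u = algebraMap (RatFunc ℂ) K RatFunc.X)
    (φ : IntCl ({u, u⁻¹} : Set K) →ₐ[ℂ] ℂ) {c : ℂ} (hφ : SpecializesAt φ u c)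
    [IsSemisimpleRing (Yok V n d ℂ c)] {m : ℕ} (R : Yok V n d K u →ₐ[K] Matrix (Fin m) (Fin m) K)
    (hR : Function.Surjective R) :
    ∃ σ : Yok V n d ℂ c →ₐ[ℂ] Matrix (Fin m) (Fin m) ℂ, Function.Surjective σ ∧
      ∀ w : List (Gen V n d), ∃ a : IntCl ({u, u⁻¹} : Set K),
        (a : K) = (R (w.map (yokGen V n d K u)).prod).trace ∧
        φ a = (σ (w.map (yokGen V n d ℂ c)).prod).trace := by
  obtain ⟨O, θ, hpid, hfrac, hO⟩ := exists_local_ring hu φ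
  have hus : u ∈ ({u, u⁻¹} : Set K) := by simp
  have hui : u ∈ integralClosure (Algebra.adjoin ℂ ({u, u⁻¹} : Set K)) K :=
    (integralClosure _ K).algebraMap_mem
      (⟨u, Algebra.subset_adjoin hus⟩ : Algebra.adjoin ℂ ({u, u⁻¹} : Set K))
  obtain ⟨huO, hθu⟩ := hO ⟨u, hui⟩
  replace hθu : θ ⟨u, huO⟩ = c := hθu.trans (hφ _ rfl)
  let uO : O := ⟨u, huO⟩
  obtain ⟨RO, hRO, hROa⟩ := exists_yok_lift_ringHom (R := O) (u := uO) (algebraMap O K)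
    (fun _ => rfl) ((baseRel_yokGen (V := V) (n := n) (d := d) (R := K) (u := u)).map R)
    (yokQuad_yokGen.map R)
  obtain ⟨p, hp, hpa⟩ := exists_yok_lift_ringHom (R := O) (u := uO) θ.toRingHom
    (fun c => θ.commutes c) (baseRel_yokGen (V := V) (n := n) (d := d) (R := ℂ) (u := c))
    (by rw [show θ.toRingHom uO = c from hθu]; exact yokQuad_yokGen)
  have : Module.Finite O (Yok V n d O uO) := baseRel_yokGen.moduleFinite
    (yokQuad_yokGen (V := V) (n := n) (d := d)).exists_span adjoin_yokGen
  have hROw := map_word RO _ _ hRO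
  have hpw := map_word p _ _ hp
  obtain ⟨σ, hσ, htr⟩ := exists_reduction (O := O) (K := K) θ.toRingHom RO
    (fun o => by rw [hROa, Algebra.algebraMap_eq_smul_one]) (by
      rw [eq_top_iff]
      intro Y _
      obtain ⟨a, rfl⟩ := hR Y
      have : a ∈ Submodule.span K (Set.range fun w : List (Gen V n d) =>
          (w.map (yokGen V n d K u)).prod) := by rw [span_words adjoin_yokGen]; trivial
      induction this using Submodule.span_induction with
      | mem a ha =>
        obtain ⟨w, rfl⟩ := ha
        refine Submodule.subset_span ⟨(w.map (yokGen V n d O uO)).prod, ?_⟩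
        rw [hROw]
        exact (map_word R _ _ (fun _ => rfl) w).symm
      | zero => rw [map_zero]; exact zero_mem _
      | add a b _ _ ha hb => rw [map_add]; exact add_mem (ha trivial) (hb trivial)
      | smul k a _ ha => rw [map_smul]; exact Submodule.smul_mem _ _ (ha trivial)) p (by
      rw [eq_top_iff, ← span_words (R := ℂ) (adjoin_yokGen (V := V) (n := n) (d := d)), Submodule.span_le]
      rintro _ ⟨w, rfl⟩
      exact Submodule.subset_span ⟨_, hpw w⟩) (fun N f hf => by
      have hq : YokQuad (R := ℂ) (θ uO) fun x => f (yokGen V n d O uO x) :=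
        (yokQuad_yokGen (V := V) (n := n) (d := d)).map_ringHom θ.toRingHom (fun c => θ.commutes c) f
          (fun o => by rw [hf, Algebra.algebraMap_eq_smul_one])
      rw [show θ uO = c from hθu] at hq
      obtain ⟨f₀, hf₀⟩ := exists_yok_lift (baseRel_yokGen.map f) hq
      refine ⟨f₀, fun x => ?_⟩
      have : x ∈ Submodule.span O (Set.range fun w : List (Gen V n d) =>
          (w.map (yokGen V n d O uO)).prod) := by rw [span_words adjoin_yokGen]; trivial
      induction this using Submodule.span_induction with
      | mem a ha =>
        obtain ⟨w, rfl⟩ := ha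
        simp only
        rw [hpw, map_word f₀ _ _ hf₀, map_word f _ _ (fun _ => rfl)]
      | zero => simp
      | add a b _ _ ha hb => rw [map_add, map_add, map_add, ha, hb]
      | smul k a _ ha =>
        rw [Algebra.smul_def, map_mul, map_mul, map_mul, hpa, hf, ha, AlgHom.commutes,
          Algebra.algebraMap_eq_smul_one])
  refine ⟨σ, hσ, fun w => ?_⟩
  have hw : R (w.map (yokGen V n d K u)).prod = (w.map fun x => R (yokGen V n d K u x)).prod :=
    map_word R _ _ (fun _ => rfl) w
  have hint := mem_integralClosure_word hus (baseRel_yokGen.map R) (yokQuad_yokGen.map R) w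
  refine ⟨⟨_, hint⟩, by rw [hw], ?_⟩
  obtain ⟨o, ho, hθo⟩ := htr (w.map (yokGen V n d O uO)).prod
  rw [hpw] at hθo
  rw [hθo]
  obtain ⟨h1, h2⟩ := hO ⟨_, hint⟩
  rw [← h2]
  refine congrArg θ (Subtype.ext ?_)
  have : (o : K) = _ := ho
  rw [this, hROw]

end Specialize
end

section
variable {V : ClassicalType} {n d : ℕ}

/-! ### Traces and determinants of idempotents, scalars -/

section LinearAlgebra

variable {k : Type*} [Field k] {E : Type*} [AddCommGroup E] [Module k E] [FiniteDimensional k E]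

/-- The rank of an idempotent. -/
theorem exists_rank_of_idempotent {p : Module.End k E} (hp : p * p = p) :
    ∃ r : ℕ, LinearMap.trace k E p = r ∧ ∀ c : k, LinearMap.det (1 - p + c • p) = c ^ r := by
  have hP : LinearMap.IsProj (LinearMap.range p) p := LinearMap.IsIdempotentElem.isProj_range p hp
  refine ⟨Module.finrank k (LinearMap.range p), hP.trace, fun c => ?_⟩
  have h := hP.eq_conj_prodMap
  set e := (LinearMap.range p).prodEquivOfIsCompl (LinearMap.ker p) hP.isCompl
  have h2 : 1 - p + c • p = e.conj (LinearMap.prodMap (c • LinearMap.id) LinearMap.id) := by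
    have h1 : (1 : Module.End k E) = e.conj LinearMap.id := by
      rw [LinearEquiv.conj_id]; rfl
    conv_lhs => rw [h, h1]
    rw [← map_smul, ← map_sub, ← map_add]
    congr 1
    ext x <;> simp
  rw [h2, LinearEquiv.conj_apply]
  have h3 := LinearMap.det_conj (LinearMap.prodMap (c • LinearMap.id) LinearMap.id :
    (LinearMap.range p × LinearMap.ker p) →ₗ[k] _) e
  rw [← LinearMap.comp_assoc] at h3
  rw [h3, LinearMap.det_prodMap, LinearMap.det_smul, LinearMap.det_id, LinearMap.det_id, mul_one, mul_one]

theorem exists_trace_eq_int [CharZero k] {Y e : Module.End k E} (he : e * e = e) (hY : Y * Y = e)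
    (h1 : e * Y = Y) (h2 : Y * e = Y) : ∃ z : ℤ, LinearMap.trace k E Y = z := by
  obtain ⟨r, hr, -⟩ := exists_rank_of_idempotent (p := (1 / 2 : k) • (e + Y)) (by
    rw [smul_mul_smul_comm, add_mul, mul_add, mul_add, he, hY, h1, h2]
    rw [show e + Y + (Y + e) = (2 : k) • (e + Y) by rw [two_smul]; abel, smul_smul]
    norm_num)
  obtain ⟨s, hs, -⟩ := exists_rank_of_idempotent (p := (1 / 2 : k) • (e - Y)) (by
    rw [smul_mul_smul_comm, sub_mul, mul_sub, mul_sub, he, hY, h1, h2]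
    rw [show e - Y - (Y - e) = (2 : k) • (e - Y) by rw [two_smul]; abel, smul_smul]
    norm_num)
  refine ⟨r - s, ?_⟩
  have : Y = (1 / 2 : k) • (e + Y) - (1 / 2 : k) • (e - Y) := by
    rw [← smul_sub, show e + Y - (e - Y) = (2 : k) • Y by rw [two_smul]; abel, smul_smul]
    norm_num
  rw [this, map_sub, hr, hs]
  push_cast
  ring

theorem exists_scalar_of_commute_all [Nontrivial E] {x : Module.End k E} (hx : ∀ f, x * f = f * x) :
    ∃ c : k, x = c • 1 := by
  obtain ⟨w, hw⟩ := exists_ne (0 : E)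
  obtain ⟨f, hf⟩ := Module.Projective.exists_dual_eq_one k hw
  refine ⟨f (x w), LinearMap.ext fun v => ?_⟩
  have := congrArg (fun g => g w) (hx (LinearMap.smulRight f v))
  simpa [hf] using this

theorem exists_scalar_of_commute [Nontrivial E] {A : Type*} [Ring A] [Algebra k A] {ι : Type*}
    {g : ι → A} (hadj : Algebra.adjoin k (Set.range g) = ⊤) {ρ : A →ₐ[k] Module.End k E}
    (hρ : Function.Surjective ρ) {x : Module.End k E} (hx : ∀ i, ρ (g i) * x = x * ρ (g i)) :
    ∃ c : k, x = c • 1 := by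
  refine exists_scalar_of_commute_all fun f => ?_
  obtain ⟨a, rfl⟩ := hρ f
  have ha : a ∈ Algebra.adjoin k (Set.range g) := by rw [hadj]; trivial
  induction ha using Algebra.adjoin_induction with
  | mem a ha => obtain ⟨i, rfl⟩ := ha; exact (hx i).symm
  | algebraMap r => rw [AlgHom.commutes, Algebra.commutes]
  | add a b _ _ ha hb => rw [map_add, mul_add, add_mul, ha, hb]
  | mul a b _ _ ha hb => rw [map_mul, ← mul_assoc, ha, mul_assoc, hb, mul_assoc]

theorem trace_conjSum {u : SimpleIdx V n → (Module.End k E)ˣ} (x : SimpleIdx V n → Module.End k E)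
    (L : List (SimpleIdx V n)) :
    LinearMap.trace k E (conjSum u x L) = (L.map fun i => LinearMap.trace k E (x i)).sum := by
  induction L with
  | nil => simp [conjSum]
  | cons i L ih => rw [conjSum, map_add, LinearMap.trace_conj, ih, List.map_cons, List.sum_cons]

end LinearAlgebra

/-! ### Irreducible representations of the group `N` -/

section GroupN

variable [GoodRank V n] [NeZero d] {E : Type*} [AddCommGroup E] [Module ℂ E]
  {g : Gen V n d → Module.End ℂ E}

theorem idem_xi_mul_self {R B : Type*} [CommRing R] [Algebra ℂ R] [Ring B] [Algebra R B]
    {g : Gen V n d → B} (h : BaseRel g) (i : SimpleIdx V n)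
    (hsq : idemR R g i * g (.xi i) ^ 2 = idemR R g i) :
    (idemR R g i * g (.xi i)) * (idemR R g i * g (.xi i)) = idemR R g i := by
  rw [mul_assoc, ← mul_assoc (g (.xi i)), h.xi_mul_idemR, mul_assoc, ← sq, hsq, h.idemR_mul_self]

theorem exists_trace_idem_xi {k : Type*} [Field k] [CharZero k] [Algebra ℂ k] {E : Type*}
    [AddCommGroup E] [Module k E] [FiniteDimensional k E] {g : Gen V n d → Module.End k E}
    (h : BaseRel g) (i : SimpleIdx V n) (hsq : idemR k g i * g (.xi i) ^ 2 = idemR k g i) :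
    ∃ z : ℤ, LinearMap.trace k E (idemR k g i * g (.xi i)) = z :=
  exists_trace_eq_int (h.idemR_mul_self i) (idem_xi_mul_self h i hsq)
    (by rw [← mul_assoc, h.idemR_mul_self])
    (by rw [mul_assoc, h.xi_mul_idemR, ← mul_assoc, h.idemR_mul_self])

theorem conjSum_mem {u : SimpleIdx V n → (Module.End ℂ E)ˣ} {x : SimpleIdx V n → Module.End ℂ E}
    (M : Submodule ℤ E) (hx : ∀ i, ∀ w ∈ M, x i w ∈ M) (hu : ∀ i, ∀ w ∈ M, (u i : Module.End ℂ E) w ∈ M)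
    (hu' : ∀ i, ∀ w ∈ M, (↑(u i)⁻¹ : Module.End ℂ E) w ∈ M) (L : List (SimpleIdx V n)) :
    ∀ w ∈ M, conjSum u x L w ∈ M := by
  induction L with
  | nil => intro w _; simp [conjSum]
  | cons i L ih =>
    intro w hw
    rw [conjSum, LinearMap.add_apply, Module.End.mul_apply, Module.End.mul_apply]
    exact add_mem (hx i w hw) (hu i _ (ih _ (hu' i w hw)))

theorem exists_int_of_isIntegral {c : ℂ} (hc : IsIntegral ℤ c) {m : ℕ} (hm : m ≠ 0) {z : ℤ}
    (h : c * m = z) : ∃ k : ℤ, c = k := by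
  have hm' : (m : ℂ) ≠ 0 := by exact_mod_cast hm
  have h1 : c = algebraMap ℚ ℂ (z / m) := by
    rw [eq_div_of_mul_eq hm' h]
    simp
  rw [h1] at hc
  have h2 : IsIntegral ℤ ((z : ℚ) / m) := (isIntegral_algebraMap_iff (algebraMap ℚ ℂ).injective).1 hc
  obtain ⟨y, hy⟩ := IsIntegrallyClosed.isIntegral_iff.1 h2
  exact ⟨y, by rw [h1, ← hy]; simp⟩

/-- The numbers `f` and `g` on an irreducible representation of `N`. -/
theorem nRep_scalars (hd : Even d) [FiniteDimensional ℂ E] [Nontrivial E] {A : Type*} [Ring A]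
    [Algebra ℂ A] {gA : Gen V n d → A} (hA : BaseRel gA)
    (hsqA : ∀ i, gA (.xi i) ^ 2 = hNeg gA i) (hadj : Algebra.adjoin ℂ (Set.range gA) = ⊤)
    {σ : A →ₐ[ℂ] Module.End ℂ E} (hσ : Function.Surjective σ)
    {L : List (SimpleIdx V n)} (hL : IsLongestWord L) :
    ∃ (k : ℤ) (c : ℕ),
      (k : ℂ) * Module.finrank ℂ E =
        (L.map fun i => LinearMap.trace ℂ E (σ (idemR ℂ gA i * gA (.xi i)))).sum ∧
      (c : ℂ) * Module.finrank ℂ E = (L.map fun i => LinearMap.trace ℂ E (σ (negPart gA i))).sum ∧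
      σ (xiProd gA L ^ 2) = ((-1 : ℂ) ^ c) • 1 := by
  let g : Gen V n d → Module.End ℂ E := fun x => σ (gA x)
  have h : BaseRel g := hA.map σ
  have hsq : ∀ i, g (.xi i) ^ 2 = hNeg g i := fun i => by
    change σ _ ^ 2 = _
    rw [← map_pow, hsqA]; rfl
  have hun : ∀ i, IsUnit (g (.xi i)) := fun i =>
    h.isUnit (fun i => by rw [hsq]; exact h.isUnit_hNeg i) _
  choose u hu using hun
  have hbr := h.braided_units hu
  have hidem : ∀ i, σ (idemR ℂ gA i * gA (.xi i)) = idemR ℂ g i * g (.xi i) := fun i => by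
    rw [map_mul, map_idemR]
  have hneg : ∀ i, σ (negPart gA i) = negPart g i := fun i => by
    rw [negPart, map_smul, map_sub, map_one]; rfl
  have hfin : (Module.finrank ℂ E) ≠ 0 := Module.finrank_pos.ne'
  -- the scalars
  have hscal : ∀ x : SimpleIdx V n → Module.End ℂ E, ConjCompat u x →
      (∀ i y, x i * g (.t y) = g (.t y) * x i) → ∃ c : ℂ, conjSum u x L = c • 1 := by
    intro x hx hxt
    refine exists_scalar_of_commute hadj hσ fun y => ?_
    cases y with
    | t y => exact (h.conjSum_comm_t hu hxt L y).symm
    | xi i =>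
      have := hx.conjSum_comm hbr hL i
      rwa [hu] at this
  obtain ⟨a, ha⟩ := hscal _ (h.conjCompat_idem hsq hu) (fun i y => h.idemR_xi_comm_t i y)
  obtain ⟨b, hb⟩ := hscal _ (h.conjCompat_negPart hd hsq hu) (fun i y => by
    rw [negPart, mul_smul_comm, smul_mul_assoc, mul_sub, sub_mul, mul_one, one_mul, hNeg, h.t_comm])
  have htr : ∀ (x : SimpleIdx V n → Module.End ℂ E) (c : ℂ), conjSum u x L = c • 1 →
      c * Module.finrank ℂ E = (L.map fun i => LinearMap.trace ℂ E (x i)).sum := by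
    intro x c hc
    rw [← trace_conjSum (u := u), hc, map_smul, LinearMap.trace_one, smul_eq_mul]
  have htra := htr _ a ha
  have htrb := htr _ b hb
  -- a weight vector
  obtain ⟨v, hv0, hv⟩ := exists_common_eigenvector (fun x => g (.t x)) (fun x y => h.t_comm x y)
  have hvw : IsWeightVec g v := hv
  obtain ⟨c, hc1, hc2⟩ := hvw.conjSum_negPart hd h hsq hu L
  have hbc : b = c := by
    rw [hb] at hc1
    have : (b - c) • v = 0 := by rw [sub_smul, sub_eq_zero]; exact hc1
    rcases smul_eq_zero.1 this with h | h
    · exact sub_eq_zero.1 h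
    · exact absurd h hv0
  -- integrality
  let M : Submodule ℤ E := Submodule.span ℤ ((fun a : Module.End ℂ E => a v) '' standardElements g)
  have hMfg : M.FG := Submodule.fg_span (h.finite_standardElements.image _)
  have hvM : v ∈ M := Submodule.subset_span ⟨1, h.one_mem_standardElements, rfl⟩
  have hst : ∀ f : Module.End ℂ E, (∀ a ∈ standardElements g, f (a v) ∈ M) → ∀ w ∈ M, f w ∈ M := by
    intro f hf w hw
    induction hw using Submodule.span_induction with
    | mem w hw => obtain ⟨a, ha, rfl⟩ := hw; exact hf a ha
    | zero => rw [map_zero]; exact zero_mem _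
    | add x y _ _ hx hy => rw [map_add]; exact add_mem hx hy
    | smul z x _ hx => rw [map_zsmul]; exact zsmul_mem hx z
  have hgM : ∀ x, ∀ w ∈ M, g x w ∈ M := fun x => hst _ fun a ha =>
    Submodule.subset_span ⟨_, h.gen_mul_mem_standardElements hsq x ha, rfl⟩
  have hwt : ∀ a ∈ standardElements g, IsWeightVec g (a v) := by
    rintro _ ⟨x, L, -, rfl⟩
    rw [Module.End.mul_apply]
    refine IsWeightVec.t h ?_ x
    induction L with
    | nil => rw [xiProd_nil]; exact hvw
    | cons i L ih => rw [xiProd_cons, Module.End.mul_apply]; exact ih.xi h i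
  have hidM : ∀ i, ∀ w ∈ M, (idemR ℂ g i * g (.xi i)) w ∈ M := fun i => hst _ fun a ha => by
    have h1 := h.gen_mul_mem_standardElements hsq (.xi i) ha
    rw [Module.End.mul_apply, ← Module.End.mul_apply (g (.xi i))]
    rcases (hwt _ h1).idem h i with h2 | h2
    · rw [h2]; exact zero_mem _
    · rw [h2]; exact Submodule.subset_span ⟨_, h1, rfl⟩
  have hM := conjSum_mem (u := u) M hidM (fun i w hw => by rw [hu]; exact hgM _ w hw) (fun i w hw => by
    have hinv : (↑(u i)⁻¹ : Module.End ℂ E) = hNeg g i * g (.xi i) := by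
      rw [← (u i).isUnit.mul_left_inj, Units.inv_mul, mul_assoc, hu, ← sq, hsq, h.hNeg_mul_self i hd]
    rw [hinv, Module.End.mul_apply]
    exact hgM _ _ (hgM _ w hw)) L
  have haint : IsIntegral ℤ a := by
    refine isIntegral_of_smul_mem_submodule M ?_ hMfg a fun w hw => ?_
    · intro hbot
      rw [hbot] at hvM
      exact hv0 hvM
    · have := hM w hw
      rwa [ha] at this
  have hsum : ∃ z : ℤ, (L.map fun i => LinearMap.trace ℂ E (idemR ℂ g i * g (.xi i))).sum = (z : ℂ) := by
    clear hscal hL ha hb htr htra htrb hc1 hc2 hM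
    induction L with
    | nil => exact ⟨0, by simp⟩
    | cons i L ih =>
      obtain ⟨z, hz⟩ := ih
      obtain ⟨y, hy⟩ := exists_trace_idem_xi h i (by
        rw [hsq, hNeg, h.idemR_comm_t]; exact h.hNeg_mul_idemR i)
      exact ⟨y + z, by rw [List.map_cons, List.sum_cons, hy, hz]; push_cast; rfl⟩
  obtain ⟨z, hz⟩ := hsum
  obtain ⟨k, hk⟩ := exists_int_of_isIntegral haint hfin (htra.trans hz)
  refine ⟨k, c, ?_, ?_, ?_⟩
  · simp only [hidem]
    rw [← htra, hk]
  · simp only [hneg]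
    rw [← htrb, hbc]
  · have hx : σ (xiProd gA L ^ 2) = xiProd g L ^ 2 := by rw [map_pow, map_xiProd]
    rw [hx]
    obtain ⟨s, hs⟩ := exists_scalar_of_commute hadj hσ (x := xiProd g L ^ 2)
      (fun x => h.longest_sq hL x)
    rw [hs]
    rw [← h.longest_sq_eq hL, hs] at hc2
    have : (s - (-1) ^ c) • v = 0 := by rw [sub_smul, sub_eq_zero]; exact hc2
    rcases smul_eq_zero.1 this with h | h
    · rw [sub_eq_zero.1 h]
    · exact absurd h hv0

end GroupN
end

section
variable {V : ClassicalType} {n d : ℕ}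

/-! ### Determinants of the squares of the generators -/

section Determinant

variable [GoodRank V n] [NeZero d]

theorem negPart_rank {K : Type*} [Field K] [CharZero K] [Algebra ℂ K] {E : Type*} [AddCommGroup E]
    [Module K E] [FiniteDimensional K E] {g : Gen V n d → Module.End K E} (hd : Even d)
    (h : BaseRel g) (i : SimpleIdx V n) :
    ∃ c : ℕ, LinearMap.trace K E (hNeg g i) = Module.finrank K E - 2 * (c : K) ∧
      (∀ a : K, LinearMap.det (1 - (1 / 2 : K) • (1 - hNeg g i) + a • (1 / 2 : K) • (1 - hNeg g i)) =
        a ^ c) := by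
  obtain ⟨c, hc, hdet⟩ := exists_rank_of_idempotent (p := (1 / 2 : K) • (1 - hNeg g i)) (by
    rw [smul_mul_smul_comm]
    simp only [sub_mul, mul_sub, one_mul, mul_one, h.hNeg_mul_self i hd]
    rw [show 1 - hNeg g i - (hNeg g i - 1) = (2 : K) • (1 - hNeg g i) by rw [two_smul]; abel, smul_smul]
    norm_num)
  refine ⟨c, ?_, hdet⟩
  rw [← hc, map_smul, map_sub, LinearMap.trace_one, smul_eq_mul]
  ring

/-- Ranks of the eigenspaces of `ξ_i` in a representation of the Yokonuma--Hecke algebra. -/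
theorem yok_det {K : Type*} [Field K] [CharZero K] [Algebra ℂ K] {E : Type*} [AddCommGroup E]
    [Module K E] [FiniteDimensional K E] {g : Gen V n d → Module.End K E} (hd : Even d)
    {u : K} (hu : u ≠ 0) (hu1 : 1 + u ≠ 0) (h : BaseRel g) (hq : YokQuad u g) (i : SimpleIdx V n) :
    ∃ a b c : ℕ, LinearMap.trace K E (idemR K g i * g (.xi i)) = a - u * b ∧
      LinearMap.trace K E (hNeg g i) = Module.finrank K E - 2 * (c : K) ∧
      LinearMap.det (g (.xi i)) ^ 2 = u ^ ((Module.finrank K E : ℤ) - (a - b)) * (-1) ^ c := by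
  set e := idemR K g i with he
  set Y := e * g (.xi i) with hY
  set H := hNeg g i with hH
  have hee : e * e = e := h.idemR_mul_self i
  have hHe : H * e = e := h.hNeg_mul_idemR i
  have heH : e * H = e := by rw [hH, hNeg, h.idemR_comm_t]; exact hHe
  have heY : e * Y = Y := by rw [hY, ← mul_assoc, hee]
  have hYe : Y * e = Y := by rw [hY, mul_assoc, h.xi_mul_idemR, ← mul_assoc, hee]
  have hYY : Y * Y = u • e + (1 - u) • Y := by
    have : Y * Y = e * g (.xi i) ^ 2 := by
      rw [hY, mul_assoc, ← mul_assoc (g (.xi i)), h.xi_mul_idemR, sq]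
      simp only [← mul_assoc]
      rw [hee]
    rw [this, hq i, mul_add, mul_smul_comm, mul_smul_comm, heH]
    congr 2
  obtain ⟨c, hc, hcdet⟩ := negPart_rank hd h i
  have hp1 : ((1 + u)⁻¹ • (Y + u • e)) * ((1 + u)⁻¹ • (Y + u • e)) = (1 + u)⁻¹ • (Y + u • e) := by
    rw [smul_mul_smul_comm]
    have : (Y + u • e) * (Y + u • e) = (1 + u) • (Y + u • e) := by
      simp only [add_mul, mul_add, smul_mul_assoc, mul_smul_comm, hYY, hee, heY, hYe]
      module
    rw [this, smul_smul]
    congr 1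
    field_simp
  have hp2 : ((1 + u)⁻¹ • (e - Y)) * ((1 + u)⁻¹ • (e - Y)) = (1 + u)⁻¹ • (e - Y) := by
    rw [smul_mul_smul_comm]
    have : (e - Y) * (e - Y) = (1 + u) • (e - Y) := by
      simp only [sub_mul, mul_sub, hYY, hee, heY, hYe]
      module
    rw [this, smul_smul]
    congr 1
    field_simp
  set N := (1 / 2 : K) • (1 - H) with hN
  have hNN : N * N = N := by
    rw [hN, smul_mul_smul_comm]
    simp only [sub_mul, mul_sub, one_mul, mul_one, hH, h.hNeg_mul_self i hd]
    rw [← hH]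
    rw [show 1 - H - (H - 1) = (2 : K) • (1 - H) by rw [two_smul]; abel, smul_smul]
    norm_num
  have hNe : N * e = 0 := by
    rw [hN, smul_mul_assoc, sub_mul, one_mul, hHe, sub_self, smul_zero]
  have heN : e * N = 0 := by
    rw [hN, mul_smul_comm, mul_sub, mul_one, heH, sub_self, smul_zero]
  have hNY : N * Y = 0 := by rw [← heY, ← mul_assoc, hNe, zero_mul]
  have hYN : Y * N = 0 := by rw [← hYe, mul_assoc, heN, mul_zero]
  have hrr : (1 - e - N) * (1 - e - N) = 1 - e - N := by
    simp only [sub_mul, mul_sub, hNN, hee, hNe, heN, one_mul, mul_one]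
    abel
  obtain ⟨a, ha, -⟩ := exists_rank_of_idempotent hp1
  obtain ⟨b, hb, hbdet⟩ := exists_rank_of_idempotent hp2
  obtain ⟨r, hr, hrdet⟩ := exists_rank_of_idempotent hrr
  have hNtr : LinearMap.trace K E N = c := by
    rw [hN, map_smul, map_sub, LinearMap.trace_one, hc, smul_eq_mul]
    ring
  have htrY : LinearMap.trace K E Y = a - u * b := by
    rw [← ha, ← hb]
    have : Y = (1 + u)⁻¹ • (Y + u • e) - u • ((1 + u)⁻¹ • (e - Y)) := by
      rw [smul_comm u, ← smul_sub, show Y + u • e - u • (e - Y) = (1 + u) • Y by module, smul_smul,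
        inv_mul_cancel₀ hu1, one_smul]
    conv_lhs => rw [this]
    rw [map_sub, map_smul _ u, smul_eq_mul]
  have htre : LinearMap.trace K E e = a + b := by
    rw [← ha, ← hb, ← map_add, ← smul_add, show Y + u • e + (e - Y) = (1 + u) • e by module, smul_smul,
      inv_mul_cancel₀ hu1, one_smul]
  have hrank : (Module.finrank K E : ℤ) = a + b + c + r := by
    have : (Module.finrank K E : K) = a + b + c + r := by
      rw [← hr, map_sub, map_sub, LinearMap.trace_one, htre, hNtr]
      ring
    exact_mod_cast this
  refine ⟨a, b, c, htrY, hc, ?_⟩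
  have hfac : g (.xi i) ^ 2 = (1 - (1 + u)⁻¹ • (e - Y) + (u ^ 2) • ((1 + u)⁻¹ • (e - Y))) *
      ((1 - (1 - e - N) + u • (1 - e - N)) * (1 - N + (-u) • N)) := by
    rw [hq i]
    have h1 : (1 - (1 - e - N) + u • (1 - e - N)) * (1 - N + (-u) • N) =
        u • (1 : Module.End K E) + (1 - u) • e - (2 * u) • N := by
      simp only [sub_mul, mul_sub, add_mul, mul_add, smul_mul_assoc, mul_smul_comm, hNN, hee, hNe, heN,
        one_mul, mul_one, smul_zero, sub_zero]
      module
    have h2 : (1 : Module.End K E) - (1 + u)⁻¹ • (e - Y) + (u ^ 2) • ((1 + u)⁻¹ • (e - Y)) =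
        1 - (1 - u) • (e - Y) := by
      rw [smul_smul, sub_add, ← sub_smul]
      congr 2
      field_simp
      ring
    rw [h1, h2]
    have h3 : (e - Y) * N = 0 := by rw [sub_mul, heN, hYN, sub_zero]
    have h4 : (e - Y) * e = e - Y := by rw [sub_mul, hee, hYe]
    have hHN : H = 1 - (2 : K) • N := by
      rw [hN, smul_smul]; norm_num
    simp only [sub_mul, mul_sub, mul_add, smul_mul_assoc, mul_smul_comm, one_mul, mul_one, h3, h4,
      smul_zero, sub_zero]
    change u • H + (1 - u) • Y = _
    rw [hHN]
    module
  rw [← map_pow, hfac, map_mul, map_mul, hbdet, hrdet, hcdet, hrank, neg_pow u]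
  rw [show ((a : ℤ) + b + c + r - (a - b)) = ((2 * b + r + c : ℕ) : ℤ) by push_cast; ring, zpow_natCast]
  rw [pow_add, pow_add, pow_mul]
  ring

theorem isRootOfUnity_mem_range {K : Type*} [Field K] [Algebra ℂ K] {z : K} {m : ℕ} (hm : m ≠ 0)
    (hz : z ^ m = 1) : ∃ c : ℂ, algebraMap ℂ K c = z := by
  have hint : IsIntegral ℂ z := by
    refine IsIntegral.of_pow (Nat.pos_of_ne_zero hm) ?_
    rw [hz]
    exact isIntegral_one
  have := IsAlgClosed.degree_eq_one_of_irreducible ℂ (minpoly.irreducible hint)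
  exact minpoly.mem_range_of_degree_eq_one ℂ z this

end Determinant

/-! ### Specializations of characters -/

section Spec

variable {K : Type*} [Field K] [Algebra ℂ K] {s : Set K}

theorem spec_algebraMap (φ : IntCl s →ₐ[ℂ] ℂ) {a : IntCl s} {c : ℂ}
    (h : (a : K) = algebraMap ℂ K c) : φ a = c := by
  have : a = algebraMap ℂ _ c := Subtype.ext h
  rw [this, AlgHom.commutes]
  rfl

theorem spec_int (φ : IntCl s →ₐ[ℂ] ℂ) {a : IntCl s} {c : ℤ} (h : (a : K) = c) : φ a = c :=
  spec_algebraMap φ (by rw [h, map_intCast])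

theorem exists_spec_zpow {u : K} (hu : u ≠ 0) (φ : IntCl ({u, u⁻¹} : Set K) →ₐ[ℂ] ℂ) {c : ℂ}
    (hφ : SpecializesAt φ u c) (f : ℤ) :
    ∃ a : IntCl ({u, u⁻¹} : Set K), (a : K) = u ^ f ∧ φ a = c ^ f := by
  have h1 : u ∈ Algebra.adjoin ℂ ({u, u⁻¹} : Set K) := Algebra.subset_adjoin (by simp)
  have h2 : u⁻¹ ∈ Algebra.adjoin ℂ ({u, u⁻¹} : Set K) := Algebra.subset_adjoin (by simp)
  let U : (IntCl ({u, u⁻¹} : Set K))ˣ :=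
    ⟨algebraMap (Algebra.adjoin ℂ ({u, u⁻¹} : Set K)) _ ⟨u, h1⟩,
      algebraMap (Algebra.adjoin ℂ ({u, u⁻¹} : Set K)) _ ⟨u⁻¹, h2⟩,
      Subtype.ext (mul_inv_cancel₀ hu), Subtype.ext (inv_mul_cancel₀ hu)⟩
  refine ⟨(U ^ f : (IntCl ({u, u⁻¹} : Set K))ˣ), ?_, ?_⟩
  · have := (Units.coe_map (algebraMap (IntCl ({u, u⁻¹} : Set K)) K).toMonoidHom (U ^ f)).symm
    refine this.trans ?_
    rw [map_zpow, Units.val_zpow_eq_zpow_val]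
    rfl
  · have := (Units.coe_map (φ : IntCl ({u, u⁻¹} : Set K) →* ℂ) (U ^ f)).symm
    refine this.trans ?_
    rw [map_zpow, Units.val_zpow_eq_zpow_val]
    congr 1
    exact hφ _ rfl

variable {B : Type*} [Ring B] [Algebra K B] {g : Gen V n d → B} {χ : B →ₗ[K] K}
  {B₀ : Type*} [Ring B₀] [Algebra ℂ B₀] {g₀ : Gen V n d → B₀} {χ₀ : B₀ →ₗ[ℂ] ℂ}
  {φ : IntCl s →ₐ[ℂ] ℂ}

theorem IsSpecialization.one (h : IsSpecialization φ g χ g₀ χ₀) :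
    ∃ a : IntCl s, (a : K) = χ 1 ∧ φ a = χ₀ 1 := by
  simpa using h []

theorem IsSpecialization.hNeg (h : IsSpecialization φ g χ g₀ χ₀) (i : SimpleIdx V n) :
    ∃ a : IntCl s, (a : K) = χ (YH.hNeg g i) ∧ φ a = χ₀ (YH.hNeg g₀ i) := by
  simpa [YH.hNeg] using h [.t ((d / 2) • corootTorus d i)]

theorem IsSpecialization.idem_xi (h : IsSpecialization φ g χ g₀ χ₀) (i : SimpleIdx V n) :
    ∃ a : IntCl s, (a : K) = χ (idemR K g i * g (.xi i)) ∧
      φ a = χ₀ (idemR ℂ g₀ i * g₀ (.xi i)) := by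
  choose a ha ha' using fun j : ℕ => h [.t (j • corootTorus d i), .xi i]
  refine ⟨algebraMap ℂ _ (1 / (d : ℂ)) * ∑ j ∈ Finset.Icc 1 d, a j, ?_, ?_⟩
  · simp only [idemR, smul_mul_assoc, map_smul, Finset.sum_mul, map_sum, smul_eq_mul]
    rw [MulMemClass.coe_mul, AddSubmonoidClass.coe_finset_sum]
    refine congrArg₂ (· * ·) rfl (Finset.sum_congr rfl fun j _ => ?_)
    simpa using ha j
  · simp only [idemR, smul_mul_assoc, map_smul, Finset.sum_mul, map_sum, smul_eq_mul, map_mul,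
      AlgHom.commutes]
    refine congrArg₂ (· * ·) rfl (Finset.sum_congr rfl fun j _ => ?_)
    simpa using ha' j

theorem IsSpecialization.xiProd_sq (h : IsSpecialization φ g χ g₀ χ₀) (L : List (SimpleIdx V n)) :
    ∃ a : IntCl s, (a : K) = χ (xiProd g L ^ 2) ∧ φ a = χ₀ (xiProd g₀ L ^ 2) := by
  have := h ((L ++ L).map .xi)
  simp only [List.map_map, List.map_append, List.prod_append] at this
  simpa only [sq, xiProd, Function.comp_def] using this

end Spec
end

section
variable {V : ClassicalType} {n d : ℕ}

section Scalar

variable [GoodRank V n] [NeZero d]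

theorem surjective_rep_of_isSplit {K : Type*} [Field K] {A : Type*} [Ring A] [Algebra K A]
    (hA : IsSplit K A) {E : Type*} [AddCommGroup E] [Module K E] [FiniteDimensional K E]
    {ρ : A →ₐ[K] Module.End K E} (hρ : IsIrreducible ρ) : Function.Surjective ρ := by
  let b := Module.finBasis K E
  have h := surjective_of_isSplit hA (matrixRep b ρ) (isIrreducible_vecRep_matrixRep b hρ)
  intro f
  obtain ⟨a, ha⟩ := h (LinearMap.toMatrixAlgEquiv b f)
  exact ⟨a, (LinearMap.toMatrixAlgEquiv b).injective ha⟩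

theorem character_apply {k A E : Type*} [Field k] [Ring A] [Algebra k A] [AddCommGroup E]
    [Module k E] (ρ : A →ₐ[k] Module.End k E) (a : A) :
    character ρ a = LinearMap.trace k E (ρ a) := rfl

theorem det_xiProd {K : Type*} [Field K] {E : Type*} [AddCommGroup E] [Module K E]
    (g : Gen V n d → Module.End K E) (L : List (SimpleIdx V n)) :
    LinearMap.det (xiProd g L ^ 2) = (L.map fun i => LinearMap.det (g (.xi i)) ^ 2).prod := by
  rw [map_pow]
  induction L with
  | nil => simp [xiProd_nil]
  | cons i L ih => rw [xiProd_cons, map_mul, mul_pow, ih, List.map_cons, List.prod_cons]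

theorem prod_zpow_neg_one {ι K : Type*} [Field K] {u : K} (hu : u ≠ 0) (f : ι → ℤ) (c : ι → ℕ)
    (L : List ι) : (L.map fun i => u ^ f i * (-1) ^ c i).prod =
      u ^ (L.map f).sum * (-1) ^ (L.map c).sum := by
  induction L with
  | nil => simp
  | cons i L ih =>
    simp only [List.map_cons, List.prod_cons, List.sum_cons, ih, zpow_add₀ hu, pow_add]
    ring

/-- `T_0²` acts as the scalar `u^f (-1)^g`. -/
theorem longest_sq_scalar (hd : Even d) {K : Type*} [Field K] [Algebra ℂ K] {u : K}
    (hu0 : u ≠ 0) (hu1 : 1 + u ≠ 0) (hY : IsSplit K (Yok V n d K u))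
    {L : List (SimpleIdx V n)} (hL : IsLongestWord L)
    {φ₁ : IntCl ({u, u⁻¹} : Set K) →ₐ[ℂ] ℂ} (hφ₁ : SpecializesAt φ₁ u 1)
    {τ₁ τ₀ : IntCl ({u} : Set K) →ₐ[ℂ] ℂ}
    {E : Type*} [AddCommGroup E] [Module K E] [FiniteDimensional K E]
    {ρ : Yok V n d K u →ₐ[K] Module.End K E} (hρ : IsIrreducible ρ)
    {χ' : Def V n d K u →ₗ[K] K} {χ₁ : MonoidAlgebra ℂ (NGroup V n d) →ₗ[ℂ] ℂ}
    {χ₀ : MonoidAlgebra ℂ (SGroup V n d) →ₗ[ℂ] ℂ}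
    (hass : IsAssociated u φ₁ τ₁ τ₀ (character ρ) χ' χ₁ χ₀) :
    ∃ f g : ℤ, (f : ℂ) = fSum L χ₀ ∧ (g : ℂ) = gSum L χ₀ ∧
      ρ (xiProd (yokGen V n d K u) L ^ 2) = (u ^ f * (-1) ^ g) • 1 := by
  have : CharZero K := charZero_of_injective_algebraMap (algebraMap ℂ K).injective
  obtain ⟨m', ρ', hρ', rfl⟩ := hass.irr'
  obtain ⟨m₁, σ₁, hσ₁, rfl⟩ := hass.irr₁
  have hsurj := surjective_rep_of_isSplit hY hρ
  have := hρ.1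
  have := hσ₁.1
  set m := Module.finrank K E with hm
  have hm0 : m ≠ 0 := Module.finrank_pos.ne'
  have hmC : (m : ℂ) ≠ 0 := by exact_mod_cast hm0
  -- degrees
  have hm₁ : (Module.finrank ℂ (Fin m₁ → ℂ) : ℂ) = m := by
    obtain ⟨a, ha, ha'⟩ := hass.spec_phi₁.one
    rw [character_apply, map_one, LinearMap.trace_one] at ha ha'
    rw [← ha']
    exact spec_algebraMap φ₁ (by rw [ha, map_natCast])
  have hχ₀ : χ₀ 1 = m := by
    obtain ⟨a, ha, ha'⟩ := hass.spec_tau₁.one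
    obtain ⟨b, hb, hb'⟩ := hass.spec_tau₀.one
    rw [character_apply, map_one, LinearMap.trace_one] at ha ha' hb
    rw [hm₁] at ha'
    have h1 := spec_algebraMap τ₁ (c := (Module.finrank K (Fin m' → K) : ℂ)) (by rw [ha, map_natCast])
    have h2 := spec_algebraMap τ₀ (c := (Module.finrank K (Fin m' → K) : ℂ)) (by rw [hb, map_natCast])
    rw [← hb', h2, ← h1, ha']
  -- values on the elements `e_i ξ_i` and `h_i(-1)`
  have hbY : BaseRel fun x => ρ (yokGen V n d K u x) := baseRel_yokGen.map ρ
  have hqY : YokQuad u fun x => ρ (yokGen V n d K u x) := yokQuad_yokGen.map ρ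
  choose a b c hab hc hdet using fun i => yok_det hd hu0 hu1 hbY hqY i
  have hbD : BaseRel fun x => ρ' (defGen V n d K u x) := baseRel_defGen.map ρ'
  have hqD : DefQuad u fun x => ρ' (defGen V n d K u x) := defQuad_defGen.map ρ'
  have hz : ∀ i, ∃ z : ℤ, character ρ' (idemR K (defGen V n d K u) i * defGen V n d K u (.xi i)) = z := by
    intro i
    rw [character_apply, map_mul, map_idemR]
    refine exists_trace_idem_xi hbD i ?_
    rw [hqD i, mul_add, mul_smul_comm, mul_smul_comm, mul_one, hNeg, hbD.idemR_comm_t]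
    have := hbD.hNeg_mul_idemR (R := K) i
    rw [hNeg] at this
    rw [this, ← add_smul, add_sub_cancel, one_smul]
  have hw : ∀ i, ∃ w : ℤ, character ρ' (hNeg (defGen V n d K u) i) = w := by
    intro i
    rw [character_apply]
    have := hbD.hNeg_mul_self i hd
    exact exists_trace_eq_int (e := 1) (one_mul 1) this (one_mul _) (mul_one _)
  choose z hz using hz
  choose w hw using hw
  have hz₁ : ∀ i, character σ₁ (idemR ℂ (nGen V n d) i * nGen V n d (.xi i)) = z i := by
    intro i
    obtain ⟨x, hx, hx'⟩ := hass.spec_tau₁.idem_xi i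
    rw [← hx']; exact spec_int τ₁ (by rw [hx, hz])
  have hz₀ : ∀ i, χ₀ (idemR ℂ (sGen V n d) i * sGen V n d (.xi i)) = z i := by
    intro i
    obtain ⟨x, hx, hx'⟩ := hass.spec_tau₀.idem_xi i
    rw [← hx']; exact spec_int τ₀ (by rw [hx, hz])
  have hw₁ : ∀ i, character σ₁ (hNeg (nGen V n d) i) = w i := by
    intro i
    obtain ⟨x, hx, hx'⟩ := hass.spec_tau₁.hNeg i
    rw [← hx']; exact spec_int τ₁ (by rw [hx, hw])
  have hw₀ : ∀ i, χ₀ (hNeg (sGen V n d) i) = w i := by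
    intro i
    obtain ⟨x, hx, hx'⟩ := hass.spec_tau₀.hNeg i
    rw [← hx']; exact spec_int τ₀ (by rw [hx, hw])
  have hza : ∀ i, z i = (a i : ℤ) - b i := by
    intro i
    obtain ⟨x, hx, hx'⟩ := hass.spec_phi₁.idem_xi i
    rw [hz₁] at hx'
    rw [character_apply, map_mul, map_idemR, hab] at hx
    obtain ⟨y, hy, hy'⟩ := exists_spec_zpow hu0 φ₁ hφ₁ 1
    rw [zpow_one] at hy hy'
    have : x = algebraMap ℂ _ (a i : ℂ) - y * algebraMap ℂ _ (b i : ℂ) := by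
      refine Subtype.ext ?_
      rw [hx, AddSubgroupClass.coe_sub, MulMemClass.coe_mul, hy]
      change _ = algebraMap ℂ K (a i) - u * algebraMap ℂ K (b i)
      rw [map_natCast, map_natCast]
    rw [this, map_sub, map_mul, AlgHom.commutes, AlgHom.commutes, hy', one_mul] at hx'
    have h2 : ((a i : ℂ) - b i) = z i := hx'
    exact_mod_cast h2.symm
  have hwc : ∀ i, w i = (m : ℤ) - 2 * c i := by
    intro i
    obtain ⟨x, hx, hx'⟩ := hass.spec_phi₁.hNeg i
    rw [hw₁] at hx'
    rw [character_apply] at hx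
    have h1 := spec_algebraMap φ₁ (a := x) (c := (m : ℂ) - 2 * (c i : ℂ)) (by
      rw [hx, map_sub, map_mul, map_natCast, map_natCast, map_ofNat]
      exact hc i)
    rw [hx'] at h1
    exact_mod_cast h1
  -- the sums
  obtain ⟨k, γ, hk, hγ, hsc⟩ := nRep_scalars hd (baseRel_nGen (V := V) (n := n) (d := d)) nGen_sq
    adjoin_nGen hσ₁.surjective_of_isAlgClosed hL
  rw [hm₁] at hk hγ
  have hk' : k * m = (L.map z).sum := by
    have : (L.map fun i => LinearMap.trace ℂ _ (σ₁ (idemR ℂ (nGen V n d) i * nGen V n d (.xi i)))) =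
        L.map fun i => (z i : ℂ) := List.map_congr_left fun i _ => hz₁ i
    rw [this] at hk
    have h2 : (L.map fun i => (z i : ℂ)).sum = ((L.map z).sum : ℤ) := by
      simp [List.map_map, Function.comp_def]
    rw [h2] at hk
    exact_mod_cast hk
  have hγ' : γ * m = (L.map c).sum := by
    have : (L.map fun i => LinearMap.trace ℂ _ (σ₁ (negPart (nGen V n d) i))) =
        L.map fun i => (c i : ℂ) := List.map_congr_left fun i _ => by
      have h1 := hw₁ i
      rw [character_apply, hwc] at h1
      rw [negPart, map_smul, map_sub, map_smul, map_sub, map_one, LinearMap.trace_one, h1, hm₁]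
      push_cast
      rw [smul_eq_mul]
      ring
    rw [this] at hγ
    have h2 : (L.map fun i => (c i : ℂ)).sum = ((L.map c).sum : ℕ) := by
      simp [List.map_map, Function.comp_def]
    rw [h2] at hγ
    exact_mod_cast hγ
  refine ⟨L.length - k, γ, ?_, ?_, ?_⟩
  · have h1 : ∀ i, 1 - χ₀ (idem (sGen V n d) i * sGen V n d (.xi i)) / χ₀ 1 = 1 - (z i : ℂ) / m := by
      intro i
      rw [idem_eq_idemR (R := ℂ), hz₀, hχ₀]
    simp only [fSum, h1]
    have h2 : ∀ L : List (SimpleIdx V n), (L.map fun i => 1 - (z i : ℂ) / m).sum =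
        L.length - ((L.map z).sum : ℤ) / m := by
      intro L
      induction L with
      | nil => simp
      | cons i L ih =>
        rw [List.map_cons, List.sum_cons, ih, List.map_cons, List.sum_cons, List.length_cons]
        push_cast
        ring
    rw [h2, ← hk']
    push_cast
    field_simp
  · have h1 : ∀ i, (χ₀ 1 - χ₀ (hNeg (sGen V n d) i)) / (2 * χ₀ 1) = (c i : ℂ) / m := by
      intro i
      rw [hw₀, hχ₀, hwc]
      push_cast
      field_simp
      ring
    simp only [gSum, h1]
    have h2 : ∀ L : List (SimpleIdx V n), (L.map fun i => (c i : ℂ) / m).sum =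
        ((L.map c).sum : ℕ) / m := by
      intro L
      induction L with
      | nil => simp
      | cons i L ih =>
        rw [List.map_cons, List.sum_cons, ih, List.map_cons, List.sum_cons]
        push_cast
        ring
    rw [h2, ← hγ']
    push_cast
    field_simp
  -- the scalar
  set g' : Gen V n d → Module.End K E := fun x => ρ (yokGen V n d K u x) with hg'
  have hx : ρ (xiProd (yokGen V n d K u) L ^ 2) = xiProd g' L ^ 2 := by rw [map_pow, map_xiProd]
  obtain ⟨y, hy⟩ := exists_scalar_of_commute adjoin_yokGen hsurj (x := xiProd g' L ^ 2)
    (fun x => hbY.longest_sq hL x)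
  have hdet' := det_xiProd g' L
  have hz' : L.map (fun i => (m : ℤ) - ((a i : ℤ) - b i)) = L.map fun i => m - z i := by
    refine List.map_congr_left fun i _ => ?_
    rw [hza]
  have hsum : (L.map fun i => (m : ℤ) - z i).sum = (L.length - k) * m := by
    have h2 : ∀ L : List (SimpleIdx V n), (L.map fun i => (m : ℤ) - z i).sum =
        L.length * m - (L.map z).sum := by
      intro L
      induction L with
      | nil => simp
      | cons i L ih =>
        rw [List.map_cons, List.sum_cons, ih, List.map_cons, List.sum_cons, List.length_cons]
        push_cast
        ring
    rw [h2, ← hk']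
    ring
  have hdet₀ : ∀ i, LinearMap.det (g' (.xi i)) ^ 2 = u ^ ((m : ℤ) - ((a i : ℤ) - b i)) * (-1) ^ c i :=
    hdet
  rw [List.map_congr_left fun i _ => hdet₀ i] at hdet'
  rw [prod_zpow_neg_one hu0, hz', hsum, ← hγ', hy, LinearMap.det_smul, map_one, mul_one, _root_.zpow_mul, pow_mul,
    zpow_natCast, ← mul_pow] at hdet'
  set q := u ^ ((L.length : ℤ) - k) * (-1) ^ γ with hq
  have hq0 : q ≠ 0 := mul_ne_zero (zpow_ne_zero _ hu0) (pow_ne_zero _ (by norm_num))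
  obtain ⟨ζ, hζ⟩ := isRootOfUnity_mem_range (z := y / q) hm0 (by
    rw [div_pow, hdet', div_self (pow_ne_zero _ hq0)])
  have hyq : y = algebraMap ℂ K ζ * q := by rw [hζ, div_mul_cancel₀ _ hq0]
  -- the root of unity is trivial
  obtain ⟨x, hx1, hx2⟩ := hass.spec_phi₁.xiProd_sq L
  rw [character_apply, hx, hy, map_smul, LinearMap.trace_one, smul_eq_mul, hyq] at hx1
  rw [character_apply, hsc, map_smul, LinearMap.trace_one, hm₁, smul_eq_mul] at hx2
  obtain ⟨v, hv, hv'⟩ := exists_spec_zpow hu0 φ₁ hφ₁ (L.length - k)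
  have hxv : x = algebraMap ℂ _ (ζ * (-1) ^ γ * m) * v := by
    refine Subtype.ext ?_
    rw [hx1, MulMemClass.coe_mul, hv, hq]
    change _ = algebraMap ℂ K (ζ * (-1) ^ γ * m) * _
    rw [map_mul, map_mul, map_natCast, map_pow, map_neg, map_one, hm]
    ring
  rw [hxv, map_mul, AlgHom.commutes, hv', _root_.one_zpow, mul_one] at hx2
  have hx3 : ζ * (-1) ^ γ * m = (-1) ^ γ * m := hx2
  have hζ1 : ζ = 1 := by
    have h0 : ((-1 : ℂ)) ^ γ * m ≠ 0 := mul_ne_zero (pow_ne_zero _ (by norm_num)) hmC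
    rw [mul_assoc] at hx3
    exact mul_right_cancel₀ h0 (by rw [hx3, one_mul])
  rw [hx, hy, hyq, hζ1, map_one, one_mul, hq, zpow_natCast]

end Scalar

/-! ### Existence of `χ₁` -/

section ExistsN

variable [GoodRank V n] [NeZero d]

theorem exists_surjective_yok_one : ∃ f : MonoidAlgebra ℂ (NGroup V n d) →ₐ[ℂ] Yok V n d ℂ 1,
    (∀ x, f (nGen V n d x) = yokGen V n d ℂ 1 x) ∧ Function.Surjective f := by
  obtain ⟨f, hf⟩ := exists_nGroup_lift (baseRel_yokGen (V := V) (n := n) (d := d) (R := ℂ) (u := 1))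
    (fun i => by
      have := yokQuad_yokGen (V := V) (n := n) (d := d) (R := ℂ) (u := 1) i
      rw [this, sub_self, zero_smul, one_smul, add_zero])
  refine ⟨f, hf, (AlgHom.range_eq_top f).1 ?_⟩
  rw [eq_top_iff, ← adjoin_yokGen, Algebra.adjoin_le_iff]
  rintro _ ⟨x, rfl⟩
  exact ⟨_, hf x⟩

theorem isSemisimpleRing_yok_one : IsSemisimpleRing (Yok V n d ℂ 1) := by
  obtain ⟨f, -, hf⟩ := exists_surjective_yok_one (V := V) (n := n) (d := d)
  have : IsSemisimpleRing (MonoidAlgebra ℂ (NGroup V n d)) := inferInstance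
  exact RingHom.isSemisimpleRing_of_surjective f.toRingHom hf

/-- The character of `N` obtained by specialization at `u = 1`. -/
theorem exists_nGroup_rep {K : Type*} [Field K] [Algebra ℂ K] [Algebra (RatFunc ℂ) K]
    [IsScalarTower ℂ (RatFunc ℂ) K] [FiniteDimensional (RatFunc ℂ) K] [IsGalois (RatFunc ℂ) K]
    {u : K} (hu : u = algebraMap (RatFunc ℂ) K RatFunc.X)
    {φ₁ : IntCl ({u, u⁻¹} : Set K) →ₐ[ℂ] ℂ} (hφ₁ : SpecializesAt φ₁ u 1)
    (hY : IsSplit K (Yok V n d K u)) {E : Type*} [AddCommGroup E] [Module K E] [FiniteDimensional K E]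
    {ρ : Yok V n d K u →ₐ[K] Module.End K E} (hρ : IsIrreducible ρ) :
    ∃ (m : ℕ) (σ : MonoidAlgebra ℂ (NGroup V n d) →ₐ[ℂ] Matrix (Fin m) (Fin m) ℂ),
      0 < m ∧ Function.Surjective σ ∧
      IsSpecialization φ₁ (yokGen V n d K u) (character ρ) (nGen V n d) (character (vecRep σ)) := by
  have := isSemisimpleRing_yok_one (V := V) (n := n) (d := d)
  let b := Module.finBasis K E
  have := hρ.1
  have hR := surjective_of_isSplit hY (matrixRep b ρ) (isIrreducible_vecRep_matrixRep b hρ)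
  obtain ⟨σ, hσ, htr⟩ := exists_specialization hu φ₁ hφ₁ (matrixRep b ρ) hR
  obtain ⟨f, hf, hfs⟩ := exists_surjective_yok_one (V := V) (n := n) (d := d)
  refine ⟨_, σ.comp f, Module.finrank_pos (R := K) (M := E), hσ.comp hfs, fun w => ?_⟩
  obtain ⟨a, ha, ha'⟩ := htr w
  refine ⟨a, by rw [ha, trace_matrixRep], ?_⟩
  rw [ha', character_vecRep, AlgHom.comp_apply, map_word f _ _ hf]

end ExistsN
end

section
variable {V : ClassicalType} {n d : ℕ} [GoodRank V n]

/-! ### Extension of specializations -/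

theorem exists_algHom_extension {A A' : Type*} [CommRing A] [CommRing A'] [Algebra ℂ A]
    [Algebra ℂ A'] [Algebra A A'] [IsScalarTower ℂ A A'] [Algebra.IsIntegral A A']
    (hinj : Function.Injective (algebraMap A A')) (τ : A →ₐ[ℂ] ℂ) :
    ∃ τ' : A' →ₐ[ℂ] ℂ, ∀ a, τ' (algebraMap A A' a) = τ a := by
  have hτs : Function.Surjective τ := fun c => ⟨algebraMap ℂ A c, by rw [AlgHom.commutes]; rfl⟩
  have : (RingHom.ker τ.toRingHom).IsMaximal := RingHom.ker_isMaximal_of_surjective _ hτs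
  obtain ⟨Q, hQ, hQ'⟩ := Ideal.exists_ideal_over_maximal_of_isIntegral (S := A')
    (RingHom.ker τ.toRingHom) (by
      rw [(RingHom.injective_iff_ker_eq_bot _).1 hinj]
      exact bot_le)
  letI : Field (A' ⧸ Q) := Ideal.Quotient.field Q
  have hmem : ∀ a : A, algebraMap A A' a ∈ Q ↔ τ a = 0 := by
    intro a
    rw [← Ideal.mem_comap, hQ']
    rfl
  have hkey : ∀ a : A, Ideal.Quotient.mk Q (algebraMap A A' a) = algebraMap ℂ (A' ⧸ Q) (τ a) := by
    intro a
    have h1 : algebraMap A A' (a - algebraMap ℂ A (τ a)) ∈ Q := by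
      rw [hmem, map_sub, AlgHom.commutes]
      exact sub_self _
    rw [map_sub, ← Ideal.Quotient.eq, ← IsScalarTower.algebraMap_apply] at h1
    rw [h1]
    rfl
  have : Algebra.IsIntegral ℂ (A' ⧸ Q) := by
    refine ⟨fun y => ?_⟩
    obtain ⟨x, rfl⟩ := Ideal.Quotient.mk_surjective y
    obtain ⟨p, hp, hpx⟩ := Algebra.IsIntegral.isIntegral (R := A) x
    refine ⟨p.map τ.toRingHom, hp.map _, ?_⟩
    rw [Polynomial.eval₂_map]
    have h2 : (algebraMap ℂ (A' ⧸ Q)).comp τ.toRingHom =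
        (Ideal.Quotient.mk Q).comp (algebraMap A A') := RingHom.ext fun a => (hkey a).symm
    rw [h2, ← Polynomial.hom_eval₂, hpx, map_zero]
  have hbij := IsAlgClosed.algebraMap_bijective_of_isIntegral (k := ℂ) (K := A' ⧸ Q)
  let e : ℂ ≃ₐ[ℂ] (A' ⧸ Q) := AlgEquiv.ofBijective (Algebra.ofId ℂ _) hbij
  refine ⟨e.symm.toAlgHom.comp (Ideal.Quotient.mkₐ ℂ Q), fun a => ?_⟩
  have h3 : (Ideal.Quotient.mkₐ ℂ Q) (algebraMap A A' a) = e (τ a) := hkey a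
  change e.symm ((Ideal.Quotient.mkₐ ℂ Q) (algebraMap A A' a)) = τ a
  rw [h3, AlgEquiv.symm_apply_apply]

/-! ### The deformation of a representation of `N` -/

section Twist

variable {R : Type*} [CommRing R] [Algebra ℂ R] {B : Type*} [Ring B] [Algebra R B]

/-- Multiplication by `1` where `h = 1`, and by `α` where `h = -1`. -/
def twistFactor (α : R) (h : B) : B :=
  (algebraMap ℂ R (1 / 2) * (1 + α)) • (1 : B) + (algebraMap ℂ R (1 / 2) * (1 - α)) • h

/-- The generators `ξ_i` multiplied by `α` where `h_i(-1) = -1`. -/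
def twist (α : R) (g : Gen V n d → B) : Gen V n d → B
  | .t x => g (.t x)
  | .xi i => g (.xi i) * twistFactor α (hNeg g i)

theorem mul_twistFactor (α : R) {x h h' : B} (e : x * h = h' * x) :
    x * twistFactor α h = twistFactor α h' * x := by
  simp only [twistFactor, mul_add, add_mul, mul_smul_comm, smul_mul_assoc, mul_one, one_mul, e]

theorem half_add_half : algebraMap ℂ R (1 / 2) + algebraMap ℂ R (1 / 2) = 1 := by
  rw [← map_add, ← map_one (algebraMap ℂ R)]
  norm_num

theorem twistFactor_mul (α β : R) {h : B} (hh : h * h = 1) :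
    twistFactor α h * twistFactor β h = twistFactor (α * β) h := by
  have hmul : ∀ p q p' q' : R, (p • (1 : B) + q • h) * (p' • (1 : B) + q' • h) =
      (p * p' + q * q') • (1 : B) + (p * q' + q * p') • h := by
    intro p q p' q'
    have h1 : (q • h) * (q' • h) = (q * q') • (1 : B) := by rw [smul_mul_smul_comm, hh]
    rw [add_mul, mul_add, mul_add, h1, smul_mul_smul_comm, smul_mul_smul_comm, smul_mul_smul_comm,
      one_mul, one_mul, mul_one, add_smul, add_smul]
    abel
  have hc : (algebraMap ℂ R (1 / 2)) * 2 = 1 := by rw [mul_two, half_add_half]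
  rw [twistFactor, twistFactor, twistFactor, hmul]
  congr 2
  · linear_combination (algebraMap ℂ R (1 / 2) * (1 + α * β)) * hc
  · linear_combination (algebraMap ℂ R (1 / 2) * (1 - α * β)) * hc

theorem twistFactor_one (h : B) : twistFactor (1 : R) h = 1 := by
  rw [twistFactor, sub_self, mul_zero, zero_smul, add_zero, mul_add, mul_one, half_add_half,
    one_smul]

variable {g : Gen V n d → B}

theorem hNeg_twist (α : R) (i : SimpleIdx V n) : hNeg (twist α g) i = hNeg g i := rfl

theorem reflectTorus_half (hd : Even d) (i j : SimpleIdx V n) :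
    reflectTorus j ((d / 2) • corootTorus d i) =
      (d / 2) • corootTorus d i - (j.root ⬝ᵥ i.coroot) • (d / 2) • corootTorus d j := by
  rw [reflectTorus_nsmul, reflectTorus, nsmul_sub, smul_comm (j.root ⬝ᵥ i.coroot)]
  congr 2
  have : (∑ k, ((j.root k : ℤ) : ZMod d) * (corootTorus d i).1 k) =
      ((j.root ⬝ᵥ i.coroot : ℤ) : ZMod d) := by
    simp [corootTorus, dotProduct]
  rw [this]
  exact Int.cast_smul_eq_zsmul (ZMod d) (j.root ⬝ᵥ i.coroot) (corootTorus d j)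

theorem two_zsmul_half (hd : Even d) (k : ℤ) (x : torus V n d) :
    (2 * k) • (d / 2) • x = 0 := by
  rw [mul_comm, mul_smul, ← Nat.cast_ofNat, natCast_zsmul, ← mul_nsmul',
    Nat.mul_div_cancel' hd.two_dvd, torus_nsmul_d, smul_zero]

theorem BaseRel.xi_mul_hNeg_of_even (h : BaseRel g) (hd : Even d)
    {i j : SimpleIdx V n} {k : ℤ} (hk : j.root ⬝ᵥ i.coroot = 2 * k) :
    g (.xi j) * hNeg g i = hNeg g i * g (.xi j) := by
  rw [hNeg, h.conj, reflectTorus_half hd, hk, two_zsmul_half hd, sub_zero]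

theorem BaseRel.xi_mul_hNeg_of_odd (h : BaseRel g) (hd : Even d)
    {i j : SimpleIdx V n} (hk : j.root ⬝ᵥ i.coroot = -1) :
    g (.xi j) * hNeg g i = hNeg g i * hNeg g j * g (.xi j) := by
  rw [hNeg, h.conj, reflectTorus_half hd, hk, hNeg, ← h.mul, neg_smul, one_smul, sub_neg_eq_add]

theorem BaseRel.hNeg_comm (h : BaseRel g) (i j : SimpleIdx V n) :
    hNeg g i * hNeg g j = hNeg g j * hNeg g i := by
  rw [hNeg, hNeg, ← h.mul, add_comm, h.mul]

theorem BaseRel.twist (h : BaseRel g) (hd : Even d) (α : R) :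
    BaseRel (twist α g) where
  one := h.one
  mul := h.mul
  conj i x := by
    have h1 : twistFactor α (hNeg g i) * g (.t x) = g (.t x) * twistFactor α (hNeg g i) :=
      (mul_twistFactor α (by rw [hNeg, ← h.mul, add_comm, h.mul])).symm
    change g (.xi i) * twistFactor α (hNeg g i) * g (.t x) =
      g (.t _) * (g (.xi i) * twistFactor α (hNeg g i))
    rw [mul_assoc, h1, ← mul_assoc, h.conj, mul_assoc]
  braid := by
    have hAA : ∀ i j, twistFactor α (hNeg g i) * twistFactor α (hNeg g j) =
        twistFactor α (hNeg g j) * twistFactor α (hNeg g i) := fun i j =>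
      mul_twistFactor α (mul_twistFactor α (h.hNeg_comm j i)).symm
    have hAC : ∀ i j k, twistFactor α (hNeg g i) * twistFactor α (hNeg g j * hNeg g k) =
        twistFactor α (hNeg g j * hNeg g k) * twistFactor α (hNeg g i) := fun i j k =>
      mul_twistFactor α (mul_twistFactor α (by
        rw [mul_assoc, h.hNeg_comm k i, ← mul_assoc, h.hNeg_comm j i, mul_assoc])).symm
    have hself : ∀ i, g (.xi i) * twistFactor α (hNeg g i) =
        twistFactor α (hNeg g i) * g (.xi i) := fun i => mul_twistFactor α (h.xi_mul_hNeg i hd)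
    have heven : ∀ i j (k : ℤ), j.root ⬝ᵥ i.coroot = 2 * k →
        g (.xi j) * twistFactor α (hNeg g i) = twistFactor α (hNeg g i) * g (.xi j) :=
      fun i j k hk => mul_twistFactor α (h.xi_mul_hNeg_of_even hd hk)
    have hodd : ∀ i j, j.root ⬝ᵥ i.coroot = -1 →
        g (.xi j) * twistFactor α (hNeg g i) =
          twistFactor α (hNeg g i * hNeg g j) * g (.xi j) :=
      fun i j hk => mul_twistFactor α (h.xi_mul_hNeg_of_odd hd hk)
    have hodd' : ∀ i j, j.root ⬝ᵥ i.coroot = -1 →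
        g (.xi j) * twistFactor α (hNeg g i * hNeg g j) =
          twistFactor α (hNeg g i) * g (.xi j) := by
      intro i j hk
      refine mul_twistFactor α ?_
      rw [← mul_assoc, h.xi_mul_hNeg_of_odd hd hk, mul_assoc, h.xi_mul_hNeg j hd, ← mul_assoc,
        mul_assoc (hNeg g i), h.hNeg_mul_self j hd, mul_one]
    have hevenC : ∀ i j (k : ℤ), j.root ⬝ᵥ i.coroot = 2 * k →
        g (.xi j) * twistFactor α (hNeg g i * hNeg g j) =
          twistFactor α (hNeg g i * hNeg g j) * g (.xi j) := by
      intro i j k hk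
      refine mul_twistFactor α ?_
      rw [← mul_assoc, h.xi_mul_hNeg_of_even hd hk, mul_assoc, h.xi_mul_hNeg j hd, ← mul_assoc]
    refine braided_of (fun i j h₁ h₂ => ?_) (fun i j h₁ h₂ => ?_) fun i j h₁ h₂ => ?_
    · change g (.xi i) * twistFactor α (hNeg g i) * (g (.xi j) * twistFactor α (hNeg g j)) =
        g (.xi j) * twistFactor α (hNeg g j) * (g (.xi i) * twistFactor α (hNeg g i))
      have e1 := heven i j 0 (by rw [h₂, mul_zero])
      have e2 := heven j i 0 (by rw [h₁, mul_zero])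
      have e3 := hAA i j
      have e4 := h.braid.two h₁ h₂
      generalize g (.xi i) = X at *
      generalize g (.xi j) = Y at *
      generalize twistFactor α (hNeg g i) = A at *
      generalize twistFactor α (hNeg g j) = C at *
      calc X * A * (Y * C) = X * (A * Y) * C := by noncomm_ring
        _ = (X * Y) * (A * C) := by rw [← e1]; noncomm_ring
        _ = Y * (X * C) * A := by rw [e4, e3]; noncomm_ring
        _ = _ := by rw [e2]; noncomm_ring
    · change g (.xi i) * twistFactor α (hNeg g i) * (g (.xi j) * twistFactor α (hNeg g j) *
          (g (.xi i) * twistFactor α (hNeg g i))) =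
        g (.xi j) * twistFactor α (hNeg g j) * (g (.xi i) * twistFactor α (hNeg g i) *
          (g (.xi j) * twistFactor α (hNeg g j)))
      have a1 := hodd' i j h₂
      have a2 := hodd j i h₁
      have a3 := hodd' j i h₁
      have a4 := hodd i j h₂
      rw [h.hNeg_comm j i] at a2 a3
      have b1 := hAA i j
      have b2 := hAC i i j
      have b3 := hAC j i j
      have e4 := h.braid.three h₁ h₂
      generalize g (.xi i) = X at *
      generalize g (.xi j) = Y at *
      generalize twistFactor α (hNeg g i * hNeg g j) = D at *
      generalize twistFactor α (hNeg g i) = A at *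
      generalize twistFactor α (hNeg g j) = C at *
      calc X * A * (Y * C * (X * A)) = X * (A * Y) * (C * X) * A := by noncomm_ring
        _ = X * Y * (D * X) * D * A := by rw [← a1, ← a3]; noncomm_ring
        _ = X * (Y * X) * (C * D * A) := by rw [← a2]; noncomm_ring
        _ = Y * X * Y * (A * D * C) := by
          have e5 : C * D * A = A * D * C := by rw [b3, mul_assoc, ← b1, ← mul_assoc, ← b2]
          rw [e4, e5]; noncomm_ring
        _ = Y * X * (D * Y) * D * C := by rw [← a4]; noncomm_ring
        _ = Y * (X * D) * (Y * D) * C := by noncomm_ring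
        _ = _ := by rw [a1, a3]; noncomm_ring
    · change g (.xi i) * twistFactor α (hNeg g i) * (g (.xi j) * twistFactor α (hNeg g j) *
          (g (.xi i) * twistFactor α (hNeg g i) * (g (.xi j) * twistFactor α (hNeg g j)))) =
        g (.xi j) * twistFactor α (hNeg g j) * (g (.xi i) * twistFactor α (hNeg g i) *
          (g (.xi j) * twistFactor α (hNeg g j) * (g (.xi i) * twistFactor α (hNeg g i))))
      have a1 := heven i j (-1) (by rw [h₂]; norm_num)
      have a2 := hodd j i h₁
      have a3 := hodd' j i h₁
      have a4 := hevenC i j (-1) (by rw [h₂]; norm_num)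
      have a5 := hself i
      rw [h.hNeg_comm j i] at a2 a3
      have b1 := hAA i j
      have b2 := hAC i i j
      have b3 := hAC j i j
      have e4 := h.braid.four h₁ h₂
      generalize g (.xi i) = X at *
      generalize g (.xi j) = Y at *
      generalize twistFactor α (hNeg g i * hNeg g j) = D at *
      generalize twistFactor α (hNeg g i) = A at *
      generalize twistFactor α (hNeg g j) = C at *
      have k1 : X * A * (Y * C * (X * A * (Y * C))) = X * Y * (C * X) * Y * (C * A * A) := by
        calc _ = X * (A * Y) * C * X * (A * Y) * C := by noncomm_ring
          _ = X * Y * (A * C) * X * Y * (A * C) := by rw [← a1]; noncomm_ring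
          _ = X * Y * C * (A * X) * Y * (C * A) := by rw [b1]; noncomm_ring
          _ = X * Y * C * X * (A * Y) * C * A := by rw [← a5]; noncomm_ring
          _ = X * Y * C * X * Y * (A * C) * A := by rw [← a1]; noncomm_ring
          _ = _ := by rw [b1]; noncomm_ring
      have k2 : Y * C * (X * A * (Y * C * (X * A))) = Y * C * X * Y * (C * X) * (A * A) := by
        calc _ = Y * C * X * (A * Y) * C * X * A := by noncomm_ring
          _ = Y * C * X * Y * (A * C) * X * A := by rw [← a1]; noncomm_ring
          _ = Y * C * X * Y * C * (A * X) * A := by rw [b1]; noncomm_ring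
          _ = _ := by rw [← a5]; noncomm_ring
      rw [k1, k2]
      calc _ = X * Y * X * (D * Y) * (C * A * A) := by rw [← a3]; noncomm_ring
        _ = X * (Y * (X * Y)) * (D * C * (A * A)) := by rw [← a4]; noncomm_ring
        _ = Y * X * Y * (X * C) * D * (A * A) := by rw [e4, ← b3]; noncomm_ring
        _ = Y * X * (Y * D) * X * D * (A * A) := by rw [a2]; noncomm_ring
        _ = Y * (X * D) * Y * (X * D) * (A * A) := by rw [a4]; noncomm_ring
        _ = _ := by rw [a3]; noncomm_ring

theorem twist_xi_sq (h : BaseRel g) (hd : Even d)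
    (hsq : ∀ i, g (.xi i) ^ 2 = hNeg g i) (α : R) (i : SimpleIdx V n) :
    twist α g (.xi i) ^ 2 = hNeg g i * twistFactor (α * α) (hNeg g i) := by
  change (g (.xi i) * twistFactor α (hNeg g i)) ^ 2 = _
  have h1 := mul_twistFactor α (h.xi_mul_hNeg i hd)
  rw [← twistFactor_mul _ _ (h.hNeg_mul_self i hd), sq, mul_assoc, ← mul_assoc _ (g (.xi i)), ← h1,
    ← mul_assoc, ← mul_assoc, ← sq, hsq i, mul_assoc]

theorem defQuad_twist (h : BaseRel g) (hd : Even d)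
    (hsq : ∀ i, g (.xi i) ^ 2 = hNeg g i) {α u : R} (hα : α * α = 2 * u - 1) :
    DefQuad u (twist α g) := by
  intro i
  have hc : (algebraMap ℂ R (1 / 2)) * 2 = 1 := by rw [mul_two, half_add_half]
  rw [twist_xi_sq h hd hsq, hα, hNeg_twist, twistFactor, mul_add, mul_smul_comm, mul_smul_comm,
    mul_one, h.hNeg_mul_self i hd]
  congr 2
  · linear_combination u * hc
  · linear_combination (1 - u) * hc

theorem twist_xi_sq_one (h : BaseRel g) (hd : Even d)
    (hsq : ∀ i, g (.xi i) ^ 2 = hNeg g i) {α : R} (hα : α * α = -1) (i : SimpleIdx V n) :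
    twist α g (.xi i) ^ 2 = 1 := by
  have hc : (algebraMap ℂ R (1 / 2)) * 2 = 1 := by rw [mul_two, half_add_half]
  rw [twist_xi_sq h hd hsq, hα, twistFactor, add_neg_cancel, mul_zero, zero_smul, zero_add,
    sub_neg_eq_add, one_add_one_eq_two, hc, one_smul, h.hNeg_mul_self i hd]

theorem twist_one : twist (1 : R) g = g := by
  funext x
  cases x with
  | t x => rfl
  | xi i => exact (congrArg _ (twistFactor_one _)).trans (mul_one _)

theorem twistFactor_mem (α : R) (i : SimpleIdx V n) {S : Subalgebra R B}
    (h : ∀ x, g (.t x) ∈ S) : twistFactor α (hNeg g i) ∈ S :=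
  S.add_mem (S.smul_mem S.one_mem _) (S.smul_mem (h _) _)

theorem adjoin_twist (h : BaseRel g) (hd : Even d) {α β : R} (hαβ : α * β = 1) :
    Algebra.adjoin R (Set.range g) ≤ Algebra.adjoin R (Set.range (twist α g)) := by
  rw [Algebra.adjoin_le_iff]
  have ht : ∀ x, g (.t x) ∈ Algebra.adjoin R (Set.range (twist α g)) := fun x =>
    Algebra.subset_adjoin ⟨.t x, rfl⟩
  rintro _ ⟨x, rfl⟩
  cases x with
  | t x => exact ht x
  | xi i =>
    have h1 : g (.xi i) = twist α g (.xi i) * twistFactor β (hNeg g i) := by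
      change _ = g (.xi i) * _ * _
      rw [mul_assoc, twistFactor_mul _ _ (h.hNeg_mul_self i hd), hαβ, twistFactor_one, mul_one]
    rw [h1]
    exact Subalgebra.mul_mem _ (Algebra.subset_adjoin ⟨.xi i, rfl⟩) (twistFactor_mem β i ht)

end Twist

section MapTwist

variable {R R' : Type*} [CommRing R] [Algebra ℂ R] [CommRing R'] [Algebra ℂ R'] {m : ℕ}

theorem map_twist (f : R →ₐ[ℂ] R') (α : R) (g : Gen V n d → Matrix (Fin m) (Fin m) R)
    (x : Gen V n d) :
    (twist α g x).map f = twist (f α) (fun y => (g y).map f) x := by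
  cases x with
  | t x => rfl
  | xi i =>
    change (g _ * twistFactor α (g _)).map f = (g _).map f * twistFactor (f α) ((g _).map f)
    rw [Matrix.map_mul]
    congr 1
    ext a b
    simp only [twistFactor, Matrix.map_apply, Matrix.add_apply, Matrix.smul_apply, smul_eq_mul,
      map_add, map_mul, map_sub, map_one, AlgHom.commutes, Matrix.one_apply]
    split_ifs <;> simp

end MapTwist

/-! ### Existence of `χ'` and `χ₀` -/

section Existence

variable [NeZero d]

theorem trace_word_map {R R' : Type*} [CommRing R] [CommRing R'] {m : ℕ} (f : R →+* R')
    (g : Gen V n d → Matrix (Fin m) (Fin m) R) (w : List (Gen V n d)) :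
    f (w.map g).prod.trace = (w.map fun x => (g x).map f).prod.trace := by
  have h1 := map_word f.mapMatrix g (fun x => (g x).map f) (fun x => rfl) w
  rw [← h1]
  simp [Matrix.trace]

theorem adjoin_map_eq_top {k' : Type*} [Field k'] [Algebra ℂ k'] {m : ℕ}
    {g : Gen V n d → Matrix (Fin m) (Fin m) ℂ} (h : Algebra.adjoin ℂ (Set.range g) = ⊤) :
    Algebra.adjoin k' (Set.range fun x => (g x).map (algebraMap ℂ k')) = ⊤ := by
  set S := Algebra.adjoin k' (Set.range fun x => (g x).map (algebraMap ℂ k')) with hS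
  have h1 : ∀ M : Matrix (Fin m) (Fin m) ℂ, M.map (algebraMap ℂ k') ∈ S := by
    intro M
    have hM : M ∈ Algebra.adjoin ℂ (Set.range g) := by rw [h]; trivial
    have h2 : (Algebra.adjoin ℂ (Set.range g)) ≤
        (S.restrictScalars ℂ).comap ((Algebra.ofId ℂ k').mapMatrix (m := Fin m)) := by
      rw [Algebra.adjoin_le_iff]
      rintro _ ⟨x, rfl⟩
      exact Algebra.subset_adjoin ⟨x, rfl⟩
    exact h2 hM
  rw [eq_top_iff]
  intro M _
  rw [Matrix.matrix_eq_sum_single M]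
  refine Subalgebra.sum_mem _ fun i _ => Subalgebra.sum_mem _ fun j _ => ?_
  have h3 := S.smul_mem (h1 (Matrix.single i j 1)) (M i j)
  rwa [Matrix.map_single _ _ _ (algebraMap ℂ k'), map_one, Matrix.smul_single, smul_eq_mul, mul_one] at h3

theorem surjective_of_conj {K : Type*} [Field K] {A : Type*} [Ring A] [Algebra K A]
    {k' : Type*} [Field k'] [Algebra K k'] {m : ℕ} (ρ : A →ₐ[K] Matrix (Fin m) (Fin m) k')
    (ρ₀ : A →ₐ[K] Matrix (Fin m) (Fin m) K) (P : GL (Fin m) k')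
    (hP : ∀ a : A, ρ a = (P : Matrix (Fin m) (Fin m) k') * (ρ₀ a).map (algebraMap K k') *
        ((P⁻¹ : GL (Fin m) k') : Matrix (Fin m) (Fin m) k'))
    (h : Algebra.adjoin k' (Set.range ρ) = ⊤) : Function.Surjective ρ₀ := by
  let ψ : A →* Matrix (Fin m) (Fin m) k' :=
    ((algebraMap K k').mapMatrix.toMonoidHom).comp (ρ₀ : A →* Matrix (Fin m) (Fin m) K)
  have h1 : Algebra.adjoin k' (Set.range ψ) = ⊤ := by
    rw [eq_top_iff]
    intro M _
    have hc : Algebra.adjoin k' (Set.range ρ) ≤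
        (Algebra.adjoin k' (Set.range ψ)).comap (MulSemiringAction.toAlgHom k' _
          (ConjAct.toConjAct P⁻¹)) := by
      rw [Algebra.adjoin_le_iff]
      rintro _ ⟨a, rfl⟩
      refine Algebra.subset_adjoin ⟨a, ?_⟩
      rw [hP]
      change _ = (P⁻¹ : GL (Fin m) k').1 * _ * _
      simp [mul_assoc]
      rfl
    have hM : P.1 * M * (P⁻¹).1 ∈ Algebra.adjoin k' (Set.range ρ) := by rw [h]; trivial
    have h2 := hc hM
    have h3 : (P⁻¹ : GL (Fin m) k').1 * (P.1 * M * (P⁻¹).1) * ((P⁻¹)⁻¹ : GL (Fin m) k').1 = M := by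
      simp [mul_assoc]
    rw [← h3]
    exact h2
  have h2 : Submodule.span k' (Set.range ψ) = ⊤ := by
    have := Algebra.adjoin_eq_span k' (Set.range ψ)
    rw [h1, ← MonoidHom.coe_mrange, Submonoid.closure_eq] at this
    rw [← MonoidHom.coe_mrange, ← this]
    rfl
  have h3 := range_eq_top_of_span_map (LinearMap.range ρ₀.toLinearMap) (k' := k') (by
    rw [← h2]
    congr 1
    ext M
    constructor
    · rintro ⟨_, ⟨a, rfl⟩, rfl⟩
      exact ⟨a, rfl⟩
    · rintro ⟨a, rfl⟩
      exact ⟨_, ⟨a, rfl⟩, rfl⟩)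
  exact LinearMap.range_eq_top.1 h3

theorem irr_of_surjective {K : Type*} [Field K] {A : Type*} [Ring A] [Algebra K A] {m : ℕ}
    (hm : 0 < m) {ρ : A →ₐ[K] Matrix (Fin m) (Fin m) K} (h : Function.Surjective ρ) :
    character (vecRep ρ) ∈ Irr K A := by
  have : Nonempty (Fin m) := ⟨⟨0, hm⟩⟩
  refine ⟨m, vecRep ρ, isIrreducible_of_surjective ?_, rfl⟩
  intro f
  obtain ⟨a, ha⟩ := h (LinearMap.toMatrix' f)
  refine ⟨a, LinearMap.ext fun x => ?_⟩
  rw [vecRep_apply, ha, LinearMap.toMatrix'_mulVec]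

theorem map_trace_twist {R R' : Type*} [CommRing R] [CommRing R'] [Algebra ℂ R] [Algebra ℂ R']
    (f : R →ₐ[ℂ] R') {m : ℕ} (β : R) (g : Gen V n d → Matrix (Fin m) (Fin m) ℂ)
    (w : List (Gen V n d)) :
    f (w.map (twist β fun x => (g x).map (algebraMap ℂ R))).prod.trace =
      (w.map (twist (f β) fun x => (g x).map (algebraMap ℂ R'))).prod.trace := by
  refine (trace_word_map f.toRingHom _ w).trans ?_
  congr 3
  funext x
  refine (map_twist f β _ x).trans ?_
  congr 1
  funext y
  ext a b
  exact f.commutes _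

theorem spec_trace_twist {A' k' : Type*} [CommRing A'] [CommRing k'] [Algebra ℂ A'] [Algebra ℂ k']
    (j : A' →ₐ[ℂ] k') (hj : Function.Injective j) (τ : A' →ₐ[ℂ] ℂ) {m : ℕ} (β a : A')
    (g : Gen V n d → Matrix (Fin m) (Fin m) ℂ) (w : List (Gen V n d))
    (h : j a = (w.map (twist (j β) fun x => (g x).map (algebraMap ℂ k'))).prod.trace) :
    τ a = (w.map (twist (τ β) g)).prod.trace := by
  rw [hj (h.trans (map_trace_twist j β g w).symm), map_trace_twist τ]
  rfl

theorem exists_sqrt_map_one {A' : Type*} [CommRing A'] [Algebra ℂ A'] (τ : A' →ₐ[ℂ] ℂ) {x α : A'}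
    (h : α * α = x) (h1 : τ x = 1) : ∃ β, β * β = x ∧ τ β = 1 := by
  have h2 : τ α * τ α = 1 := by rw [← map_mul, h, h1]
  rcases mul_self_eq_one_iff.1 h2 with h3 | h3
  · exact ⟨_, h, h3⟩
  · exact ⟨-α, by rw [neg_mul_neg, h], by rw [map_neg, h3, neg_neg]⟩

theorem exists_associated (hd : Even d) {K : Type*} [Field K] [Algebra ℂ K] {u : K}
    (hu2 : 2 * u - 1 ≠ 0) {τ₁ τ₀ : IntCl ({u} : Set K) →ₐ[ℂ] ℂ} (hτ₁ : SpecializesAt τ₁ u 1)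
    (hτ₀ : SpecializesAt τ₀ u 0) (hZ : IsSplit K (Def V n d K u)) {m : ℕ} (hm : 0 < m)
    (σ : MonoidAlgebra ℂ (NGroup V n d) →ₐ[ℂ] Matrix (Fin m) (Fin m) ℂ)
    (hσ : Function.Surjective σ) :
    ∃ χ' ∈ Irr K (Def V n d K u), ∃ χ₀ ∈ Irr ℂ (MonoidAlgebra ℂ (SGroup V n d)),
      IsSpecialization τ₁ (defGen V n d K u) χ' (nGen V n d) (character (vecRep σ)) ∧
      IsSpecialization τ₀ (defGen V n d K u) χ' (sGen V n d) χ₀ := by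
  have : Nonempty (Fin m) := ⟨⟨0, hm⟩⟩
  set g₀ : Gen V n d → Matrix (Fin m) (Fin m) ℂ := fun x => σ (nGen V n d x) with hg₀
  have hb₀ : BaseRel g₀ := baseRel_nGen.map σ
  have hsq₀ : ∀ i, g₀ (.xi i) ^ 2 = hNeg g₀ i := fun i => by
    rw [hg₀, ← map_pow, nGen_sq]
    rfl
  have hadj₀ : Algebra.adjoin ℂ (Set.range g₀) = ⊤ := by
    have : Set.range g₀ = σ '' Set.range (nGen V n d) := by rw [← Set.range_comp]; rfl
    rw [this, ← AlgHom.map_adjoin, adjoin_nGen, Algebra.map_top, AlgHom.range_eq_top]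
    exact hσ
  let A := IntCl ({u} : Set K)
  let k' := AlgebraicClosure K
  let A' := integralClosure A k'
  have huA : u ∈ integralClosure (Algebra.adjoin ℂ {u}) K :=
    isIntegral_algebraMap (R := Algebra.adjoin ℂ {u}) (x := ⟨u, Algebra.subset_adjoin rfl⟩)
  let uA : A := ⟨u, huA⟩
  obtain ⟨α, hα⟩ := IsAlgClosed.exists_pow_nat_eq (algebraMap K k' (2 * u - 1)) zero_lt_two
  have hinjA : Function.Injective (algebraMap A k') := by
    intro a b hab
    exact Subtype.ext ((algebraMap K k').injective hab)
  have hinj : Function.Injective (algebraMap A A') := by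
    intro a b hab
    exact hinjA (congrArg (fun x : A' => (x : k')) hab)
  have hαA : α ∈ A' := by
    refine IsIntegral.of_pow zero_lt_two ?_
    rw [hα]
    exact isIntegral_algebraMap (R := A) (x := 2 * uA - 1)
  obtain ⟨τ₁', hτ₁'⟩ := exists_algHom_extension (A := A) (A' := A') hinj τ₁
  obtain ⟨τ₀', hτ₀'⟩ := exists_algHom_extension (A := A) (A' := A') hinj τ₀
  obtain ⟨β, hβ, hβ1⟩ := exists_sqrt_map_one τ₁' (x := algebraMap A A' (2 * uA - 1))
    (α := ⟨α, hαA⟩) (Subtype.ext ((sq α).symm.trans hα)) (by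
      rw [hτ₁', map_sub, map_mul, hτ₁ uA rfl, map_ofNat, map_one]
      norm_num)
  have hε : τ₀' β * τ₀' β = -1 := by
    rw [← map_mul, hβ, hτ₀', map_sub, map_mul, hτ₀ uA rfl, map_ofNat, map_one]
    norm_num
  have hβk : (β : k') * β = 2 * algebraMap K k' u - 1 := by
    have := congrArg (fun x : A' => (x : k')) hβ
    refine this.trans ?_
    change algebraMap K k' (2 * u - 1) = _
    rw [map_sub, map_mul, map_ofNat, map_one]
  -- the representation of `S`
  obtain ⟨f, hf⟩ := exists_sGroup_lift (hb₀.twist hd (τ₀' β)) (twist_xi_sq_one hb₀ hd hsq₀ hε)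
  have hfs : Function.Surjective f := by
    rw [← AlgHom.range_eq_top, eq_top_iff, ← hadj₀]
    refine (adjoin_twist hb₀ hd (β := -τ₀' β) (by rw [mul_neg, hε, neg_neg])).trans ?_
    rw [Algebra.adjoin_le_iff]
    rintro _ ⟨x, rfl⟩
    exact ⟨_, hf x⟩
  -- the representation of `Z`
  have hbk : BaseRel fun x => (g₀ x).map (algebraMap ℂ k') :=
    hb₀.map ((algebraMap ℂ k').mapMatrix (m := Fin m))
  have hsqk : ∀ i, ((g₀ (.xi i)).map (algebraMap ℂ k')) ^ 2 =
      hNeg (fun x => (g₀ x).map (algebraMap ℂ k')) i := fun i => by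
    have := congrArg ((algebraMap ℂ k').mapMatrix (m := Fin m)) (hsq₀ i)
    rw [map_pow] at this
    exact this
  have hqk := (defQuad_twist (R := k') hbk hd hsqk hβk)
  obtain ⟨ρ, hρ⟩ := exists_def_lift (R := K) (hbk.twist hd (β : k'))
    (DefQuad.restrictScalars (R := K) hqk)
  obtain ⟨ρ₀, P, hP⟩ := hZ k' m ρ
  have hβ0 : (β : k') ≠ 0 := by
    intro h0
    rw [h0, mul_zero] at hβk
    refine hu2 ((algebraMap K k').injective ?_)
    rw [map_sub, map_mul, map_ofNat, map_one, map_zero, ← hβk]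
  have hρ₀ : Function.Surjective ρ₀ := by
    refine surjective_of_conj ρ ρ₀ P hP ?_
    rw [eq_top_iff, ← adjoin_map_eq_top hadj₀]
    refine (adjoin_twist hbk hd (mul_inv_cancel₀ hβ0)).trans (Algebra.adjoin_mono ?_)
    rintro _ ⟨x, rfl⟩
    exact ⟨_, hρ x⟩
  have htr : ∀ a, algebraMap K k' (ρ₀ a).trace = (ρ a).trace := by
    intro a
    rw [hP, Matrix.trace_mul_comm, ← mul_assoc, Units.inv_mul, one_mul]
    simp [Matrix.trace]
  have key : ∀ (τ : A →ₐ[ℂ] ℂ) (τ' : A' →ₐ[ℂ] ℂ), (∀ a, τ' (algebraMap A A' a) = τ a) →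
      ∀ w : List (Gen V n d), ∃ a : A, (a : K) = (ρ₀ (w.map (defGen V n d K u)).prod).trace ∧
        τ a = (w.map (twist (τ' β) g₀)).prod.trace := by
    intro τ τ' hτ w
    have hint := mem_integralClosure_word_def (Set.mem_singleton u)
      (baseRel_defGen.map ρ₀) ((defQuad_defGen (u := u)).map ρ₀) w
    rw [← map_word ρ₀ _ _ (fun x => rfl)] at hint
    refine ⟨⟨_, hint⟩, rfl, ?_⟩
    refine (hτ _).symm.trans (spec_trace_twist (IsScalarTower.toAlgHom ℂ A' k')
      Subtype.val_injective τ' β _ g₀ w ?_)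
    refine (htr _).trans ?_
    rw [map_word ρ _ _ hρ]
    rfl
  refine ⟨_, irr_of_surjective hm hρ₀, _, irr_of_surjective hm hfs, fun w => ?_, fun w => ?_⟩
  · obtain ⟨a, ha, ha'⟩ := key τ₁ τ₁' hτ₁' w
    refine ⟨a, by rw [ha, character_vecRep], ?_⟩
    rw [ha', character_vecRep, hβ1, twist_one, map_word σ _ _ fun x => rfl]
  · obtain ⟨a, ha, ha'⟩ := key τ₀ τ₀' hτ₀' w
    refine ⟨a, by rw [ha, character_vecRep], ?_⟩
    rw [ha', character_vecRep, map_word f _ _ hf]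

end Existence
end

section
/-! ### Semisimplicity of Hecke algebras -/

namespace HeckeAlgebra

variable {G : Type*} [Group G] [Fintype G] {U : Subgroup G}

open Classical in
instance : Fintype U := Fintype.ofFinite U

instance : Module.Finite ℂ (HeckeAlgebra U) :=
  inferInstanceAs (Module.Finite ℂ (biInvariant U))

theorem sum_toFun {ι : Type*} (s : Finset ι) (F : ι → HeckeAlgebra U) (y : G) :
    (∑ v ∈ s, F v).toFun y = ∑ v ∈ s, (F v).toFun y := by
  classical
  induction s using Finset.induction_on with
  | empty => rfl
  | insert a s ha ih => rw [Finset.sum_insert ha, Finset.sum_insert ha, add_toFun, ih]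

/-- The adjoint `g ↦ conj (f g⁻¹)` of a bi-invariant function. -/
def adj (f : HeckeAlgebra U) : HeckeAlgebra U :=
  ⟨fun g => (starRingEnd ℂ) (f.toFun g⁻¹), by
    intro h hh k hk g
    have : (h * g * k)⁻¹ = k⁻¹ * g⁻¹ * h⁻¹ := by group
    simp only [this]
    rw [f.inv (U.inv_mem hk) (U.inv_mem hh)]⟩

theorem adj_toFun (f : HeckeAlgebra U) (g : G) :
    f.adj.toFun g = (starRingEnd ℂ) (f.toFun g⁻¹) := rfl

theorem adj_mul (f f' : HeckeAlgebra U) : (f * f').adj = f'.adj * f.adj := by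
  refine ext' fun g => ?_
  simp only [adj_toFun, mul_toFun, map_mul, map_sum, map_inv₀, map_natCast]
  congr 1
  refine Fintype.sum_equiv (Equiv.mulLeft g) _ _ fun x => ?_
  simp only [Equiv.coe_mulLeft]
  rw [mul_comm]
  congr 3 <;> group

theorem adj_adj (f : HeckeAlgebra U) : f.adj.adj = f := by
  refine ext' fun g => ?_
  simp [adj_toFun]

theorem eq_zero_of_mul_adj {f : HeckeAlgebra U} (h : f * f.adj = 0) : f = 0 := by
  have h1 := congrArg (fun x : HeckeAlgebra U => x.toFun 1) h
  simp only [mul_toFun, zero_toFun, adj_toFun, mul_one, inv_inv, mul_eq_zero, inv_eq_zero,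
    card_ne, false_or] at h1
  simp only [Complex.mul_conj] at h1
  have h2 : ∑ x : G, Complex.normSq (f.toFun x) = 0 := by exact_mod_cast h1
  rw [Finset.sum_eq_zero_iff_of_nonneg fun x _ => Complex.normSq_nonneg _] at h2
  refine ext' fun g => ?_
  exact Complex.normSq_eq_zero.1 (h2 g (Finset.mem_univ g))

theorem eq_zero_of_isNilpotent {f : HeckeAlgebra U} (hf : f.adj = f) (h : IsNilpotent f) :
    f = 0 := by
  obtain ⟨k, hk⟩ := h
  have key : ∀ k : ℕ, f ^ (2 ^ k) = 0 → f = 0 := by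
    intro k
    induction k with
    | zero => simp
    | succ k ih =>
      intro h
      refine ih (eq_zero_of_mul_adj ?_)
      have hadj : ∀ m : ℕ, (f ^ (m + 1)).adj = f ^ (m + 1) := by
        intro m
        induction m with
        | zero => simpa using hf
        | succ m ihm =>
          rw [pow_succ, adj_mul, ihm, hf, ← pow_succ, ← pow_succ']
      obtain ⟨m, hm⟩ := Nat.exists_eq_succ_of_ne_zero (pow_ne_zero k two_ne_zero)
      rw [hm, hadj m, ← Nat.succ_eq_add_one, ← hm, ← pow_add, ← two_mul, ← pow_succ']
      exact h
  exact key k (pow_eq_zero_of_le Nat.lt_two_pow_self.le hk)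

instance : IsSemisimpleRing (HeckeAlgebra U) := by
  have : IsArtinianRing (HeckeAlgebra U) := IsArtinianRing.of_finite ℂ _
  rw [IsArtinianRing.isSemisimpleRing_iff_jacobson, eq_bot_iff]
  intro f hf
  have hn : IsNilpotent (Ring.jacobson (HeckeAlgebra U)) := IsSemiprimaryRing.isNilpotent
  obtain ⟨k, hk⟩ := hn
  have h1 : f * f.adj ∈ Ring.jacobson (HeckeAlgebra U) := Ideal.mul_mem_right _ _ hf
  have h2 : IsNilpotent (f * f.adj) := ⟨k, by
    have := Ideal.pow_mem_pow h1 k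
    rw [hk] at this
    exact this⟩
  exact eq_zero_of_mul_adj (eq_zero_of_isNilpotent (by rw [adj_mul, adj_adj]) h2)

/-! ### Double cosets -/

open Classical in
/-- The function `x ↦ |U|⁻¹ #{(u, v) : u g v = x}`. -/
def br (U : Subgroup G) (g : G) : HeckeAlgebra U :=
  ⟨fun x => (Nat.card U : ℂ)⁻¹ * ∑ u : U, ∑ v : U, if (u : G) * g * v = x then 1 else 0, by
    intro h hh k hk x
    refine congrArg ((Nat.card U : ℂ)⁻¹ * ·) ?_
    refine Fintype.sum_equiv (Equiv.mulLeft (⟨h, hh⟩ : U)⁻¹) _ _ fun u => ?_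
    refine Fintype.sum_equiv (Equiv.mulRight (⟨k, hk⟩ : U)⁻¹) _ _ fun v => ?_
    refine if_congr ?_ rfl rfl
    simp only [Equiv.coe_mulLeft, Equiv.coe_mulRight, Subgroup.coe_mul, Subgroup.coe_inv]
    constructor
    · intro e
      have : h⁻¹ * (u : G) * g * (v * k⁻¹) = h⁻¹ * (u * g * v) * k⁻¹ := by group
      rw [this, e]
      group
    · rintro rfl
      group⟩

open Classical in
theorem br_toFun (g x : G) : (br U g).toFun x =
    (Nat.card U : ℂ)⁻¹ * ∑ u : U, ∑ v : U, if (u : G) * g * v = x then 1 else 0 := rfl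

theorem br_mul_left {u : G} (hu : u ∈ U) (g : G) : br U (u * g) = br U g := by
  classical
  refine ext' fun x => ?_
  rw [br_toFun, br_toFun]
  congr 1
  refine Fintype.sum_equiv (Equiv.mulRight (⟨u, hu⟩ : U)) _ _ fun v => ?_
  simp only [Equiv.coe_mulRight, Subgroup.coe_mul, mul_assoc]

theorem br_mul_right {u : G} (hu : u ∈ U) (g : G) : br U (g * u) = br U g := by
  classical
  refine ext' fun x => ?_
  rw [br_toFun, br_toFun]
  congr 1
  refine Finset.sum_congr rfl fun v _ => ?_
  refine Fintype.sum_equiv (Equiv.mulLeft (⟨u, hu⟩ : U)) _ _ fun v => ?_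
  simp only [Equiv.coe_mulLeft, Subgroup.coe_mul, mul_assoc]

theorem br_mul_toFun (g : G) (f : HeckeAlgebra U) (y : G) :
    (br U g * f).toFun y = (Nat.card U : ℂ)⁻¹ * ∑ u : U, f.toFun (g⁻¹ * (u : G)⁻¹ * y) := by
  classical
  rw [mul_toFun]
  congr 1
  simp only [br_toFun, mul_assoc, Finset.sum_mul, ite_mul, one_mul, zero_mul]
  rw [← Finset.mul_sum, Finset.sum_comm]
  have h1 : ∀ u : U, (∑ x : G, ∑ v : U,
      if (u : G) * (g * v) = x then f.toFun (x⁻¹ * y) else 0) =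
      Nat.card U * f.toFun (g⁻¹ * ((u : G)⁻¹ * y)) := by
    intro u
    rw [Finset.sum_comm]
    have h2 : ∀ v : U, (∑ x : G, if (u : G) * (g * v) = x then f.toFun (x⁻¹ * y) else 0) =
        f.toFun (g⁻¹ * ((u : G)⁻¹ * y)) := by
      intro v
      rw [Finset.sum_ite_eq, if_pos (Finset.mem_univ _)]
      have : ((u : G) * (g * v))⁻¹ * y = (v : G)⁻¹ * (g⁻¹ * ((u : G)⁻¹ * y)) := by group
      rw [this, f.inv_left (U.inv_mem v.2)]
    rw [Finset.sum_congr rfl fun v _ => h2 v, Finset.sum_const, Finset.card_univ, nsmul_eq_mul,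
      Nat.card_eq_fintype_card]
  rw [Finset.sum_congr rfl fun u _ => h1 u, ← Finset.mul_sum, inv_mul_cancel_left₀ card_ne]

theorem br_mul (g g' : G) :
    br U g * br U g' = (Nat.card U : ℂ)⁻¹ • ∑ v : U, br U (g * v * g') := by
  classical
  refine ext' fun y => ?_
  rw [br_mul_toFun, smul_toFun, sum_toFun]
  congr 1
  simp only [br_toFun, ← Finset.mul_sum]
  congr 1
  rw [Finset.sum_comm]
  refine Finset.sum_congr rfl fun u' _ => ?_
  refine Finset.sum_congr rfl fun u _ => ?_
  refine Finset.sum_congr rfl fun v _ => ?_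
  refine if_congr ?_ rfl rfl
  constructor
  · intro e
    have : (u : G) * (g * u' * g') * v = u * g * (u' * g' * v) := by group
    rw [this, e]
    group
  · rintro rfl
    group

theorem br_one : br U (1 : G) = 1 := by
  classical
  refine ext' fun x => ?_
  rw [one_toFun, br_toFun]
  split_ifs with hx
  · have h1 : ∀ u : U, (∑ v : U, if (u : G) * 1 * v = x then (1 : ℂ) else 0) = 1 := by
      intro u
      rw [Finset.sum_eq_single (u⁻¹ * ⟨x, hx⟩)]
      · simp
      · intro v _ hv
        refine if_neg fun e => hv ?_
        refine Subtype.ext ?_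
        have : (v : G) = (u : G)⁻¹ * ((u : G) * 1 * v) := by group
        rw [this, e]
        rfl
      · simp
    rw [Finset.sum_congr rfl fun u _ => h1 u, Finset.sum_const, Finset.card_univ, nsmul_eq_mul,
      mul_one, Nat.card_eq_fintype_card, inv_mul_cancel₀]
    rw [← Nat.card_eq_fintype_card]
    exact card_ne
  · rw [Finset.sum_eq_zero, mul_zero]
    refine fun u _ => Finset.sum_eq_zero fun v _ => if_neg fun e => hx ?_
    rw [← e, mul_one]
    exact U.mul_mem u.2 v.2

theorem br_toFun_self_ne (g : G) : (br U g).toFun g ≠ 0 := by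
  classical
  rw [br_toFun]
  refine mul_ne_zero (inv_ne_zero card_ne) ?_
  have : (∑ u : U, ∑ v : U, if (u : G) * g * v = g then (1 : ℂ) else 0) =
      ((∑ u : U, ∑ v : U, if (u : G) * g * v = g then 1 else 0 : ℕ) : ℂ) := by
    push_cast
    rfl
  rw [this, Nat.cast_ne_zero]
  refine (Finset.sum_pos' (fun u _ => Nat.zero_le _) ⟨1, Finset.mem_univ _, ?_⟩).ne'
  refine (Finset.sum_pos' (fun u _ => Nat.zero_le _) ⟨1, Finset.mem_univ _, ?_⟩)
  simp

theorem br_toFun_eq_zero {g x : G} (h : ∀ u ∈ U, ∀ v ∈ U, u * g * v ≠ x) :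
    (br U g).toFun x = 0 := by
  classical
  rw [br_toFun, Finset.sum_eq_zero, mul_zero]
  exact fun u _ => Finset.sum_eq_zero fun v _ => if_neg (h u u.2 v v.2)

theorem span_br : Submodule.span ℂ (Set.range (br U)) = ⊤ := by
  classical
  rw [eq_top_iff]
  intro f _
  have key : f = ∑ g : G, ((Nat.card U : ℂ)⁻¹ * f.toFun g) • br U g := by
    refine ext' fun x => ?_
    rw [sum_toFun]
    simp only [smul_toFun, br_toFun, Finset.mul_sum, mul_ite, mul_one, mul_zero]
    rw [Finset.sum_comm]
    have h1 : ∀ u : U, (∑ g : G, ∑ v : U, if (u : G) * g * v = x then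
        (Nat.card U : ℂ)⁻¹ * f.toFun g * (Nat.card U : ℂ)⁻¹ else 0) =
        (Nat.card U : ℂ)⁻¹ * f.toFun x := by
      intro u
      rw [Finset.sum_comm]
      have h2 : ∀ v : U, (∑ g : G, if (u : G) * g * v = x then
          (Nat.card U : ℂ)⁻¹ * f.toFun g * (Nat.card U : ℂ)⁻¹ else 0) =
          (Nat.card U : ℂ)⁻¹ * f.toFun x * (Nat.card U : ℂ)⁻¹ := by
        intro v
        rw [Finset.sum_eq_single ((u : G)⁻¹ * x * (v : G)⁻¹)]
        · rw [if_pos (by group), f.inv (U.inv_mem u.2) (U.inv_mem v.2)]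
        · intro g _ hg
          refine if_neg fun e => hg ?_
          rw [← e]
          group
        · simp
      rw [Finset.sum_congr rfl fun v _ => h2 v, Finset.sum_const, Finset.card_univ, nsmul_eq_mul,
        mul_comm, mul_assoc, ← Nat.card_eq_fintype_card, inv_mul_cancel₀ card_ne, mul_one]
    rw [Finset.sum_congr rfl fun u _ => h1 u, Finset.sum_const, Finset.card_univ, nsmul_eq_mul,
      ← Nat.card_eq_fintype_card, mul_inv_cancel_left₀ card_ne]
  rw [key]
  exact Submodule.sum_mem _ fun g _ => Submodule.smul_mem _ _ (Submodule.subset_span ⟨g, rfl⟩)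

theorem br_inv_toFun (g x : G) : (br U g⁻¹).toFun x⁻¹ = (br U g).toFun x := by
  classical
  rw [br_toFun, br_toFun, Finset.sum_comm]
  congr 1
  refine Fintype.sum_equiv (Equiv.inv U) _ _ fun u => ?_
  refine Fintype.sum_equiv (Equiv.inv U) _ _ fun v => ?_
  refine if_congr ?_ rfl rfl
  rw [← _root_.inv_inj]
  simp [mul_assoc]

theorem br_toFun_self (g : G) : (br U g).toFun g = (br U g * br U g⁻¹).toFun 1 := by
  rw [br_mul_toFun, ← br_inv_toFun, Finset.sum_congr rfl fun (u : U) _ => show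
    (br U g⁻¹).toFun (g⁻¹ * (u : G)⁻¹ * 1) = (br U g⁻¹).toFun g⁻¹ by
      rw [mul_one, inv_right _ (U.inv_mem u.2)]]
  rw [Finset.sum_const, Finset.card_univ, nsmul_eq_mul, ← Nat.card_eq_fintype_card,
    inv_mul_cancel_left₀ card_ne]

end HeckeAlgebra
end

section
variable {V : ClassicalType} {n d : ℕ} [GoodRank V n]

/-! ### Reduced words of rank two -/

section RankTwoWords

theorem height_root_pos (i : SimpleIdx V n) : 0 < height V i.root :=
  height_pos (isPosRoot_root i)

theorem weyl_mulVec_nil (v : Fin n → ℤ) : weylElement ([] : List (SimpleIdx V n)) *ᵥ v = v := by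
  rw [weylElement_nil, one_mulVec]

theorem weyl_mulVec_cons (i : SimpleIdx V n) (L : List (SimpleIdx V n)) (v : Fin n → ℤ) :
    weylElement (i :: L) *ᵥ v = simpleReflection i *ᵥ (weylElement L *ᵥ v) := by
  rw [weylElement_cons, mulVec_mulVec]

theorem isReducedWord_singleton (i : SimpleIdx V n) : IsReducedWord [i] := by
  rw [isReducedWord_cons_iff isReducedWord_nil, List.reverse_nil, weyl_mulVec_nil]
  exact height_root_pos i

theorem isReducedWord_pair {i j : SimpleIdx V n} {c : ℤ} (h : i.root ⬝ᵥ j.coroot = -c)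
    (hc : 0 ≤ c) : IsReducedWord [i, j] := by
  rw [isReducedWord_cons_iff (isReducedWord_singleton j), List.reverse_singleton,
    weyl_mulVec_cons, weyl_mulVec_nil, reflection_root, h, height_sub, height_smul]
  have := height_root_pos i
  have := mul_nonneg hc (height_root_pos j).le
  linarith

theorem isReducedWord_three {i j : SimpleIdx V n} {c e : ℤ} (h₁ : i.root ⬝ᵥ j.coroot = -c)
    (h₂ : j.root ⬝ᵥ i.coroot = -e) (he : 0 ≤ e) (hc : 0 < c) (hce : 1 ≤ c * e) :
    IsReducedWord [i, j, i] := by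
  rw [isReducedWord_cons_iff (isReducedWord_pair h₂ he)]
  simp only [List.reverse_cons, List.reverse_nil, List.nil_append, List.cons_append,
    weyl_mulVec_cons, weyl_mulVec_nil, reflection_root, h₁, h₂, mulVec_sub, mulVec_smul,
    simpleReflection_mulVec_self, root_dot_coroot, height_sub, height_smul, height_neg]
  nlinarith [mul_pos hc (height_root_pos j), mul_nonneg (sub_nonneg.2 hce) (height_root_pos i).le]

theorem isReducedWord_four {i j : SimpleIdx V n} (h₁ : i.root ⬝ᵥ j.coroot = -1)
    (h₂ : j.root ⬝ᵥ i.coroot = -2) : IsReducedWord [i, j, i, j] ∧ IsReducedWord [j, i, j, i] := by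
  have := height_root_pos i
  have := height_root_pos j
  constructor
  · rw [isReducedWord_cons_iff (isReducedWord_three h₂ h₁ zero_le_one zero_lt_two (by norm_num))]
    simp only [List.reverse_cons, List.reverse_nil, List.nil_append, List.cons_append,
      weyl_mulVec_cons, weyl_mulVec_nil, reflection_root, h₁, h₂, mulVec_sub, mulVec_smul,
      simpleReflection_mulVec_self, root_dot_coroot, height_sub, height_smul, height_neg, mulVec_neg]
    linarith
  · rw [isReducedWord_cons_iff (isReducedWord_three h₁ h₂ zero_le_two zero_lt_one (by norm_num))]
    simp only [List.reverse_cons, List.reverse_nil, List.nil_append, List.cons_append,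
      weyl_mulVec_cons, weyl_mulVec_nil, reflection_root, h₁, h₂, mulVec_sub, mulVec_smul,
      simpleReflection_mulVec_self, root_dot_coroot, height_sub, height_smul, height_neg, mulVec_neg]
    linarith

end RankTwoWords

/-! ### Groups with root subgroups and the algebra of `U`-double cosets -/

/-- The properties of a finite group `G` with a maximal unipotent subgroup `U`, one-parameter
subgroups `x_i` for the simple roots, and a system `g` of generators of the normalizer of the
torus, which determine the structure of the Hecke algebra of `(G, U)`. -/
structure IsSplitPair {G : Type*} [Group G] (F : Type*) [Field F] (U : Subgroup G)
    (g : Gen V n d → G) (x : SimpleIdx V n → F → G) : Prop where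
  base : BaseRel g
  xi_sq : ∀ i, g (.xi i) ^ 2 = hNeg g i
  norm : ∀ y, ∀ v ∈ U, g (.t y) * v * (g (.t y))⁻¹ ∈ U
  x_mem : ∀ i t, x i t ∈ U
  x_add : ∀ i s t, x i (s + t) = x i s * x i t
  decomp : ∀ i, ∀ v ∈ U, ∃ t, ∃ v' ∈ U, g (.xi i) * v' * (g (.xi i))⁻¹ ∈ U ∧ v = v' * x i t
  pos : ∀ i L, IsReducedWord (i :: L) → ∀ t, (xiProd g L)⁻¹ * x i t * xiProd g L ∈ U
  neg : ∀ i t, g (.xi i) * x i t * (g (.xi i))⁻¹ ∈ U → t = 0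
  rank : ∀ i, ∃ κ : Fˣ ≃ ZMod d, ∀ t : Fˣ, ∃ u ∈ U, ∃ v ∈ U, g (.xi i) * x i t * g (.xi i) =
    u * (g (.t (κ t • corootTorus d i)) * g (.xi i)) * v
  disj : ∀ a ∈ standardElements g, ∀ b ∈ standardElements g, ∀ u ∈ U, ∀ v ∈ U,
    u * a * v = b → a = b
  inj : ∀ y L y' L', IsReducedWord L → IsReducedWord L' → g (.t y) * xiProd g L = g (.t y') * xiProd g L' →
    y = y' ∧ weylElement L = weylElement L'
  gen : Subgroup.closure ((U : Set G) ∪ Set.range g) = ⊤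

namespace IsSplitPair

open HeckeAlgebra

variable {G : Type*} [Group G] [Fintype G] {F : Type*} [Field F] [Fintype F] {U : Subgroup G}
  {g : Gen V n d → G} {x : SimpleIdx V n → F → G}

theorem x_zero (h : IsSplitPair F U g x) (i : SimpleIdx V n) : x i 0 = 1 := by
  have := h.x_add i 0 0
  rw [add_zero] at this
  exact (mul_eq_left.1 this.symm)

theorem sum_const_br (a : HeckeAlgebra U) : (Nat.card U : ℂ)⁻¹ • ∑ _v : U, a = a := by
  rw [Finset.sum_const, Finset.card_univ, ← Nat.card_eq_fintype_card, ← Nat.cast_smul_eq_nsmul ℂ,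
    smul_smul, inv_mul_cancel₀ card_ne, one_smul]

theorem br_t_mul (h : IsSplitPair F U g x) (y : torus V n d) (a : G) :
    br U (g (.t y)) * br U a = br U (g (.t y) * a) := by
  rw [br_mul, Finset.sum_congr rfl fun (v : U) _ => show br U (g (.t y) * v * a) =
    br U (g (.t y) * a) by
      have : g (.t y) * v * a = (g (.t y) * v * (g (.t y))⁻¹) * (g (.t y) * a) := by group
      rw [this, br_mul_left (h.norm y v v.2)], sum_const_br]

theorem t_inv (h : IsSplitPair F U g x) (y : torus V n d) : (g (.t y))⁻¹ = g (.t (-y)) :=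
  inv_eq_of_mul_eq_one_left (h.base.t_neg y)

theorem br_mul_t (h : IsSplitPair F U g x) (y : torus V n d) (a : G) :
    br U a * br U (g (.t y)) = br U (a * g (.t y)) := by
  rw [br_mul, Finset.sum_congr rfl fun (v : U) _ => show br U (a * v * g (.t y)) =
    br U (a * g (.t y)) by
      have e : a * v * g (.t y) = (a * g (.t y)) * (g (.t (-y)) * v * (g (.t (-y)))⁻¹) := by
        rw [← h.t_inv]
        group
      rw [e, br_mul_right (h.norm _ v v.2)], sum_const_br]

theorem br_xi_mul (h : IsSplitPair F U g x) (i : SimpleIdx V n) (a : G) :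
    br U (g (.xi i)) * br U a =
      (Fintype.card F : ℂ)⁻¹ • ∑ t : F, br U (g (.xi i) * x i t * a) := by
  have hq : (Fintype.card F : ℂ) ≠ 0 := by exact_mod_cast Fintype.card_ne_zero
  have h1 : ∀ t : F, ∑ v : U, br U (g (.xi i) * v * a) =
      ∑ v : U, br U (g (.xi i) * (v * x i t) * a) := fun t =>
    (Fintype.sum_equiv (Equiv.mulRight (⟨x i t, h.x_mem i t⟩ : U)) _ _ fun v => rfl).symm
  have h2 : ∀ v : U, ∑ t : F, br U (g (.xi i) * (v * x i t) * a) =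
      ∑ t : F, br U (g (.xi i) * x i t * a) := by
    intro v
    obtain ⟨c, v', hv', hv'', e⟩ := h.decomp i v v.2
    refine Fintype.sum_equiv (Equiv.addLeft c) _ _ fun t => ?_
    rw [Equiv.coe_addLeft, e, h.x_add]
    have : g (.xi i) * (v' * x i c * x i t) * a =
        (g (.xi i) * v' * (g (.xi i))⁻¹) * (g (.xi i) * (x i c * x i t) * a) := by group
    rw [this, br_mul_left hv'']
  have h3 : (Fintype.card F : ℂ) • ∑ v : U, br U (g (.xi i) * v * a) =
      ∑ v : U, ∑ t : F, br U (g (.xi i) * x i t * a) := by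
    rw [← Finset.sum_congr rfl fun v _ => h2 v, Finset.sum_comm,
      ← Finset.sum_congr rfl fun t _ => h1 t, Finset.sum_const, Finset.card_univ,
      ← Nat.cast_smul_eq_nsmul ℂ]
  rw [br_mul, ← inv_smul_smul₀ hq (∑ v : U, br U (g (.xi i) * v * a)), h3, smul_comm, sum_const_br]

theorem sum_const_F (a : HeckeAlgebra U) : (Fintype.card F : ℂ)⁻¹ • ∑ _t : F, a = a := by
  have hq : (Fintype.card F : ℂ) ≠ 0 := by exact_mod_cast Fintype.card_ne_zero
  rw [Finset.sum_const, Finset.card_univ, ← Nat.cast_smul_eq_nsmul ℂ,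
    smul_smul, inv_mul_cancel₀ hq, one_smul]

theorem br_xi_mul_word (h : IsSplitPair F U g x) {i : SimpleIdx V n} {L : List (SimpleIdx V n)}
    (hL : IsReducedWord (i :: L)) :
    br U (g (.xi i)) * br U (xiProd g L) = br U (xiProd g (i :: L)) := by
  rw [br_xi_mul h, Finset.sum_congr rfl fun t _ => show br U (g (.xi i) * x i t * xiProd g L) =
    br U (xiProd g (i :: L)) by
      have : g (.xi i) * x i t * xiProd g L =
          (g (.xi i) * xiProd g L) * ((xiProd g L)⁻¹ * x i t * xiProd g L) := by group
      rw [this, br_mul_right (h.pos i L hL t), xiProd_cons], sum_const_F]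

/-- The generators of the Hecke algebra. -/
def hGen (U : Subgroup G) (g : Gen V n d → G) (y : Gen V n d) : HeckeAlgebra U := br U (g y)

theorem xiProd_hGen (h : IsSplitPair F U g x) {L : List (SimpleIdx V n)} (hL : IsReducedWord L) :
    xiProd (hGen U g) L = br U (xiProd g L) := by
  induction L with
  | nil => rw [xiProd_nil, xiProd_nil, br_one]
  | cons i L ih => rw [xiProd_cons, ih hL.tail, ← h.br_xi_mul_word hL, hGen]

theorem baseRel_hGen (h : IsSplitPair F U g x) : BaseRel (hGen U g) where
  one := by rw [hGen, h.base.one, br_one]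
  mul y y' := by rw [hGen, hGen, hGen, h.br_t_mul, h.base.mul]
  conj i y := by rw [hGen, hGen, hGen, h.br_mul_t, h.br_t_mul, h.base.conj]
  braid := by
    have key : ∀ L L' : List (SimpleIdx V n), IsReducedWord L → IsReducedWord L' →
        xiProd g L = xiProd g L' → xiProd (hGen U g) L = xiProd (hGen U g) L' := by
      intro L L' hL hL' e
      rw [h.xiProd_hGen hL, h.xiProd_hGen hL', e]
    refine braided_of (fun i j h₁ h₂ => ?_) (fun i j h₁ h₂ => ?_) fun i j h₁ h₂ => ?_
    · have := key [i, j] [j, i] (isReducedWord_pair (c := 0) (by rw [h₁, neg_zero]) le_rfl)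
        (isReducedWord_pair (c := 0) (by rw [h₂, neg_zero]) le_rfl)
        (by simpa [xiProd] using h.base.braid.two h₁ h₂)
      simpa [xiProd] using this
    · have := key [i, j, i] [j, i, j] (isReducedWord_three h₁ h₂ zero_le_one zero_lt_one le_rfl)
        (isReducedWord_three h₂ h₁ zero_le_one zero_lt_one le_rfl)
        (by simpa [xiProd] using h.base.braid.three h₁ h₂)
      simpa [xiProd] using this
    · have := key [i, j, i, j] [j, i, j, i] (isReducedWord_four h₁ h₂).1
        (isReducedWord_four h₁ h₂).2 (by simpa [xiProd] using h.base.braid.four h₁ h₂)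
      simpa [xiProd] using this

theorem sum_zmod [NeZero d] {A : Type*} [AddCommMonoid A] (f : ℕ → A) :
    ∑ c : ZMod d, f c.val = ∑ j ∈ Finset.range d, f j :=
  Finset.sum_nbij ZMod.val (fun c _ => Finset.mem_range.2 (ZMod.val_lt c))
    (fun a _ b _ e => ZMod.val_injective d e)
    (fun j hj => ⟨(j : ZMod d), Finset.mem_coe.2 (Finset.mem_univ _),
      ZMod.val_cast_of_lt (Finset.mem_range.1 hj)⟩) fun _ _ => rfl

theorem yokQuad_hGen [NeZero d] (h : IsSplitPair F U g x) (hF : Fintype.card F = d + 1) :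
    YokQuad (R := ℂ) (Fintype.card F : ℂ)⁻¹ (hGen U g) := by
  classical
  intro i
  have hb := h.baseRel_hGen
  have hq : (Fintype.card F : ℂ) ≠ 0 := by exact_mod_cast Fintype.card_ne_zero
  obtain ⟨κ, hκ⟩ := h.rank i
  have h0 : br U (g (.xi i) * x i 0 * g (.xi i)) = hNeg (hGen U g) i := by
    rw [h.x_zero, mul_one, ← sq, h.xi_sq]
    rfl
  have h1 : ∀ t : Fˣ, br U (g (.xi i) * x i t * g (.xi i)) =
      hGen U g (.t (corootTorus d i)) ^ (κ t).val * hGen U g (.xi i) := by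
    intro t
    obtain ⟨u, hu, v, hv, e⟩ := hκ t
    rw [e, br_mul_right hv, br_mul_left hu, ← h.br_t_mul, smul_coroot_eq_nsmul, ← hb.t_nsmul]
    rfl
  have h2 : ∑ t : F, br U (g (.xi i) * x i t * g (.xi i)) =
      hNeg (hGen U g) i + ∑ t : Fˣ, br U (g (.xi i) * x i t * g (.xi i)) := by
    rw [Fintype.sum_eq_add_sum_compl (0 : F), h0]
    congr 1
    symm
    refine Finset.sum_nbij (fun t : Fˣ => (t : F)) (fun t _ => by simp)
      (fun a _ b _ e => Units.ext e) (fun t ht => ?_) fun _ _ => rfl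
    have ht0 : t ≠ 0 := by simpa using ht
    exact ⟨Units.mk0 t ht0, by simp, rfl⟩
  have h3 : ∑ t : Fˣ, br U (g (.xi i) * x i t * g (.xi i)) =
      (d : ℂ) • (idemR ℂ (hGen U g) i * hGen U g (.xi i)) := by
    rw [Finset.sum_congr rfl fun t _ => h1 t, ← Finset.sum_mul, hb.idemR_eq,
      Fintype.sum_equiv κ _ (fun c => hGen U g (.t (corootTorus d i)) ^ c.val) fun _ => rfl,
      sum_zmod (fun j => hGen U g (.t (corootTorus d i)) ^ j), smul_mul_assoc, smul_smul]
    have hd : (d : ℂ) ≠ 0 := NeZero.ne _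
    have : (d : ℂ) * algebraMap ℂ ℂ (1 / d) = 1 := by
      change (d : ℂ) * (1 / d) = 1
      field_simp
    rw [this, one_smul]
  have h4 : 1 - (Fintype.card F : ℂ)⁻¹ = (Fintype.card F : ℂ)⁻¹ * d := by
    field_simp
    rw [hF]
    push_cast
    ring
  rw [sq, hGen, br_xi_mul h, h2, h3, smul_add, smul_smul, h4]
  rfl

theorem br_standard_mem (h : IsSplitPair F U g x) {a : G} (ha : a ∈ standardElements g) :
    br U a ∈ Algebra.adjoin ℂ (Set.range (hGen U g)) := by
  obtain ⟨y, L, hL, rfl⟩ := ha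
  rw [← h.br_t_mul, ← h.xiProd_hGen hL]
  exact Subalgebra.mul_mem _ (Algebra.subset_adjoin ⟨.t y, rfl⟩) (xiProd_mem_adjoin _ L)

/-- The union of the double cosets of the standard elements. -/
def cells (U : Subgroup G) (g : Gen V n d → G) : Set G :=
  {a | ∃ s ∈ standardElements g, ∃ u ∈ U, ∃ v ∈ U, a = u * s * v}

theorem t_mul_cells (h : IsSplitPair F U g x) (y : torus V n d) {a : G} (ha : a ∈ cells U g) :
    g (.t y) * a ∈ cells U g := by
  obtain ⟨s, hs, u, hu, v, hv, rfl⟩ := ha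
  refine ⟨_, h.base.t_mul_mem_standardElements y hs, _, h.norm y u hu, v, hv, ?_⟩
  group

theorem t_mul_word (h : IsSplitPair F U g x) (y : torus V n d) (L : List (SimpleIdx V n)) :
    g (.t y) * xiProd g L = xiProd g L * g (.t (wordTorus L.reverse y)) := by
  rw [h.base.xiProd_t, ← wordTorus_append, wordTorus_of_eq_one]
  rw [weylElement_append, weylElement_mul_reverse]

theorem mul_cells {a u v : G} (ha : a ∈ cells U g) (hu : u ∈ U) (hv : v ∈ U) :
    u * a * v ∈ cells U g := by
  obtain ⟨s, hs, u', hu', v', hv', rfl⟩ := ha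
  refine ⟨s, hs, u * u', U.mul_mem hu hu', v' * v, U.mul_mem hv' hv, ?_⟩
  group

theorem xi_mul_cells_of_reduced (h : IsSplitPair F U g x) {i : SimpleIdx V n}
    {L : List (SimpleIdx V n)} (hL : IsReducedWord (i :: L)) (y : torus V n d) {u : G}
    (hu : u ∈ U) : g (.xi i) * u * (g (.t y) * xiProd g L) ∈ cells U g := by
  obtain ⟨c, v, hv, hv', rfl⟩ := h.decomp i u hu
  have h1 : (g (.t y) * xiProd g L)⁻¹ * x i c * (g (.t y) * xiProd g L) ∈ U := by
    rw [h.t_mul_word]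
    have := h.norm (-wordTorus L.reverse y) _ (h.pos i L hL c)
    rw [← h.t_inv] at this
    convert this using 1
    group
  refine ⟨g (.t (reflectTorus i y)) * xiProd g (i :: L), ⟨_, _, hL, rfl⟩, _, hv', _, h1, ?_⟩
  rw [xiProd_cons, ← mul_assoc (g (.t _)), ← h.base.conj]
  group

theorem xi_mul_cells (h : IsSplitPair F U g x) (i : SimpleIdx V n) {a : G} (ha : a ∈ cells U g) :
    g (.xi i) * a ∈ cells U g := by
  obtain ⟨s, ⟨y, L, hL, rfl⟩, u, hu, v, hv, rfl⟩ := ha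
  by_cases hi : IsReducedWord (i :: L)
  · have := mul_cells (h.xi_mul_cells_of_reduced hi y hu) U.one_mem hv
    convert this using 1
    group
  · have hneg : height V (weylElement L.reverse *ᵥ i.root) < 0 := by
      by_contra hn
      exact hi ((isReducedWord_cons_iff hL i).2
        (height_neg_of_not ((isRootVec_root i).weyl L.reverse) hn))
    obtain ⟨L', hL', e, -⟩ := hL.exists_cons i hneg
    obtain ⟨c, v', hv', hv'', rfl⟩ := h.decomp i u hu
    have e1 : g (.t y) * xiProd g L =
        g (.xi i) * (g (.t (reflectTorus i y)) * xiProd g L') := by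
      rw [h.base.xiProd_congr hL hL' e, xiProd_cons, ← mul_assoc, ← mul_assoc, h.base.conj,
        reflectTorus_reflectTorus]
    rw [e1]
    have key : g (.xi i) * x i c * g (.xi i) *
        (g (.t (reflectTorus i y)) * xiProd g L') ∈ cells U g := by
      by_cases hc : c = 0
      · rw [hc, h.x_zero, mul_one, ← sq, h.xi_sq]
        exact h.t_mul_cells _ ⟨_, ⟨reflectTorus i y, L', hL'.tail, rfl⟩, 1, U.one_mem, 1, U.one_mem,
          by group⟩
      · obtain ⟨κ, hκ⟩ := h.rank i
        obtain ⟨u₁, hu₁, u₂, hu₂, e2⟩ := hκ (Units.mk0 c hc)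
        have e3 : g (.xi i) * x i c * g (.xi i) =
          u₁ * (g (.t (κ (Units.mk0 c hc) • corootTorus d i)) * g (.xi i)) * u₂ := e2
        rw [e3]
        have := mul_cells (h.t_mul_cells (κ (Units.mk0 c hc) • corootTorus d i)
          (h.xi_mul_cells_of_reduced hL' (reflectTorus i y) hu₂)) hu₁ U.one_mem
        convert this using 1
        group
    have := mul_cells key hv'' hv
    convert this using 1
    group

theorem cells_eq (h : IsSplitPair F U g x) (a : G) : a ∈ cells U g := by
  have key : ∀ b ∈ Subgroup.closure ((U : Set G) ∪ Set.range g), ∀ a ∈ cells U g,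
      b * a ∈ cells U g := by
    intro b hb
    induction hb using Subgroup.closure_induction_left with
    | one =>
      intro a ha
      rwa [one_mul]
    | mul_left b hb y _ ih =>
      intro a ha
      rw [mul_assoc]
      rcases hb with hb | ⟨b | b, rfl⟩
      · simpa using mul_cells (ih a ha) hb U.one_mem
      · exact h.t_mul_cells _ (ih a ha)
      · exact h.xi_mul_cells _ (ih a ha)
    | inv_mul_cancel b hb y _ ih =>
      intro a ha
      rw [mul_assoc]
      rcases hb with hb | ⟨b | b, rfl⟩
      · simpa using mul_cells (ih a ha) (U.inv_mem hb) U.one_mem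
      · rw [h.t_inv]
        exact h.t_mul_cells _ (ih a ha)
      · have e : (g (.xi b))⁻¹ = (hNeg g b)⁻¹ * g (.xi b) := by
          rw [← h.xi_sq]
          group
        rw [e, hNeg, h.t_inv, mul_assoc]
        exact h.t_mul_cells _ (h.xi_mul_cells _ (ih a ha))
  have := key a (by rw [h.gen]; trivial) 1
    ⟨1, h.base.one_mem_standardElements, 1, U.one_mem, 1, U.one_mem, by group⟩
  rwa [mul_one] at this

theorem adjoin_hGen (h : IsSplitPair F U g x) :
    Algebra.adjoin ℂ (Set.range (hGen U g)) = ⊤ := by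
  rw [eq_top_iff]
  intro f _
  have hf : f ∈ Submodule.span ℂ (Set.range (br U)) := by rw [span_br]; trivial
  have : Submodule.span ℂ (Set.range (br U)) ≤
      Subalgebra.toSubmodule (Algebra.adjoin ℂ (Set.range (hGen U g))) := by
    rw [Submodule.span_le]
    rintro _ ⟨a, rfl⟩
    obtain ⟨s, hs, u, hu, v, hv, rfl⟩ := h.cells_eq a
    rw [br_mul_right hv, br_mul_left hu]
    exact h.br_standard_mem hs
  exact this hf

theorem exists_algEquiv [NeZero d] (h : IsSplitPair F U g x) (hF : Fintype.card F = d + 1) :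
    ∃ e : Yok V n d ℂ (Fintype.card F : ℂ)⁻¹ ≃ₐ[ℂ] HeckeAlgebra U,
      ∀ y, e (yokGen V n d ℂ _ y) = hGen U g y := by
  classical
  obtain ⟨f, hf⟩ := exists_yok_lift h.baseRel_hGen (h.yokQuad_hGen hF)
  have hsurj : Function.Surjective f := by
    rw [← AlgHom.range_eq_top, eq_top_iff, ← h.adjoin_hGen, Algebra.adjoin_le_iff]
    rintro _ ⟨y, rfl⟩
    exact ⟨_, hf y⟩
  have hinj : Function.Injective f := by
    rw [injective_iff_map_eq_zero]
    intro a ha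
    let I := torus V n d × Set.range (weylElement : List (SimpleIdx V n) → _)
    have : Finite (Set.range (weylElement : List (SimpleIdx V n) → _)) :=
      finite_weylElement.to_subtype
    have : Fintype I := Fintype.ofFinite I
    have hw : ∀ w : Set.range (weylElement : List (SimpleIdx V n) → _), ∃ L : List (SimpleIdx V n),
        IsReducedWord L ∧ weylElement L = w.1 := by
      rintro ⟨_, L, rfl⟩
      exact exists_reduced L
    choose red hred hred' using hw
    let S : I → Yok V n d ℂ (Fintype.card F : ℂ)⁻¹ := fun p =>
      yokGen V n d ℂ _ (.t p.1) * xiProd (yokGen V n d ℂ _) (red p.2)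
    have hS : a ∈ Submodule.span ℂ (Set.range S) := by
      have h1 := baseRel_yokGen.adjoin_le_span (yokQuad_yokGen.exists_span)
        (a := a) (by rw [adjoin_yokGen]; trivial)
      refine Submodule.span_mono ?_ h1
      rintro _ ⟨y, L, hL, rfl⟩
      refine ⟨(y, ⟨_, L, rfl⟩), ?_⟩
      change _ * _ = _ * _
      rw [baseRel_yokGen.xiProd_congr (hred _) hL (hred' ⟨_, L, rfl⟩).symm]
    obtain ⟨c, rfl⟩ := (Submodule.mem_span_range_iff_exists_fun ℂ).1 hS
    have hfS : ∀ p : I, f (S p) = br U (g (.t p.1) * xiProd g (red p.2)) := by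
      intro p
      rw [map_mul, hf, map_xiProd, ← h.br_t_mul, ← h.xiProd_hGen (hred _)]
      simp only [hf]
      rfl
    refine Finset.sum_eq_zero fun p _ => ?_
    suffices c p = 0 by rw [this, zero_smul]
    have h2 := congrArg (fun φ : HeckeAlgebra U => φ.toFun (g (.t p.1) * xiProd g (red p.2))) ha
    simp only [map_sum, map_smul, hfS, sum_toFun, smul_toFun, zero_toFun] at h2
    rw [Finset.sum_eq_single p] at h2
    · exact (mul_eq_zero.1 h2).resolve_right (br_toFun_self_ne _)
    · intro p' _ hp
      rw [br_toFun_eq_zero, mul_zero]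
      intro u hu v hv e
      have h3 := h.disj _ ⟨_, _, hred p'.2, rfl⟩ _ ⟨_, _, hred p.2, rfl⟩ u hu v hv e
      obtain ⟨h4, h5⟩ := h.inj _ _ _ _ (hred p'.2) (hred p.2) h3
      rw [hred', hred'] at h5
      exact hp (Prod.ext h4 (Subtype.ext h5))
    · simp
  exact ⟨AlgEquiv.ofBijective f ⟨hinj, hsurj⟩, hf⟩

open Classical in
theorem br_t_toFun (h : IsSplitPair F U g x) (y : torus V n d) (a : G) :
    (br U (g (.t y))).toFun a = if ∃ u ∈ U, ∃ v ∈ U, a = u * g (.t y) * v then 1 else 0 := by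
  split_ifs with ha
  · obtain ⟨u, hu, v, hv, rfl⟩ := ha
    rw [inv _ hu hv, br_toFun_self, h.br_t_mul, mul_inv_cancel, br_one, one_toFun,
      if_pos U.one_mem]
  · exact br_toFun_eq_zero fun u hu v hv e => ha ⟨u, hu, v, hv, e.symm⟩

open Classical in
theorem br_xi_toFun (h : IsSplitPair F U g x) (i : SimpleIdx V n) (a : G) :
    (br U (g (.xi i))).toFun a = (Fintype.card F : ℂ)⁻¹ *
      if ∃ u ∈ U, ∃ v ∈ U, a = u * g (.xi i) * v then 1 else 0 := by
  split_ifs with ha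
  · obtain ⟨u, hu, v, hv, rfl⟩ := ha
    rw [inv _ hu hv, br_toFun_self, h.br_xi_mul, smul_toFun, sum_toFun, Finset.sum_eq_single 0]
    · rw [h.x_zero, mul_one, mul_inv_cancel, br_one, one_toFun, if_pos U.one_mem]
    · intro t _ ht
      refine br_toFun_eq_zero fun u hu v hv e => ht (h.neg i t ?_)
      have e2 : g (.xi i) * x i t * (g (.xi i))⁻¹ = u⁻¹ * (u * (g (.xi i) * x i t * (g (.xi i))⁻¹) * v) * v⁻¹ := by
        group
      rw [e2, e, mul_one]
      exact U.mul_mem (U.inv_mem hu) (U.inv_mem hv)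
    · simp
  · rw [mul_zero]
    exact br_toFun_eq_zero fun u hu v hv e => ha ⟨u, hu, v, hv, e.symm⟩

end IsSplitPair
end

section
variable {V : ClassicalType} {n : ℕ}

/-! ### The weights of the defining representation -/

/-- The index of the basis vector of weight `e_k`. -/
def pI : (V : ClassicalType) → {n : ℕ} → Fin n → RepIdx V n
  | .A, _, k => k
  | .Astar, _, k => k
  | .B, _, k => some (.inl k)
  | .C, _, k => .inl k
  | .D, _, k => .inl k

/-- The index of the basis vector of weight `-e_k`, in types `B`, `C` and `D`. -/
def mI : (V : ClassicalType) → {n : ℕ} → Fin n → RepIdx V n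
  | .A, _, k => k
  | .Astar, _, k => k
  | .B, _, k => some (.inr k)
  | .C, _, k => .inr k
  | .D, _, k => .inr k

/-- The index of the basis vector of weight `0` in type `B`. -/
def zI : RepIdx .B n := (none : Option (Fin n ⊕ Fin n))

/-- The index of the opposite weight, in types `B`, `C` and `D`. -/
def opp : {V : ClassicalType} → {n : ℕ} → RepIdx V n → RepIdx V n
  | .A, _, r => r
  | .Astar, _, r => r
  | .B, _, none => zI
  | .B, _, some (.inl k) => mI .B k
  | .B, _, some (.inr k) => pI .B k
  | .C, _, .inl k => mI .C k
  | .C, _, .inr k => pI .C k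
  | .D, _, .inl k => mI .D k
  | .D, _, .inr k => pI .D k

/-- The coefficients of the invariant form. -/
def formCoef (F : Type*) [Field F] : {V : ClassicalType} → {n : ℕ} → RepIdx V n → F
  | .A, _, _ => 1
  | .Astar, _, _ => 1
  | .B, _, none => 2
  | .B, _, some _ => 1
  | .C, _, .inl _ => 1
  | .C, _, .inr _ => -1
  | .D, _, _ => 1

theorem idx_cases (r : RepIdx V n) : (∃ k, r = pI V k) ∨ (V.HasZero ∧ ∃ k, r = mI V k) ∨
    (V = .B ∧ HEq r (zI (n := n))) := by
  cases V with
  | A => exact .inl ⟨r, rfl⟩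
  | Astar => exact .inl ⟨r, rfl⟩
  | B =>
    rcases r with _ | k | k
    · exact .inr (.inr ⟨rfl, HEq.rfl⟩)
    · exact .inl ⟨k, rfl⟩
    · exact .inr (.inl ⟨trivial, k, rfl⟩)
  | C =>
    rcases r with k | k
    · exact .inl ⟨k, rfl⟩
    · exact .inr (.inl ⟨trivial, k, rfl⟩)
  | D =>
    rcases r with k | k
    · exact .inl ⟨k, rfl⟩
    · exact .inr (.inl ⟨trivial, k, rfl⟩)

theorem weight_pI (k : Fin n) : weight V n (pI V k) = Pi.single k 1 := by
  cases V <;> rfl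

theorem weight_mI (hV : V.HasZero) (k : Fin n) : weight V n (mI V k) = -Pi.single k 1 := by
  cases V <;> first | rfl | exact hV.elim

theorem weight_zI : weight .B n zI = 0 := rfl

theorem weight_zero {r : RepIdx V n} (hV : V = .B) (h : HEq r (zI (n := n))) :
    weight V n r = 0 := by
  subst hV
  rw [eq_of_heq h]
  rfl

/-- The possible weights. -/
theorem weight_cases (r : RepIdx V n) : (∃ k, r = pI V k ∧ weight V n r = Pi.single k 1) ∨
    (V.HasZero ∧ ∃ k, r = mI V k ∧ weight V n r = -Pi.single k 1) ∨
    (V = .B ∧ HEq r (zI (n := n)) ∧ weight V n r = 0) := by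
  rcases idx_cases r with ⟨k, rfl⟩ | ⟨hV, k, rfl⟩ | ⟨hV, h⟩
  · exact .inl ⟨k, rfl, weight_pI k⟩
  · exact .inr (.inl ⟨hV, k, rfl, weight_mI hV k⟩)
  · exact .inr (.inr ⟨hV, h, weight_zero hV h⟩)

theorem weight_injective {r s : RepIdx V n} (h : weight V n r = weight V n s) : r = s := by
  rcases weight_cases r with ⟨k, rfl, hk⟩ | ⟨hV, k, rfl, hk⟩ | ⟨hV, hr, hk⟩ <;>
  rcases weight_cases s with ⟨l, rfl, hl⟩ | ⟨hV', l, rfl, hl⟩ | ⟨hV', hs, hl⟩ <;>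
  rw [hk, hl] at h <;>
  first
  | exact eq_of_heq (hr.trans hs.symm)
  | (have h1 := congrFun h k
     have h2 := congrFun h l
     simp only [Pi.single_apply, Pi.neg_apply, Pi.zero_apply] at h1 h2
     grind)
  | (have h1 := congrFun h k
     simp [Pi.single_apply] at h1)
  | (have h1 := congrFun h l
     simp [Pi.single_apply] at h1)

theorem weight_opp (hV : V.HasZero) (r : RepIdx V n) : weight V n (opp r) = -weight V n r := by
  cases V with
  | A => exact hV.elim
  | Astar => exact hV.elim
  | B => rcases r with _ | k | k; exacts [neg_zero.symm, rfl, (neg_neg _).symm]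
  | C => rcases r with k | k; exacts [rfl, (neg_neg _).symm]
  | D => rcases r with k | k; exacts [rfl, (neg_neg _).symm]

theorem opp_opp (hV : V.HasZero) (r : RepIdx V n) : opp (opp r) = r :=
  weight_injective (by rw [weight_opp hV, weight_opp hV, neg_neg])

theorem opp_pI (hV : V.HasZero) (k : Fin n) : opp (pI V k) = mI V k :=
  weight_injective (by rw [weight_opp hV, weight_pI, weight_mI hV])

theorem opp_mI (hV : V.HasZero) (k : Fin n) : opp (mI V k) = pI V k := by
  rw [← opp_pI hV, opp_opp hV]

theorem opp_zI : opp (zI (n := n)) = zI := rfl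

theorem pI_injective {k l : Fin n} (h : pI V k = pI V l) : k = l := by
  have h1 := congrFun (congrArg (weight V n) h) k
  rw [weight_pI, weight_pI] at h1
  simp only [Pi.single_apply] at h1
  grind

theorem pI_ne_mI (hV : V.HasZero) (k l : Fin n) : pI V k ≠ mI V l := by
  intro h
  have h1 := congrFun (congrArg (weight V n) h) k
  rw [weight_pI, weight_mI hV] at h1
  simp only [Pi.single_apply, Pi.neg_apply] at h1
  grind

/-! ### Positions of the root vectors -/

theorem eq_diff {i j : Fin n} (hij : i ≠ j) {r s : RepIdx V n}
    (h : weight V n r - weight V n s = Pi.single i 1 - Pi.single j 1) :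
    (r = pI V i ∧ s = pI V j) ∨ (V.HasZero ∧ r = mI V j ∧ s = mI V i) := by
  have h1 := congrFun h i
  have h2 := congrFun h j
  rcases weight_cases r with ⟨k, rfl, hk⟩ | ⟨hV, k, rfl, hk⟩ | ⟨hV, hr, hk⟩ <;>
  rcases weight_cases s with ⟨l, rfl, hl⟩ | ⟨hV', l, rfl, hl⟩ | ⟨hV', hs, hl⟩ <;>
  rw [hk, hl] at h1 h2 <;>
  simp only [Pi.sub_apply, Pi.single_apply, Pi.neg_apply, Pi.zero_apply] at h1 h2 <;> grind

theorem eq_sum {i j : Fin n} {r s : RepIdx V n}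
    (h : weight V n r - weight V n s = Pi.single i 1 + Pi.single j 1) :
    V.HasZero ∧ ((r = pI V i ∧ s = mI V j) ∨ (r = pI V j ∧ s = mI V i)) := by
  have h1 := congrFun h i
  have h2 := congrFun h j
  rcases weight_cases r with ⟨k, rfl, hk⟩ | ⟨hV, k, rfl, hk⟩ | ⟨hV, hr, hk⟩ <;>
  rcases weight_cases s with ⟨l, rfl, hl⟩ | ⟨hV', l, rfl, hl⟩ | ⟨hV', hs, hl⟩ <;>
  rw [hk, hl] at h1 h2 <;>
  simp only [Pi.sub_apply, Pi.add_apply, Pi.single_apply, Pi.neg_apply, Pi.zero_apply] at h1 h2 <;>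
  grind

theorem eq_two {i : Fin n} {r s : RepIdx V n}
    (h : weight V n r - weight V n s = Pi.single i 2) :
    V.HasZero ∧ r = pI V i ∧ s = mI V i := by
  simpa using eq_sum (i := i) (j := i) (by rw [h, ← Pi.single_add]; rfl)

theorem eq_one {i : Fin n} {r s : RepIdx .B n}
    (h : weight .B n r - weight .B n s = Pi.single i 1) :
    (r = pI .B i ∧ s = zI) ∨ (r = zI ∧ s = mI .B i) := by
  have h1 := congrFun h i
  rcases weight_cases r with ⟨k, rfl, hk⟩ | ⟨hV, k, rfl, hk⟩ | ⟨hV, hr, hk⟩ <;>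
  rcases weight_cases s with ⟨l, rfl, hl⟩ | ⟨hV', l, rfl, hl⟩ | ⟨hV', hs, hl⟩ <;>
  rw [hk, hl] at h h1 <;>
  simp only [Pi.sub_apply, Pi.single_apply, Pi.neg_apply, Pi.zero_apply] at h1 <;>
  first
  | (exfalso; grind)
  | (have h2 := congrFun h k
     have h3 := congrFun h l
     simp only [Pi.sub_apply, Pi.single_apply, Pi.neg_apply, Pi.zero_apply] at h2 h3
     exfalso
     grind)
  | exact .inl ⟨by grind, eq_of_heq hs⟩
  | exact .inr ⟨eq_of_heq hr, by grind⟩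

/-! ### Root vectors -/

section RootVectors

variable {F : Type*} [Field F]

theorem rootVector_diff_of_hasZero (hV : V.HasZero) (i j : Fin n) :
    rootVector n F V (.diff i j) =
      Matrix.single (pI V i) (pI V j) 1 - Matrix.single (mI V j) (mI V i) 1 := by
  cases V <;> first | rfl | exact hV.elim

theorem rootVector_diff (hV : ¬ V.HasZero) (i j : Fin n) :
    rootVector n F V (.diff i j) = Matrix.single (pI V i) (pI V j) 1 := by
  cases V <;> first | rfl | exact (hV trivial).elim

/-- The sign in the root vectors of the roots `e_i + e_j`. -/
def sumSign (F : Type*) [Field F] (V : ClassicalType) : F := if V = .C then 1 else -1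

theorem rootVector_sum (hV : V.HasZero) (i j : Fin n) :
    rootVector n F V (.sum i j) = Matrix.single (pI V i) (mI V j) 1 +
      Matrix.single (pI V j) (mI V i) (sumSign F V) := by
  cases V <;> first | exact hV.elim | skip
  · rw [sumSign, if_neg (by decide), ← Matrix.single_neg, ← sub_eq_add_neg]; rfl
  · rw [sumSign, if_pos rfl]; rfl
  · rw [sumSign, if_neg (by decide), ← Matrix.single_neg, ← sub_eq_add_neg]; rfl

theorem rootVector_negSum (hV : V.HasZero) (i j : Fin n) :
    rootVector n F V (.negSum i j) = Matrix.single (mI V j) (pI V i) 1 +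
      Matrix.single (mI V i) (pI V j) (sumSign F V) := by
  cases V <;> first | exact hV.elim | skip
  · rw [sumSign, if_neg (by decide), ← Matrix.single_neg, ← sub_eq_add_neg]; rfl
  · rw [sumSign, if_pos rfl]; rfl
  · rw [sumSign, if_neg (by decide), ← Matrix.single_neg, ← sub_eq_add_neg]; rfl

/-- The matrix is supported at the positions `(r, s)` with `weight r - weight s = v`. -/
def Supp (v : Fin n → ℤ) (M : Matrix (RepIdx V n) (RepIdx V n) F) : Prop :=
  ∀ r s, M r s ≠ 0 → weight V n r - weight V n s = v

theorem supp_single {v : Fin n → ℤ} {a b : RepIdx V n} (h : weight V n a - weight V n b = v)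
    (c : F) : Supp v (Matrix.single a b c) := by
  intro r s hrs
  rw [Matrix.single_apply] at hrs
  by_cases hc : a = r ∧ b = s
  · rw [← hc.1, ← hc.2, h]
  · exact absurd (if_neg hc) hrs

theorem Supp.add {v : Fin n → ℤ} {M N : Matrix (RepIdx V n) (RepIdx V n) F} (hM : Supp v M)
    (hN : Supp v N) : Supp v (M + N) := by
  intro r s hrs
  by_cases h : M r s = 0
  · exact hN r s fun h' => hrs (by rw [Matrix.add_apply, h, h', add_zero])
  · exact hM r s h

theorem Supp.sub {v : Fin n → ℤ} {M N : Matrix (RepIdx V n) (RepIdx V n) F} (hM : Supp v M)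
    (hN : Supp v N) : Supp v (M - N) := by
  intro r s hrs
  by_cases h : M r s = 0
  · exact hN r s fun h' => hrs (by rw [Matrix.sub_apply, h, h', sub_zero])
  · exact hM r s h

theorem Supp.mul {v w : Fin n → ℤ} {M N : Matrix (RepIdx V n) (RepIdx V n) F} (hM : Supp v M)
    (hN : Supp w N) : Supp (v + w) (M * N) := by
  intro r s hrs
  rw [Matrix.mul_apply] at hrs
  obtain ⟨k, -, hk⟩ := Finset.exists_ne_zero_of_sum_ne_zero hrs
  rw [← hM r k (left_ne_zero_of_mul hk), ← hN k s (right_ne_zero_of_mul hk)]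
  abel

theorem RootName.IsRoot.eq_or_eq {a : RootName n} (ha : a.IsRoot V)
    (h : ∃ i, a = .single i ∨ a = .negSingle i) : V = .B ∨ V = .C := by
  obtain ⟨i, rfl | rfl⟩ := h <;> simpa [RootName.IsRoot, RootName.IsPos, RootName.neg] using ha

theorem supp_rootVector {a : RootName n} (ha : a.IsRoot V) :
    Supp (a.root V) (rootVector n F V a) := by
  by_cases hV : V.HasZero
  · cases a with
    | diff i j =>
      rw [rootVector_diff_of_hasZero hV]
      exact (supp_single (by rw [weight_pI, weight_pI]; rfl) _).sub
        (supp_single (by rw [weight_mI hV, weight_mI hV, RootName.root]; abel) _)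
    | sum i j =>
      rw [rootVector_sum hV]
      exact (supp_single (by rw [weight_pI, weight_mI hV, RootName.root]; abel) _).add
        (supp_single (by rw [weight_pI, weight_mI hV, RootName.root]; abel) _)
    | negSum i j =>
      rw [rootVector_negSum hV]
      exact (supp_single (by rw [weight_pI, weight_mI hV, RootName.root]; abel) _).add
        (supp_single (by rw [weight_pI, weight_mI hV, RootName.root]; abel) _)
    | single i =>
      rcases ha.eq_or_eq ⟨i, by simp⟩ with rfl | rfl
      · exact (supp_single (a := pI .B i) (b := zI) (by rw [weight_pI, weight_zI, sub_zero]; rfl) _).sub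
          (supp_single (a := zI) (b := mI .B i)
            (by rw [weight_mI hV, weight_zI, zero_sub, neg_neg]; rfl) _)
      · refine supp_single (a := pI .C i) (b := mI .C i) ?_ _
        rw [weight_pI, weight_mI hV, sub_neg_eq_add, ← Pi.single_add]
        rfl
    | negSingle i =>
      rcases ha.eq_or_eq ⟨i, by simp⟩ with rfl | rfl
      · exact (supp_single (a := zI) (b := pI .B i) (by rw [weight_pI, weight_zI, zero_sub]; rfl) _).sub
          (supp_single (a := mI .B i) (b := zI) (by rw [weight_mI hV, weight_zI, sub_zero]; rfl) _)
      · refine supp_single (a := mI .C i) (b := pI .C i) ?_ _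
        rw [weight_pI, weight_mI hV, ← neg_add', ← Pi.single_add]
        rfl
  · cases a with
    | diff i j =>
      rw [rootVector_diff hV]
      exact supp_single (by rw [weight_pI, weight_pI]; rfl) _
    | _ => cases V <;> simp_all [RootName.IsRoot, RootName.IsPos, RootName.neg, ClassicalType.HasZero]

/-! ### The invariant form -/

/-- The matrix of the invariant bilinear form, in types `B`, `C` and `D`. -/
def formMatrix (F : Type*) [Field F] (V : ClassicalType) (n : ℕ) :
    Matrix (RepIdx V n) (RepIdx V n) F :=
  Matrix.of fun r s => if s = opp r then formCoef F r else 0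

/-- Matrices in the Lie algebra of the form. -/
def Skew (X : Matrix (RepIdx V n) (RepIdx V n) F) : Prop :=
  V.HasZero → Xᵀ * formMatrix F V n + formMatrix F V n * X = 0

/-- Matrices preserving the form. -/
def Isom (X : Matrix (RepIdx V n) (RepIdx V n) F) : Prop :=
  V.HasZero → Xᵀ * formMatrix F V n * X = formMatrix F V n

theorem mul_form_apply (hV : V.HasZero) (X : Matrix (RepIdx V n) (RepIdx V n) F)
    (r s : RepIdx V n) : (X * formMatrix F V n) r s = X r (opp s) * formCoef F (opp s) := by
  rw [Matrix.mul_apply, Finset.sum_eq_single (opp s)]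
  · simp [formMatrix, opp_opp hV]
  · intro k _ hk
    have : ¬ s = opp k := fun e => hk (by rw [e, opp_opp hV])
    simp [formMatrix, this]
  · simp

theorem form_mul_apply (X : Matrix (RepIdx V n) (RepIdx V n) F)
    (r s : RepIdx V n) : (formMatrix F V n * X) r s = formCoef F r * X (opp r) s := by
  rw [Matrix.mul_apply, Finset.sum_eq_single (opp r)]
  · simp [formMatrix]
  · intro k _ hk
    simp [formMatrix, hk]
  · simp

theorem form_single (hV : V.HasZero) (a b : RepIdx V n) (c : F) :
    (Matrix.single a b c)ᵀ * formMatrix F V n + formMatrix F V n * Matrix.single a b c =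
      Matrix.single b (opp a) (c * formCoef F a) +
        Matrix.single (opp a) b (formCoef F (opp a) * c) := by
  congr 1 <;> ext r s
  · rw [mul_form_apply hV, Matrix.transpose_apply, Matrix.single_apply, Matrix.single_apply]
    by_cases h : a = opp s
    · rw [h, opp_opp hV]
      split_ifs <;> simp_all
    · have : opp a ≠ s := fun e => h (by rw [← e, opp_opp hV])
      simp [h, this]
  · rw [form_mul_apply, Matrix.single_apply, Matrix.single_apply]
    by_cases h : a = opp r
    · rw [h, opp_opp hV]
      split_ifs <;> simp_all
    · have : opp a ≠ r := fun e => h (by rw [← e, opp_opp hV])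
      simp [h, this]

theorem skew_pair (a b : RepIdx V n) {c c' : F}
    (h1 : c * formCoef F a + formCoef F b * c' = 0)
    (h2 : formCoef F (opp a) * c + c' * formCoef F (opp b) = 0) :
    Skew (Matrix.single a b c + Matrix.single (opp b) (opp a) c') := by
  intro hV
  rw [Matrix.transpose_add, add_mul, mul_add, add_add_add_comm, form_single hV, form_single hV,
    opp_opp hV, add_comm (Matrix.single (opp a) b (c' * _)), add_add_add_comm,
    ← Matrix.single_add, ← Matrix.single_add, h1, h2, Matrix.single_zero, Matrix.single_zero,
    add_zero]

theorem formCoef_pI (k : Fin n) : formCoef F (pI V k) = 1 := by cases V <;> rfl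

theorem formCoef_mI (hV : V.HasZero) (k : Fin n) : formCoef F (mI V k) = -sumSign F V := by
  cases V <;> first | exact hV.elim | skip
  · rw [sumSign, if_neg (by decide), neg_neg]; rfl
  · rw [sumSign, if_pos rfl]; rfl
  · rw [sumSign, if_neg (by decide), neg_neg]; rfl

theorem skew_diff (i j : Fin n) : Skew (rootVector n F V (.diff i j)) := by
  intro hV
  rw [rootVector_diff_of_hasZero hV, sub_eq_add_neg, Matrix.single_neg, ← opp_pI hV,
    ← opp_pI hV]
  refine skew_pair _ _ ?_ ?_ hV
  · rw [formCoef_pI, formCoef_pI]; ring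
  · rw [opp_pI hV, opp_pI hV, formCoef_mI hV, formCoef_mI hV]; ring

theorem sumSign_mul_self : sumSign F V * sumSign F V = 1 := by
  rw [sumSign]; split_ifs <;> ring

theorem skew_sum (i j : Fin n) :
    Skew (Matrix.single (pI V i) (mI V j) 1 + Matrix.single (pI V j) (mI V i) (sumSign F V)) := by
  intro hV
  rw [← opp_pI hV i, ← opp_mI hV j]
  refine skew_pair _ _ ?_ ?_ hV
  · rw [formCoef_pI, formCoef_mI hV]; linear_combination (-1 : F) * sumSign_mul_self (F := F) (V := V)
  · rw [opp_pI hV, formCoef_mI hV, opp_mI hV, formCoef_pI]; ring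

theorem skew_rootVector {a : RootName n} (ha : a.IsRoot V) : Skew (rootVector n F V a) := by
  cases a with
  | diff i j => exact skew_diff i j
  | sum i j =>
    intro hV
    rw [rootVector_sum hV]
    exact skew_sum i j hV
  | negSum i j =>
    intro hV
    rw [rootVector_negSum hV, ← opp_pI hV i, ← opp_mI hV j]
    refine skew_pair _ _ ?_ ?_ hV
    · rw [formCoef_pI, formCoef_mI hV]; ring
    · rw [opp_mI hV, opp_pI hV, formCoef_mI hV, formCoef_pI]
      linear_combination (-1 : F) * sumSign_mul_self (F := F) (V := V)
  | single i =>
    rcases ha.eq_or_eq ⟨i, by simp⟩ with rfl | rfl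
    · have := skew_pair (F := F) (pI .B i) zI (c := 2) (c' := -1)
        (by rw [formCoef_pI, show formCoef F (zI (n := n)) = 2 from rfl]; ring)
        (by rw [opp_zI, show formCoef F (zI (n := n)) = 2 from rfl]
            change (1 : F) * 2 + _ = 0
            ring)
      rw [← Matrix.single_neg, ← sub_eq_add_neg] at this
      exact this
    · intro hV
      have := form_single (F := F) hV (pI .C i) (mI .C i) 1
      rw [opp_pI hV, ← Matrix.single_add, formCoef_pI, formCoef_mI hV, sumSign, if_pos rfl] at this
      refine Eq.trans this ?_
      rw [show (1 : F) * 1 + -1 * 1 = 0 by ring, Matrix.single_zero]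
  | negSingle i =>
    rcases ha.eq_or_eq ⟨i, by simp⟩ with rfl | rfl
    · have := skew_pair (F := F) zI (pI .B i) (c := 1) (c' := -2)
        (by rw [formCoef_pI, show formCoef F (zI (n := n)) = 2 from rfl]; ring)
        (by rw [opp_zI, show formCoef F (zI (n := n)) = 2 from rfl]
            change (2 : F) * 1 + -2 * 1 = 0
            ring)
      rw [← Matrix.single_neg, ← sub_eq_add_neg] at this
      exact this
    · intro hV
      have := form_single (F := F) hV (mI .C i) (pI .C i) 1
      rw [opp_mI hV, ← Matrix.single_add, formCoef_pI, formCoef_mI hV, sumSign, if_pos rfl] at this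
      refine Eq.trans this ?_
      rw [show (1 : F) * -1 + 1 * 1 = 0 by ring, Matrix.single_zero]

theorem Skew.apply {X : Matrix (RepIdx V n) (RepIdx V n) F} (h : Skew X) (hV : V.HasZero)
    (r s : RepIdx V n) : X (opp s) r * formCoef F (opp s) + formCoef F r * X (opp r) s = 0 := by
  have := congrFun (congrFun (h hV) r) s
  rwa [Matrix.add_apply, mul_form_apply hV, form_mul_apply, Matrix.transpose_apply] at this

/-- The root spaces are one-dimensional. -/
theorem eq_smul_rootVector (h2 : (2 : F) ≠ 0) {a : RootName n} (ha : a.IsPos V)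
    {X : Matrix (RepIdx V n) (RepIdx V n) F} (hX : Supp (a.root V) X) (hs : Skew X) :
    ∃ c : F, X = c • rootVector n F V a := by
  have key : ∀ c : F, (∀ r s, weight V n r - weight V n s = a.root V →
      X r s = c * rootVector n F V a r s) → X = c • rootVector n F V a := by
    intro c hc
    ext r s
    by_cases h : weight V n r - weight V n s = a.root V
    · exact hc r s h
    · have h1 : X r s = 0 := by_contra fun h' => h (hX r s h')
      have h3 : rootVector n F V a r s = 0 := by_contra fun h' => h (supp_rootVector (.inl ha) r s h')
      rw [Matrix.smul_apply, h1, h3, smul_zero]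
  cases a with
  | diff i j =>
    have hij : i ≠ j := fun e => by simp [RootName.IsPos, e] at ha
    refine ⟨X (pI V i) (pI V j), key _ fun r s h => ?_⟩
    rcases eq_diff hij h with ⟨rfl, rfl⟩ | ⟨hV, rfl, rfl⟩
    · by_cases hV : V.HasZero
      · rw [rootVector_diff_of_hasZero hV]
        simp [Matrix.single_apply, (pI_ne_mI hV _ _).symm]
      · rw [rootVector_diff hV]
        simp
    · have h3 := hs.apply hV (pI V j) (mI V i)
      rw [opp_mI hV, opp_pI hV, formCoef_pI, formCoef_pI] at h3
      rw [rootVector_diff_of_hasZero hV]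
      simp only [Matrix.sub_apply, Matrix.single_apply, pI_ne_mI hV, if_true, and_self, false_and,
        if_false]
      linear_combination h3
  | sum i j =>
    have hij : i ≠ j := fun e => by simp [RootName.IsPos, e] at ha
    have hV : V.HasZero := ha.2
    refine ⟨X (pI V i) (mI V j), key _ fun r s h => ?_⟩
    have hpij : pI V i ≠ pI V j := fun e => hij (pI_injective e)
    rw [rootVector_sum hV]
    rcases (eq_sum h).2 with ⟨rfl, rfl⟩ | ⟨rfl, rfl⟩
    · simp [Matrix.single_apply, hpij.symm]
    · have h3 := hs.apply hV (mI V j) (mI V i)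
      rw [opp_mI hV, opp_mI hV, formCoef_pI, formCoef_mI hV] at h3
      simp only [Matrix.add_apply, Matrix.single_apply, hpij, if_true, and_self, false_and,
        if_false]
      linear_combination (-sumSign F V) * h3 - (X (pI V j) (mI V i)) * sumSign_mul_self (F := F) (V := V)
  | negSum i j => exact ha.elim
  | single i =>
    have ha' : V = .B ∨ V = .C := ha
    rcases ha' with rfl | rfl
    · refine ⟨X (pI .B i) zI / 2, key _ fun r s h => ?_⟩
      have hv : rootVector n F .B (.single i) =
          Matrix.single (pI .B i) zI 2 - Matrix.single zI (mI .B i) 1 := rfl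
      rw [hv]
      have hz : (zI (n := n)) ≠ pI .B i := fun e => by cases e
      rcases eq_one h with ⟨rfl, rfl⟩ | ⟨rfl, rfl⟩
      · simp [Matrix.single_apply, hz, h2]
      · have h3 := hs.apply trivial zI (mI .B i)
        rw [opp_mI (V := .B) trivial, opp_zI, formCoef_pI, show formCoef F (zI (n := n)) = 2 from rfl] at h3
        simp only [Matrix.sub_apply, Matrix.single_apply, hz.symm, if_true, and_self, false_and,
          if_false]
        field_simp
        linear_combination h3
    · refine ⟨X (pI .C i) (mI .C i), key _ fun r s h => ?_⟩
      have hv : rootVector n F .C (.single i) = Matrix.single (pI .C i) (mI .C i) 1 := rfl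
      obtain ⟨-, rfl, rfl⟩ := eq_two h
      rw [hv]
      simp
  | negSingle i => exact ha.elim

end RootVectors
end

section
variable {V : ClassicalType} {n : ℕ}

/-! ### The root subgroups -/

section RootSubgroups

variable {F : Type*} [Field F]

theorem abs_weight_le (r : RepIdx V n) (k : Fin n) : |weight V n r k| ≤ 1 := by
  rcases weight_cases r with ⟨l, -, h⟩ | ⟨-, l, -, h⟩ | ⟨-, -, h⟩ <;> rw [h]
  · rw [Pi.single_apply]; split_ifs <;> simp
  · rw [Pi.neg_apply, Pi.single_apply]; split_ifs <;> simp
  · simp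

theorem root_neg (a : RootName n) : a.neg.root V = -a.root V := by
  cases a <;> simp [RootName.neg, RootName.root]

theorem IsRoot.height_ne {a : RootName n} (ha : a.IsRoot V) : height V (a.root V) ≠ 0 := by
  rcases ha with ha | ha
  · exact (height_pos ⟨a, ha, rfl⟩).ne'
  · have := height_pos ⟨_, ha, rfl⟩
    rw [root_neg, height_neg] at this
    linarith

theorem rootVector_cube {a : RootName n} (ha : a.IsRoot V) :
    rootVector n F V a * rootVector n F V a * rootVector n F V a = 0 := by
  ext r s
  by_contra h
  have h1 := ((supp_rootVector (F := F) ha).mul (supp_rootVector ha)).mul (supp_rootVector ha) r s h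
  have h2 : a.root V = 0 := by
    ext k
    have h3 := congrFun h1 k
    simp only [Pi.sub_apply, Pi.add_apply] at h3
    have h4 := abs_le.1 (abs_weight_le r k)
    have h5 := abs_le.1 (abs_weight_le s k)
    rw [Pi.zero_apply]
    omega
  exact IsRoot.height_ne ha (by rw [h2]; simp [height])

theorem xMatrix_add (h2 : (2 : F) ≠ 0) {a : RootName n} (ha : a.IsRoot V) (s t : F) :
    xMatrix V n F a (s + t) = xMatrix V n F a s * xMatrix V n F a t := by
  have h3 := rootVector_cube (F := F) ha
  simp only [xMatrix]
  set X := rootVector n F V a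
  have h4 : (s + t) ^ 2 / 2 = s ^ 2 / 2 + s * t + t ^ 2 / 2 := by field_simp; ring
  have e1 : X * X ^ 2 = 0 := by rw [sq, ← mul_assoc, h3]
  have e2 : X ^ 2 * X = 0 := by rw [sq, h3]
  have e3 : X ^ 2 * X ^ 2 = 0 := by rw [sq X, ← mul_assoc, h3, zero_mul]
  rw [h4]
  simp only [mul_add, add_mul, mul_one, one_mul, smul_mul_smul_comm, e1, e2, e3, smul_zero,
    add_zero]
  rw [← sq X]
  module

theorem xMatrix_zero (a : RootName n) : xMatrix V n F a 0 = 1 := by simp [xMatrix]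

theorem Skew.isom_xMatrix (h2 : (2 : F) ≠ 0) {a : RootName n} (ha : a.IsRoot V) (t : F) :
    Isom (xMatrix V n F a t) := by
  intro hV
  have h1 : (rootVector n F V a)ᵀ * formMatrix F V n = -(formMatrix F V n * rootVector n F V a) :=
    eq_neg_of_add_eq_zero_left (skew_rootVector ha hV)
  have h3 : (xMatrix V n F a t)ᵀ * formMatrix F V n = formMatrix F V n * xMatrix V n F a (-t) := by
    simp only [xMatrix, sq, Matrix.transpose_add, Matrix.transpose_one, Matrix.transpose_smul,
      Matrix.transpose_mul, add_mul, mul_add, one_mul, mul_one, Matrix.smul_mul, Matrix.mul_smul,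
      mul_assoc, h1, mul_neg, neg_mul, neg_neg, smul_neg, neg_smul]
    rw [← mul_assoc _ (formMatrix F V n), h1, neg_mul, mul_assoc, smul_neg, neg_neg]
  rw [h3, mul_assoc, ← xMatrix_add h2 ha, neg_add_cancel, xMatrix_zero, mul_one]

theorem Isom.mul {M N : Matrix (RepIdx V n) (RepIdx V n) F} (hM : Isom M) (hN : Isom N) :
    Isom (M * N) := by
  intro hV
  rw [Matrix.transpose_mul, ← mul_assoc, mul_assoc Nᵀ, mul_assoc Nᵀ, hM hV, hN hV]

theorem Isom.of_mul_eq_one {M N : Matrix (RepIdx V n) (RepIdx V n) F} (hM : Isom M)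
    (h : M * N = 1) : Isom N := by
  intro hV
  rw [← hM hV, ← mul_assoc, ← mul_assoc, ← Matrix.transpose_mul, h, Matrix.transpose_one, one_mul,
    hM hV, mul_assoc, h, mul_one]

theorem Isom.skew_conj {g g' X : Matrix (RepIdx V n) (RepIdx V n) F} (hg : Isom g)
    (h : g * g' = 1) (hX : Skew X) : Skew (g * X * g') := by
  intro hV
  have hg' : Isom g' := hg.of_mul_eq_one h
  have h' : g' * g = 1 := mul_eq_one_comm.1 h
  have e1 : gᵀ * formMatrix F V n = formMatrix F V n * g' := by
    calc gᵀ * formMatrix F V n = gᵀ * formMatrix F V n * g * g' := by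
          rw [mul_assoc _ g, h, mul_one]
      _ = _ := by rw [hg hV]
  have e2 : g'ᵀ * formMatrix F V n = formMatrix F V n * g := by
    calc g'ᵀ * formMatrix F V n = g'ᵀ * formMatrix F V n * g' * g := by
          rw [mul_assoc _ g', h', mul_one]
      _ = _ := by rw [hg' hV]
  have e3 := hX hV
  rw [Matrix.transpose_mul, Matrix.transpose_mul, mul_assoc, mul_assoc, e1, ← mul_assoc Xᵀ,
    eq_neg_of_add_eq_zero_left e3, mul_assoc, neg_mul, mul_neg, ← mul_assoc, ← mul_assoc, e2]
  simp [mul_assoc]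

/-! ### Monomial matrices -/

/-- The monomial matrix over the Weyl group element `w` with the coefficients `ε`. -/
def mono (w : Matrix (Fin n) (Fin n) ℤ) (ε : (Fin n → ℤ) → F) :
    Matrix (RepIdx V n) (RepIdx V n) F :=
  Matrix.of fun r s => if weight V n r = w *ᵥ weight V n s then ε (weight V n s) else 0

theorem mono_apply (w : Matrix (Fin n) (Fin n) ℤ) (ε : (Fin n → ℤ) → F) (r s : RepIdx V n) :
    mono w ε r s = if weight V n r = w *ᵥ weight V n s then ε (weight V n s) else 0 := rfl

/-- The matrix permutes the weights. -/
def Stable (V : ClassicalType) (w : Matrix (Fin n) (Fin n) ℤ) : Prop :=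
  ∀ s : RepIdx V n, ∃ r : RepIdx V n, weight V n r = w *ᵥ weight V n s

theorem mono_mul {w w' : Matrix (Fin n) (Fin n) ℤ} (hw : Stable V w') (ε ε' : (Fin n → ℤ) → F) :
    (mono w ε * mono w' ε' : Matrix (RepIdx V n) (RepIdx V n) F) =
      mono (w * w') fun v => ε (w' *ᵥ v) * ε' v := by
  ext r s
  obtain ⟨k, hk⟩ := hw s
  rw [Matrix.mul_apply, Finset.sum_eq_single k]
  · simp only [mono_apply, ← mulVec_mulVec, hk, if_true]
    split_ifs <;> simp
  · intro l _ hl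
    rw [mono_apply w', if_neg fun e => hl (weight_injective (e.trans hk.symm)), mul_zero]
  · simp

theorem mono_congr {w : Matrix (Fin n) (Fin n) ℤ} {ε ε' : (Fin n → ℤ) → F}
    (h : ∀ s : RepIdx V n, ε (weight V n s) = ε' (weight V n s)) :
    (mono w ε : Matrix (RepIdx V n) (RepIdx V n) F) = mono w ε' := by
  ext r s
  rw [mono_apply, mono_apply, h]

theorem mono_one : (mono 1 1 : Matrix (RepIdx V n) (RepIdx V n) F) = 1 := by
  ext r s
  rw [mono_apply, one_mulVec, Matrix.one_apply]
  exact if_congr ⟨weight_injective, fun h => by rw [h]⟩ rfl rfl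

theorem hMatrix_eq (H : Fin n → ℤ) (t : Fˣ) :
    hMatrix V n F H t = mono 1 fun v => ((t ^ (v ⬝ᵥ H) : Fˣ) : F) := by
  ext r s
  rw [mono_apply, one_mulVec, hMatrix, Matrix.diagonal_apply]
  by_cases h : r = s
  · subst h
    rw [if_pos rfl, if_pos rfl]
    rfl
  · rw [if_neg h, if_neg fun e => h (weight_injective e)]

theorem stable_one : Stable V (1 : Matrix (Fin n) (Fin n) ℤ) := fun s => ⟨s, (one_mulVec _).symm⟩

theorem Stable.mul {w w' : Matrix (Fin n) (Fin n) ℤ} (h : Stable V w) (h' : Stable V w') :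
    Stable V (w * w') := fun s => by
  obtain ⟨k, hk⟩ := h' s
  obtain ⟨r, hr⟩ := h k
  exact ⟨r, by rw [hr, hk, mulVec_mulVec]⟩

theorem refl_apply [GoodRank V n] (i : SimpleIdx V n) (v : Fin n → ℤ) (k : Fin n) :
    (simpleReflection i *ᵥ v) k = v k - (v ⬝ᵥ i.coroot) * i.root k := by
  rw [simpleReflection_mulVec', dotProduct_comm]
  rfl

theorem stable_simpleReflection [GoodRank V n] (i : SimpleIdx V n) :
    Stable V (simpleReflection i) := by
  have key : ∀ k : Fin n, ∃ r : RepIdx V n,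
      weight V n r = simpleReflection i *ᵥ Pi.single k 1 := by
    intro k
    have hs : ∀ l, (simpleReflection i *ᵥ Pi.single k 1) l = (Pi.single k 1 : Fin n → ℤ) l - i.coroot k * i.root l := by
      intro l
      rw [refl_apply, single_dotProduct, one_mul]
    cases simpleShape i with
    | diff p hp h =>
      simp only [SimpleIdx.coroot, SimpleIdx.root, h, RootName.coroot, RootName.root,
        Pi.sub_apply] at hs
      have hip : i.1 ≠ p := fun e => by rw [e] at hp; omega
      refine ⟨pI V (if k = i.1 then p else if k = p then i.1 else k), funext fun l => ?_⟩
      rw [weight_pI, hs]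
      simp only [Pi.single_apply]
      grind
    | single h0 hV h =>
      have hV' : V.HasZero := by rcases hV with rfl | rfl <;> trivial
      simp only [SimpleIdx.coroot, SimpleIdx.root, h, RootName.coroot, RootName.root] at hs
      by_cases hk : k = i.1
      · refine ⟨mI V k, funext fun l => ?_⟩
        rw [weight_mI hV', hs]
        simp only [Pi.single_apply, Pi.neg_apply]
        rcases hV with rfl | rfl <;> grind
      · refine ⟨pI V k, funext fun l => ?_⟩
        rw [weight_pI, hs]
        simp only [Pi.single_apply]
        grind
    | sum p h0 hp hV h =>
      subst hV
      simp only [SimpleIdx.coroot, SimpleIdx.root, h, RootName.coroot, RootName.root,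
        Pi.add_apply] at hs
      have hip : i.1 ≠ p := fun e => by rw [e] at h0; omega
      by_cases hk : k = i.1 ∨ k = p
      · refine ⟨mI .D (if k = i.1 then p else i.1), funext fun l => ?_⟩
        rw [weight_mI (V := .D) trivial, hs]
        simp only [Pi.single_apply, Pi.neg_apply]
        grind
      · refine ⟨pI .D k, funext fun l => ?_⟩
        rw [weight_pI, hs]
        simp only [Pi.single_apply]
        grind
  intro s
  rcases weight_cases s with ⟨k, -, h⟩ | ⟨hV, k, -, h⟩ | ⟨-, -, h⟩
  · rw [h]
    exact key k
  · obtain ⟨r, hr⟩ := key k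
    exact ⟨opp r, by rw [weight_opp hV, hr, h, mulVec_neg]⟩
  · exact ⟨s, by rw [h, mulVec_zero]⟩

theorem stable_weylElement [GoodRank V n] (L : List (SimpleIdx V n)) :
    Stable V (weylElement L) := by
  induction L with
  | nil => rw [weylElement_nil]; exact stable_one
  | cons i L ih => rw [weylElement_cons]; exact (stable_simpleReflection i).mul ih

end RootSubgroups
end

section
variable {V : ClassicalType} {n : ℕ} [GoodRank V n]

/-! ### The representatives of the simple reflections -/

section Signs

/-- The sum of the coordinates. -/
def total (v : Fin n → ℤ) : ℤ := ∑ k, v k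

/-- The parity of the sign in the column of weight `v` of the representative of `s_i`. -/
def sgnExp (i : SimpleIdx V n) (v : Fin n → ℤ) : ℤ :=
  if (i.1 : ℕ) = 0 ∧ V = .B then 1 + total v - v i.1
  else if (i.1 : ℕ) = 0 ∧ V = .C then (v i.1 + 1) / 2 else v i.1

variable (F : Type*) [Field F]

/-- `(-1)^e`. -/
def sg (e : ℤ) : F := if Even e then 1 else -1

variable {F}

theorem sg_add (a b : ℤ) : sg F (a + b) = sg F a * sg F b := by
  simp only [sg, Int.even_add]
  split_ifs <;> simp_all

theorem sg_congr {a b : ℤ} (h : Even (a - b)) : sg F a = sg F b := by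
  rw [Int.even_sub] at h
  simp only [sg, h]

theorem sg_ne_zero (a : ℤ) : sg F a ≠ 0 := by
  rw [sg]; split_ifs <;> simp

theorem refl_diff {i : SimpleIdx V n} {p : Fin n} (hp : (p : ℕ) + 1 = i.1)
    (h : i.name = .diff i.1 p) (v : Fin n → ℤ) (k : Fin n) :
    (simpleReflection i *ᵥ v) k = if k = i.1 then v p else if k = p then v i.1 else v k := by
  have hip : i.1 ≠ p := fun e => by rw [e] at hp; omega
  rw [refl_apply]
  simp only [SimpleIdx.coroot, SimpleIdx.root, h, RootName.coroot, RootName.root, Pi.sub_apply,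
    dotProduct_sub, dotProduct_single, Pi.single_apply]
  split_ifs <;> simp_all

theorem refl_sum {i : SimpleIdx V n} {p : Fin n} (hip : i.1 ≠ p)
    (h : i.name = .sum i.1 p) (v : Fin n → ℤ) (k : Fin n) :
    (simpleReflection i *ᵥ v) k = if k = i.1 then -v p else if k = p then -v i.1 else v k := by
  rw [refl_apply]
  simp only [SimpleIdx.coroot, SimpleIdx.root, h, RootName.coroot, RootName.root, Pi.add_apply,
    dotProduct_add, dotProduct_single, Pi.single_apply]
  split_ifs <;> simp_all

theorem refl_single {i : SimpleIdx V n}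
    (h : i.name = .single i.1) (v : Fin n → ℤ) (k : Fin n) :
    (simpleReflection i *ᵥ v) k = if k = i.1 then -v i.1 else v k := by
  rw [refl_apply]
  simp only [SimpleIdx.coroot, SimpleIdx.root, h, RootName.coroot, RootName.root,
    dotProduct_single, Pi.single_apply]
  split_ifs <;> simp_all <;> ring

theorem sum_refl (i : SimpleIdx V n) (v : Fin n → ℤ) :
    total (simpleReflection i *ᵥ v) = total v - (v ⬝ᵥ i.coroot) * ∑ k, i.root k := by
  rw [total, total, Finset.mul_sum, ← Finset.sum_sub_distrib]
  exact Finset.sum_congr rfl fun k _ => refl_apply i v k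

/-- The data of a simple root that determine its reflection and its sign. -/
inductive SignShape (i : SimpleIdx V n) : Prop
  | diff (p : Fin n) (hp : (p : ℕ) + 1 = i.1) (hr : i.root = Pi.single i.1 1 - Pi.single p 1)
      (hc : i.coroot = Pi.single i.1 1 - Pi.single p 1)
      (hs : ∀ v k, (simpleReflection i *ᵥ v) k =
        if k = i.1 then v p else if k = p then v i.1 else v k)
      (hS : ∀ v, total (simpleReflection i *ᵥ v) = total v)
      (he : ∀ v, sgnExp i v = v i.1)
  | singleB (h0 : (i.1 : ℕ) = 0) (hV : V = .B) (hr : i.root = Pi.single i.1 1)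
      (hc : i.coroot = Pi.single i.1 2)
      (hs : ∀ v k, (simpleReflection i *ᵥ v) k = if k = i.1 then -v i.1 else v k)
      (hS : ∀ v, total (simpleReflection i *ᵥ v) = total v - 2 * v i.1)
      (he : ∀ v, sgnExp i v = 1 + total v - v i.1)
  | singleC (h0 : (i.1 : ℕ) = 0) (hV : V = .C) (hr : i.root = Pi.single i.1 2)
      (hc : i.coroot = Pi.single i.1 1)
      (hs : ∀ v k, (simpleReflection i *ᵥ v) k = if k = i.1 then -v i.1 else v k)
      (he : ∀ v, sgnExp i v = (v i.1 + 1) / 2)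
  | sum (p : Fin n) (h0 : (i.1 : ℕ) = 0) (hp : (p : ℕ) = 1) (hV : V = .D)
      (hr : i.root = Pi.single i.1 1 + Pi.single p 1)
      (hc : i.coroot = Pi.single i.1 1 + Pi.single p 1)
      (hs : ∀ v k, (simpleReflection i *ᵥ v) k =
        if k = i.1 then -v p else if k = p then -v i.1 else v k)
      (he : ∀ v, sgnExp i v = v i.1)

theorem signShape (i : SimpleIdx V n) : SignShape i := by
  cases simpleShape i with
  | diff p hp h =>
    have h0 : (i.1 : ℕ) ≠ 0 := by omega
    have hr : i.root = Pi.single i.1 1 - Pi.single p 1 := by simp [SimpleIdx.root, h, RootName.root]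
    refine .diff p hp hr (by simp [SimpleIdx.coroot, h, RootName.coroot]) (refl_diff hp h)
      (fun v => ?_) fun v => by simp [sgnExp, h0]
    rw [sum_refl, hr]
    simp [Finset.sum_sub_distrib]
  | single h0 hV h =>
    rcases hV with rfl | rfl
    · have hr : i.root = Pi.single i.1 1 := by simp [SimpleIdx.root, h, RootName.root]
      have hc : i.coroot = Pi.single i.1 2 := by simp [SimpleIdx.coroot, h, RootName.coroot]
      refine .singleB h0 rfl hr hc (refl_single h) (fun v => ?_) fun v => by simp [sgnExp, h0]
      rw [sum_refl, hr, hc]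
      simp [mul_comm]
    · exact .singleC h0 rfl (by simp [SimpleIdx.root, h, RootName.root])
        (by simp [SimpleIdx.coroot, h, RootName.coroot]) (refl_single h)
        fun v => by simp [sgnExp, h0]
  | sum p h0 hp hV h =>
    have hip : i.1 ≠ p := fun e => by rw [e] at h0; omega
    exact .sum p h0 hp hV (by simp [SimpleIdx.root, h, RootName.root])
      (by simp [SimpleIdx.coroot, h, RootName.coroot]) (refl_sum hip h)
      fun v => by simp [sgnExp, hV]

theorem sgnExp_refl (i : SimpleIdx V n) (v : Fin n → ℤ) :
    Even (sgnExp i (simpleReflection i *ᵥ v) + sgnExp i v - v ⬝ᵥ i.coroot) := by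
  rw [Int.even_iff]
  rcases signShape i with ⟨p, hp, hr, hc, hs, hS, he⟩ | ⟨h0, hV, hr, hc, hs, hS, he⟩ |
    ⟨h0, hV, hr, hc, hs, he⟩ | ⟨p, h0, hp, hV, hr, hc, hs, he⟩ <;>
  simp only [he, hs, hc, if_true, dotProduct_sub, dotProduct_add, dotProduct_single, mul_one]
  · omega
  · rw [hS]; omega
  · rcases Int.even_or_odd' (v i.1) with ⟨k, hk | hk⟩ <;> omega
  · omega

theorem sgnExp_braid (i j : SimpleIdx V n) (v : Fin n → ℤ) :
    (i.root ⬝ᵥ j.coroot = 0 → j.root ⬝ᵥ i.coroot = 0 →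
      Even ((sgnExp i (simpleReflection j *ᵥ v) + sgnExp j v) -
        (sgnExp j (simpleReflection i *ᵥ v) + sgnExp i v))) ∧
    (i.root ⬝ᵥ j.coroot = -1 → j.root ⬝ᵥ i.coroot = -1 →
      Even ((sgnExp i (simpleReflection j *ᵥ simpleReflection i *ᵥ v) +
        (sgnExp j (simpleReflection i *ᵥ v) + sgnExp i v)) -
        (sgnExp j (simpleReflection i *ᵥ simpleReflection j *ᵥ v) +
        (sgnExp i (simpleReflection j *ᵥ v) + sgnExp j v)))) ∧
    (i.root ⬝ᵥ j.coroot = -1 → j.root ⬝ᵥ i.coroot = -2 →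
      Even ((sgnExp i (simpleReflection j *ᵥ simpleReflection i *ᵥ simpleReflection j *ᵥ v) +
        (sgnExp j (simpleReflection i *ᵥ simpleReflection j *ᵥ v) +
        (sgnExp i (simpleReflection j *ᵥ v) + sgnExp j v))) -
        (sgnExp j (simpleReflection i *ᵥ simpleReflection j *ᵥ simpleReflection i *ᵥ v) +
        (sgnExp i (simpleReflection j *ᵥ simpleReflection i *ᵥ v) +
        (sgnExp j (simpleReflection i *ᵥ v) + sgnExp i v))))) := by
  simp only [Int.even_iff]
  refine ⟨fun h₁ h₂ => ?_, fun h₁ h₂ => ?_, fun h₁ h₂ => ?_⟩ <;>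
  rcases signShape i with ⟨p, hp, hr, hc, hs, hS, he⟩ | ⟨h0, hV, hr, hc, hs, hS, he⟩ |
    ⟨h0, hV, hr, hc, hs, he⟩ | ⟨p, h0, hp, hV, hr, hc, hs, he⟩ <;>
  rcases signShape j with ⟨p', hp', hr', hc', hs', hS', he'⟩ | ⟨h0', hV', hr', hc', hs', hS', he'⟩ |
    ⟨h0', hV', hr', hc', hs', he'⟩ | ⟨p', h0', hp', hV', hr', hc', hs', he'⟩ <;>
  simp only [hr, hc, hr', hc', dotProduct_sub, dotProduct_add, dotProduct_single, mul_one,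
    Pi.sub_apply, Pi.add_apply, Pi.single_apply] at h₁ h₂ <;>
  simp only [he, he', hs, hs', *] <;>
  clear hs hs' he he' hr hr' hc hc' <;> (try clear hS) <;> (try clear hS') <;> grind

end Signs
end

section
variable {V : ClassicalType} {n : ℕ}

section Representatives

variable {F : Type*} [Field F]

theorem isRoot_neg {a : RootName n} (ha : a.IsRoot V) : a.neg.IsRoot V := by
  rcases ha with ha | ha
  · exact .inr (by cases a <;> exact ha)
  · exact .inl ha

theorem rep_mul_of_sq_zero {X Y : Matrix (RepIdx V n) (RepIdx V n) F} (hX : X ^ 2 = 0)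
    (hY : Y ^ 2 = 0) (hXYX : X * Y * X = X) (t : Fˣ) :
    (1 + (t : F) • X + ((t : F) ^ 2 / 2) • X ^ 2) *
      (1 + (-(t⁻¹ : Fˣ) : F) • Y + ((-(t⁻¹ : Fˣ) : F) ^ 2 / 2) • Y ^ 2) *
      (1 + (t : F) • X + ((t : F) ^ 2 / 2) • X ^ 2) =
    1 - X * Y - Y * X + (t : F) • X - ((t⁻¹ : Fˣ) : F) • Y := by
  rw [sq] at hX
  simp only [hX, hY, sq X, smul_zero, add_zero, mul_add, add_mul, mul_one, one_mul,
    smul_mul_smul_comm, hXYX]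
  match_scalars <;> simp

theorem mono_zero {w : Matrix (Fin n) (Fin n) ℤ} {ε : (Fin n → ℤ) → F} (h : ∀ v, ε v = 0) :
    (mono w ε : Matrix (RepIdx V n) (RepIdx V n) F) = 0 := by
  ext r s
  rw [mono_apply, h, ite_self, Matrix.zero_apply]

theorem mono_eq_of {w : Matrix (Fin n) (Fin n) ℤ} {ε : (Fin n → ℤ) → F}
    {M : Matrix (RepIdx V n) (RepIdx V n) F} (h : ∀ s, ∃ r₀ : RepIdx V n,
      weight V n r₀ = w *ᵥ weight V n s ∧
      ∀ r, M r s = if r = r₀ then ε (weight V n s) else 0) : M = mono w ε := by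
  ext r s
  obtain ⟨r₀, h1, h2⟩ := h s
  rw [h2, mono_apply, ← h1]
  exact if_congr ⟨fun e => by rw [e], weight_injective⟩ rfl rfl

variable [GoodRank V n]

theorem weight_dot_le {i : SimpleIdx V n} (hi : ¬ (V = .B ∧ (i.1 : ℕ) = 0))
    (r : RepIdx V n) : weight V n r ⬝ᵥ i.coroot = -1 ∨ weight V n r ⬝ᵥ i.coroot = 0 ∨
      weight V n r ⬝ᵥ i.coroot = 1 := by
  rcases signShape i with ⟨p, hp, hr, hc, hs, hS, he⟩ | ⟨h0, hV, hr, hc, hs, hS, he⟩ |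
    ⟨h0, hV, hr, hc, hs, he⟩ | ⟨p, h0, hp, hV, hr, hc, hs, he⟩ <;>
  rcases weight_cases r with ⟨k, -, h⟩ | ⟨-, k, -, h⟩ | ⟨-, -, h⟩ <;>
  simp only [h, hc, neg_dotProduct, single_dotProduct, zero_dotProduct, Pi.sub_apply, Pi.add_apply,
    Pi.single_apply] <;> grind

theorem sg_weight {i : SimpleIdx V n} (hi : ¬ (V = .B ∧ (i.1 : ℕ) = 0))
    (r : RepIdx V n) (hd : weight V n r ⬝ᵥ i.coroot = 0) : sg F (sgnExp i (weight V n r)) = 1 := by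
  have : sgnExp i (weight V n r) = 0 := by
    rcases signShape i with ⟨p, hp, hr, hc, hs, hS, he⟩ | ⟨h0, hV, hr, hc, hs, hS, he⟩ |
      ⟨h0, hV, hr, hc, hs, he⟩ | ⟨p, h0, hp, hV, hr, hc, hs, he⟩ <;>
    rcases weight_cases r with ⟨k, -, h⟩ | ⟨-, k, -, h⟩ | ⟨-, -, h⟩ <;>
    simp only [h, hc, he, neg_dotProduct, single_dotProduct, zero_dotProduct, Pi.sub_apply,
      Pi.add_apply, Pi.single_apply, Pi.neg_apply, Pi.zero_apply] at hd ⊢ <;> grind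
  rw [this, sg, if_pos (by decide)]

theorem rootVector_apply_simple {i : SimpleIdx V n}
    (hi : ¬ (V = .B ∧ (i.1 : ℕ) = 0)) {r s : RepIdx V n}
    (h : weight V n r - weight V n s = i.root) :
    rootVector n F V i.name r s = sg F (sgnExp i (weight V n s)) ∧
      rootVector n F V i.name.neg s r = -sg F (sgnExp i (weight V n r)) := by
  cases simpleShape i with
  | diff p hp hn =>
    have hip : i.1 ≠ p := fun e => by rw [e] at hp; omega
    have he : ∀ v, sgnExp i v = v i.1 := fun v => by simp [sgnExp, show (i.1 : ℕ) ≠ 0 by omega]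
    rw [SimpleIdx.root, hn] at h
    have hneg : i.name.neg = .diff p i.1 := by rw [hn]; rfl
    rw [he, he, hneg, hn]
    rcases eq_diff hip h with ⟨rfl, rfl⟩ | ⟨hV, rfl, rfl⟩
    · by_cases hV : V.HasZero
      · rw [rootVector_diff_of_hasZero hV, rootVector_diff_of_hasZero hV]
        simp [Matrix.single_apply, (pI_ne_mI hV _ _).symm, weight_pI, hip, sg]
      · rw [rootVector_diff hV, rootVector_diff hV]
        simp [weight_pI, hip, sg]
    · rw [rootVector_diff_of_hasZero hV, rootVector_diff_of_hasZero hV]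
      simp [Matrix.single_apply, pI_ne_mI hV, weight_mI hV, hip, sg]
  | single h0 hV hn =>
    rcases hV with rfl | rfl
    · exact absurd ⟨rfl, h0⟩ hi
    · have he : ∀ v, sgnExp i v = (v i.1 + 1) / 2 := fun v => by simp [sgnExp, h0]
      rw [SimpleIdx.root, hn] at h
      obtain ⟨hV, rfl, rfl⟩ := eq_two h
      have hneg : i.name.neg = .negSingle i.1 := by rw [hn]; rfl
      have e1 : rootVector n F .C (.single i.1) = Matrix.single (pI .C i.1) (mI .C i.1) 1 := rfl
      have e2 : rootVector n F .C (.negSingle i.1) = Matrix.single (mI .C i.1) (pI .C i.1) 1 := rfl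
      rw [he, he, hneg, hn, e1, e2, weight_pI, weight_mI hV]
      simp [sg]
  | sum p h0 hp hV hn =>
    subst hV
    have hip : i.1 ≠ p := fun e => by rw [e] at h0; omega
    have hV : ClassicalType.HasZero .D := trivial
    have he : ∀ v, sgnExp i v = v i.1 := fun v => by simp [sgnExp]
    rw [SimpleIdx.root, hn] at h
    have hneg : i.name.neg = .negSum i.1 p := by rw [hn]; rfl
    have hpI : pI .D i.1 ≠ pI .D p := fun e => hip (pI_injective e)
    rw [he, he, hneg, hn, rootVector_sum hV, rootVector_negSum hV, sumSign, if_neg (by decide)]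
    rcases (eq_sum h).2 with ⟨rfl, rfl⟩ | ⟨rfl, rfl⟩
    · simp [Matrix.single_apply, weight_pI, weight_mI hV, hip, hpI.symm, sg]
    · simp [Matrix.single_apply, weight_pI, weight_mI hV, hip, hpI, sg]

theorem refl_dot_self (i : SimpleIdx V n) (v : Fin n → ℤ) :
    (simpleReflection i *ᵥ v) ⬝ᵥ i.coroot = -(v ⬝ᵥ i.coroot) := by
  rw [simpleReflection_mulVec', sub_dotProduct, smul_dotProduct, root_dot_coroot,
    dotProduct_comm i.coroot, smul_eq_mul]
  ring

theorem rootVector_eq_mono {i : SimpleIdx V n}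
    (hi : ¬ (V = .B ∧ (i.1 : ℕ) = 0)) :
    rootVector n F V i.name = mono (simpleReflection i) (fun v =>
      if v ⬝ᵥ i.coroot = -1 then sg F (sgnExp i v) else 0) ∧
    rootVector n F V i.name.neg = mono (simpleReflection i) (fun v =>
      if v ⬝ᵥ i.coroot = 1 then -sg F (sgnExp i v) else 0) := by
  have hd : ∀ r s : RepIdx V n, weight V n r - weight V n s = i.root →
      weight V n s ⬝ᵥ i.coroot = -1 ∧ weight V n r ⬝ᵥ i.coroot = 1 := by
    intro r s h
    have h1 := congrArg (· ⬝ᵥ i.coroot) h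
    simp only [sub_dotProduct, root_dot_coroot] at h1
    have := weight_dot_le hi r
    have := weight_dot_le hi s
    omega
  constructor <;> ext r s <;> rw [mono_apply, simpleReflection_mulVec', dotProduct_comm i.coroot]
  · by_cases h : weight V n r - weight V n s = i.root
    · rw [(rootVector_apply_simple hi h).1, (hd r s h).1, if_pos, if_pos rfl]
      rw [sub_eq_iff_eq_add.1 h]; module
    · rw [show rootVector n F V i.name r s = 0 from by_contra fun h' => h
        (supp_rootVector (.inl (name_isPos i)) r s h')]
      split_ifs with h1 h2
      · exact absurd (by rw [h1, h2]; module) h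
      all_goals rfl
  · by_cases h : weight V n s - weight V n r = i.root
    · rw [(rootVector_apply_simple hi h).2, (hd s r h).2, if_pos, if_pos rfl]
      rw [sub_eq_iff_eq_add.1 h]; module
    · rw [show rootVector n F V i.name.neg r s = 0 from by_contra fun h' => h (by
        have := supp_rootVector (isRoot_neg (.inl (name_isPos i))) r s h'
        rw [root_neg] at this
        rw [← neg_sub, this, neg_neg]; rfl)]
      split_ifs with h1 h2
      · exact absurd (by rw [h1, h2]; module) h
      all_goals rfl

/-- The product of root elements that represents a simple reflection. -/
theorem rep_simple_of_ne {i : SimpleIdx V n} (hi : ¬ (V = .B ∧ (i.1 : ℕ) = 0))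
    (t : Fˣ) : xMatrix V n F i.name t * xMatrix V n F i.name.neg (-(t⁻¹ : Fˣ)) *
      xMatrix V n F i.name t = mono (simpleReflection i) fun v =>
        ((t ^ (-(v ⬝ᵥ i.coroot)) : Fˣ) : F) * sg F (sgnExp i v) := by
  obtain ⟨hX, hY⟩ := rootVector_eq_mono (F := F) hi
  have hst := stable_simpleReflection i
  have hss := simpleReflection_mul_self i
  have hsg : ∀ v, v ⬝ᵥ i.coroot = 1 ∨ v ⬝ᵥ i.coroot = -1 →
      sg F (sgnExp i (simpleReflection i *ᵥ v)) * sg F (sgnExp i v) = -1 := by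
    intro v hv
    rw [← sg_add, sg_congr (sgnExp_refl i v)]
    rcases hv with hv | hv <;> rw [hv, sg, if_neg (by decide)]
  have hXY : rootVector n F V i.name * rootVector n F V i.name.neg =
      mono 1 fun v => if v ⬝ᵥ i.coroot = 1 then 1 else 0 := by
    rw [hX, hY, mono_mul hst, hss]
    congr 1
    funext v
    simp only [refl_dot_self, neg_inj]
    split_ifs with h
    · linear_combination -hsg v (.inl h)
    · ring
  have hYX : rootVector n F V i.name.neg * rootVector n F V i.name =
      mono 1 fun v => if v ⬝ᵥ i.coroot = -1 then 1 else 0 := by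
    rw [hX, hY, mono_mul hst, hss]
    congr 1
    funext v
    simp only [refl_dot_self, neg_eq_iff_eq_neg]
    split_ifs with h
    · linear_combination -hsg v (.inr h)
    · ring
  have hX2 : rootVector n F V i.name ^ 2 = 0 := by
    rw [sq, hX, mono_mul hst]
    refine mono_zero fun v => ?_
    rw [refl_dot_self]
    split_ifs <;> first | omega | simp
  have hY2 : rootVector n F V i.name.neg ^ 2 = 0 := by
    rw [sq, hY, mono_mul hst]
    refine mono_zero fun v => ?_
    rw [refl_dot_self]
    split_ifs <;> first | omega | simp
  have hXYX : rootVector n F V i.name * rootVector n F V i.name.neg * rootVector n F V i.name =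
      rootVector n F V i.name := by
    rw [hXY, hX, mono_mul hst, one_mul]
    congr 1
    funext v
    simp only [refl_dot_self, neg_eq_iff_eq_neg]
    split_ifs <;> simp
  rw [xMatrix, xMatrix, rep_mul_of_sq_zero hX2 hY2 hXYX, hXY, hYX, hX, hY]
  ext r s
  simp only [Matrix.add_apply, Matrix.sub_apply, Matrix.smul_apply, mono_apply, one_mulVec,
    smul_eq_mul, Matrix.one_apply]
  have hrs : r = s ↔ weight V n r = weight V n s := ⟨fun h => by rw [h], weight_injective⟩
  simp only [hrs]
  rcases weight_dot_le hi s with h | h | h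
  · simp [h]
  · rw [sg_weight hi s h, simpleReflection_mulVec', dotProduct_comm i.coroot, h]
    simp
  · simp only [h]
    split_ifs <;> simp at *

theorem rep_simple_single [GoodRank .B n] (h2 : (2 : F) ≠ 0) {i : SimpleIdx .B n}
    (h0 : (i.1 : ℕ) = 0) (t : Fˣ) :
    xMatrix .B n F i.name t * xMatrix .B n F i.name.neg (-(t⁻¹ : Fˣ)) *
      xMatrix .B n F i.name t = mono (simpleReflection i) fun v =>
        ((t ^ (-(v ⬝ᵥ i.coroot)) : Fˣ) : F) * sg F (sgnExp i v) := by
  have hn : i.name = .single i.1 := by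
    rcases simpleShape i with ⟨p, hp, h⟩ | ⟨-, -, h⟩ | ⟨-, -, -, hV, -⟩
    · omega
    · exact h
    · cases hV
  have hneg : i.name.neg = .negSingle i.1 := by rw [hn]; rfl
  have hpz : pI .B i.1 ≠ zI := fun e => by cases e
  have hmz : mI .B i.1 ≠ zI := fun e => by cases e
  have hpm : pI .B i.1 ≠ mI .B i.1 := pI_ne_mI (V := .B) trivial _ _
  set p := pI .B i.1 with hp
  set m := mI .B i.1 with hm
  have e1 : rootVector n F .B i.name = (2 : F) • Matrix.single p zI 1 - Matrix.single zI m 1 := by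
    rw [hn, Matrix.smul_single, smul_eq_mul, mul_one]; rfl
  have e2 : rootVector n F .B i.name.neg = Matrix.single zI p 1 - (2 : F) • Matrix.single m zI 1 := by
    rw [hneg, Matrix.smul_single, smul_eq_mul, mul_one]; rfl
  have ht : (t : F) ≠ 0 := t.ne_zero
  have key : xMatrix .B n F i.name t * xMatrix .B n F i.name.neg (-(t⁻¹ : Fˣ)) *
      xMatrix .B n F i.name t = 1 - Matrix.single p p 1 - Matrix.single m m 1 -
        (2 : F) • Matrix.single zI zI 1 - ((t : F) ^ 2) • Matrix.single p m 1 -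
        ((t : F)⁻¹ ^ 2) • Matrix.single m p 1 := by
    rw [xMatrix, xMatrix, e1, e2]
    simp only [sq, mul_add, add_mul, mul_sub, sub_mul, mul_one, one_mul, Matrix.smul_mul,
      Matrix.mul_smul, Matrix.single_mul_single_same, Matrix.single_mul_single_of_ne, ne_eq, hpm,
      hpm.symm, hpz, hpz.symm, hmz, hmz.symm, not_false_eq_true, smul_zero, sub_zero, zero_sub,
      add_zero, zero_add, smul_add, smul_sub, smul_neg, neg_zero, neg_mul, mul_neg,
      Units.val_inv_eq_inv_val]
    match_scalars <;> field_simp <;> ring_nf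
  rw [key]
  have he : ∀ v, sgnExp i v = 1 + total v - v i.1 := fun v => by simp [sgnExp, h0]
  have hc : ∀ v, v ⬝ᵥ i.coroot = v i.1 * 2 := fun v => by
    simp [SimpleIdx.coroot, hn, RootName.coroot]
  refine mono_eq_of fun s => ?_
  have tot : ∀ k : Fin n, total (Pi.single k 1 : Fin n → ℤ) = 1 := fun k => by simp [total]
  have totn : ∀ k : Fin n, total (-Pi.single k 1 : Fin n → ℤ) = -1 := fun k => by simp [total]
  rcases weight_cases s with ⟨k, rfl, hk⟩ | ⟨-, k, rfl, hk⟩ | ⟨-, hz, hk⟩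
  · by_cases hki : k = i.1
    · subst hki
      refine ⟨m, ?_, fun r => ?_⟩
      · rw [hk, hm, weight_mI (V := .B) trivial]
        ext l
        rw [refl_single hn]
        simp only [Pi.single_apply, Pi.neg_apply]; grind
      · rw [hk, hc, he, tot]
        simp [Matrix.single_apply, Matrix.one_apply, ← hp, hpm.symm, hpz.symm, sg, eq_comm]
        grind
    · refine ⟨pI .B k, ?_, fun r => ?_⟩
      · rw [hk]
        ext l
        rw [refl_single hn]
        simp only [Pi.single_apply]; grind
      · have h1 : p ≠ pI .B k := fun e => hki (pI_injective e).symm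
        have h3 : zI ≠ pI .B k := fun e => by cases e
        rw [hk, hc, he, tot]
        simp [Matrix.single_apply, Matrix.one_apply, h1, h3, (pI_ne_mI (V := .B) trivial _ _).symm, hm, sg, Ne.symm hki]
  · by_cases hki : k = i.1
    · subst hki
      refine ⟨p, ?_, fun r => ?_⟩
      · rw [hk, hp, weight_pI]
        ext l
        rw [refl_single hn]
        simp only [Pi.single_apply, Pi.neg_apply]; grind
      · rw [hk, hc, he, totn]
        simp [Matrix.single_apply, Matrix.one_apply, ← hm, hpm, hmz.symm, sg, eq_comm]
        grind
    · refine ⟨mI .B k, ?_, fun r => ?_⟩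
      · rw [hk]
        ext l
        rw [refl_single hn]
        simp only [Pi.single_apply, Pi.neg_apply]; grind
      · have h1 : m ≠ mI .B k := fun e => hki (by
          have := congrArg opp e
          rw [hm, opp_mI (V := .B) trivial, opp_mI (V := .B) trivial] at this
          exact (pI_injective this).symm)
        have h3 : zI ≠ mI .B k := fun e => by cases e
        rw [hk, hc, he, totn]
        simp [Matrix.single_apply, Matrix.one_apply, h1, h3, pI_ne_mI (V := .B) trivial, hp, sg, Ne.symm hki]
  · obtain rfl := eq_of_heq hz
    refine ⟨zI, by rw [hk, mulVec_zero], fun r => ?_⟩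
    rw [hk, hc, he]
    simp [Matrix.single_apply, Matrix.one_apply, hpz, hmz, sg, eq_comm, total]
    grind

theorem rep_simple (h2 : (2 : F) ≠ 0) (i : SimpleIdx V n) (t : Fˣ) :
    xMatrix V n F i.name t * xMatrix V n F i.name.neg (-(t⁻¹ : Fˣ)) *
      xMatrix V n F i.name t = mono (simpleReflection i) fun v =>
        ((t ^ (-(v ⬝ᵥ i.coroot)) : Fˣ) : F) * sg F (sgnExp i v) := by
  by_cases hi : V = .B ∧ (i.1 : ℕ) = 0
  · obtain ⟨rfl, h0⟩ := hi
    exact rep_simple_single h2 h0 t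
  · exact rep_simple_of_ne hi t

theorem wMatrix_eq (h2 : (2 : F) ≠ 0) (i : SimpleIdx V n) :
    wMatrix F i = mono (simpleReflection i) fun v => sg F (sgnExp i v) := by
  have := rep_simple h2 i (1 : Fˣ)
  simpa [wMatrix] using this

theorem rep_simple_eq_mul (h2 : (2 : F) ≠ 0) (i : SimpleIdx V n) (t : Fˣ) :
    xMatrix V n F i.name t * xMatrix V n F i.name.neg (-(t⁻¹ : Fˣ)) *
      xMatrix V n F i.name t = hMatrix V n F i.coroot t * wMatrix F i := by
  rw [rep_simple h2, wMatrix_eq h2, hMatrix_eq, mono_mul (stable_simpleReflection i), one_mul]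
  congr 1
  funext v
  rw [refl_dot_self]

theorem wMatrix_sq (h2 : (2 : F) ≠ 0) (i : SimpleIdx V n) :
    wMatrix F i * wMatrix F i = hMatrix V n F i.coroot (-1) := by
  rw [wMatrix_eq h2, hMatrix_eq, mono_mul (stable_simpleReflection i), simpleReflection_mul_self]
  congr 1
  funext v
  rw [← sg_add, sg_congr (sgnExp_refl i v), sg]
  split_ifs with h
  · rw [h.neg_one_zpow, Units.val_one]
  · rw [(Int.not_even_iff_odd.1 h).neg_one_zpow]; simp

theorem wMatrix_hMatrix (h2 : (2 : F) ≠ 0) (i : SimpleIdx V n) (H : Fin n → ℤ)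
    (t : Fˣ) : wMatrix F i * hMatrix V n F H t =
      hMatrix V n F (simpleReflection i *ᵥ H) t * wMatrix F i := by
  rw [wMatrix_eq h2, hMatrix_eq, hMatrix_eq, mono_mul stable_one,
    mono_mul (stable_simpleReflection i), one_mul, mul_one]
  congr 1
  funext v
  rw [one_mulVec, mul_comm, simpleReflection_dot]

theorem braided_wMatrix (h2 : (2 : F) ≠ 0) :
    Braided (fun i : SimpleIdx V n => wMatrix F i) := by
  have hs := braided_simpleReflection (V := V) (n := n)
  refine braided_of (fun i j a b => ?_) (fun i j a b => ?_) fun i j a b => ?_ <;>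
  have hi := stable_simpleReflection i <;> have hj := stable_simpleReflection j <;>
  simp only [wMatrix_eq h2, mono_mul, hi, hj, hi.mul, hj.mul,
    hi.mul (hj.mul hi), hj.mul (hi.mul hj), ← sg_add, ← mulVec_mulVec]
  · rw [hs.two a b]
    congr 1
    funext v
    exact sg_congr ((sgnExp_braid i j v).1 a b)
  · rw [hs.three a b]
    congr 1
    funext v
    exact sg_congr ((sgnExp_braid i j v).2.1 a b)
  · rw [hs.four a b]
    congr 1
    funext v
    exact sg_congr ((sgnExp_braid i j v).2.2 a b)

end Representatives
end

section
variable {V : ClassicalType} {n : ℕ}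

/-! ### Unitriangular isometries -/

theorem IsRootVec.neg {v : Fin n → ℤ} (h : IsRootVec V v) : IsRootVec V (-v) :=
  h.symm.imp id fun h => by rwa [neg_neg]

theorem isRootVec_diff {k l : Fin n} (h : k ≠ l) :
    IsRootVec V (Pi.single k 1 - Pi.single l 1) := by
  rcases lt_or_gt_of_ne h with h | h
  · exact .inr ⟨.diff l k, h, by rw [RootName.root, neg_sub]⟩
  · exact .inl ⟨.diff k l, h, rfl⟩

theorem isRootVec_sum (hV : V.HasZero) {k l : Fin n} (h : k ≠ l) :
    IsRootVec V (Pi.single k 1 + Pi.single l 1) := by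
  rcases lt_or_gt_of_ne h with h | h
  · exact .inl ⟨.sum k l, ⟨h, hV⟩, rfl⟩
  · exact .inl ⟨.sum l k, ⟨h, hV⟩, by rw [RootName.root, add_comm]⟩

/-- The differences of distinct weights are roots, except for opposite weights. -/
theorem weight_sub_cases {r s : RepIdx V n} (h : r ≠ s) :
    IsRootVec V (weight V n r - weight V n s) ∨ ((V = .B ∨ V = .D) ∧ r = opp s) := by
  have hz : V = .B → ∀ k : Fin n, IsRootVec V (Pi.single k 1) := fun hV k =>
    .inl ⟨.single k, .inl hV, by subst hV; rfl⟩
  have h2 : ∀ k : Fin n, V.HasZero → IsRootVec V (Pi.single k 1 + Pi.single k 1) ∨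
      (V = .B ∨ V = .D) := by
    intro k hV
    cases V with
    | A => exact hV.elim
    | Astar => exact hV.elim
    | B => exact .inr (.inl rfl)
    | C => exact .inl (.inl ⟨.single k, .inr rfl, by rw [← Pi.single_add]; rfl⟩)
    | D => exact .inr (.inr rfl)
  rcases weight_cases r with ⟨k, rfl, hk⟩ | ⟨hV, k, rfl, hk⟩ | ⟨hV, hr, hk⟩ <;>
  rcases weight_cases s with ⟨l, rfl, hl⟩ | ⟨hV', l, rfl, hl⟩ | ⟨hV', hs, hl⟩ <;> rw [hk, hl]
  · exact .inl (isRootVec_diff fun e => h (by rw [e]))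
  · rw [sub_neg_eq_add]
    by_cases e : k = l
    · rw [← e]
      exact (h2 k hV').imp_right fun h => ⟨h, (opp_mI hV' k).symm⟩
    · exact .inl (isRootVec_sum hV' e)
  · rw [sub_zero]; exact .inl (hz hV' k)
  · rw [← neg_add']
    by_cases e : k = l
    · rw [← e]
      exact (h2 k hV).imp IsRootVec.neg fun h => ⟨h, (opp_pI hV k).symm⟩
    · exact .inl (isRootVec_sum hV e).neg
  · rw [sub_neg_eq_add, neg_add_eq_sub]
    exact .inl (isRootVec_diff fun e => h (by rw [e]))
  · rw [sub_zero]; exact .inl (hz hV' k).neg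
  · rw [zero_sub]; exact .inl (hz hV l).neg
  · rw [zero_sub, neg_neg]; exact .inl (hz hV l)
  · exact absurd (eq_of_heq (hr.trans hs.symm)) h

theorem two_le_height {r s : RepIdx V n} (h : 0 < height V (weight V n r - weight V n s)) :
    2 ≤ height V (weight V n r - weight V n s) := by
  rw [height_sub] at h ⊢
  rcases weight_cases r with ⟨k, -, hk⟩ | ⟨-, k, -, hk⟩ | ⟨rfl, -, hk⟩ <;>
  rcases weight_cases s with ⟨l, -, hl⟩ | ⟨-, l, -, hl⟩ | ⟨hV, -, hl⟩ <;>
  rw [hk, hl] at h ⊢ <;> try subst hV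
  all_goals
    try simp only [height_neg, height_single, mul_one] at h ⊢
    try cases V
  all_goals simp only [htCoord, height, Pi.zero_apply, mul_zero, Finset.sum_const_zero] at h ⊢
  all_goals omega

section Uni

variable {F : Type*} [Field F]

theorem formCoef_eq_one (hV : V = .B ∨ V = .D) {s : RepIdx V n} (h : opp s ≠ s) :
    formCoef F s = 1 := by
  rcases hV with rfl | rfl
  · rcases s with _ | s
    · exact absurd rfl h
    · rfl
  · rfl

theorem Isom.apply {M : Matrix (RepIdx V n) (RepIdx V n) F} (hM : Isom M) (hV : V.HasZero)
    (r s : RepIdx V n) : ∑ k, M (opp k) r * formCoef F (opp k) * M k s =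
      if s = opp r then formCoef F r else 0 := by
  have := congrFun (congrFun (hM hV) r) s
  rw [Matrix.mul_apply] at this
  rw [← show formMatrix F V n r s = if s = opp r then formCoef F r else 0 from rfl, ← this]
  exact Finset.sum_congr rfl fun k _ => by rw [mul_form_apply hV, Matrix.transpose_apply]

theorem Isom.opp_apply_eq_zero (h2 : (2 : F) ≠ 0) {M : Matrix (RepIdx V n) (RepIdx V n) F}
    (hM : Isom M) (hV : V = .B ∨ V = .D) {s : RepIdx V n} (hs : opp s ≠ s) (h1 : M s s = 1)
    (h : ∀ r, r ≠ s → r ≠ opp s → M r s = 0 ∨ M (opp r) s = 0) : M (opp s) s = 0 := by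
  have hV' : V.HasZero := by rcases hV with rfl | rfl <;> trivial
  have h3 := hM.apply hV' s s
  rw [if_neg hs.symm, Finset.sum_eq_add s (opp s) hs.symm] at h3
  · rw [opp_opp hV', h1, formCoef_eq_one hV hs,
      formCoef_eq_one hV (by rwa [opp_opp hV', ne_comm])] at h3
    exact (mul_eq_zero.1 (show (2 : F) * M (opp s) s = 0 by linear_combination h3)).resolve_left h2
  · intro r _ hr
    rcases h r hr.1 hr.2 with h | h <;> rw [h] <;> ring
  all_goals simp

/-- Isometries that are unitriangular for the height of the weights. -/
structure Uni (M : Matrix (RepIdx V n) (RepIdx V n) F) : Prop where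
  isom : Isom M
  diag : ∀ r, M r r = 1
  pos : ∀ r s, M r s ≠ 0 → r ≠ s → 0 < height V (weight V n r - weight V n s)

theorem Uni.of_root (h2 : (2 : F) ≠ 0) {M : Matrix (RepIdx V n) (RepIdx V n) F} (hM : Isom M)
    (h1 : ∀ r, M r r = 1) (h : ∀ r s, M r s ≠ 0 → IsRootVec V (weight V n r - weight V n s) →
      0 < height V (weight V n r - weight V n s)) : Uni M := by
  refine ⟨hM, h1, fun r s hrs hne => ?_⟩
  rcases weight_sub_cases hne with hr | ⟨hV, rfl⟩
  · exact h r s hrs hr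
  · have hV' : V.HasZero := by rcases hV with rfl | rfl <;> trivial
    by_contra hc
    refine hrs (hM.opp_apply_eq_zero h2 hV hne (h1 s) fun r hr hr' => ?_)
    by_contra! h3
    have hr'' : opp r ≠ s := fun e => hr' (by rw [← e, opp_opp hV'])
    have key : ∀ k, k ≠ s → k ≠ opp s → M k s ≠ 0 → 0 < height V (weight V n k - weight V n s) :=
      fun k hk hk' h4 => h k s h4 ((weight_sub_cases hk).resolve_right fun e => hk' e.2)
    have h5 := key r hr hr' h3.1
    have h6 := key _ hr'' (fun e => hr (by rw [← opp_opp hV' r, e, opp_opp hV'])) h3.2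
    simp only [weight_opp hV', height_sub, height_neg] at h5 h6 hc
    omega

theorem eq_one_of_root (h2 : (2 : F) ≠ 0) {M : Matrix (RepIdx V n) (RepIdx V n) F} (hM : Isom M)
    (h1 : ∀ r, M r r = 1) (h : ∀ r s, IsRootVec V (weight V n r - weight V n s) → M r s = 0) :
    M = 1 := by
  ext r s
  by_cases hne : r = s
  · rw [hne, h1, Matrix.one_apply_eq]
  rw [Matrix.one_apply_ne hne]
  rcases weight_sub_cases hne with hr | ⟨hV, rfl⟩
  · exact h r s hr
  · exact hM.opp_apply_eq_zero h2 hV hne (h1 s) fun r hr hr' =>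
      .inl (h r s ((weight_sub_cases hr).resolve_right fun e => hr' e.2))

theorem Uni.one : Uni (1 : Matrix (RepIdx V n) (RepIdx V n) F) :=
  ⟨fun _ => by simp, fun _ => by simp, fun r s h hne => absurd (Matrix.one_apply_ne hne) h⟩

theorem Uni.nonneg {M : Matrix (RepIdx V n) (RepIdx V n) F} (hM : Uni M) {r s : RepIdx V n}
    (h : M r s ≠ 0) : 0 ≤ height V (weight V n r) - height V (weight V n s) ∧
      (r ≠ s → 0 < height V (weight V n r) - height V (weight V n s)) := by
  rw [← height_sub]
  by_cases hrs : r = s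
  · simp [hrs, height]
  · have := hM.pos r s h hrs
    exact ⟨this.le, fun _ => this⟩

theorem Uni.mul {M N : Matrix (RepIdx V n) (RepIdx V n) F} (hM : Uni M) (hN : Uni N) :
    Uni (M * N) := by
  refine ⟨hM.isom.mul hN.isom, fun r => ?_, fun r s h hrs => ?_⟩
  · rw [Matrix.mul_apply, Finset.sum_eq_single r, hM.diag, hN.diag, one_mul]
    · intro k _ hk
      by_contra h
      have h1 := (hM.nonneg (left_ne_zero_of_mul h)).2 hk.symm
      have h3 := (hN.nonneg (right_ne_zero_of_mul h)).2 hk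
      omega
    · simp
  · rw [Matrix.mul_apply] at h
    obtain ⟨k, -, hk⟩ := Finset.exists_ne_zero_of_sum_ne_zero h
    have h1 := hM.nonneg (left_ne_zero_of_mul hk)
    have h3 := hN.nonneg (right_ne_zero_of_mul hk)
    rw [height_sub]
    by_cases e : r = k
    · subst e
      have := h3.2 hrs
      omega
    · have := h1.2 e
      omega

theorem uni_xMatrix (h2 : (2 : F) ≠ 0) {a : RootName n} (ha : a.IsPos V) (t : F) :
    Uni (xMatrix V n F a t) := by
  have hs := supp_rootVector (F := F) (.inl ha : a.IsRoot V)
  have hp := height_pos ⟨a, ha, rfl⟩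
  have h0 : ∀ r : RepIdx V n, rootVector n F V a r r = 0 ∧ (rootVector n F V a ^ 2) r r = 0 := by
    intro r
    constructor <;> by_contra h
    · have := hs r r h
      rw [sub_self] at this
      rw [← this] at hp
      simp [height] at hp
    · rw [sq] at h
      have := congrArg (height V) (hs.mul hs r r h)
      rw [sub_self, height_add] at this
      simp only [height, Pi.zero_apply, mul_zero, Finset.sum_const_zero] at this hp
      omega
  refine ⟨Skew.isom_xMatrix h2 (.inl ha) t, fun r => ?_, fun r s h hrs => ?_⟩
  · simp [xMatrix, h0 r]
  · simp only [xMatrix, Matrix.add_apply, Matrix.one_apply_ne hrs, Matrix.smul_apply] at h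
    by_cases h1 : rootVector n F V a r s = 0
    · have h3 : (rootVector n F V a * rootVector n F V a) r s ≠ 0 := fun e => h (by simp [h1, sq, e])
      rw [hs.mul hs r s h3, height_add]
      omega
    · rw [hs r s h1]
      exact hp

/-- The component of a unitriangular isometry at a simple root lies in the Lie algebra. -/
theorem Uni.skew_component [GoodRank V n] {M : Matrix (RepIdx V n) (RepIdx V n) F} (hM : Uni M)
    (i : SimpleIdx V n) (hi : height V i.root = 2) :
    Skew (Matrix.of fun r s => if weight V n r - weight V n s = i.root then M r s else 0) := by
  intro hV
  ext r s
  rw [Matrix.add_apply, mul_form_apply hV, form_mul_apply, Matrix.transpose_apply]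
  simp only [Matrix.of_apply, weight_opp hV, Matrix.zero_apply]
  have hc : -weight V n s - weight V n r = -weight V n r - weight V n s := by abel
  rw [hc]
  split_ifs with h
  · have h1 := congrArg (height V) h
    rw [height_sub, height_neg, hi] at h1
    have hne : s ≠ opp r := by
      rintro rfl
      rw [weight_opp hV, height_neg] at h1
      omega
    have h3 := hM.isom.apply hV r s
    rw [if_neg hne, Finset.sum_eq_add s (opp r) hne, hM.diag, opp_opp hV, hM.diag] at h3
    · linear_combination h3
    · intro k _ hk
      by_contra h4
      have h5 := two_le_height (hM.pos _ _ (right_ne_zero_of_mul h4) hk.1)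
      have h6 := two_le_height (hM.pos _ _ (left_ne_zero_of_mul (left_ne_zero_of_mul h4))
        fun e => hk.2 (by rw [← e, opp_opp hV]))
      rw [height_sub, weight_opp hV, height_neg] at h6
      rw [height_sub] at h5
      omega
    all_goals simp
  · simp

theorem Uni.exists_clear [GoodRank V n] (h2 : (2 : F) ≠ 0)
    {M : Matrix (RepIdx V n) (RepIdx V n) F} (hM : Uni M) (i : SimpleIdx V n)
    (hi : height V i.root = 2) : ∃ c : F, ∀ r s, weight V n r - weight V n s = i.root →
      (xMatrix V n F i.name c * M) r s = 0 := by
  obtain ⟨c, hc⟩ := eq_smul_rootVector h2 (name_isPos i)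
    (X := Matrix.of fun r s => if weight V n r - weight V n s = i.root then M r s else 0)
    (fun r s h => by
      by_contra h'
      exact h (if_neg h')) (hM.skew_component i hi)
  have hs := supp_rootVector (F := F) (.inl (name_isPos i) : i.name.IsRoot V)
  refine ⟨-c, fun r s h => ?_⟩
  have h1 := congrFun (congrFun hc r) s
  rw [Matrix.of_apply, if_pos h, Matrix.smul_apply, smul_eq_mul] at h1
  have h3 : (rootVector n F V i.name * M) r s = rootVector n F V i.name r s := by
    rw [Matrix.mul_apply, Finset.sum_eq_single s, hM.diag, mul_one]
    · intro k _ hk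
      by_contra h4
      have h5 := hs r k (left_ne_zero_of_mul h4)
      exact hk (weight_injective (sub_right_injective (h5.trans h.symm)))
    · simp
  have h4 : (rootVector n F V i.name ^ 2 * M) r s = 0 := by
    rw [Matrix.mul_apply]
    refine Finset.sum_eq_zero fun k _ => ?_
    by_contra h4
    have h5 := hs.mul hs r k (by rw [← sq]; exact left_ne_zero_of_mul h4)
    have h6 := (hM.nonneg (right_ne_zero_of_mul h4)).1
    have h7 := congrArg (height V) h5
    have h8 := congrArg (height V) h
    rw [height_add, height_sub] at h7
    rw [height_sub] at h8
    change _ = height V i.root + height V i.root at h7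
    omega
  rw [xMatrix]
  simp only [add_mul, one_mul, Matrix.smul_mul, Matrix.add_apply, Matrix.smul_apply, h3, h4,
    smul_eq_mul, h1]
  ring

end Uni
end

section
variable {V : ClassicalType} {n : ℕ} [GoodRank V n]

/-! ### The Chevalley groups -/

theorem height_simple (i : SimpleIdx V n) : height V i.root = 2 := by
  rcases signShape i with ⟨p, hp, hr, -, -, -, -⟩ | ⟨h0, rfl, hr, -, -, -, -⟩ |
    ⟨h0, rfl, hr, -, -, -⟩ | ⟨p, h0, hp, rfl, hr, -, -, -⟩ <;> rw [hr]
  · rw [height_sub, height_single, height_single, ← hp]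
    cases V <;> simp [htCoord] <;> ring
  · simp [height_single, htCoord, h0]
  · simp [height_single, htCoord, h0]
  · simp [height_add, height_single, htCoord, h0, hp]

section Chevalley

variable {F : Type*} [Field F]

/-- The matrix of an element of the Chevalley group. -/
def mat : chevalley V n F →* Matrix (RepIdx V n) (RepIdx V n) F :=
  (Units.coeHom _).comp (chevalley V n F).subtype

theorem mat_injective {a b : chevalley V n F} (h : mat a = mat b) : a = b :=
  Subtype.ext (Units.ext h)

theorem mat_mul_inv (a : chevalley V n F) : mat a * mat a⁻¹ = 1 := by
  rw [← map_mul, mul_inv_cancel, map_one]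

theorem RootName.IsPos.isRoot {a : RootName n} (ha : a.IsPos V) : a.IsRoot V := .inl ha

variable (h2 : (2 : F) ≠ 0)

/-- The root elements. -/
def xElt {a : RootName n} (ha : a.IsRoot V) (t : F) : chevalley V n F :=
  ⟨⟨xMatrix V n F a t, xMatrix V n F a (-t),
    by rw [← xMatrix_add h2 ha, add_neg_cancel, xMatrix_zero],
    by rw [← xMatrix_add h2 ha, neg_add_cancel, xMatrix_zero]⟩,
    Subgroup.subset_closure (.inl ⟨a, t, ha, rfl⟩)⟩

theorem mat_xElt {a : RootName n} (ha : a.IsRoot V) (t : F) :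
    mat (xElt h2 ha t) = xMatrix V n F a t := rfl

theorem hMatrix_add (H H' : Fin n → ℤ) (s : Fˣ) :
    hMatrix V n F (H + H') s = hMatrix V n F H s * hMatrix V n F H' s := by
  rw [hMatrix_eq, hMatrix_eq, hMatrix_eq, mono_mul stable_one, one_mul]
  congr 1
  funext v
  rw [one_mulVec, dotProduct_add, _root_.zpow_add, Units.val_mul]

theorem hMatrix_zero (s : Fˣ) : hMatrix V n F 0 s = 1 := by
  rw [hMatrix_eq, ← mono_one]
  congr 1
  funext v
  simp

/-- The elements of the torus. -/
def hElt {H : Fin n → ℤ} (hH : V = .Astar → ∑ j, H j = 0) (s : Fˣ) : chevalley V n F :=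
  ⟨⟨hMatrix V n F H s, hMatrix V n F (-H) s,
    by rw [← hMatrix_add, add_neg_cancel, hMatrix_zero],
    by rw [← hMatrix_add, neg_add_cancel, hMatrix_zero]⟩,
    Subgroup.subset_closure (.inr ⟨H, s, hH, rfl⟩)⟩

/-- The representatives of the simple reflections. -/
def wElt (i : SimpleIdx V n) : chevalley V n F :=
  xElt h2 (name_isPos i).isRoot 1 * xElt h2 (isRoot_neg (name_isPos i).isRoot) (-1) *
    xElt h2 (name_isPos i).isRoot 1

theorem mat_wElt (i : SimpleIdx V n) : mat (wElt h2 i) = wMatrix F i := rfl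

theorem isom_mat (h2 : (2 : F) ≠ 0) (a : chevalley V n F) : Isom (mat a) := by
  obtain ⟨a, ha⟩ := a
  change Isom (a : Matrix (RepIdx V n) (RepIdx V n) F)
  induction ha using Subgroup.closure_induction with
  | mem a ha =>
    rcases ha with ⟨b, t, hb, e⟩ | ⟨H, s, -, e⟩ <;> rw [e]
    · exact Skew.isom_xMatrix h2 hb t
    · intro hV
      ext r s'
      rw [mul_assoc, hMatrix, Matrix.diagonal_transpose, Matrix.diagonal_mul, Matrix.mul_diagonal,
        formMatrix, Matrix.of_apply]
      split_ifs with h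
      · rw [h, mul_comm (formCoef F r), ← mul_assoc, ← Units.val_mul, ← _root_.zpow_add, weight_opp hV]
        simp
      · simp
  | one => exact Uni.one.isom
  | mul a b _ _ ha hb => exact ha.mul hb
  | inv a _ ha => exact ha.of_mul_eq_one (a.mul_inv)

/-! ### Monomial elements -/

/-- The matrix is monomial over `w`. -/
def IsMono (w : Matrix (Fin n) (Fin n) ℤ) (M : Matrix (RepIdx V n) (RepIdx V n) F) : Prop :=
  ∃ ε : (Fin n → ℤ) → F, (∀ v, ε v ≠ 0) ∧ M = mono w ε

theorem IsMono.mul {w w' : Matrix (Fin n) (Fin n) ℤ} {M N : Matrix (RepIdx V n) (RepIdx V n) F}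
    (hM : IsMono w M) (hN : IsMono w' N) (hw : Stable V w') : IsMono (w * w') (M * N) := by
  obtain ⟨ε, hε, rfl⟩ := hM
  obtain ⟨ε', hε', rfl⟩ := hN
  exact ⟨_, fun v => mul_ne_zero (hε _) (hε' v), mono_mul hw _ _⟩

theorem isMono_hMatrix (H : Fin n → ℤ) (s : Fˣ) : IsMono 1 (hMatrix V n F H s) :=
  ⟨_, fun _ => Units.ne_zero _, hMatrix_eq H s⟩

theorem isMono_word (L : List (SimpleIdx V n)) :
    IsMono (weylElement L) (mat (L.map (wElt h2)).prod) := by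
  induction L with
  | nil => exact ⟨1, fun _ => one_ne_zero, by rw [weylElement_nil, mono_one]; exact map_one _⟩
  | cons i L ih =>
    rw [List.map_cons, List.prod_cons, map_mul, weylElement_cons]
    exact IsMono.mul ⟨_, fun _ => sg_ne_zero _, wMatrix_eq h2 i⟩ ih (stable_weylElement L)

theorem IsMono.inv {L : List (SimpleIdx V n)} {a : chevalley V n F}
    (h : IsMono (weylElement L) (mat a)) : IsMono (weylElement L.reverse) (mat a⁻¹) := by
  obtain ⟨ε, hε, e⟩ := h
  refine ⟨fun v => (ε (weylElement L.reverse *ᵥ v))⁻¹, fun v => inv_ne_zero (hε _), ?_⟩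
  have : mono (weylElement L.reverse) (fun v => (ε (weylElement L.reverse *ᵥ v))⁻¹) * mat a = 1 := by
    rw [e, mono_mul (stable_weylElement L), weylElement_reverse_mul, ← mono_one]
    congr 1
    funext v
    rw [mulVec_mulVec, weylElement_reverse_mul, one_mulVec, inv_mul_cancel₀ (hε v), Pi.one_apply]
  rw [← mul_one (mono _ _), ← mat_mul_inv a, ← mul_assoc, this, one_mul]

theorem exists_weight (L : List (SimpleIdx V n)) (r' : RepIdx V n) :
    ∃ r : RepIdx V n, weight V n r' = weylElement L *ᵥ weight V n r := by
  obtain ⟨r, hr⟩ := stable_weylElement L.reverse r'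
  exact ⟨r, by rw [hr, mulVec_mulVec, weylElement_mul_reverse, one_mulVec]⟩

theorem weyl_injective (L : List (SimpleIdx V n)) {v w : Fin n → ℤ}
    (h : weylElement L *ᵥ v = weylElement L *ᵥ w) : v = w := by
  have := congrArg (weylElement L.reverse *ᵥ ·) h
  simpa only [mulVec_mulVec, weylElement_reverse_mul, one_mulVec] using this

theorem conj_apply {L : List (SimpleIdx V n)} {ε : (Fin n → ℤ) → F}
    {M N : Matrix (RepIdx V n) (RepIdx V n) F}
    (h : N * mono (weylElement L) ε = mono (weylElement L) ε * M) {r' s' r s : RepIdx V n}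
    (hr : weight V n r' = weylElement L *ᵥ weight V n r)
    (hs : weight V n s' = weylElement L *ᵥ weight V n s) :
    N r' s' * ε (weight V n s) = ε (weight V n r) * M r s := by
  have := congrFun (congrFun h r') s
  rw [Matrix.mul_apply, Matrix.mul_apply, Finset.sum_eq_single s', Finset.sum_eq_single r,
    mono_apply, mono_apply, if_pos hs, if_pos hr] at this
  · exact this
  · intro k _ hk
    rw [mono_apply, if_neg, zero_mul]
    exact fun e => hk (weight_injective (weyl_injective L (e.symm.trans hr)))
  · simp
  · intro k _ hk
    rw [mono_apply, if_neg, mul_zero]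
    exact fun e => hk (weight_injective (e.trans hs.symm))
  · simp

theorem conj_mat (a b : chevalley V n F) : mat (a * b * a⁻¹) * mat a = mat a * mat b := by
  rw [← map_mul, ← map_mul, inv_mul_cancel_right]

theorem uni_conj (h2 : (2 : F) ≠ 0) {L : List (SimpleIdx V n)} {a v : chevalley V n F}
    (ha : IsMono (weylElement L) (mat a)) (hv : Uni (mat v))
    (h : ∀ r s, mat v r s ≠ 0 → IsPosRoot V (weight V n r - weight V n s) →
      0 < height V (weylElement L *ᵥ (weight V n r - weight V n s))) : Uni (mat (a * v * a⁻¹)) := by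
  obtain ⟨ε, hε, e⟩ := ha
  have hc := conj_mat a v
  rw [e] at hc
  refine .of_root h2 (isom_mat h2 _) (fun r' => ?_) fun r' s' hrs hroot => ?_
  · obtain ⟨r, hr⟩ := exists_weight L r'
    have := conj_apply hc hr hr
    rw [hv.diag, mul_one] at this
    exact mul_right_cancel₀ (hε _) (this.trans (one_mul _).symm)
  · obtain ⟨r, hr⟩ := exists_weight L r'
    obtain ⟨s, hs⟩ := exists_weight L s'
    have h1 := conj_apply hc hr hs
    have h3 : mat v r s ≠ 0 := fun h' => by
      rw [h', mul_zero] at h1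
      exact mul_ne_zero hrs (hε _) h1
    rw [hr, hs, ← mulVec_sub] at hroot ⊢
    have h4 := hroot.weyl L.reverse
    rw [mulVec_mulVec, weylElement_reverse_mul, one_mulVec] at h4
    have h5 := (hv.nonneg h3).1
    rw [← height_sub] at h5
    exact h r s h3 (h4.pos_of_height (not_lt.2 h5))

theorem conj_root {L : List (SimpleIdx V n)} {a : chevalley V n F}
    (ha : IsMono (weylElement L) (mat a)) {c b : RootName n} (hc : c.IsRoot V) (hb : b.IsPos V)
    (h : weylElement L *ᵥ c.root V = b.root V) : ∃ z : F, ∀ t,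
      a * xElt h2 hc t * a⁻¹ = xElt h2 hb.isRoot (z * t) := by
  obtain ⟨ε, hε, e⟩ := ha
  have h' : mat a⁻¹ * mat a = 1 := by rw [← map_mul, inv_mul_cancel, map_one]
  obtain ⟨z, hz⟩ := eq_smul_rootVector h2 hb (X := mat a * rootVector n F V c * mat a⁻¹)
    (fun r' s' hrs => by
      obtain ⟨r, hr⟩ := exists_weight L r'
      obtain ⟨s, hs⟩ := exists_weight L s'
      have h1 := conj_apply (L := L) (ε := ε) (M := rootVector n F V c)
        (N := mat a * rootVector n F V c * mat a⁻¹) (by rw [← e, mul_assoc, h', mul_one]) hr hs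
      rw [hr, hs, ← mulVec_sub, supp_rootVector (F := F) hc r s, h]
      intro h3
      rw [h3, mul_zero] at h1
      exact mul_ne_zero hrs (hε _) h1)
    ((isom_mat h2 a).skew_conj (mat_mul_inv a) (skew_rootVector hc))
  refine ⟨z, fun t => mat_injective ?_⟩
  have hsq : mat a * rootVector n F V c ^ 2 * mat a⁻¹ = z ^ 2 • rootVector n F V b ^ 2 := by
    rw [← smul_pow, ← hz, sq, sq]
    simp only [mul_assoc]
    rw [← mul_assoc (mat a⁻¹), h', one_mul]
  rw [map_mul, map_mul, mat_xElt, mat_xElt, xMatrix, xMatrix, mul_add, mul_add, add_mul, add_mul,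
    mul_one, mat_mul_inv, Matrix.mul_smul, Matrix.smul_mul, Matrix.mul_smul, Matrix.smul_mul, hz,
    hsq, smul_smul, smul_smul]
  congr 2 <;> congr 1 <;> ring

/-! ### The unipotent subgroup -/

variable [Fintype F]

theorem uni_of_mem (h2 : (2 : F) ≠ 0) {a : chevalley V n F} (ha : a ∈ unipotent V n F) : Uni (mat a) := by
  have : Subgroup.closure {g : GL (RepIdx V n) F | ∃ (a : RootName n) (t : F), a.IsPos V ∧
      (g : Matrix (RepIdx V n) (RepIdx V n) F) = xMatrix V n F a t} ≤
      { carrier := {g : GL (RepIdx V n) F | Uni (g : Matrix (RepIdx V n) (RepIdx V n) F)}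
        mul_mem' := fun ha hb => ha.mul hb
        one_mem' := Uni.one
        inv_mem' := fun {g} hg => by
          have h : ∀ k : ℕ, Uni ((g ^ k : GL (RepIdx V n) F) : Matrix (RepIdx V n) (RepIdx V n) F) := fun k => by
            induction k with
            | zero => rw [pow_zero]; exact Uni.one
            | succ k ih => rw [pow_succ]; exact ih.mul hg
          have h3 : g⁻¹ = g ^ (orderOf g - 1) := inv_eq_of_mul_eq_one_left (by
            rw [← pow_succ, Nat.sub_add_cancel (orderOf_pos g), pow_orderOf_eq_one])
          rw [Set.mem_setOf_eq, h3]
          exact h _ } := by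
    rw [Subgroup.closure_le]
    rintro g ⟨b, t, hb, e⟩
    change Uni _
    rw [e]
    exact uni_xMatrix h2 hb t
  exact this (Subgroup.mem_subgroupOf.1 ha)

theorem xElt_mem {a : RootName n} (ha : a.IsPos V) (t : F) :
    xElt h2 ha.isRoot t ∈ unipotent V n F :=
  Subgroup.mem_subgroupOf.2 (Subgroup.subset_closure ⟨a, t, ha, rfl⟩)

theorem exists_clear_mem {v : chevalley V n F} (hv : Uni (mat v))
    (i : SimpleIdx V n) : ∃ c, Uni (mat (wElt h2 i * (xElt h2 (name_isPos i).isRoot c * v) *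
      (wElt h2 i)⁻¹)) := by
  obtain ⟨c, hc⟩ := hv.exists_clear h2 i (height_simple i)
  have hw : IsMono (weylElement [i]) (mat (wElt h2 i)) := by
    simpa using isMono_word h2 [i]
  refine ⟨c, uni_conj h2 hw (by rw [map_mul]; exact (uni_xMatrix h2 (name_isPos i) c).mul hv)
    fun r s hrs hpos => ?_⟩
  rw [weylElement_cons, weylElement_nil, mul_one]
  refine height_pos (reflection_isPosRoot i hpos fun h => hrs ?_)
  rw [map_mul]
  exact hc r s h

theorem conj_mem_of_reduced {i : SimpleIdx V n} {L : List (SimpleIdx V n)}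
    (h : IsReducedWord (i :: L)) (t : F) :
    ((L.map (wElt h2)).prod)⁻¹ * xElt h2 (name_isPos i).isRoot t * (L.map (wElt h2)).prod ∈
      unipotent V n F := by
  obtain ⟨b, hb, e⟩ := ((isRootVec_root i).weyl L.reverse).pos_of_height
    (not_lt.2 ((isReducedWord_cons_iff h.tail i).1 h).le)
  obtain ⟨z, hz⟩ := conj_root h2 (isMono_word h2 L).inv (name_isPos i).isRoot hb e.symm
  have := hz t
  rw [inv_inv] at this
  rw [this]
  exact xElt_mem h2 hb _

theorem mem_unipotent_iff (h2 : (2 : F) ≠ 0) {L : List (SimpleIdx V n)} (hL : IsLongestWord L)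
    {v : chevalley V n F} : v ∈ unipotent V n F ↔ Uni (mat v) := by
  refine ⟨uni_of_mem h2, fun hv => ?_⟩
  have key : ∀ L : List (SimpleIdx V n), IsReducedWord L → ∃ u ∈ unipotent V n F,
      Uni (mat ((L.map (wElt h2)).prod * (u * v) * ((L.map (wElt h2)).prod)⁻¹)) := by
    intro L hL
    induction L with
    | nil => exact ⟨1, one_mem _, by simpa using hv⟩
    | cons i L ih =>
      obtain ⟨u, hu, hu'⟩ := ih hL.tail
      obtain ⟨c, hc⟩ := exists_clear_mem h2 hu' i
      refine ⟨_, mul_mem (conj_mem_of_reduced h2 hL c) hu, ?_⟩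
      convert hc using 2
      rw [List.map_cons, List.prod_cons]
      group
  obtain ⟨u, hu, hu'⟩ := key L hL.1
  have huv : Uni (mat (u * v)) := by rw [map_mul]; exact (uni_of_mem h2 hu).mul hv
  have h1 : mat (u * v) = 1 := by
    refine eq_one_of_root h2 huv.isom huv.diag fun r s hrs => ?_
    by_contra h
    have h3 := (huv.nonneg h).1
    rw [← height_sub] at h3
    have h4 := hL.neg (hrs.pos_of_height (not_lt.2 h3))
    obtain ⟨ε, hε, e⟩ := isMono_word h2 L
    have hc := conj_mat (L.map (wElt h2)).prod (u * v)
    rw [e] at hc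
    obtain ⟨r', hr'⟩ := stable_weylElement L r
    obtain ⟨s', hs'⟩ := stable_weylElement L s
    have h5 := conj_apply hc hr' hs'
    have h6 := (hu'.nonneg (left_ne_zero_of_mul (h5 ▸ mul_ne_zero (hε _) h))).1
    rw [← height_sub, hr', hs', ← mulVec_sub] at h6
    omega
  have h3 : u * v = 1 := mat_injective (by rw [h1, map_one])
  rw [← inv_eq_of_mul_eq_one_right h3]
  exact inv_mem hu

end Chevalley
end

section
variable {V : ClassicalType} {n d : ℕ} [GoodRank V n]

/-! ### The Chevalley groups are split pairs -/

theorem exists_torusLift [NeZero d] (y : torus V n d) : ∃ H : Fin n → ℤ,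
    (V = .Astar → ∑ j, H j = 0) ∧ ∀ j, (H j : ZMod d) = y.1 j := by
  by_cases hV : V = .Astar ∧ 0 < n
  · set H : Fin n → ℤ := fun j => ((y.1 j).val : ℤ)
    have hH : ∀ j, (H j : ZMod d) = y.1 j := fun j => by simp [H]
    refine ⟨H - Pi.single ⟨0, hV.2⟩ (∑ j, H j), fun _ => by simp, fun j => ?_⟩
    have h0 : ((∑ j, H j : ℤ) : ZMod d) = 0 := by
      rw [Int.cast_sum, Finset.sum_congr rfl fun j _ => hH j]
      exact y.2 hV.1
    rw [Pi.sub_apply, Int.cast_sub, hH, Pi.single_apply]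
    split_ifs <;> simp [h0]
  · refine ⟨fun j => ((y.1 j).val : ℤ), fun h => ?_, fun j => by simp⟩
    obtain rfl : n = 0 := by by_contra hn; exact hV ⟨h, Nat.pos_of_ne_zero hn⟩
    simp

/-- An integral lift of an element of the torus. -/
def torusLift [NeZero d] (y : torus V n d) : Fin n → ℤ := (exists_torusLift y).choose

theorem eq_of_mulVec_weight {w w' : Matrix (Fin n) (Fin n) ℤ}
    (h : ∀ s : RepIdx V n, w *ᵥ weight V n s = w' *ᵥ weight V n s) : w = w' := by
  ext i j
  have := congrFun (h (pI V j)) i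
  simpa [weight_pI] using this

section

variable {F : Type*} [Field F]

theorem IsMono.weyl_eq {L : List (SimpleIdx V n)} {w' : Matrix (Fin n) (Fin n) ℤ}
    {M : Matrix (RepIdx V n) (RepIdx V n) F}
    (h : IsMono (weylElement L) M) (h' : IsMono w' M) : weylElement L = w' := by
  obtain ⟨ε, hε, rfl⟩ := h
  obtain ⟨ε', hε', e⟩ := h'
  refine eq_of_mulVec_weight (V := V) fun s => ?_
  obtain ⟨r, hr⟩ := stable_weylElement L s
  have := congrFun (congrFun e r) s
  rw [mono_apply, mono_apply, if_pos hr] at this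
  by_contra hne
  rw [if_neg (by rwa [hr])] at this
  exact hε _ this

/-- Monomial matrices in the same double coset of unitriangular matrices are equal. -/
theorem IsMono.eq_of_uni {L L' : List (SimpleIdx V n)}
    {A B u v : Matrix (RepIdx V n) (RepIdx V n) F} (hA : IsMono (weylElement L) A)
    (hB : IsMono (weylElement L') B) (hu : Uni u) (hv : Uni v) (h : u * A = B * v) : A = B := by
  obtain ⟨ε, hε, rfl⟩ := hA
  obtain ⟨ε', hε', rfl⟩ := hB
  choose k hk using stable_weylElement (V := V) L
  choose m hm using fun s => exists_weight L' (k s)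
  have hkm : ∀ s, ε (weight V n s) = ε' (weight V n (m s)) * v (m s) s := by
    intro s
    have := congrFun (congrFun h (k s)) s
    rw [Matrix.mul_apply, Matrix.mul_apply, Finset.sum_eq_single (k s),
      Finset.sum_eq_single (m s), mono_apply, mono_apply, if_pos (hk s), if_pos (hm s), hu.diag,
      one_mul] at this
    · exact this
    · intro l _ hl
      rw [mono_apply, if_neg, zero_mul]
      exact fun e => hl (weight_injective (weyl_injective L' (e.symm.trans (hm s))))
    · simp
    · intro l _ hl
      rw [mono_apply, if_neg, mul_zero]
      exact fun e => hl (weight_injective (e.trans (hk s).symm))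
    · simp
  have hinj : Function.Injective m := fun s s' e => weight_injective (weyl_injective L (by
    rw [← hk, ← hk, hm, hm, e]))
  have hv' : ∀ s, v (m s) s ≠ 0 := fun s h0 => hε _ (by rw [hkm s, h0, mul_zero])
  have hsum : ∑ s, (height V (weight V n (m s)) - height V (weight V n s)) = 0 := by
    rw [Finset.sum_sub_distrib, sub_eq_zero]
    exact (Equiv.ofBijective m (Finite.injective_iff_bijective.1 hinj)).sum_comp
      fun s => height V (weight V n s)
  have hms : ∀ s, m s = s := fun s => by
    by_contra hne
    have h1 := (Finset.sum_eq_zero_iff_of_nonneg fun s _ => (hv.nonneg (hv' s)).1).1 hsum s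
      (Finset.mem_univ s)
    have h3 := (hv.nonneg (hv' s)).2 hne
    omega
  have hw : weylElement L = weylElement L' := eq_of_mulVec_weight (V := V) fun s => by
    rw [← hk, hm, hms]
  rw [hw]
  refine mono_congr fun s => ?_
  rw [hkm, hms, hv.diag, mul_one]

theorem rootVector_simple_ne (h2 : (2 : F) ≠ 0) (i : SimpleIdx V n) :
    ∃ r s, rootVector n F V i.name r s ≠ 0 := by
  by_cases hi : V = .B ∧ (i.1 : ℕ) = 0
  · obtain ⟨rfl, h0⟩ := hi
    rcases simpleShape i with ⟨p, hp, h⟩ | ⟨-, -, h⟩ | ⟨-, -, -, hV, -⟩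
    · omega
    · refine ⟨pI .B i.1, zI, ?_⟩
      rw [h, show rootVector n F .B (.single i.1) =
        Matrix.single (pI .B i.1) zI 2 - Matrix.single zI (mI .B i.1) 1 from rfl]
      have : (zI (n := n)) ≠ pI .B i.1 := fun e => by cases e
      simp [Matrix.single_apply, this, h2]
    · cases hV
  · rw [(rootVector_eq_mono hi).1]
    have : ∃ s : RepIdx V n, weight V n s ⬝ᵥ i.coroot = -1 := by
      rcases signShape i with ⟨p, hp, -, hc, -, -, -⟩ | ⟨h0, hV, -, -, -, -, -⟩ |
        ⟨h0, hV, -, hc, -, -⟩ | ⟨p, h0, hp, hV, -, hc, -, -⟩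
      · have hip : p ≠ i.1 := fun e => by rw [e] at hp; omega
        exact ⟨pI V p, by simp [weight_pI, hc, hip]⟩
      · exact absurd ⟨hV, h0⟩ hi
      · exact ⟨mI V i.1, by simp [weight_mI (show V.HasZero by rw [hV]; trivial), hc]⟩
      · have hip : i.1 ≠ p := fun e => by rw [e] at h0; omega
        exact ⟨mI V i.1, by simp [weight_mI (show V.HasZero by rw [hV]; trivial), hc, hip]⟩
    obtain ⟨s, hs⟩ := this
    obtain ⟨r, hr⟩ := stable_simpleReflection i s
    exact ⟨r, s, by rw [mono_apply, if_pos hr, if_pos hs]; exact sg_ne_zero _⟩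

theorem hMatrix_smul (k : ℤ) (H : Fin n → ℤ) (s : Fˣ) :
    hMatrix V n F (k • H) s = hMatrix V n F H (s ^ k) := by
  rw [hMatrix_eq, hMatrix_eq]
  congr 1
  funext v
  rw [dotProduct_smul, smul_eq_mul, _root_.zpow_mul]

theorem hMatrix_mul (H : Fin n → ℤ) (s t : Fˣ) :
    hMatrix V n F H (s * t) = hMatrix V n F H s * hMatrix V n F H t := by
  rw [hMatrix_eq, hMatrix_eq, hMatrix_eq, mono_mul stable_one, one_mul]
  congr 1
  funext v
  rw [one_mulVec, _root_.mul_zpow, Units.val_mul]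

end

section

variable {F : Type*} [Field F] [Fintype F] [NeZero d] (h2 : (2 : F) ≠ 0) (γ : Fˣ)

/-- The generators of the normalizer of the torus in the Chevalley group. -/
def groupGen : Gen V n d → chevalley V n F
  | .t y => hElt (exists_torusLift y).choose_spec.1 γ
  | .xi i => wElt h2 i

theorem hMatrix_congr (hγ : orderOf γ = d) {H H' : Fin n → ℤ}
    (h : ∀ j, (H j : ZMod d) = H' j) : hMatrix V n F H γ = hMatrix V n F H' γ := by
  rw [hMatrix_eq, hMatrix_eq]
  congr 1
  funext v
  congr 1
  rw [zpow_eq_zpow_iff_modEq, hγ, ← ZMod.intCast_eq_intCast_iff]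
  simp [dotProduct, h]

theorem mat_groupGen_t (hγ : orderOf γ = d) (y : torus V n d) {H : Fin n → ℤ}
    (h : ∀ j, (H j : ZMod d) = y.1 j) : mat (groupGen h2 γ (.t y)) = hMatrix V n F H γ :=
  hMatrix_congr γ hγ fun j => by rw [(exists_torusLift y).choose_spec.2, h]

theorem isMono_standard (y : torus V n d) (L : List (SimpleIdx V n)) :
    IsMono (weylElement L) (mat (groupGen h2 γ (.t y) * xiProd (groupGen (d := d) h2 γ) L)) := by
  rw [map_mul, ← one_mul (weylElement L)]
  exact (isMono_hMatrix _ γ).mul (isMono_word h2 L) (stable_weylElement L)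

theorem baseRel_groupGen (hγ : orderOf γ = d) :
    BaseRel (groupGen h2 γ : Gen V n d → chevalley V n F) := by
  refine ⟨mat_injective ?_, fun x y => mat_injective ?_, fun i x => mat_injective ?_,
    fun i j => mat_injective ?_⟩
  · rw [mat_groupGen_t h2 γ hγ 0 (H := 0) (by simp), hMatrix_zero, map_one]
  · rw [map_mul, mat_groupGen_t h2 γ hγ x (exists_torusLift x).choose_spec.2,
      mat_groupGen_t h2 γ hγ y (exists_torusLift y).choose_spec.2, ← hMatrix_add]
    exact mat_groupGen_t h2 γ hγ _ fun j => by
      rw [Pi.add_apply, Int.cast_add, (exists_torusLift x).choose_spec.2,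
        (exists_torusLift y).choose_spec.2]
      rfl
  · rw [map_mul, map_mul]
    refine (wMatrix_hMatrix h2 i _ γ).trans ?_
    congr 1
    refine (mat_groupGen_t h2 γ hγ _ fun j => ?_).symm
    rw [simpleReflection_mulVec, Pi.sub_apply, Pi.smul_apply, smul_eq_mul, Int.cast_sub,
      Int.cast_mul, dotProduct, Int.cast_sum, (exists_torusLift x).choose_spec.2]
    simp only [Int.cast_mul, (exists_torusLift x).choose_spec.2]
    rfl
  · rw [map_alternating, map_alternating]
    exact braided_wMatrix h2 i j

theorem xi_sq_groupGen (hd : Even d) (hγ : orderOf γ = d) (i : SimpleIdx V n) :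
    (groupGen h2 γ : Gen V n d → chevalley V n F) (.xi i) ^ 2 = hNeg (groupGen (d := d) h2 γ) i := by
  have hpow : γ ^ (d / 2) = -1 := by
    have h1 : γ ^ (d / 2) * γ ^ (d / 2) = 1 := by
      rw [← pow_add, ← two_mul, Nat.two_mul_div_two_of_even hd, ← hγ, pow_orderOf_eq_one]
    have h3 : γ ^ (d / 2) ≠ 1 := fun h => by
      have h4 := orderOf_dvd_of_pow_eq_one h
      rw [hγ] at h4
      have := Nat.le_of_dvd (by have := NeZero.pos d; have := hd.two_dvd; omega) h4
      have := NeZero.pos d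
      omega
    rw [ne_eq, Units.ext_iff] at h3
    rw [Units.ext_iff] at h1 ⊢
    rw [Units.val_mul, Units.val_one] at h1
    exact (mul_self_eq_one_iff.1 h1).resolve_left h3
  refine mat_injective ?_
  rw [sq, map_mul, hNeg, mat_groupGen_t h2 γ hγ _ (H := ((d / 2 : ℕ) : ℤ) • i.coroot), hMatrix_smul,
    zpow_natCast, hpow]
  · exact wMatrix_sq h2 i
  · intro j
    rw [Pi.smul_apply, smul_eq_mul, Int.cast_mul, Int.cast_natCast, ← nsmul_eq_mul]
    rfl

theorem rank_groupGen (hγ' : ∀ x : Fˣ, x ∈ Subgroup.zpowers γ) (hγ : orderOf γ = d)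
    (i : SimpleIdx V n) (hnorm : ∀ v ∈ unipotent V n F,
      (wElt h2 i * wElt h2 i)⁻¹ * v * (wElt h2 i * wElt h2 i) ∈ unipotent V n F)
    (hneg : ∀ t, wElt h2 i * xElt h2 (name_isPos i).isRoot t * (wElt h2 i)⁻¹ ∈ unipotent V n F →
      t = 0) :
    ∃ κ : Fˣ ≃ ZMod d, ∀ t : Fˣ, ∃ u ∈ unipotent V n F, ∃ v ∈ unipotent V n F,
      wElt h2 i * xElt h2 (name_isPos i).isRoot t * wElt h2 i =
        u * (groupGen h2 γ (.t (κ t • corootTorus d i)) * wElt h2 i) * v := by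
  set w := wElt h2 i
  have hw : IsMono (weylElement [i]) (mat w) := by simpa using isMono_word h2 [i]
  have hr := isRoot_neg (name_isPos i).isRoot
  obtain ⟨z, hz⟩ := conj_root h2 hw.inv hr (name_isPos i) (by
    change weylElement [i] *ᵥ _ = i.root
    rw [weylElement_cons, weylElement_nil, mul_one, root_neg, mulVec_neg]
    exact neg_eq_iff_eq_neg.2 (simpleReflection_mulVec_self i))
  set x := xElt (V := V) (n := n) h2 (name_isPos i).isRoot
  have hx0 : x 0 = 1 := mat_injective (by rw [map_one]; exact xMatrix_zero _)
  have hxa : ∀ s t, x s * x t = x (s + t) := fun s t => mat_injective (by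
    rw [map_mul]; exact (xMatrix_add h2 (name_isPos i).isRoot s t).symm)
  have hx : ∀ s, (x s)⁻¹ = x (-s) := fun s => inv_eq_of_mul_eq_one_left (by
    rw [hxa, neg_add_cancel, hx0])
  have hxm : ∀ s, x s ∈ unipotent V n F := fun s => xElt_mem h2 (name_isPos i) s
  have hrep : ∀ s : Fˣ, mat (x s * (w * x (z * -(s⁻¹ : Fˣ)) * w⁻¹) * x s) =
      hMatrix V n F i.coroot s * wMatrix F i := by
    intro s
    rw [← rep_simple_eq_mul h2 i s, ← hz]
    have : x s * (w * (w⁻¹ * xElt h2 hr (-(s⁻¹ : Fˣ)) * w⁻¹⁻¹) * w⁻¹) * x s =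
        x s * xElt h2 hr (-(s⁻¹ : Fˣ)) * x s := by group
    rw [this]
    rfl
  have hz0 : z ≠ 0 := by
    rintro rfl
    have h1 := hrep 1
    have h3 : x (1 : Fˣ) * (w * x (0 * -((1 : Fˣ)⁻¹ : Fˣ)) * w⁻¹) * x (1 : Fˣ) = w := by
      refine mat_injective (h1.trans ?_)
      rw [hMatrix_eq]
      simp only [_root_.one_zpow, Units.val_one]
      rw [show (fun _ => 1 : (Fin n → ℤ) → F) = 1 from rfl, mono_one, one_mul]
      rfl
    rw [zero_mul, hx0, mul_one, mul_inv_cancel, mul_one] at h3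
    refine one_ne_zero (hneg 1 ?_)
    rw [← h3]
    exact mul_mem (mul_mem (mul_mem (hxm _) (hxm _)) (hxm _)) (inv_mem (mul_mem (hxm _) (hxm _)))
  have hbij : Function.Bijective fun k : ZMod d => γ ^ k.val := by
    constructor
    · intro k l h
      exact ZMod.val_injective d (pow_injOn_Iio_orderOf (by rw [hγ]; exact ZMod.val_lt k)
        (by rw [hγ]; exact ZMod.val_lt l) h)
    · intro s
      obtain ⟨k, rfl⟩ := hγ' s
      refine ⟨(k : ZMod d), ?_⟩
      change γ ^ (k : ZMod d).val = γ ^ k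
      rw [← zpow_natCast, zpow_eq_zpow_iff_modEq, hγ, ← ZMod.intCast_eq_intCast_iff]
      simp
  refine ⟨((Equiv.inv Fˣ).trans (Equiv.mulLeft (Units.mk0 z hz0))).trans
    (Equiv.ofBijective _ hbij).symm, fun t => ?_⟩
  set k : ZMod d := (Equiv.ofBijective _ hbij).symm (Units.mk0 z hz0 * t⁻¹) with hk
  have hk' : γ ^ k.val = Units.mk0 z hz0 * t⁻¹ := (Equiv.ofBijective _ hbij).apply_symm_apply _
  set s : Fˣ := -(Units.mk0 z hz0 * t⁻¹) with hs
  have hs' : z * -((s⁻¹ : Fˣ) : F) = t := by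
    rw [hs]
    simp
    field_simp
  have h1 := hrep s
  rw [hs'] at h1
  refine ⟨x (-s), hxm _, (w * w)⁻¹ * x (-s) * (w * w), hnorm _ (hxm _), ?_⟩
  change _ = x (-s) * (groupGen h2 γ (.t (k • corootTorus d i)) * w) * _
  have h3 : x s * (w * x t * w⁻¹) * x s * (w * w) = groupGen h2 γ (.t (k • corootTorus d i)) * w := by
    refine mat_injective ?_
    rw [map_mul, h1, map_mul, map_mul, mat_groupGen_t h2 γ hγ _ (H := (k.val : ℤ) • i.coroot),
      hMatrix_smul, zpow_natCast, hk', ← neg_neg (Units.mk0 z hz0 * t⁻¹), ← hs,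
      show -s = s * -1 by simp, hMatrix_mul, ← wMatrix_sq h2 i]
    · change _ * wMatrix F i * (wMatrix F i * wMatrix F i) = _ * wMatrix F i
      simp only [mul_assoc]
    · intro j
      rw [Pi.smul_apply, smul_eq_mul, Int.cast_mul, Int.cast_natCast, ZMod.natCast_zmod_val]
      rfl
  rw [← h3, ← hx]
  group

end
end

section
variable {V : ClassicalType} {n d : ℕ}

section

variable {F : Type*} [Field F] [Fintype F] [GoodRank V n] [NeZero d] (h2 : (2 : F) ≠ 0) (γ : Fˣ)

theorem closure_groupGen {L : List (SimpleIdx V n)} (hL : IsLongestWord L)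
    (hγ' : ∀ x : Fˣ, x ∈ Subgroup.zpowers γ) (hγ : orderOf γ = d) :
    Subgroup.closure ((unipotent V n F : Set (chevalley V n F)) ∪
      Set.range (groupGen h2 γ : Gen V n d → chevalley V n F)) = ⊤ := by
  set S := Subgroup.closure ((unipotent V n F : Set (chevalley V n F)) ∪
      Set.range (groupGen h2 γ : Gen V n d → chevalley V n F)) with hS
  have hU : ∀ a ∈ unipotent V n F, a ∈ S := fun a ha => Subgroup.subset_closure (.inl ha)
  have hg : ∀ a : Gen V n d, groupGen h2 γ a ∈ S := fun a => Subgroup.subset_closure (.inr ⟨a, rfl⟩)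
  have hn : (L.map (wElt h2)).prod ∈ S := Subgroup.list_prod_mem _ fun a ha => by
    obtain ⟨i, -, rfl⟩ := List.mem_map.1 ha
    exact hg (.xi i)
  have hle : chevalley V n F ≤ S.map (chevalley V n F).subtype := by
    conv_lhs => rw [chevalley]
    rw [Subgroup.closure_le]
    rintro g (⟨a, t, ha, e⟩ | ⟨H, s, hH, e⟩)
    · refine ⟨xElt h2 ha t, ?_, Units.ext e.symm⟩
      rcases ha with hp | hp
      · exact hU _ (xElt_mem h2 hp t)
      · obtain ⟨b, hb, eb⟩ := (((show IsRootVec V (a.root V) from .inr ⟨a.neg, hp, root_neg a⟩)).weyl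
          L).pos_of_height (fun h => by
            have := hL.neg ⟨_, hp, rfl⟩
            rw [root_neg, mulVec_neg, height_neg] at this
            omega)
        obtain ⟨z, hz⟩ := conj_root h2 (isMono_word h2 L) (.inr hp) hb eb.symm
        have h1 : xElt h2 (.inr hp) t = ((L.map (wElt h2)).prod)⁻¹ * xElt h2 hb.isRoot (z * t) *
            (L.map (wElt h2)).prod := by
          rw [← hz t]
          group
        rw [h1]
        exact mul_mem (mul_mem (inv_mem hn) (hU _ (xElt_mem h2 hb _))) hn
    · obtain ⟨k, rfl⟩ := hγ' s
      refine ⟨groupGen h2 γ (.t ⟨fun j => ((k * H j : ℤ) : ZMod d), fun hV => ?_⟩), hg _,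
        Units.ext ?_⟩
      · rw [← Int.cast_sum, ← Finset.mul_sum, hH hV, mul_zero, Int.cast_zero]
      · rw [e, ← hMatrix_smul]
        exact mat_groupGen_t h2 γ hγ _ fun j => rfl
  rw [eq_top_iff]
  intro a _
  obtain ⟨b, hb, e⟩ := hle a.2
  rwa [← Subtype.ext e]

theorem isSplitPair {L : List (SimpleIdx V n)} (hL : IsLongestWord L) (hd : Even d)
    (hγ' : ∀ x : Fˣ, x ∈ Subgroup.zpowers γ) (hγ : orderOf γ = d) :
    IsSplitPair F (unipotent V n F) (groupGen h2 γ : Gen V n d → chevalley V n F)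
      (fun i t => xElt h2 (name_isPos i).isRoot t) := by
  have hbase := baseRel_groupGen (d := d) (V := V) (n := n) h2 γ hγ
  have hmem : ∀ v : chevalley V n F, v ∈ unipotent V n F ↔ Uni (mat v) := fun v =>
    mem_unipotent_iff h2 hL
  have hnorm : ∀ a : chevalley V n F, IsMono (weylElement ([] : List (SimpleIdx V n))) (mat a) →
      ∀ v ∈ unipotent V n F, a * v * a⁻¹ ∈ unipotent V n F := by
    intro a ha v hv
    rw [hmem] at hv ⊢
    refine uni_conj h2 ha hv fun r s _ h => ?_
    rw [weylElement_nil, one_mulVec]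
    exact height_pos h
  have ht : ∀ y : torus V n d, IsMono (weylElement ([] : List (SimpleIdx V n)))
      (mat (groupGen h2 γ (.t y))) := fun y => by
    rw [weylElement_nil]; exact isMono_hMatrix _ γ
  have hxa : ∀ (i : SimpleIdx V n) (s t : F), xElt h2 (name_isPos i).isRoot (s + t) =
      xElt h2 (name_isPos i).isRoot s * xElt h2 (name_isPos i).isRoot t := fun i s t =>
    mat_injective (by rw [map_mul]; exact xMatrix_add h2 (name_isPos i).isRoot s t)
  have hneg : ∀ (i : SimpleIdx V n) (t : F),
      wElt h2 i * xElt h2 (name_isPos i).isRoot t * (wElt h2 i)⁻¹ ∈ unipotent V n F → t = 0 := by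
    intro i t h
    obtain ⟨r, s, hrs⟩ := rootVector_simple_ne h2 i
    have hs := supp_rootVector (F := F) (name_isPos i).isRoot
    have h1 := hs r s hrs
    obtain ⟨ε, hε, e⟩ := isMono_word h2 [i]
    obtain ⟨r', hr'⟩ := stable_weylElement [i] r
    obtain ⟨s', hs'⟩ := stable_weylElement [i] s
    have hc := conj_mat (wElt h2 i) (xElt h2 (name_isPos i).isRoot t)
    rw [List.map_singleton, List.prod_singleton] at e
    rw [e] at hc
    have h3 := conj_apply hc hr' hs'
    have h4 : mat (xElt h2 (name_isPos i).isRoot t) r s = t * rootVector n F V i.name r s := by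
      have hne : r ≠ s := by
        rintro rfl
        have := height_simple i
        change _ = i.root at h1
        rw [← h1, sub_self] at this
        simp [height] at this
      have h5 : (rootVector n F V i.name * rootVector n F V i.name) r s = 0 := by
        by_contra h5
        have h6 := congrArg (height V) ((hs.mul hs r s h5).symm.trans h1)
        rw [height_add] at h6
        have := height_simple i
        change height V i.root + height V i.root = height V i.root at h6
        omega
      rw [mat_xElt, xMatrix]
      simp [Matrix.one_apply_ne hne, sq, h5]
    by_contra ht
    rw [h4] at h3
    have h6 := ((uni_of_mem h2 h).nonneg (left_ne_zero_of_mul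
      (h3 ▸ mul_ne_zero (hε _) (mul_ne_zero ht hrs)))).1
    rw [← height_sub, hr', hs', ← mulVec_sub, h1, weylElement_cons, weylElement_nil, mul_one] at h6
    change 0 ≤ height V (simpleReflection i *ᵥ i.root) at h6
    rw [simpleReflection_mulVec_self, height_neg, height_simple] at h6
    omega
  have hxi : ∀ i : SimpleIdx V n, IsMono (weylElement ([] : List (SimpleIdx V n)))
      (mat (wElt h2 i * wElt h2 i)) := fun i => by
    rw [weylElement_nil, map_mul]
    exact (wMatrix_sq h2 i).symm ▸ isMono_hMatrix _ _
  refine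
    { base := hbase
      xi_sq := xi_sq_groupGen h2 γ hd hγ
      norm := fun y => hnorm _ (ht y)
      x_mem := fun i t => xElt_mem h2 (name_isPos i) t
      x_add := hxa
      decomp := fun i v hv => ?_
      pos := fun i L' h t => conj_mem_of_reduced h2 h t
      neg := hneg
      rank := fun i => rank_groupGen h2 γ hγ' hγ i (fun v hv => ?_) (hneg i)
      disj := ?_
      inj := fun y L₁ y' L₂ h₁ h₃ e => ?_
      gen := closure_groupGen h2 γ hL hγ' hγ }
  · obtain ⟨c, hc⟩ := exists_clear_mem h2 ((hmem _).1 (inv_mem hv)) i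
    rw [← hmem] at hc
    refine ⟨c, (xElt h2 (name_isPos i).isRoot c * v⁻¹)⁻¹,
      inv_mem (mul_mem (xElt_mem h2 (name_isPos i) c) (inv_mem hv)), ?_, by group⟩
    convert inv_mem hc using 1
    change wElt h2 i * _ * (wElt h2 i)⁻¹ = _
    group
  · have := hnorm _ (IsMono.inv (hxi i)) v hv
    rwa [inv_inv] at this
  · rintro a ⟨y, L₁, -, rfl⟩ b ⟨y', L₂, -, rfl⟩ u hu v hv e
    have e' := congrArg mat (eq_mul_inv_of_mul_eq e)
    rw [map_mul, map_mul _ _ v⁻¹] at e'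
    exact mat_injective ((isMono_standard h2 γ y L₁).eq_of_uni (isMono_standard h2 γ y' L₂)
      ((hmem _).1 hu) ((hmem _).1 (inv_mem hv)) e')
  · have hw := (isMono_standard h2 γ y L₁).weyl_eq (e ▸ isMono_standard h2 γ y' L₂)
    refine ⟨?_, hw⟩
    rw [hbase.xiProd_congr h₁ h₃ hw.symm, mul_left_inj] at e
    refine Subtype.ext (funext fun j => ?_)
    have h5 := congrFun (congrFun (congrArg mat e) (pI V j)) (pI V j)
    change hMatrix V n F (torusLift y) γ _ _ = hMatrix V n F (torusLift y') γ _ _ at h5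
    rw [hMatrix_eq, hMatrix_eq, mono_apply, mono_apply, if_pos (one_mulVec _).symm,
      if_pos (one_mulVec _).symm, Units.val_inj, zpow_eq_zpow_iff_modEq, hγ, weight_pI, single_dotProduct,
      single_dotProduct, one_mul, one_mul, ← ZMod.intCast_eq_intCast_iff] at h5
    rwa [torusLift, torusLift, (exists_torusLift y).choose_spec.2,
      (exists_torusLift y').choose_spec.2] at h5

open Classical in
theorem cosetIndicator_toFun (M : Matrix (RepIdx V n) (RepIdx V n) F) (g : chevalley V n F) :
    (cosetIndicator M).toFun g = if ∃ y ∈ unipotent V n F, ∃ z ∈ unipotent V n F,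
      mat g = mat y * M * mat z then 1 else 0 := rfl

/-- The generators of the Hecke algebra are those of the split pair. -/
theorem heckeGen_eq {L : List (SimpleIdx V n)} (hL : IsLongestWord L) (hd : Even d)
    (hγ' : ∀ x : Fˣ, x ∈ Subgroup.zpowers γ) (hγ : orderOf γ = d) (a : Gen V n d) :
    heckeGen γ a = IsSplitPair.hGen (unipotent V n F) (groupGen h2 γ) a := by
  have h := isSplitPair h2 γ hL hd hγ' hγ
  have key : ∀ (c g : chevalley V n F) (M : Matrix (RepIdx V n) (RepIdx V n) F), mat c = M →
      ((∃ y ∈ unipotent V n F, ∃ z ∈ unipotent V n F, mat g = mat y * M * mat z) ↔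
        ∃ u ∈ unipotent V n F, ∃ v ∈ unipotent V n F, g = u * c * v) := by
    rintro c g M rfl
    simp only [← map_mul]
    exact ⟨fun ⟨u, hu, v, hv, e⟩ => ⟨u, hu, v, hv, mat_injective e⟩,
      fun ⟨u, hu, v, hv, e⟩ => ⟨u, hu, v, hv, congrArg mat e⟩⟩
  refine HeckeAlgebra.ext' fun g => ?_
  cases a with
  | t y =>
    have hk := key _ g _ (mat_groupGen_t h2 γ hγ y fun j => Eq.trans (Int.cast_natCast _)
      (ZMod.natCast_zmod_val (y.1 j)))
    rw [show (heckeGen γ (.t y) : HeckeAlgebra (unipotent V n F)) = cosetIndicator _ from rfl,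
      cosetIndicator_toFun, IsSplitPair.hGen, h.br_t_toFun]
    by_cases hc : ∃ u ∈ unipotent V n F, ∃ v ∈ unipotent V n F, g = u * groupGen h2 γ (.t y) * v
    · rw [if_pos hc, if_pos (hk.2 hc)]
    · rw [if_neg hc, if_neg (mt hk.1 hc)]
  | xi i =>
    have hk := key _ g _ (mat_wElt h2 i)
    rw [show (heckeGen γ (.xi i) : HeckeAlgebra (unipotent V n F)) =
      (Fintype.card F : ℂ)⁻¹ • cosetIndicator (wMatrix F i) from rfl, HeckeAlgebra.smul_toFun,
      cosetIndicator_toFun, IsSplitPair.hGen, h.br_xi_toFun]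
    by_cases hc : ∃ u ∈ unipotent V n F, ∃ v ∈ unipotent V n F, g = u * wElt h2 i * v
    · rw [if_pos (hk.2 hc)]
      exact congrArg _ (if_pos hc).symm
    · rw [if_neg (mt hk.1 hc)]
      exact congrArg _ (if_neg hc).symm

end
end

section
variable {V : ClassicalType} {n d : ℕ}

theorem xiProd_sq_eq_word {M : Type*} [Monoid M] (g : Gen V n d → M) (L : List (SimpleIdx V n)) :
    xiProd g L ^ 2 = (((L ++ L).map Gen.xi).map g).prod := by
  rw [sq, List.map_append, List.map_append, List.prod_append, List.map_map]
  rfl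

/-- If `T_{w₀}²` acts as `u^f (-1)^g`, then in every specialization at `u = c` it acts as
`c^f (-1)^g`. -/
theorem longest_sq_specialized [GoodRank V n] {K : Type*} [Field K] [Algebra ℂ K] {u : K}
    (hu0 : u ≠ 0) {L : List (SimpleIdx V n)} (hL : IsLongestWord L)
    {φ : IntCl ({u, u⁻¹} : Set K) →ₐ[ℂ] ℂ} {c : ℂ} (hφ : SpecializesAt φ u c)
    {E : Type*} [AddCommGroup E] [Module K E] [FiniteDimensional K E]
    {ρ : Yok V n d K u →ₐ[K] Module.End K E} {f g : ℤ}
    (hs : ρ (xiProd (yokGen V n d K u) L ^ 2) = (u ^ f * (-1) ^ g) • 1)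
    {B : Type*} [Ring B] [Algebra ℂ B] {h : Gen V n d → B} (hh : BaseRel h)
    (hadj : Algebra.adjoin ℂ (Set.range h) = ⊤) {m : ℕ}
    {σ : B →ₐ[ℂ] Module.End ℂ (Fin m → ℂ)} (hσ : IsIrreducible σ)
    (hsp : IsSpecialization φ (yokGen V n d K u) (character ρ) h (character σ)) :
    σ (xiProd h L ^ 2) = (c ^ f * (-1) ^ g) • 1 := by
  have := hσ.1
  obtain ⟨y, hy⟩ := exists_scalar_of_commute hadj hσ.surjective_of_isAlgClosed
    (x := σ (xiProd h L ^ 2)) fun i => by rw [← map_mul, ← map_mul, hh.longest_sq hL]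
  have hdim : (Module.finrank ℂ (Fin m → ℂ) : ℂ) = Module.finrank K E := by
    obtain ⟨a, ha, ha'⟩ := hsp.one
    rw [character_apply, map_one, LinearMap.trace_one] at ha ha'
    rw [← ha']
    exact spec_algebraMap φ (by rw [ha, map_natCast])
  obtain ⟨b, hb, hb'⟩ := exists_spec_zpow hu0 φ hφ f
  obtain ⟨a, ha, ha'⟩ := hsp ((L ++ L).map Gen.xi)
  rw [← xiProd_sq_eq_word, character_apply, hs, map_smul, LinearMap.trace_one, smul_eq_mul] at ha
  rw [← xiProd_sq_eq_word, character_apply, hy, map_smul, LinearMap.trace_one, smul_eq_mul] at ha'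
  obtain ⟨ε, hε, hε'⟩ : ∃ ε : ℤ, (-1 : K) ^ g = ε ∧ (-1 : ℂ) ^ g = ε := by
    rcases Int.even_or_odd g with h | h
    · exact ⟨1, by rw [h.neg_one_zpow, Int.cast_one], by rw [h.neg_one_zpow, Int.cast_one]⟩
    · exact ⟨-1, by simp [h.neg_one_zpow], by simp [h.neg_one_zpow]⟩
  have hab : a = b * ((ε : IntCl ({u, u⁻¹} : Set K)) * (Module.finrank K E : IntCl _)) :=
    Subtype.ext (by
      rw [ha, hε, ← hb, mul_assoc]
      rfl)
  rw [hab, map_mul, map_mul, hb', map_intCast, map_natCast, ← hdim, ← mul_assoc] at ha'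
  have hm : (Module.finrank ℂ (Fin m → ℂ) : ℂ) ≠ 0 := by exact_mod_cast Module.finrank_pos.ne'
  rw [hy, ← mul_right_cancel₀ hm ha', hε']

theorem two_ne_zero_of_card {F : Type*} [Field F] [Fintype F] (hd : Even d)
    (hF : Fintype.card F = d + 1) : (2 : F) ≠ 0 := by
  refine Ring.two_ne_zero fun h => ?_
  have := FiniteField.even_card_of_char_two h
  have := hd.two_dvd
  omega
end

end YH

end

theorem mainTheorem3
    (V : YH.ClassicalType) (n d : ℕ) (hn : V = .D → 2 ≤ n) (hd : Even d) (hd0 : 0 < d)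
    (K : Type*) [Field K] [Algebra ℂ K] [Algebra (RatFunc ℂ) K]
    [IsScalarTower ℂ (RatFunc ℂ) K] [FiniteDimensional (RatFunc ℂ) K] [IsGalois (RatFunc ℂ) K]
    (u : K) (hu : u = algebraMap (RatFunc ℂ) K RatFunc.X)
    (hY : YH.IsSplit K (YH.Yok V n d K u))
    (L : List (YH.SimpleIdx V n)) (hL : YH.IsLongestWord L)
    (φ₁ : YH.IntCl ({u, u⁻¹} : Set K) →ₐ[ℂ] ℂ) (hφ₁ : YH.SpecializesAt φ₁ u 1)
    (τ₁ : YH.IntCl ({u} : Set K) →ₐ[ℂ] ℂ) (hτ₁ : YH.SpecializesAt τ₁ u 1)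
    (τ₀ : YH.IntCl ({u} : Set K) →ₐ[ℂ] ℂ) (hτ₀ : YH.SpecializesAt τ₀ u 0)
    (E : Type*) [AddCommGroup E] [Module K E] [FiniteDimensional K E]
    (ρ : YH.Yok V n d K u →ₐ[K] Module.End K E) (hρ : YH.IsIrreducible ρ) :
    (YH.IsSplit K (YH.Def V n d K u) →
      ∃ χ' χ₁ χ₀, YH.IsAssociated u φ₁ τ₁ τ₀ (YH.character ρ) χ' χ₁ χ₀) ∧
    ∀ χ' χ₁ χ₀, YH.IsAssociated u φ₁ τ₁ τ₀ (YH.character ρ) χ' χ₁ χ₀ →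
      ∃ f g : ℤ, (f : ℂ) = YH.fSum L χ₀ ∧ (g : ℂ) = YH.gSum L χ₀ ∧
        ρ (YH.xiProd (YH.yokGen V n d K u) L ^ 2) = (u ^ f * (-1) ^ g) • 1 ∧
        ∀ (F : Type*) [Field F] [Fintype F], Fintype.card F = d + 1 →
          ∀ γ : Fˣ, (∀ x : Fˣ, x ∈ Subgroup.zpowers γ) →
          ∀ φq : YH.IntCl ({u, u⁻¹} : Set K) →ₐ[ℂ] ℂ,
            YH.SpecializesAt φq u (Fintype.card F : ℂ)⁻¹ →
            (∃ χq ∈ YH.Irr ℂ (YH.HeckeAlgebra (YH.unipotent V n F)),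
              YH.IsSpecialization φq (YH.yokGen V n d K u) (YH.character ρ)
                (YH.heckeGen γ) χq) ∧
            ∀ (m : ℕ) (σ : YH.HeckeAlgebra (YH.unipotent V n F) →ₐ[ℂ]
                Module.End ℂ (Fin m → ℂ)),
              YH.IsIrreducible σ →
              YH.IsSpecialization φq (YH.yokGen V n d K u) (YH.character ρ)
                (YH.heckeGen γ) (YH.character σ) →
              σ (YH.xiProd (YH.heckeGen (d := d) γ) L ^ 2) =
                ((Fintype.card F : ℂ) ^ (-f) * (-1) ^ g) • 1 := by
  have : YH.GoodRank V n := ⟨hn⟩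
  have : NeZero d := ⟨hd0.ne'⟩
  have hpoly : ∀ p : Polynomial ℂ, p ≠ 0 →
      algebraMap (RatFunc ℂ) K (algebraMap (Polynomial ℂ) (RatFunc ℂ) p) ≠ 0 := fun p hp =>
    (map_ne_zero_iff _ (algebraMap (RatFunc ℂ) K).injective).2
      ((map_ne_zero_iff _ (RatFunc.algebraMap_injective ℂ)).2 hp)
  have hu0 : u ≠ 0 := by
    simpa [hu] using hpoly Polynomial.X Polynomial.X_ne_zero
  have hu1 : 1 + u ≠ 0 := by
    have h : (1 + Polynomial.X : Polynomial ℂ) ≠ 0 := fun h => by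
      simpa using congrArg (Polynomial.eval 0) h
    simpa [hu] using hpoly _ h
  have hu2 : 2 * u - 1 ≠ 0 := by
    have h : (2 * Polynomial.X - 1 : Polynomial ℂ) ≠ 0 := fun h => by
      simpa using congrArg (Polynomial.eval 0) h
    have h' : algebraMap (Polynomial ℂ) (RatFunc ℂ) 2 = 2 := map_ofNat _ 2
    have h'' : algebraMap (RatFunc ℂ) K 2 = 2 := map_ofNat _ 2
    simpa [hu, h', h''] using hpoly _ h
  refine ⟨fun hZ => ?_, fun χ' χ₁ χ₀ hass => ?_⟩
  · obtain ⟨m, σ, hm, hσ, h₁⟩ := YH.exists_nGroup_rep hu hφ₁ hY hρ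
    obtain ⟨χ', hχ', χ₀, hχ₀, h₂, h₃⟩ := YH.exists_associated hd hu2 hτ₁ hτ₀ hZ hm σ hσ
    exact ⟨χ', _, χ₀, hχ', YH.irr_of_surjective hm hσ, hχ₀, h₁, h₂, h₃⟩
  obtain ⟨f, g, hf, hg, hs⟩ := YH.longest_sq_scalar hd hu0 hu1 hY hL hφ₁ hρ hass
  refine ⟨f, g, hf, hg, hs, fun F _ _ hF γ hγ' φq hφq => ?_⟩
  have h2 : (2 : F) ≠ 0 := YH.two_ne_zero_of_card hd hF
  have hγ : orderOf γ = d := by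
    rw [orderOf_eq_card_of_forall_mem_zpowers hγ', Nat.card_units, Nat.card_eq_fintype_card, hF,
      Nat.add_sub_cancel]
  have h := YH.isSplitPair h2 γ hL hd hγ' hγ
  have hgen : (YH.heckeGen γ : YH.Gen V n d → YH.HeckeAlgebra (YH.unipotent V n F)) =
      YH.IsSplitPair.hGen (YH.unipotent V n F) (YH.groupGen h2 γ) :=
    funext (YH.heckeGen_eq h2 γ hL hd hγ' hγ)
  rw [hgen]
  refine ⟨?_, fun m σ hσ hsp => ?_⟩
  · obtain ⟨e, he⟩ := h.exists_algEquiv hF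
    have : IsSemisimpleRing (YH.Yok V n d ℂ (Fintype.card F : ℂ)⁻¹) :=
      e.symm.toRingEquiv.isSemisimpleRing
    let b := Module.finBasis K E
    obtain ⟨σ, hσ, htr⟩ := YH.exists_specialization hu φq hφq (YH.matrixRep b ρ)
      (YH.surjective_of_isSplit hY _ (YH.isIrreducible_vecRep_matrixRep b hρ))
    have := hρ.1
    let τ := σ.comp e.symm.toAlgHom
    have hτ : Function.Surjective τ := hσ.comp e.symm.surjective
    refine ⟨_, YH.irr_of_surjective Module.finrank_pos hτ, fun w => ?_⟩
    obtain ⟨a, ha, ha'⟩ := htr w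
    refine ⟨a, by rw [ha, YH.trace_matrixRep], ?_⟩
    rw [ha', YH.character_vecRep, AlgHom.comp_apply, ← YH.map_word e _ _ he]
    exact congrArg (fun x => (σ x).trace) (e.symm_apply_apply _).symm
  · rw [zpow_neg, ← inv_zpow]
    exact YH.longest_sq_specialized hu0 hL hφq hs h.baseRel_hGen h.adjoin_hGen hσ hsp
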